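/- **The logic.** $FO\lambda^{\Delta\mathbb N}$ is intuitionistic first-order logic over simply typed $\lambda$-terms modulo $\beta\eta$, with connectives $\bot,\top,\land,\lor,\supset,\forall_\tau,\exists_\tau$, where quantified types $\tau$ do not contain the type $o$ of formulas. Sequents $\Gamma\longrightarrow C$ have a finite multiset $\Gamma$ on the left; the rules are the usual left and right rules, initial sequents on atoms, contraction, cut, the rules for $nat$, namely $\Gamma\longrightarrow nat\,z$, from $\Gamma\longrightarrow nat\,I$ infer $\Gamma\longrightarrow nat(s\,I)$, and from $\longrightarrow B\,z$, $\;B\,j\longrightarrow B(s\,j)$, $\;B\,I,\Gamma\longrightarrow C$ infer $nat\,I,\Gamma\longrightarrow C$ ($j$ fresh), and two rules relative to a definition $\mathcal D$. A definition is a set of clauses $\forall\bar x[p\,\bar t\triangleq B]$ ($p\ne nat$, the free variables of $B$ are free in $\bar t$) such that predicates can be given levels in $\mathbb N$ with the level of $B$ at most that of $p$, where $\bot,\top$ have level $0$, the level of $B\supset C$ is $\max(\mathrm{lev}(B)+1,\mathrm{lev}(C))$, that of $B\land C$ and $B\lor C$ is the maximum, and quantifiers do not change it. The rules are: infer $\Gamma\longrightarrow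 p\,\bar u$ from $\Gamma\longrightarrow B\theta$ if $p\,\bar u=(p\,\bar t)\theta$ for a clause; and infer $p\,\bar u,\Gamma\longrightarrow C$ from all the sequents $B\theta,\Gamma\theta\longrightarrow C\theta$, where for every clause for $p$ (with fresh $\bar x$) $\theta$ ranges over a complete set of unifiers of $p\,\bar u$ and $p\,\bar t$. **The signature.** It has base types $nt,i,evs,atm,prp,atmlst,prplst$, constants $z:nt$, $s:nt\to nt$, $nil$ and $::$ for the types $atmlst$ (elements $atm$) and $prplst$ (elements $prp$), $\langle\cdot\rangle:atm\to prp$, $tt:prp$, $\&:prp\to prp\to prp$, ${\multimap},{\Rightarrow}:atm\to prp\to prp$, $\bigwedge:(i\to prp)\to prp$, $fst:evs\to i$, $fst_{i\to i}:evs\to i\to i$, $rst:evs\to evs$, and arbitrary further types, constants and predicates. Write $\tau^*$ for $evs\to\tau$, $\tau^{**}=(\tau^*)^*$, and let $nil^*,::^*,\langle\cdot\rangle^*,tt^*,\&^*,\multimap^*,\Rightarrow^*$ be the pointwise versions, e.g. $A::^*L=\lambda l.(A\,l)::(L\,l)$, and $\bigwedge^*B=\lambda l.\bigwedge x(B\,l\,x)$.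 **The definition $\mathcal D_0=\mathcal D(nat)\cup\mathcal D(lists)\cup\mathcal D(evars)\cup\mathcal D(linear)$.** $\mathcal D(nat)$: $I=I\triangleq\top$; $sum\,z\,J\,J\triangleq nat\,J$; $sum\,(sI)\,J\,(sK)\triangleq sum\,I\,J\,K$; $z<sJ\triangleq nat\,J$; $sI<sJ\triangleq I<J$; $I\le I\triangleq\top$; $I\le J\triangleq I<J$. $\mathcal D(lists)$: for element types $atm$ and $prp$, over lists of type $lst^*$ (as displayed) and likewise $lst^{**}$ (with separate predicates): $length\,nil^*\,z\triangleq\top$; $length\,(A::^*L)\,(sI)\triangleq length\,L\,I$; $list\,L\triangleq\exists i(nat\,i\land length\,L\,i)$; $element\,A\,(A::^*L)\triangleq\top$; $element\,A\,(A'::^*L)\triangleq element\,A\,L$; $split\,nil^*\,nil^*\,nil^*\triangleq\top$; $split\,(A::^*L_1)\,(A::^*L_2)\,L_3\triangleq split\,L_1\,L_2\,L_3$; $split\,(A::^*L_1)\,L_2\,(A::^*L_3)\triangleq split\,L_1\,L_2\,L_3$; $permute\,nil^*\,nil^*\triangleq\top$; $permute\,(A::^*L_1)\,L_2\triangleq\exists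 l(split\,L_2\,(A::^*nil^*)\,l\land permute\,L_1\,l)$. $\mathcal D(evars)$: for each $\tau\in\{atm,prp,atmlst,prplst\}$: $subst\,I\,T\,X\,X'\triangleq subst_0\,I\,(\lambda l'.T)(\lambda l'.X)(\lambda l'.X')$; $subst_0\,z\,T\,(\lambda l'\lambda l.X\,l'(fst\,l)(rst\,l))\,(\lambda l'\lambda l.X\,l'(T\,l'\,l)(rst\,l))\triangleq\top$; $subst_0\,(sI)\,\hat T\,\hat X\,\hat X'\triangleq subst_0\,I\,\check T\,\check X\,\check X'$; $extend\,I\,X\,X'\triangleq extend_0\,I\,(\lambda l'.X)(\lambda l'.X')$; $extend_0\,z\,(\lambda l'\lambda l.X\,l'\,l)\,(\lambda l'\lambda l.X\,l'(rst\,l))\triangleq\top$; $extend_0\,(sI)\,\hat X\,\hat X'\triangleq extend_0\,I\,\check X\,\check X'$; where $\hat Y=\lambda l'\lambda l.Y\,l'(fst\,l)(rst\,l)$ and $\check Y=\lambda l'\lambda l.Y(rst\,l')(fst\,l')\,l$. $\mathcal D(linear)$: for $seq$ of arguments of types $nt,atmlst^*,atmlst^*,prp^*$ and $split\_seq$ of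 arguments of types $nt,atmlst^*,atmlst^*,prplst^*$: $seq\,I\,IL\,(A::^*nil^*)\,\langle A\rangle^*\triangleq\top$; $seq\,I\,(A'::^*IL)\,nil^*\,\langle A\rangle^*\triangleq element\,A\,(A'::^*IL)$; $seq\,(sI)\,IL\,LL\,\langle A\rangle^*\triangleq\exists ll\exists il(list\,ll\land list\,il\land prog\,A\,ll\,il\land split\_seq\,I\,IL\,LL\,ll\land split\_seq\,I\,IL\,nil^*\,il)$; $seq\,I\,IL\,LL\,tt^*\triangleq\top$; $seq\,(sI)\,IL\,LL\,(B\,\&^*C)\triangleq seq\,I\,IL\,LL\,B\land seq\,I\,IL\,LL\,C$; $seq\,(sI)\,IL\,LL\,(A\multimap^*B)\triangleq seq\,I\,IL\,(A::^*LL)\,B$; $seq\,(sI)\,IL\,LL\,(A\Rightarrow^*B)\triangleq seq\,I\,(A::^*IL)\,LL\,B$; $seq\,(sI)\,IL\,LL\,(\bigwedge^*B)\triangleq seq\,I\,(\lambda l.IL(rst\,l))(\lambda l.LL(rst\,l))(\lambda l.B(rst\,l)(fst\,l))$; $split\_seq\,I\,IL\,nil^*\,nil^*\triangleq\top$; $split\_seq\,I\,IL\,LL\,(B::^*L)\triangleq\exists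 ll_1\exists ll_2(split\,LL\,ll_1\,ll_2\land seq\,I\,IL\,ll_1\,B\land split\_seq\,I\,IL\,ll_2\,L)$. The predicate $prog$, with arguments of types $atm^*,prplst^*,prplst^*$, has no clause in $\mathcal D_0$. Write $IL;LL\rhd B$ for $\exists i(nat\,i\land seq\,i\,IL\,LL\,B)$, and let $$P_{subst}=\forall i,t,a,a',ll,il\,(nat\,i\supset prog\,a\,ll\,il\supset subst\,i\,t\,a\,a'\supset\exists ll'\exists il'(prog\,a'\,ll'\,il'\land subst\,i\,t\,ll\,ll'\land subst\,i\,t\,il\,il')),$$ $$P_{extend}=\forall i,a,a',ll,il\,(nat\,i\supset prog\,a\,ll\,il\supset extend\,i\,a\,a'\supset\exists ll'\exists il'(prog\,a'\,ll'\,il'\land extend\,i\,ll\,ll'\land extend\,i\,il\,il')).$$ **Theorem (Rule Admissibility for Linear Logic).** The following four formulas are derivable in $FO\lambda^{\Delta\mathbb N}$ using the definition $\mathcal D_0$. 1. (Specialization) $P_{subst}\supset\forall i,b,il,ll\,(nat\,i\supset list\,il\supset list\,ll\supset seq\,(s\,i)\,il\,ll\,(\bigwedge^*b)\supset\forall x\;seq\,i\,il\,ll\,(\lambda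 l.b\,l\,(x\,l)))$, with $b:(i\to prp)^*$, $x:i^*$. 2. (Cut) $P_{extend}\supset\forall a,b,il,ll\,(list\,il\supset list\,ll\supset (a::^*il;ll\rhd b)\supset(il;nil^*\rhd\langle a\rangle^*)\supset(il;ll\rhd b))$. 3. (Linear cut) $P_{extend}\supset\forall a,b,il,ll,ll_1,ll_2\,(list\,il\supset list\,ll\supset split\,ll\,ll_1\,ll_2\supset(il;a::^*ll_1\rhd b)\supset(il;ll_2\rhd\langle a\rangle^*)\supset(il;ll\rhd b))$. 4. (Structural rules) $\forall i,b,il,il',ll,ll'\,(nat\,i\supset list\,il\supset list\,il'\supset list\,ll\supset\forall a(element\,a\,il\supset element\,a\,il')\supset permute\,ll\,ll'\supset seq\,i\,il\,ll\,b\supset seq\,i\,il'\,ll'\,b)$. Moreover 2, 3 and 4 are derivable using every definition that extends $\mathcal D_0$ by clauses for predicates that $\mathcal D_0$ does not define, in particular by arbitrary clauses for $prog$. -/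

import Mathlib

/-! The meta-logic `FOλ^{ΔN}` (intuitionistic first-order logic over simply typed `λ`-terms with
definitions and natural-number induction), and the encoding of a fragment of linear logic in it. -/

namespace FOLDN

/-! ### Types, signatures, terms -/

/-- Simple types without the type of formulas. `i` is the type of object-level individuals, `evs` the
type of lists of eigenvariables, `other` are further base types of the signature. -/
inductive Ty (β : Type) : Type
  | nt | i | evs | atm | prp | atmlst | prplst
  | other (b : β)
  | arr (σ τ : Ty β)

/-- A signature: what it has beyond the base types, constants and predicates that are built in. -/
structure Sig where
  Base : Type
  Con : Type
  conTy : Con → Ty Base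
  Prd : Type
  prdTy : Prd → List (Ty Base)

/-- The two element types of lists. -/
inductive Elem : Type
  | atm | prp

def Elem.ty {β : Type} : Elem → Ty β
  | .atm => .atm
  | .prp => .prp

def Elem.lst {β : Type} : Elem → Ty β
  | .atm => .atmlst
  | .prp => .prplst

/-- The four types at which operations on eigenvariables are used. -/
inductive ETy : Type
  | atm | prp | atmlst | prplst

def ETy.ty {β : Type} : ETy → Ty β
  | .atm => .atm
  | .prp => .prp
  | .atmlst => .atmlst
  | .prplst => .prplst

/-- `τ^{*⋯*}` with `n` stars; `τ^* = evs → τ`. -/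
def Ty.stars {β : Type} : ℕ → Ty β → Ty β
  | 0, τ => τ
  | n + 1, τ => .arr .evs (Ty.stars n τ)

/-- `τ^*`. -/
abbrev Ty.star {β : Type} (τ : Ty β) : Ty β := .arr .evs τ

abbrev Ctx (S : Sig) : Type := List (Ty S.Base)

/-- Typed de Bruijn indices. -/
inductive Var {β : Type} : List (Ty β) → Ty β → Type
  | zero {Γ : List (Ty β)} {τ : Ty β} : Var (τ :: Γ) τ
  | succ {Γ : List (Ty β)} {σ τ : Ty β} : Var Γ τ → Var (σ :: Γ) τ

def Var.toNat {β : Type} : {Γ : List (Ty β)} → {τ : Ty β} → Var Γ τ → ℕ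
  | _, _, .zero => 0
  | _, _, .succ x => x.toNat + 1

/-- Constants: `z`, `s`, list constructors, the object-level connectives
`⟨·⟩, tt, &, ⊸, ⇒, ⋀_i`, the projections `fst_i, fst_{i→i}, rst`, and those of the signature. -/
inductive Con (S : Sig) : Ty S.Base → Type
  | zero : Con S .nt
  | succ : Con S (.arr .nt .nt)
  | nil (e : Elem) : Con S e.lst
  | cons (e : Elem) : Con S (.arr e.ty (.arr e.lst e.lst))
  | atom : Con S (.arr .atm .prp)
  | tt : Con S .prp
  | wth : Con S (.arr .prp (.arr .prp .prp))
  | limp : Con S (.arr .atm (.arr .prp .prp))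
  | iimp : Con S (.arr .atm (.arr .prp .prp))
  | bigwedge : Con S (.arr (.arr .i .prp) .prp)
  | fst : Con S (.arr .evs .i)
  | fstFun : Con S (.arr .evs (.arr .i .i))
  | rst : Con S (.arr .evs .evs)
  | other (c : S.Con) : Con S (S.conTy c)

/-- Simply typed `λ`-terms. -/
inductive Tm (S : Sig) : Ctx S → Ty S.Base → Type
  | var {Γ : Ctx S} {τ : Ty S.Base} : Var Γ τ → Tm S Γ τ
  | con {Γ : Ctx S} {τ : Ty S.Base} : Con S τ → Tm S Γ τ
  | app {Γ : Ctx S} {σ τ : Ty S.Base} : Tm S Γ (.arr σ τ) → Tm S Γ σ → Tm S Γ τ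
  | lam {Γ : Ctx S} {σ τ : Ty S.Base} : Tm S (σ :: Γ) τ → Tm S Γ (.arr σ τ)

/-- Renamings. -/
abbrev Ren {β : Type} (Γ Δ : List (Ty β)) : Type := ∀ τ : Ty β, Var Γ τ → Var Δ τ

def Ren.lift {β : Type} {Γ Δ : List (Ty β)} {σ : Ty β} (ρ : Ren Γ Δ) : Ren (σ :: Γ) (σ :: Δ)
  | _, .zero => .zero
  | _, .succ x => .succ (ρ _ x)

def Tm.rename {S : Sig} : {Γ Δ : Ctx S} → {τ : Ty S.Base} → Ren Γ Δ → Tm S Γ τ → Tm S Δ τ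
  | _, _, _, ρ, .var x => .var (ρ _ x)
  | _, _, _, _, .con c => .con c
  | _, _, _, ρ, .app t u => .app (t.rename ρ) (u.rename ρ)
  | _, _, _, ρ, .lam t => .lam (t.rename ρ.lift)

/-- Weakening by one variable. -/
def Tm.wk {S : Sig} {Γ : Ctx S} {σ τ : Ty S.Base} (t : Tm S Γ τ) : Tm S (σ :: Γ) τ :=
  t.rename (fun _ x => .succ x)

/-- Substitutions of terms over `Δ` for the variables of `Γ`. -/
abbrev Sub (S : Sig) (Γ Δ : Ctx S) : Type := ∀ τ : Ty S.Base, Var Γ τ → Tm S Δ τ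

def Sub.lift {S : Sig} {Γ Δ : Ctx S} {σ : Ty S.Base} (θ : Sub S Γ Δ) : Sub S (σ :: Γ) (σ :: Δ)
  | _, .zero => .var .zero
  | _, .succ x => (θ _ x).wk

def Tm.subst {S : Sig} : {Γ Δ : Ctx S} → {τ : Ty S.Base} → Sub S Γ Δ → Tm S Γ τ → Tm S Δ τ
  | _, _, _, θ, .var x => θ _ x
  | _, _, _, _, .con c => .con c
  | _, _, _, θ, .app t u => .app (t.subst θ) (u.subst θ)
  | _, _, _, θ, .lam t => .lam (t.subst θ.lift)

/-- The substitution `[t/x]` for the last variable `x`. -/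
def Sub.single {S : Sig} {Γ : Ctx S} {σ : Ty S.Base} (t : Tm S Γ σ) : Sub S (σ :: Γ) Γ
  | _, .zero => t
  | _, .succ x => .var x

/-- `βη`-conversion. -/
inductive Conv {S : Sig} : {Γ : Ctx S} → {τ : Ty S.Base} → Tm S Γ τ → Tm S Γ τ → Prop
  | refl {Γ : Ctx S} {τ : Ty S.Base} (t : Tm S Γ τ) : Conv t t
  | symm {Γ : Ctx S} {τ : Ty S.Base} {t u : Tm S Γ τ} : Conv t u → Conv u t
  | trans {Γ : Ctx S} {τ : Ty S.Base} {t u v : Tm S Γ τ} : Conv t u → Conv u v → Conv t v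
  | app {Γ : Ctx S} {σ τ : Ty S.Base} {t t' : Tm S Γ (.arr σ τ)} {u u' : Tm S Γ σ} :
      Conv t t' → Conv u u' → Conv (.app t u) (.app t' u')
  | lam {Γ : Ctx S} {σ τ : Ty S.Base} {t t' : Tm S (σ :: Γ) τ} :
      Conv t t' → Conv (.lam t) (.lam t')
  | beta {Γ : Ctx S} {σ τ : Ty S.Base} (t : Tm S (σ :: Γ) τ) (u : Tm S Γ σ) :
      Conv (.app (.lam t) u) (t.subst (Sub.single u))
  | eta {Γ : Ctx S} {σ τ : Ty S.Base} (t : Tm S Γ (.arr σ τ)) :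
      Conv (.lam (.app t.wk (.var .zero))) t

/-- Indices (counted from `0` in the context) of the free variables. -/
def Tm.fv {S : Sig} : {Γ : Ctx S} → {τ : Ty S.Base} → Tm S Γ τ → Set ℕ
  | _, _, .var x => {x.toNat}
  | _, _, .con _ => ∅
  | _, _, .app t u => t.fv ∪ u.fv
  | _, _, .lam t => {n | n + 1 ∈ t.fv}

/-- Lists of arguments of predicates. -/
inductive Args (S : Sig) (Γ : Ctx S) : List (Ty S.Base) → Type
  | nil : Args S Γ []
  | cons {τ : Ty S.Base} {τs : List (Ty S.Base)} : Tm S Γ τ → Args S Γ τs → Args S Γ (τ :: τs)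

infixr:67 " ;; " => Args.cons

def Args.subst {S : Sig} {Γ Δ : Ctx S} (θ : Sub S Γ Δ) :
    {τs : List (Ty S.Base)} → Args S Γ τs → Args S Δ τs
  | _, .nil => .nil
  | _, .cons t ts => .cons (t.subst θ) (ts.subst θ)

inductive Args.Conv {S : Sig} {Γ : Ctx S} :
    {τs : List (Ty S.Base)} → Args S Γ τs → Args S Γ τs → Prop
  | nil : Args.Conv .nil .nil
  | cons {τ : Ty S.Base} {τs : List (Ty S.Base)} {t t' : Tm S Γ τ} {ts ts' : Args S Γ τs} :
      FOLDN.Conv t t' → Args.Conv ts ts' → Args.Conv (t ;; ts) (t' ;; ts')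

def Args.fv {S : Sig} {Γ : Ctx S} : {τs : List (Ty S.Base)} → Args S Γ τs → Set ℕ
  | _, .nil => ∅
  | _, .cons t ts => t.fv ∪ ts.fv

/-! ### Predicates and formulas -/

/-- Predicate constants, other than `nat`, by the list of their argument types. The list
predicates over `lst` with `n` stars, and the eigenvariable operations, come once for every element
type; `other` are further predicates of the signature. -/
inductive Pred (S : Sig) : List (Ty S.Base) → Type
  | eq : Pred S [.nt, .nt]
  | lt : Pred S [.nt, .nt]
  | le : Pred S [.nt, .nt]
  | sum : Pred S [.nt, .nt, .nt]
  | length (e : Elem) (n : ℕ) : Pred S [.stars n e.lst, .nt]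
  | list (e : Elem) (n : ℕ) : Pred S [.stars n e.lst]
  | element (e : Elem) (n : ℕ) : Pred S [.stars n e.ty, .stars n e.lst]
  | split (e : Elem) (n : ℕ) : Pred S [.stars n e.lst, .stars n e.lst, .stars n e.lst]
  | permute (e : Elem) (n : ℕ) : Pred S [.stars n e.lst, .stars n e.lst]
  | subst (e : ETy) : Pred S [.nt, .star .i, .star e.ty, .star e.ty]
  | subst₀ (e : ETy) : Pred S [.nt, .star (.star .i), .star (.star e.ty), .star (.star e.ty)]
  | extend (e : ETy) : Pred S [.nt, .star e.ty, .star e.ty]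
  | extend₀ (e : ETy) : Pred S [.nt, .star (.star e.ty), .star (.star e.ty)]
  | prog : Pred S [.star .atm, .star .prplst, .star .prplst]
  | seq : Pred S [.nt, .star .atmlst, .star .atmlst, .star .prp]
  | splitSeq : Pred S [.nt, .star .atmlst, .star .atmlst, .star .prplst]
  | other (p : S.Prd) : Pred S (S.prdTy p)

/-- Formulas, with free variables in a context. -/
inductive Fm (S : Sig) : Ctx S → Type
  | bot {Γ : Ctx S} : Fm S Γ
  | top {Γ : Ctx S} : Fm S Γ
  | and {Γ : Ctx S} : Fm S Γ → Fm S Γ → Fm S Γ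
  | or {Γ : Ctx S} : Fm S Γ → Fm S Γ → Fm S Γ
  | imp {Γ : Ctx S} : Fm S Γ → Fm S Γ → Fm S Γ
  | all {Γ : Ctx S} (τ : Ty S.Base) : Fm S (τ :: Γ) → Fm S Γ
  | ex {Γ : Ctx S} (τ : Ty S.Base) : Fm S (τ :: Γ) → Fm S Γ
  | nat {Γ : Ctx S} : Tm S Γ .nt → Fm S Γ
  | pred {Γ : Ctx S} {τs : List (Ty S.Base)} : Pred S τs → Args S Γ τs → Fm S Γ

infixr:40 " ⊃ₘ " => Fm.imp
infixr:50 " ⊓ₘ " => Fm.and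

def Fm.subst {S : Sig} : {Γ Δ : Ctx S} → Sub S Γ Δ → Fm S Γ → Fm S Δ
  | _, _, _, .bot => .bot
  | _, _, _, .top => .top
  | _, _, θ, .and B C => .and (B.subst θ) (C.subst θ)
  | _, _, θ, .or B C => .or (B.subst θ) (C.subst θ)
  | _, _, θ, .imp B C => .imp (B.subst θ) (C.subst θ)
  | _, _, θ, .all τ B => .all τ (B.subst θ.lift)
  | _, _, θ, .ex τ B => .ex τ (B.subst θ.lift)
  | _, _, θ, .nat t => .nat (t.subst θ)
  | _, _, θ, .pred p ts => .pred p (ts.subst θ)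

/-- `B[t/x]` for the last variable `x`. -/
def Fm.inst {S : Sig} {Γ : Ctx S} {σ : Ty S.Base} (B : Fm S (σ :: Γ)) (t : Tm S Γ σ) : Fm S Γ :=
  B.subst (Sub.single t)

def Fm.wk {S : Sig} {Γ : Ctx S} {σ : Ty S.Base} (B : Fm S Γ) : Fm S (σ :: Γ) :=
  B.subst (fun _ x => .var (.succ x))

/-- `βη`-conversion of formulas. -/
inductive Fm.Conv {S : Sig} : {Γ : Ctx S} → Fm S Γ → Fm S Γ → Prop
  | bot {Γ : Ctx S} : Fm.Conv (.bot : Fm S Γ) .bot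
  | top {Γ : Ctx S} : Fm.Conv (.top : Fm S Γ) .top
  | and {Γ : Ctx S} {B B' C C' : Fm S Γ} :
      Fm.Conv B B' → Fm.Conv C C' → Fm.Conv (.and B C) (.and B' C')
  | or {Γ : Ctx S} {B B' C C' : Fm S Γ} :
      Fm.Conv B B' → Fm.Conv C C' → Fm.Conv (.or B C) (.or B' C')
  | imp {Γ : Ctx S} {B B' C C' : Fm S Γ} :
      Fm.Conv B B' → Fm.Conv C C' → Fm.Conv (.imp B C) (.imp B' C')
  | all {Γ : Ctx S} {τ : Ty S.Base} {B B' : Fm S (τ :: Γ)} :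
      Fm.Conv B B' → Fm.Conv (.all τ B) (.all τ B')
  | ex {Γ : Ctx S} {τ : Ty S.Base} {B B' : Fm S (τ :: Γ)} :
      Fm.Conv B B' → Fm.Conv (.ex τ B) (.ex τ B')
  | nat {Γ : Ctx S} {t t' : Tm S Γ .nt} : FOLDN.Conv t t' → Fm.Conv (.nat t) (.nat t')
  | pred {Γ : Ctx S} {τs : List (Ty S.Base)} {p : Pred S τs} {ts ts' : Args S Γ τs} :
      Args.Conv ts ts' → Fm.Conv (.pred p ts) (.pred p ts')

def Fm.IsAtomic {S : Sig} {Γ : Ctx S} : Fm S Γ → Prop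
  | .nat _ => True
  | .pred _ _ => True
  | _ => False

def Fm.fv {S : Sig} : {Γ : Ctx S} → Fm S Γ → Set ℕ
  | _, .bot => ∅
  | _, .top => ∅
  | _, .and B C => B.fv ∪ C.fv
  | _, .or B C => B.fv ∪ C.fv
  | _, .imp B C => B.fv ∪ C.fv
  | _, .all _ B => {n | n + 1 ∈ B.fv}
  | _, .ex _ B => {n | n + 1 ∈ B.fv}
  | _, .nat t => t.fv
  | _, .pred _ ts => ts.fv

/-- The level of a formula, for levels `lnat` of `nat` and `lv` of the other predicates. -/
def Fm.level {S : Sig} (lnat : ℕ) (lv : ∀ τs : List (Ty S.Base), Pred S τs → ℕ) :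
    {Γ : Ctx S} → Fm S Γ → ℕ
  | _, .bot => 0
  | _, .top => 0
  | _, .and B C => max (B.level lnat lv) (C.level lnat lv)
  | _, .or B C => max (B.level lnat lv) (C.level lnat lv)
  | _, .imp B C => max (B.level lnat lv + 1) (C.level lnat lv)
  | _, .all _ B => B.level lnat lv
  | _, .ex _ B => B.level lnat lv
  | _, .nat _ => lnat
  | _, .pred p _ => lv _ p

/-! ### Definitions and derivations -/

/-- A definitional clause `∀ x̄ [p t̄ ≜ B]`; `ctx` is the list of the types of `x̄`. -/
structure Clause (S : Sig) where
  ctx : Ctx S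
  {arity : List (Ty S.Base)}
  head : Pred S arity
  args : Args S ctx arity
  body : Fm S ctx

/-- A definition: a set of clauses, the free variables of every body being free in the head, and the
predicates having levels such that no body has a greater level than its head. -/
structure Definition (S : Sig) where
  clauses : Set (Clause S)
  fv_body : ∀ c ∈ clauses, c.body.fv ⊆ c.args.fv
  stratified : ∃ (lnat : ℕ) (lv : ∀ τs : List (Ty S.Base), Pred S τs → ℕ),
    ∀ c ∈ clauses, c.body.level lnat lv ≤ lv _ c.head

/-- Sets of substitutions for the variables of `Δ` and, disjoint from them, those of `Φ`. -/
abbrev SubSet (S : Sig) (Δ Φ : Ctx S) : Type :=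
  ∀ Δ' : Ctx S, Sub S Δ Δ' → Sub S Φ Δ' → Prop

/-- `(ρ, θ)` unifies `u` (over `Δ`) and `t` (over `Φ`). -/
def Unifies {S : Sig} {Δ Φ Δ' : Ctx S} {τs : List (Ty S.Base)} (u : Args S Δ τs) (t : Args S Φ τs)
    (ρ : Sub S Δ Δ') (θ : Sub S Φ Δ') : Prop :=
  Args.Conv (u.subst ρ) (t.subst θ)

/-- `U` is a complete set of unifiers: it consists of unifiers, and every unifier is an instance
of one in `U`. -/
def IsCSU {S : Sig} {Δ Φ : Ctx S} {τs : List (Ty S.Base)} (u : Args S Δ τs) (t : Args S Φ τs)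
    (U : SubSet S Δ Φ) : Prop :=
  (∀ Δ' ρ θ, U Δ' ρ θ → Unifies u t ρ θ) ∧
  ∀ (Δ'' : Ctx S) (ρ : Sub S Δ Δ'') (θ : Sub S Φ Δ''), Unifies u t ρ θ →
    ∃ (Δ' : Ctx S) (ρ₀ : Sub S Δ Δ') (θ₀ : Sub S Φ Δ') (σ : Sub S Δ' Δ''), U Δ' ρ₀ θ₀ ∧
      (∀ τ x, Conv (ρ τ x) ((ρ₀ τ x).subst σ)) ∧ ∀ τ x, Conv (θ τ x) ((θ₀ τ x).subst σ)

/-- The constant `s` applied to a term. -/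
def suc {S : Sig} {Γ : Ctx S} (t : Tm S Γ .nt) : Tm S Γ .nt := .app (.con .succ) t

/-- The substitution `[s j / j]` for the last variable `j`. -/
def Sub.step {S : Sig} {Γ : Ctx S} : Sub S (.nt :: Γ) (.nt :: Γ)
  | _, .zero => suc (.var .zero)
  | _, .succ x => .var (.succ x)

/-- `Derives D Δ Γ C`: the sequent `Γ ⟶ C`, whose free variables are among those of `Δ`, is
derivable with the definition `D`. The rules `convL` and `convR` express that formulas are
identified up to `βη`-conversion, and `fresh` that a derivation may use variables that are not free
in its end-sequent. -/
inductive Derives {S : Sig} (D : Set (Clause S)) :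
    (Δ : Ctx S) → Multiset (Fm S Δ) → Fm S Δ → Prop
  | botL {Δ : Ctx S} {Γ : Multiset (Fm S Δ)} {B : Fm S Δ} : Derives D Δ (.bot ::ₘ Γ) B
  | topR {Δ : Ctx S} {Γ : Multiset (Fm S Δ)} : Derives D Δ Γ .top
  | andL₁ {Δ : Ctx S} {Γ : Multiset (Fm S Δ)} {B C E : Fm S Δ} :
      Derives D Δ (B ::ₘ Γ) E → Derives D Δ (.and B C ::ₘ Γ) E
  | andL₂ {Δ : Ctx S} {Γ : Multiset (Fm S Δ)} {B C E : Fm S Δ} :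
      Derives D Δ (C ::ₘ Γ) E → Derives D Δ (.and B C ::ₘ Γ) E
  | andR {Δ : Ctx S} {Γ : Multiset (Fm S Δ)} {B C : Fm S Δ} :
      Derives D Δ Γ B → Derives D Δ Γ C → Derives D Δ Γ (.and B C)
  | orL {Δ : Ctx S} {Γ : Multiset (Fm S Δ)} {B C E : Fm S Δ} :
      Derives D Δ (B ::ₘ Γ) E → Derives D Δ (C ::ₘ Γ) E → Derives D Δ (.or B C ::ₘ Γ) E
  | orR₁ {Δ : Ctx S} {Γ : Multiset (Fm S Δ)} {B C : Fm S Δ} :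
      Derives D Δ Γ B → Derives D Δ Γ (.or B C)
  | orR₂ {Δ : Ctx S} {Γ : Multiset (Fm S Δ)} {B C : Fm S Δ} :
      Derives D Δ Γ C → Derives D Δ Γ (.or B C)
  | impL {Δ : Ctx S} {Γ : Multiset (Fm S Δ)} {B C E : Fm S Δ} :
      Derives D Δ Γ B → Derives D Δ (C ::ₘ Γ) E → Derives D Δ (.imp B C ::ₘ Γ) E
  | impR {Δ : Ctx S} {Γ : Multiset (Fm S Δ)} {B C : Fm S Δ} :
      Derives D Δ (B ::ₘ Γ) C → Derives D Δ Γ (.imp B C)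
  | allL {Δ : Ctx S} {Γ : Multiset (Fm S Δ)} {τ : Ty S.Base} {B : Fm S (τ :: Δ)} {C : Fm S Δ}
      (t : Tm S Δ τ) : Derives D Δ (B.inst t ::ₘ Γ) C → Derives D Δ (.all τ B ::ₘ Γ) C
  | allR {Δ : Ctx S} {Γ : Multiset (Fm S Δ)} {τ : Ty S.Base} {B : Fm S (τ :: Δ)} :
      Derives D (τ :: Δ) (Γ.map Fm.wk) B → Derives D Δ Γ (.all τ B)
  | exL {Δ : Ctx S} {Γ : Multiset (Fm S Δ)} {τ : Ty S.Base} {B : Fm S (τ :: Δ)} {C : Fm S Δ} :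
      Derives D (τ :: Δ) (B ::ₘ Γ.map Fm.wk) C.wk → Derives D Δ (.ex τ B ::ₘ Γ) C
  | exR {Δ : Ctx S} {Γ : Multiset (Fm S Δ)} {τ : Ty S.Base} {B : Fm S (τ :: Δ)}
      (t : Tm S Δ τ) : Derives D Δ Γ (B.inst t) → Derives D Δ Γ (.ex τ B)
  | init {Δ : Ctx S} {Γ : Multiset (Fm S Δ)} {A : Fm S Δ} : A.IsAtomic → Derives D Δ (A ::ₘ Γ) A
  | contrL {Δ : Ctx S} {Γ : Multiset (Fm S Δ)} {B C : Fm S Δ} :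
      Derives D Δ (B ::ₘ B ::ₘ Γ) C → Derives D Δ (B ::ₘ Γ) C
  | cut {Δ : Ctx S} {Γ Γ' : Multiset (Fm S Δ)} {B C : Fm S Δ} :
      Derives D Δ Γ' B → Derives D Δ (B ::ₘ Γ) C → Derives D Δ (Γ' + Γ) C
  | natR_zero {Δ : Ctx S} {Γ : Multiset (Fm S Δ)} : Derives D Δ Γ (.nat (.con .zero))
  | natR_succ {Δ : Ctx S} {Γ : Multiset (Fm S Δ)} {t : Tm S Δ .nt} :
      Derives D Δ Γ (.nat t) → Derives D Δ Γ (.nat (suc t))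
  | natL {Δ : Ctx S} {Γ : Multiset (Fm S Δ)} {C : Fm S Δ} {t : Tm S Δ .nt}
      (B : Fm S (.nt :: Δ)) :
      Derives D Δ 0 (B.inst (.con .zero)) → Derives D (.nt :: Δ) {B} (B.subst Sub.step) →
      Derives D Δ (B.inst t ::ₘ Γ) C → Derives D Δ (.nat t ::ₘ Γ) C
  | defR {Δ Φ : Ctx S} {Γ : Multiset (Fm S Δ)} {τs : List (Ty S.Base)} {p : Pred S τs}
      {u : Args S Δ τs} {t : Args S Φ τs} {B : Fm S Φ} (θ : Sub S Φ Δ) :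
      (⟨Φ, p, t, B⟩ : Clause S) ∈ D → Args.Conv u (t.subst θ) →
      Derives D Δ Γ (B.subst θ) → Derives D Δ Γ (.pred p u)
  | defL {Δ : Ctx S} {Γ : Multiset (Fm S Δ)} {C : Fm S Δ} {τs : List (Ty S.Base)} {p : Pred S τs}
      {u : Args S Δ τs} (U : ∀ Φ : Ctx S, Args S Φ τs → Fm S Φ → SubSet S Δ Φ) :
      (∀ Φ t B, (⟨Φ, p, t, B⟩ : Clause S) ∈ D → IsCSU u t (U Φ t B)) →
      (∀ Φ t B, (⟨Φ, p, t, B⟩ : Clause S) ∈ D → ∀ Δ' ρ θ, U Φ t B Δ' ρ θ →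
        Derives D Δ' (B.subst θ ::ₘ Γ.map (Fm.subst ρ)) (C.subst ρ)) →
      Derives D Δ (.pred p u ::ₘ Γ) C
  | convL {Δ : Ctx S} {Γ : Multiset (Fm S Δ)} {B B' C : Fm S Δ} :
      Fm.Conv B B' → Derives D Δ (B ::ₘ Γ) C → Derives D Δ (B' ::ₘ Γ) C
  | convR {Δ : Ctx S} {Γ : Multiset (Fm S Δ)} {C C' : Fm S Δ} :
      Fm.Conv C C' → Derives D Δ Γ C → Derives D Δ Γ C'
  | fresh {Δ : Ctx S} {Γ : Multiset (Fm S Δ)} {C : Fm S Δ} (τ : Ty S.Base) :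
      Derives D (τ :: Δ) (Γ.map Fm.wk) C.wk → Derives D Δ Γ C

/-- The closed formula `B` is derivable using the definition `D`. -/
def Definition.Proves {S : Sig} (D : Definition S) (B : Fm S []) : Prop := Derives D.clauses [] 0 B

/-- `D` extends `D₀` by clauses that do not define any predicate defined by `D₀`. -/
def Definition.Extends {S : Sig} (D D₀ : Definition S) : Prop :=
  D₀.clauses ⊆ D.clauses ∧
  ∀ c ∈ D.clauses, (∃ c₀ ∈ D₀.clauses,
    (⟨c₀.arity, c₀.head⟩ : Σ τs, Pred S τs) = ⟨c.arity, c.head⟩) → c ∈ D₀.clauses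

/-! ### Abbreviations for terms and formulas -/

section Abbreviations

variable {S : Sig} {Γ : Ctx S}

abbrev v0 {a : Ty S.Base} : Tm S (a :: Γ) a := .var .zero
abbrev v1 {a b : Ty S.Base} : Tm S (a :: b :: Γ) b := .var (.succ .zero)
abbrev v2 {a b c : Ty S.Base} : Tm S (a :: b :: c :: Γ) c := .var (.succ (.succ .zero))
abbrev v3 {a b c d : Ty S.Base} : Tm S (a :: b :: c :: d :: Γ) d :=
  .var (.succ (.succ (.succ .zero)))
abbrev v4 {a b c d e : Ty S.Base} : Tm S (a :: b :: c :: d :: e :: Γ) e :=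
  .var (.succ (.succ (.succ (.succ .zero))))
abbrev v5 {a b c d e f : Ty S.Base} : Tm S (a :: b :: c :: d :: e :: f :: Γ) f :=
  .var (.succ (.succ (.succ (.succ (.succ .zero)))))

abbrev v6 {a b c d e f g : Ty S.Base} : Tm S (a :: b :: c :: d :: e :: f :: g :: Γ) g :=
  .var (.succ (.succ (.succ (.succ (.succ (.succ .zero))))))

abbrev v7 {a b c d e f g h : Ty S.Base} : Tm S (a :: b :: c :: d :: e :: f :: g :: h :: Γ) h :=
  .var (.succ (.succ (.succ (.succ (.succ (.succ (.succ .zero)))))))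

infixl:80 " ⬝ₘ " => Tm.app

abbrev zr : Tm S Γ .nt := .con .zero
abbrev fst (l : Tm S Γ .evs) : Tm S Γ .i := .con .fst ⬝ₘ l
abbrev rst (l : Tm S Γ .evs) : Tm S Γ .evs := .con .rst ⬝ₘ l

/-- `nil` below `n` abstractions over `evs`. -/
def nilS (e : Elem) : (n : ℕ) → {Γ : Ctx S} → Tm S Γ (.stars n e.lst)
  | 0, _ => .con (.nil e)
  | n + 1, _ => .lam (nilS e n)

/-- `X :: L` below `n` abstractions over `evs`; for `n = 1` it is `λ l. (X l) :: (L l)`. -/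
def consS (e : Elem) : (n : ℕ) → {Γ : Ctx S} → Tm S Γ (.stars n e.ty) → Tm S Γ (.stars n e.lst) →
    Tm S Γ (.stars n e.lst)
  | 0, _, X, L => .con (.cons e) ⬝ₘ X ⬝ₘ L
  | n + 1, _, X, L => .lam (consS e n (X.wk ⬝ₘ v0) (L.wk ⬝ₘ v0))

/-- `nil^*` and `::^*` for atoms and for propositions. -/
def anil : Tm S Γ (.star .atmlst) := nilS .atm 1
def acons (A : Tm S Γ (.star .atm)) (L : Tm S Γ (.star .atmlst)) : Tm S Γ (.star .atmlst) :=
  consS .atm 1 A L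
def pnil : Tm S Γ (.star .prplst) := nilS .prp 1
def pcons (B : Tm S Γ (.star .prp)) (L : Tm S Γ (.star .prplst)) : Tm S Γ (.star .prplst) :=
  consS .prp 1 B L

/-- `⟨A⟩^*`, `tt^*`, `B &^* C`, `A ⊸^* B`, `A ⇒^* B`, `⋀^* B`. -/
def atomS (A : Tm S Γ (.star .atm)) : Tm S Γ (.star .prp) := .lam (.con .atom ⬝ₘ (A.wk ⬝ₘ v0))
def ttS : Tm S Γ (.star .prp) := .lam (.con .tt)
def withS (B C : Tm S Γ (.star .prp)) : Tm S Γ (.star .prp) :=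
  .lam (.con .wth ⬝ₘ (B.wk ⬝ₘ v0) ⬝ₘ (C.wk ⬝ₘ v0))
def limpS (A : Tm S Γ (.star .atm)) (B : Tm S Γ (.star .prp)) : Tm S Γ (.star .prp) :=
  .lam (.con .limp ⬝ₘ (A.wk ⬝ₘ v0) ⬝ₘ (B.wk ⬝ₘ v0))
def iimpS (A : Tm S Γ (.star .atm)) (B : Tm S Γ (.star .prp)) : Tm S Γ (.star .prp) :=
  .lam (.con .iimp ⬝ₘ (A.wk ⬝ₘ v0) ⬝ₘ (B.wk ⬝ₘ v0))
def bigwedgeS (B : Tm S Γ (.star (.arr .i .prp))) : Tm S Γ (.star .prp) :=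
  .lam (.con .bigwedge ⬝ₘ .lam (B.wk.wk ⬝ₘ v1 ⬝ₘ v0))

/-- `λ l. X (rst l)`. -/
def shift {τ : Ty S.Base} (X : Tm S Γ (.star τ)) : Tm S Γ (.star τ) := .lam (X.wk ⬝ₘ rst v0)

/-- `λ l' λ l. X l' (fst l) (rst l)`. -/
def onList {τ : Ty S.Base} (X : Tm S Γ (.star (.arr .i (.star τ)))) : Tm S Γ (.star (.star τ)) :=
  .lam (.lam (X.wk.wk ⬝ₘ v1 ⬝ₘ fst v0 ⬝ₘ rst v0))

/-- `λ l' λ l. X (rst l') (fst l') l`. -/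
def moved {τ : Ty S.Base} (X : Tm S Γ (.star (.arr .i (.star τ)))) : Tm S Γ (.star (.star τ)) :=
  .lam (.lam (X.wk.wk ⬝ₘ rst v1 ⬝ₘ fst v1 ⬝ₘ v0))

/-- Atomic formulas over the built-in predicates. -/
def fEq (I J : Tm S Γ .nt) : Fm S Γ := .pred .eq (I ;; J ;; .nil)
def fLt (I J : Tm S Γ .nt) : Fm S Γ := .pred .lt (I ;; J ;; .nil)
def fSum (I J K : Tm S Γ .nt) : Fm S Γ := .pred .sum (I ;; J ;; K ;; .nil)
def fLength (e : Elem) (n : ℕ) (L : Tm S Γ (.stars n e.lst)) (I : Tm S Γ .nt) : Fm S Γ :=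
  .pred (.length e n) (L ;; I ;; .nil)
def fList (e : Elem) (n : ℕ) (L : Tm S Γ (.stars n e.lst)) : Fm S Γ := .pred (.list e n) (L ;; .nil)
def fElement (e : Elem) (n : ℕ) (X : Tm S Γ (.stars n e.ty)) (L : Tm S Γ (.stars n e.lst)) :
    Fm S Γ := .pred (.element e n) (X ;; L ;; .nil)
def fSplit (e : Elem) (n : ℕ) (L L₁ L₂ : Tm S Γ (.stars n e.lst)) : Fm S Γ :=
  .pred (.split e n) (L ;; L₁ ;; L₂ ;; .nil)
def fPermute (e : Elem) (n : ℕ) (L L' : Tm S Γ (.stars n e.lst)) : Fm S Γ :=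
  .pred (.permute e n) (L ;; L' ;; .nil)
def fSubst (e : ETy) (I : Tm S Γ .nt) (T : Tm S Γ (.star .i)) (X X' : Tm S Γ (.star e.ty)) :
    Fm S Γ := .pred (.subst e) (I ;; T ;; X ;; X' ;; .nil)
def fSubst₀ (e : ETy) (I : Tm S Γ .nt) (T : Tm S Γ (.star (.star .i)))
    (X X' : Tm S Γ (.star (.star e.ty))) : Fm S Γ := .pred (.subst₀ e) (I ;; T ;; X ;; X' ;; .nil)
def fExtend (e : ETy) (I : Tm S Γ .nt) (X X' : Tm S Γ (.star e.ty)) : Fm S Γ :=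
  .pred (.extend e) (I ;; X ;; X' ;; .nil)
def fExtend₀ (e : ETy) (I : Tm S Γ .nt) (X X' : Tm S Γ (.star (.star e.ty))) : Fm S Γ :=
  .pred (.extend₀ e) (I ;; X ;; X' ;; .nil)
/-- `prog A LL IL`: a clause with head `A`, linear hypotheses `LL`, intuitionistic ones `IL`. -/
def fProg (A : Tm S Γ (.star .atm)) (LL IL : Tm S Γ (.star .prplst)) : Fm S Γ :=
  .pred .prog (A ;; LL ;; IL ;; .nil)
def fSeq (I : Tm S Γ .nt) (IL LL : Tm S Γ (.star .atmlst)) (B : Tm S Γ (.star .prp)) : Fm S Γ :=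
  .pred .seq (I ;; IL ;; LL ;; B ;; .nil)
def fSplitSeq (I : Tm S Γ .nt) (IL LL : Tm S Γ (.star .atmlst)) (L : Tm S Γ (.star .prplst)) :
    Fm S Γ := .pred .splitSeq (I ;; IL ;; LL ;; L ;; .nil)

/-- `∃ i (nat i ∧ seq i IL LL B)`. -/
def prv (IL LL : Tm S Γ (.star .atmlst)) (B : Tm S Γ (.star .prp)) : Fm S Γ :=
  .ex .nt (.nat v0 ⊓ₘ fSeq v0 IL.wk LL.wk B.wk)

end Abbreviations

/-! ### The definitions. In each clause the variables are listed with their types. -/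

section Clauses

variable (S : Sig)

/-- `D(nat)`. -/
def natClauses : List (Clause S) :=
  [ -- `I = I`
    ⟨[.nt], .eq, v0 ;; v0 ;; .nil, .top⟩,
    -- `I`, `J`, `K`
    ⟨[.nt], .sum, zr ;; v0 ;; v0 ;; .nil, .nat v0⟩,
    ⟨[.nt, .nt, .nt], .sum, suc v0 ;; v1 ;; suc v2 ;; .nil, fSum v0 v1 v2⟩,
    ⟨[.nt], .lt, zr ;; suc v0 ;; .nil, .nat v0⟩,
    ⟨[.nt, .nt], .lt, suc v0 ;; suc v1 ;; .nil, fLt v0 v1⟩,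
    ⟨[.nt], .le, v0 ;; v0 ;; .nil, .top⟩,
    ⟨[.nt, .nt], .le, v0 ;; v1 ;; .nil, fLt v0 v1⟩ ]

/-- The list predicates with elements of type `e`, over lists with `n` stars. -/
def listClauses (e : Elem) (n : ℕ) : List (Clause S) :=
  let lst : Ty S.Base := .stars n e.lst
  let elt : Ty S.Base := .stars n e.ty
  [ ⟨[], .length e n, nilS e n ;; zr ;; .nil, .top⟩,
    -- `A, L, I`
    ⟨[elt, lst, .nt], .length e n, consS e n v0 v1 ;; suc v2 ;; .nil, fLength e n v1 v2⟩,
    -- `L`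
    ⟨[lst], .list e n, v0 ;; .nil, .ex .nt (.nat v0 ⊓ₘ fLength e n v1 v0)⟩,
    -- `A, L`
    ⟨[elt, lst], .element e n, v0 ;; consS e n v0 v1 ;; .nil, .top⟩,
    -- `A, A', L`
    ⟨[elt, elt, lst], .element e n, v0 ;; consS e n v1 v2 ;; .nil, fElement e n v0 v2⟩,
    ⟨[], .split e n, nilS e n ;; nilS e n ;; nilS e n ;; .nil, .top⟩,
    -- `A, L₁, L₂, L₃`
    ⟨[elt, lst, lst, lst], .split e n, consS e n v0 v1 ;; consS e n v0 v2 ;; v3 ;; .nil,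
      fSplit e n v1 v2 v3⟩,
    ⟨[elt, lst, lst, lst], .split e n, consS e n v0 v1 ;; v2 ;; consS e n v0 v3 ;; .nil,
      fSplit e n v1 v2 v3⟩,
    ⟨[], .permute e n, nilS e n ;; nilS e n ;; .nil, .top⟩,
    -- `A, L₁, L₂`; in the body `l₂₂` comes first
    ⟨[elt, lst, lst], .permute e n, consS e n v0 v1 ;; v2 ;; .nil,
      .ex lst (fSplit e n v3 (consS e n v1 (nilS e n)) v0 ⊓ₘ fPermute e n v2 v0)⟩ ]

/-- `D(evars(τ))` for the type `τ` given by `e`. -/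
def evarsClauses (e : ETy) : List (Clause S) :=
  let τ : Ty S.Base := e.ty
  [ -- `I, T, X, X'`
    ⟨[.nt, .star .i, .star τ, .star τ], .subst e, v0 ;; v1 ;; v2 ;; v3 ;; .nil,
      fSubst₀ e v0 (.lam v2) (.lam v3) (.lam v4)⟩,
    -- `T, X`
    ⟨[.star (.star .i), .star (.arr .i (.star τ))], .subst₀ e,
      zr ;; v0 ;; onList v1 ;; .lam (.lam (v3 ⬝ₘ v1 ⬝ₘ (v2 ⬝ₘ v1 ⬝ₘ v0) ⬝ₘ rst v0)) ;; .nil, .top⟩,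
    -- `I, T, X, X'`
    ⟨[.nt, .star (.arr .i (.star .i)), .star (.arr .i (.star τ)), .star (.arr .i (.star τ))],
      .subst₀ e, suc v0 ;; onList v1 ;; onList v2 ;; onList v3 ;; .nil,
      fSubst₀ e v0 (moved v1) (moved v2) (moved v3)⟩,
    -- `I, X, X'`
    ⟨[.nt, .star τ, .star τ], .extend e, v0 ;; v1 ;; v2 ;; .nil,
      fExtend₀ e v0 (.lam v2) (.lam v3)⟩,
    -- `X`
    ⟨[.star (.star τ)], .extend₀ e,
      zr ;; .lam (.lam (v2 ⬝ₘ v1 ⬝ₘ v0)) ;; .lam (.lam (v2 ⬝ₘ v1 ⬝ₘ rst v0)) ;; .nil, .top⟩,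
    -- `I, X, X'`
    ⟨[.nt, .star (.arr .i (.star τ)), .star (.arr .i (.star τ))],
      .extend₀ e, suc v0 ;; onList v1 ;; onList v2 ;; .nil,
      fExtend₀ e v0 (moved v1) (moved v2)⟩ ]

/-- `D(linear)`. -/
def linearClauses : List (Clause S) :=
  [ -- `I, IL, A`
    ⟨[.nt, .star .atmlst, .star .atm], .seq, v0 ;; v1 ;; acons v2 anil ;; atomS v2 ;; .nil, .top⟩,
    -- `I, A', IL, A`
    ⟨[.nt, .star .atm, .star .atmlst, .star .atm], .seq,
      v0 ;; acons v1 v2 ;; anil ;; atomS v3 ;; .nil, fElement .atm 1 v3 (acons v1 v2)⟩,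
    -- `I, IL, LL, A`; in the body `il, ll` come first
    ⟨[.nt, .star .atmlst, .star .atmlst, .star .atm], .seq,
      suc v0 ;; v1 ;; v2 ;; atomS v3 ;; .nil,
      .ex (.star .prplst) (.ex (.star .prplst)
        (fList .prp 1 v1 ⊓ₘ fList .prp 1 v0 ⊓ₘ fProg v5 v1 v0 ⊓ₘ
          fSplitSeq v2 v3 v4 v1 ⊓ₘ fSplitSeq v2 v3 anil v0))⟩,
    -- `I, IL, LL`
    ⟨[.nt, .star .atmlst, .star .atmlst], .seq, v0 ;; v1 ;; v2 ;; ttS ;; .nil, .top⟩,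
    -- `I, IL, LL, B, C`
    ⟨[.nt, .star .atmlst, .star .atmlst, .star .prp, .star .prp], .seq,
      suc v0 ;; v1 ;; v2 ;; withS v3 v4 ;; .nil, fSeq v0 v1 v2 v3 ⊓ₘ fSeq v0 v1 v2 v4⟩,
    -- `I, IL, LL, A, B`
    ⟨[.nt, .star .atmlst, .star .atmlst, .star .atm, .star .prp], .seq,
      suc v0 ;; v1 ;; v2 ;; limpS v3 v4 ;; .nil, fSeq v0 v1 (acons v3 v2) v4⟩,
    ⟨[.nt, .star .atmlst, .star .atmlst, .star .atm, .star .prp], .seq,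
      suc v0 ;; v1 ;; v2 ;; iimpS v3 v4 ;; .nil, fSeq v0 (acons v3 v1) v2 v4⟩,
    -- `I, IL, LL, B`
    ⟨[.nt, .star .atmlst, .star .atmlst, .star (.arr .i .prp)], .seq,
      suc v0 ;; v1 ;; v2 ;; bigwedgeS v3 ;; .nil,
      fSeq v0 (shift v1) (shift v2) (.lam (v4 ⬝ₘ rst v0 ⬝ₘ fst v0))⟩,
    -- `I, IL`
    ⟨[.nt, .star .atmlst], .splitSeq, v0 ;; v1 ;; anil ;; pnil ;; .nil, .top⟩,
    -- `I, IL, LL, B, L`; in the body `ll₂, ll₁` come first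
    ⟨[.nt, .star .atmlst, .star .atmlst, .star .prp, .star .prplst], .splitSeq,
      v0 ;; v1 ;; v2 ;; pcons v3 v4 ;; .nil,
      .ex (.star .atmlst) (.ex (.star .atmlst)
        (fSplit .atm 1 v4 v1 v0 ⊓ₘ fSeq v2 v3 v1 v5 ⊓ₘ
          fSplitSeq v2 v3 v0 v6))⟩ ]

/-- `D(lists)`. -/
def listsClauses : List (Clause S) :=
  listClauses S .atm 1 ++ listClauses S .prp 1 ++ listClauses S .atm 2 ++ listClauses S .prp 2

/-- `D(evars)`. -/
def evarsAllClauses : List (Clause S) :=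
  evarsClauses S .atm ++ evarsClauses S .prp ++ evarsClauses S .atmlst ++ evarsClauses S .prplst

/-- `D(nat) ∪ D(lists) ∪ D(evars) ∪ D(linear)`. -/
def linearLogicClauses : List (Clause S) :=
  natClauses S ++ listsClauses S ++ evarsAllClauses S ++ linearClauses S

theorem natClauses_fv : ∀ c ∈ natClauses S, c.body.fv ⊆ c.args.fv := by
  simp [natClauses, Fm.fv, Args.fv, Tm.fv, Var.toNat, fSum, fLt, suc]

theorem listClauses_fv (e : Elem) (n : ℕ) (hn : n = 1 ∨ n = 2) :
    ∀ c ∈ listClauses S e n, c.body.fv ⊆ c.args.fv := by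
  rcases hn with rfl | rfl <;>
  simp [listClauses, Fm.fv, Args.fv, Tm.fv, Var.toNat, fLength, fElement, fSplit, fPermute,
    consS, nilS, suc, Tm.wk, Tm.rename, Set.subset_def]

theorem evarsClauses_fv (e : ETy) : ∀ c ∈ evarsClauses S e, c.body.fv ⊆ c.args.fv := by
  simp [evarsClauses, Fm.fv, Args.fv, Tm.fv, Var.toNat, fSubst₀, fExtend₀, suc, onList, moved,
    Tm.wk, Tm.rename, Set.subset_def]

theorem linearClauses_fv : ∀ c ∈ linearClauses S, c.body.fv ⊆ c.args.fv := by
  simp [linearClauses, Fm.fv, Args.fv, Tm.fv, Var.toNat, fElement, fSplit, fProg, fSeq, fSplitSeq,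
    fList, consS, nilS, suc, shift, acons, anil, pcons, atomS, withS, limpS, iimpS,
    bigwedgeS, Tm.wk, Tm.rename, Set.subset_def]

theorem linearLogicClauses_fv : ∀ c ∈ linearLogicClauses S, c.body.fv ⊆ c.args.fv := by
  intro c hc
  simp only [linearLogicClauses, listsClauses, evarsAllClauses, List.mem_append] at hc
  rcases hc with ((hc | ((hc | hc) | hc) | hc) | ((hc | hc) | hc) | hc) | hc
  · exact natClauses_fv S c hc
  · exact listClauses_fv S _ _ (.inl rfl) c hc
  · exact listClauses_fv S _ _ (.inl rfl) c hc
  · exact listClauses_fv S _ _ (.inr rfl) c hc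
  · exact listClauses_fv S _ _ (.inr rfl) c hc
  · exact evarsClauses_fv S _ c hc
  · exact evarsClauses_fv S _ c hc
  · exact evarsClauses_fv S _ c hc
  · exact evarsClauses_fv S _ c hc
  · exact linearClauses_fv S c hc

theorem linearLogicClauses_level : ∀ c ∈ linearLogicClauses S,
    c.body.level 0 (fun _ _ => 0) ≤ 0 := by
  simp [linearLogicClauses, natClauses, listsClauses, evarsAllClauses, linearClauses, listClauses,
    evarsClauses, Fm.level, fSum, fLt, fLength, fElement, fSplit, fPermute,
    fSubst₀, fExtend₀, fProg, fSeq, fSplitSeq, fList]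

/-- `D(nat) ∪ D(lists) ∪ D(evars) ∪ D(linear)` as a definition. -/
def linearLogic : Definition S where
  clauses := {c | c ∈ linearLogicClauses S}
  fv_body := linearLogicClauses_fv S
  stratified := ⟨0, fun _ _ => 0, linearLogicClauses_level S⟩

end Clauses

/-! ### The formulas. In the bodies the last quantified variable is `v0`, the one before `v1`, … -/

section Formulas

variable (S : Sig)

/-- `P_subst`. -/
def PSubst : Fm S [] :=
  -- `∀ i t a a' ll il`
  .all .nt <| .all (.star .i) <| .all (.star .atm) <| .all (.star .atm) <|
  .all (.star .prplst) <| .all (.star .prplst) <|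
    .nat v5 ⊃ₘ fProg v3 v1 v0 ⊃ₘ fSubst .atm v5 v4 v3 v2 ⊃ₘ
      -- `∃ ll' il'`
      .ex (.star .prplst) (.ex (.star .prplst)
        (fProg v4 v1 v0 ⊓ₘ fSubst .prplst v7 v6 v3 v1 ⊓ₘ fSubst .prplst v7 v6 v2 v0))

/-- `P_extend`. -/
def PExtend : Fm S [] :=
  -- `∀ i a a' ll il`
  .all .nt <| .all (.star .atm) <| .all (.star .atm) <|
  .all (.star .prplst) <| .all (.star .prplst) <|
    .nat v4 ⊃ₘ fProg v3 v1 v0 ⊃ₘ fExtend .atm v4 v3 v2 ⊃ₘ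
      -- `∃ ll' il'`
      .ex (.star .prplst) (.ex (.star .prplst)
        (fProg v4 v1 v0 ⊓ₘ fExtend .prplst v6 v3 v1 ⊓ₘ fExtend .prplst v6 v2 v0))

/-- Specialization rule. -/
def specialization : Fm S [] :=
  PSubst S ⊃ₘ
  -- `∀ i b il ll`
  (.all .nt <| .all (.star (.arr .i .prp)) <| .all (.star .atmlst) <| .all (.star .atmlst) <|
    .nat v3 ⊃ₘ fList .atm 1 v1 ⊃ₘ fList .atm 1 v0 ⊃ₘ
      fSeq (suc v3) v1 v0 (bigwedgeS v2) ⊃ₘ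
        -- `∀ x. seq i il ll (λ l. b l (x l))`
        .all (.star .i) (fSeq v4 v2 v1 (.lam (v4 ⬝ₘ v0 ⬝ₘ (v1 ⬝ₘ v0)))))

/-- Cut rule for an intuitionistic hypothesis. -/
def cutRule : Fm S [] :=
  PExtend S ⊃ₘ
  -- `∀ a b il ll`
  (.all (.star .atm) <| .all (.star .prp) <| .all (.star .atmlst) <| .all (.star .atmlst) <|
    fList .atm 1 v1 ⊃ₘ fList .atm 1 v0 ⊃ₘ
      prv (acons v3 v1) v0 v2 ⊃ₘ prv v1 anil (atomS v3) ⊃ₘ prv v1 v0 v2)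

/-- Cut rule for a linear hypothesis. -/
def linearCutRule : Fm S [] :=
  PExtend S ⊃ₘ
  -- `∀ a b il ll ll₁ ll₂`
  (.all (.star .atm) <| .all (.star .prp) <| .all (.star .atmlst) <| .all (.star .atmlst) <|
  .all (.star .atmlst) <| .all (.star .atmlst) <|
    fList .atm 1 v3 ⊃ₘ fList .atm 1 v2 ⊃ₘ fSplit .atm 1 v2 v1 v0 ⊃ₘ
      prv v3 (acons v5 v1) v4 ⊃ₘ prv v3 v0 (atomS v5) ⊃ₘ prv v3 v2 v4)

/-- Invariance under inclusion of intuitionistic and permutation of linear hypotheses. -/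
def structuralRule : Fm S [] :=
  -- `∀ i b il il' ll ll'`
  .all .nt <| .all (.star .prp) <| .all (.star .atmlst) <| .all (.star .atmlst) <|
  .all (.star .atmlst) <| .all (.star .atmlst) <|
    .nat v5 ⊃ₘ fList .atm 1 v3 ⊃ₘ fList .atm 1 v2 ⊃ₘ fList .atm 1 v1 ⊃ₘ
      .all (.star .atm) (fElement .atm 1 v0 v4 ⊃ₘ fElement .atm 1 v0 v3) ⊃ₘ
      fPermute .atm 1 v1 v0 ⊃ₘ fSeq v5 v3 v1 v4 ⊃ₘ fSeq v5 v2 v0 v4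

end Formulas
end FOLDN

/-! The proof has two layers: a way of arguing inside $FO\lambda^{\Delta\mathbb N}$ as one argues in
ordinary intuitionistic mathematics, and the object-level argument, which is a height induction for
a sequent calculus with atomic cuts.

For the first layer, a finite set of variables together with a multiset of hypotheses is regarded as
a world (`World`), a substitution that makes the old hypotheses derivable as a passage to a later
world (`Hom`), and a formula as true at a world when it is derivable there (`Holds`). Since
derivability is closed under substitution, weakening and cut (`Derives.subst_le`,
`Derives.cut_all`), implication and universal quantification obey the Kripke clauses. Existential
statements and defined atoms are true only locally: their left rules yield a witness, or an
applicable clause, in later worlds, and only for proving a further formula. The modality `J` records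
exactly this. The rule for $nat$ becomes an induction principle over worlds, from which induction on
lists follows through their lengths.

The left rule for definitions turns into case analysis on clauses (`At.cases`), but using a case
requires solving equations modulo $\beta\eta$: the constructors, also pointwise under abstractions,
have to be injective and disjoint, and an equation such as $\lambda l'\lambda
l.\,X\,l'(fst\,l)(rst\,l)=\lambda l'\lambda l.\,c(\dots)$ has to force $X$ itself to begin with $c$.
The second point is not a matter of matching, because $fst$ and $rst$ are mere constants and no
pairing inverts them. It is settled by a presheaf model in the style of normalization by evaluation,
where base values may remember the constant at their head and $evs$ is enlarged by formal pairs on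
which $fst$ and $rst$ compute. In it, the substitution of $fst\,l$ and $rst\,l$ for two variables
has a left inverse (`isSplit_onListSub`); such a substitution is injective and reflects constructors
(`Sub.IsSplit.injective`, `Sub.IsSplit.con₂`).

The object-level argument rests on three height inductions. Structural rules (`Seq.weaken`): the
lists of hypotheses can be changed along inclusion and permutation, and the height can be raised, by
following the clauses; a permutation of the linear hypotheses is distributed over the premises of a
program clause. Changes of eigenvariables (`Seq.rel`): inserting, deleting or instantiating the
$n$-th eigenvariable throughout a sequent preserves derivability at the same height, provided that
$prog$ is closed under the change. Such a change is a partial function commuting with all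
constructors; under $\bigwedge$ the position $n$ becomes $n+1$. Cut (`Seq.cut`, `Seq.linearCut`): as
the cut formula is an atom, induction on the height of the derivation that uses it is enough. The
derivation of the atom replaces the leaves where the atom is used, and the two heights are added. To
carry it under $\bigwedge$ it is extended by a fresh eigenvariable, which is where $P_{extend}$
enters. In the linear case the cut atom belongs to exactly one of the linear premises of a program
clause, and the associativity of splitting redistributes the hypotheses accordingly
(`SplitSeq.cut`).

Specialization inverts the last clause, substitutes the given term for the first eigenvariable, and
then deletes this eigenvariable, on which nothing depends any more. Both operations are changes in
the above sense; with $\mathcal D_0$ itself the condition on $prog$ holds because $prog$ has no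
clauses. -/

namespace FOLDN

variable {S : Sig}

/-! ### Substitution calculus -/

theorem Ren.lift_comp {β : Type} {Γ Δ Ξ : List (Ty β)} {σ : Ty β} (ρ : Ren Γ Δ) (ρ' : Ren Δ Ξ) :
    (Ren.lift (fun τ x => ρ' τ (ρ τ x)) : Ren (σ :: Γ) (σ :: Ξ)) =
      fun τ x => ρ'.lift τ (ρ.lift τ x) := by
  funext τ x; cases x <;> rfl

theorem Tm.rename_rename {Γ Δ Ξ : Ctx S} {τ : Ty S.Base} (t : Tm S Γ τ) (ρ : Ren Γ Δ)
    (ρ' : Ren Δ Ξ) : (t.rename ρ).rename ρ' = t.rename (fun τ x => ρ' τ (ρ τ x)) := by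
  induction t generalizing Δ Ξ with
  | var x => rfl
  | con c => rfl
  | app t u iht ihu => simp only [Tm.rename, iht, ihu]
  | lam t ih => simp only [Tm.rename, ih, Ren.lift_comp]

theorem Sub.lift_comp_ren {Γ Δ Ξ : Ctx S} {σ : Ty S.Base} (ρ : Ren Γ Δ) (θ : Sub S Δ Ξ) :
    (Sub.lift (fun τ x => θ τ (ρ τ x)) : Sub S (σ :: Γ) (σ :: Ξ)) =
      fun τ x => θ.lift τ (ρ.lift τ x) := by
  funext τ x; cases x <;> rfl

theorem Tm.subst_of_rename {Γ Δ Ξ : Ctx S} {τ : Ty S.Base} (t : Tm S Γ τ) (ρ : Ren Γ Δ)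
    (θ : Sub S Δ Ξ) : (t.rename ρ).subst θ = t.subst (fun τ x => θ τ (ρ τ x)) := by
  induction t generalizing Δ Ξ with
  | var x => rfl
  | con c => rfl
  | app t u iht ihu => simp only [Tm.rename, Tm.subst, iht, ihu]
  | lam t ih => simp only [Tm.rename, Tm.subst, ih, Sub.lift_comp_ren]

theorem Tm.wk_rename_lift {Γ Δ : Ctx S} {σ τ : Ty S.Base} (t : Tm S Γ τ) (ρ : Ren Γ Δ) :
    (t.wk (σ := σ)).rename ρ.lift = (t.rename ρ).wk := by
  simp only [Tm.wk, Tm.rename_rename]; rfl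

theorem Sub.lift_rename {Γ Δ Ξ : Ctx S} {σ : Ty S.Base} (θ : Sub S Γ Δ) (ρ : Ren Δ Ξ) :
    (Sub.lift (fun τ x => (θ τ x).rename ρ) : Sub S (σ :: Γ) (σ :: Ξ)) =
      fun τ x => (θ.lift τ x).rename ρ.lift := by
  funext τ x
  cases x with
  | zero => rfl
  | succ x => exact (Tm.wk_rename_lift _ _).symm

theorem Tm.rename_subst {Γ Δ Ξ : Ctx S} {τ : Ty S.Base} (t : Tm S Γ τ) (θ : Sub S Γ Δ)
    (ρ : Ren Δ Ξ) : (t.subst θ).rename ρ = t.subst (fun τ x => (θ τ x).rename ρ) := by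
  induction t generalizing Δ Ξ with
  | var x => rfl
  | con c => rfl
  | app t u iht ihu => simp only [Tm.rename, Tm.subst, iht, ihu]
  | lam t ih => simp only [Tm.rename, Tm.subst, ih, Sub.lift_rename]

/-- Composition of substitutions. -/
def Sub.comp {Γ Δ Ξ : Ctx S} (θ : Sub S Γ Δ) (η : Sub S Δ Ξ) : Sub S Γ Ξ :=
  fun τ x => (θ τ x).subst η

/-- The identity substitution. -/
def Sub.id (Γ : Ctx S) : Sub S Γ Γ := fun _ x => .var x

/-- The substitution that weakens by one variable. -/
def Sub.wk (Γ : Ctx S) (σ : Ty S.Base) : Sub S Γ (σ :: Γ) := fun _ x => .var (.succ x)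

theorem Tm.wk_subst_lift {Γ Δ : Ctx S} {σ τ : Ty S.Base} (t : Tm S Γ τ) (θ : Sub S Γ Δ) :
    (t.wk (σ := σ)).subst θ.lift = (t.subst θ).wk := by
  simp only [Tm.wk, Tm.subst_of_rename, Tm.rename_subst]; rfl

theorem Sub.lift_comp {Γ Δ Ξ : Ctx S} {σ : Ty S.Base} (θ : Sub S Γ Δ) (η : Sub S Δ Ξ) :
    (Sub.lift (θ.comp η) : Sub S (σ :: Γ) (σ :: Ξ)) = θ.lift.comp η.lift := by
  funext τ x
  cases x with
  | zero => rfl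
  | succ x => exact (Tm.wk_subst_lift _ _).symm

theorem Sub.lift_id {Γ : Ctx S} {σ : Ty S.Base} :
    (Sub.lift (Sub.id Γ) : Sub S (σ :: Γ) (σ :: Γ)) = Sub.id _ := by
  funext τ x; cases x <;> rfl

theorem Tm.subst_subst {Γ Δ Ξ : Ctx S} {τ : Ty S.Base} (t : Tm S Γ τ) (θ : Sub S Γ Δ)
    (η : Sub S Δ Ξ) : (t.subst θ).subst η = t.subst (θ.comp η) := by
  induction t generalizing Δ Ξ with
  | var x => rfl
  | con c => rfl
  | app t u iht ihu => simp only [Tm.subst, iht, ihu]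
  | lam t ih => simp only [Tm.subst, ih, Sub.lift_comp]

@[simp] theorem Tm.subst_id {Γ : Ctx S} {τ : Ty S.Base} (t : Tm S Γ τ) :
    t.subst (Sub.id Γ) = t := by
  induction t with
  | var x => rfl
  | con c => rfl
  | app t u iht ihu => simp only [Tm.subst, iht, ihu]
  | lam t ih => simp only [Tm.subst, Sub.lift_id, ih]

theorem Ren.toSub_lift {Γ Δ : Ctx S} {σ : Ty S.Base} (ρ : Ren Γ Δ) :
    (Sub.lift (fun τ x => .var (ρ τ x)) : Sub S (σ :: Γ) (σ :: Δ)) =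
      fun τ x => .var (ρ.lift τ x) := by
  funext τ x; cases x <;> rfl

theorem Tm.rename_eq_subst {Γ Δ : Ctx S} {τ : Ty S.Base} (t : Tm S Γ τ) (ρ : Ren Γ Δ) :
    t.rename ρ = t.subst (fun τ x => .var (ρ τ x)) := by
  induction t generalizing Δ with
  | var x => rfl
  | con c => rfl
  | app t u iht ihu => simp only [Tm.rename, Tm.subst, iht, ihu]
  | lam t ih => simp only [Tm.rename, Tm.subst, ih, Ren.toSub_lift]

theorem Tm.wk_eq_subst {Γ : Ctx S} {σ τ : Ty S.Base} (t : Tm S Γ τ) :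
    t.wk = t.subst (Sub.wk Γ σ) := t.rename_eq_subst _

/-- Extension of a substitution by one term. -/
def Sub.cons {Γ Δ : Ctx S} {σ : Ty S.Base} (t : Tm S Δ σ) (θ : Sub S Γ Δ) : Sub S (σ :: Γ) Δ
  | _, .zero => t
  | _, .succ x => θ _ x

/-- With `Sub.single_comp` this is what makes substitution commute with $\beta$-reduction and with
instantiation of quantifiers. -/
theorem Sub.lift_comp_single {Γ Δ : Ctx S} {σ : Ty S.Base} (θ : Sub S Γ Δ) (t : Tm S Δ σ) :
    θ.lift.comp (Sub.single t) = Sub.cons t θ := by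
  funext τ x
  cases x with
  | zero => rfl
  | succ x =>
    simp only [Sub.comp, Sub.lift, Sub.cons, Tm.wk, Tm.subst_of_rename]
    exact Tm.subst_id _

theorem Sub.single_comp {Γ Δ : Ctx S} {σ : Ty S.Base} (t : Tm S Γ σ) (θ : Sub S Γ Δ) :
    (Sub.single t).comp θ = Sub.cons (t.subst θ) θ := by
  funext τ x; cases x <;> rfl

theorem Sub.wk_comp_lift {Γ Δ : Ctx S} {σ : Ty S.Base} (θ : Sub S Γ Δ) :
    (Sub.wk Γ σ).comp θ.lift = θ.comp (Sub.wk Δ σ) := by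
  funext τ x
  exact Tm.wk_eq_subst _

theorem Sub.comp_assoc {Γ Δ Ξ Ψ : Ctx S} (θ : Sub S Γ Δ) (η : Sub S Δ Ξ) (ζ : Sub S Ξ Ψ) :
    (θ.comp η).comp ζ = θ.comp (η.comp ζ) := by
  funext τ x; exact Tm.subst_subst _ _ _

theorem Args.subst_subst {Γ Δ Ξ : Ctx S} {τs : List (Ty S.Base)} (t : Args S Γ τs)
    (θ : Sub S Γ Δ) (η : Sub S Δ Ξ) : (t.subst θ).subst η = t.subst (θ.comp η) := by
  induction t with
  | nil => rfl
  | cons t ts ih => simp only [Args.subst, ih, Tm.subst_subst]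

@[simp] theorem Args.subst_id {Γ : Ctx S} {τs : List (Ty S.Base)} (t : Args S Γ τs) :
    t.subst (Sub.id Γ) = t := by
  induction t with
  | nil => rfl
  | cons t ts ih => simp only [Args.subst, ih, Tm.subst_id]

theorem Fm.subst_subst {Γ Δ Ξ : Ctx S} (B : Fm S Γ) (θ : Sub S Γ Δ) (η : Sub S Δ Ξ) :
    (B.subst θ).subst η = B.subst (θ.comp η) := by
  induction B generalizing Δ Ξ with
  | bot => rfl
  | top => rfl
  | and B C ihB ihC => simp only [Fm.subst, ihB, ihC]
  | or B C ihB ihC => simp only [Fm.subst, ihB, ihC]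
  | imp B C ihB ihC => simp only [Fm.subst, ihB, ihC]
  | all τ B ih => simp only [Fm.subst, ih, Sub.lift_comp]
  | ex τ B ih => simp only [Fm.subst, ih, Sub.lift_comp]
  | nat t => simp only [Fm.subst, Tm.subst_subst]
  | pred p ts => simp only [Fm.subst, Args.subst_subst]

@[simp] theorem Fm.subst_id {Γ : Ctx S} (B : Fm S Γ) : B.subst (Sub.id Γ) = B := by
  induction B with
  | bot => rfl
  | top => rfl
  | and B C ihB ihC => simp only [Fm.subst, ihB, ihC]
  | or B C ihB ihC => simp only [Fm.subst, ihB, ihC]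
  | imp B C ihB ihC => simp only [Fm.subst, ihB, ihC]
  | all τ B ih => simp only [Fm.subst, ih, Sub.lift_id]
  | ex τ B ih => simp only [Fm.subst, ih, Sub.lift_id]
  | nat t => simp only [Fm.subst, Tm.subst_id]
  | pred p ts => simp only [Fm.subst, Args.subst_id]

theorem Fm.wk_eq_subst {Γ : Ctx S} {σ : Ty S.Base} (B : Fm S Γ) :
    B.wk = B.subst (Sub.wk Γ σ) := rfl

theorem Fm.wk_subst_lift {Γ Δ : Ctx S} {σ : Ty S.Base} (B : Fm S Γ) (θ : Sub S Γ Δ) :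
    (B.wk (σ := σ)).subst θ.lift = (B.subst θ).wk := by
  simp only [Fm.wk_eq_subst, Fm.subst_subst, Sub.wk_comp_lift]

theorem Fm.inst_subst {Γ Δ : Ctx S} {σ : Ty S.Base} (B : Fm S (σ :: Γ)) (t : Tm S Γ σ)
    (θ : Sub S Γ Δ) : (B.inst t).subst θ = (B.subst θ.lift).inst (t.subst θ) := by
  simp only [Fm.inst, Fm.subst_subst, Sub.lift_comp_single, Sub.single_comp]

/-! ### Conversion and substitution -/

theorem Conv.subst {Γ Δ : Ctx S} {τ : Ty S.Base} {t u : Tm S Γ τ} (h : Conv t u)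
    (θ : Sub S Γ Δ) : Conv (t.subst θ) (u.subst θ) := by
  induction h generalizing Δ with
  | refl t => exact .refl _
  | symm _ ih => exact .symm (ih θ)
  | trans _ _ ih₁ ih₂ => exact .trans (ih₁ θ) (ih₂ θ)
  | app _ _ ih₁ ih₂ => exact .app (ih₁ θ) (ih₂ θ)
  | lam _ ih => exact .lam (ih _)
  | beta t u =>
    have := Conv.beta (t.subst θ.lift) (u.subst θ)
    rwa [Tm.subst_subst, Sub.lift_comp_single, ← Sub.single_comp, ← Tm.subst_subst] at this
  | eta t =>
    have := Conv.eta (t.subst θ)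
    rwa [← Tm.wk_subst_lift] at this

/-- Pointwise convertible substitutions. -/
def Sub.Conv {Γ Δ : Ctx S} (θ η : Sub S Γ Δ) : Prop := ∀ τ x, FOLDN.Conv (θ τ x) (η τ x)

theorem Sub.Conv.lift {Γ Δ : Ctx S} {σ : Ty S.Base} {θ η : Sub S Γ Δ} (h : Sub.Conv θ η) :
    Sub.Conv (Sub.lift (σ := σ) θ) η.lift := by
  intro τ x
  cases x with
  | zero => exact .refl _
  | succ x =>
    simp only [Sub.lift, Tm.wk_eq_subst]
    exact (h _ x).subst _

theorem Tm.subst_conv {Γ Δ : Ctx S} {τ : Ty S.Base} (t : Tm S Γ τ) {θ η : Sub S Γ Δ}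
    (h : Sub.Conv θ η) : Conv (t.subst θ) (t.subst η) := by
  induction t generalizing Δ with
  | var x => exact h _ x
  | con c => exact .refl _
  | app t u iht ihu => exact .app (iht h) (ihu h)
  | lam t ih => exact .lam (ih h.lift)

theorem Args.Conv.symm {Γ : Ctx S} {τs : List (Ty S.Base)} {t u : Args S Γ τs}
    (h : Args.Conv t u) : Args.Conv u t := by
  induction h with
  | nil => exact .nil
  | cons h _ ih => exact .cons h.symm ih

theorem Args.Conv.trans {Γ : Ctx S} {τs : List (Ty S.Base)} {t u v : Args S Γ τs}
    (h : Args.Conv t u) (h' : Args.Conv u v) : Args.Conv t v := by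
  induction h with
  | nil => exact h'
  | cons h _ ih => cases h' with | cons k ks => exact .cons (h.trans k) (ih ks)

theorem Args.Conv.subst {Γ Δ : Ctx S} {τs : List (Ty S.Base)} {t u : Args S Γ τs}
    (h : Args.Conv t u) (θ : Sub S Γ Δ) : Args.Conv (t.subst θ) (u.subst θ) := by
  induction h with
  | nil => exact .nil
  | cons h _ ih => exact .cons (h.subst θ) ih

theorem Args.subst_conv {Γ Δ : Ctx S} {τs : List (Ty S.Base)} (t : Args S Γ τs) {θ η : Sub S Γ Δ}
    (h : Sub.Conv θ η) : Args.Conv (t.subst θ) (t.subst η) := by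
  induction t with
  | nil => exact .nil
  | cons t ts ih => exact .cons (t.subst_conv h) ih

theorem Fm.Conv.symm {Γ : Ctx S} {B C : Fm S Γ} (h : Fm.Conv B C) : Fm.Conv C B := by
  induction h with
  | bot => exact .bot
  | top => exact .top
  | and _ _ ih ih' => exact .and ih ih'
  | or _ _ ih ih' => exact .or ih ih'
  | imp _ _ ih ih' => exact .imp ih ih'
  | all _ ih => exact .all ih
  | ex _ ih => exact .ex ih
  | nat h => exact .nat h.symm
  | pred h => exact .pred h.symm

theorem Fm.Conv.subst {Γ Δ : Ctx S} {B C : Fm S Γ} (h : Fm.Conv B C) (θ : Sub S Γ Δ) :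
    Fm.Conv (B.subst θ) (C.subst θ) := by
  induction h generalizing Δ with
  | bot => exact .bot
  | top => exact .top
  | and _ _ ih ih' => exact .and (ih θ) (ih' θ)
  | or _ _ ih ih' => exact .or (ih θ) (ih' θ)
  | imp _ _ ih ih' => exact .imp (ih θ) (ih' θ)
  | all _ ih => exact .all (ih _)
  | ex _ ih => exact .ex (ih _)
  | nat h => exact .nat (h.subst θ)
  | pred h => exact .pred (h.subst θ)

theorem Fm.subst_conv {Γ Δ : Ctx S} (B : Fm S Γ) {θ η : Sub S Γ Δ} (h : Sub.Conv θ η) :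
    Fm.Conv (B.subst θ) (B.subst η) := by
  induction B generalizing Δ with
  | bot => exact .bot
  | top => exact .top
  | and B C ihB ihC => exact .and (ihB h) (ihC h)
  | or B C ihB ihC => exact .or (ihB h) (ihC h)
  | imp B C ihB ihC => exact .imp (ihB h) (ihC h)
  | all τ B ih => exact .all (ih h.lift)
  | ex τ B ih => exact .ex (ih h.lift)
  | nat t => exact .nat (t.subst_conv h)
  | pred p ts => exact .pred (ts.subst_conv h)

end FOLDN

namespace FOLDN

variable {S : Sig}

/-! ### Structural properties of derivability -/

theorem Fm.IsAtomic.subst {Γ Δ : Ctx S} {A : Fm S Γ} (h : A.IsAtomic) (θ : Sub S Γ Δ) :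
    (A.subst θ).IsAtomic := by
  cases A <;> first | exact h.elim | trivial

/-- Needed for the step premise of the induction rule, whose variable $j$ is not touched by a
substitution for the ambient variables. -/
theorem Sub.step_comp_lift {Γ Δ : Ctx S} (θ : Sub S Γ Δ) :
    (Sub.step (Γ := Γ)).comp θ.lift = θ.lift.comp Sub.step := by
  funext τ x
  cases x with
  | zero => rfl
  | succ x =>
    simp only [Sub.comp, Sub.step, Sub.lift, Tm.subst, Tm.wk, Tm.subst_of_rename]
    exact Tm.rename_eq_subst _ _

theorem map_wk_le {Δ Δ' : Ctx S} {τ : Ty S.Base} {Γ : Multiset (Fm S Δ)} {Γ' : Multiset (Fm S Δ')}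
    {ρ : Sub S Δ Δ'} (h : Γ.map (Fm.subst ρ) ≤ Γ') :
    (Γ.map (Fm.wk (σ := τ))).map (Fm.subst ρ.lift) ≤ Γ'.map (Fm.wk (σ := τ)) := by
  have := Multiset.map_le_map (f := Fm.wk (σ := τ)) h
  rw [Multiset.map_map] at this ⊢
  simpa only [Function.comp_def, Fm.wk_subst_lift] using this

theorem cons_map_le {Δ Δ' : Ctx S} {Γ : Multiset (Fm S Δ)} {B : Fm S Δ} {Γ' : Multiset (Fm S Δ')}
    {ρ : Sub S Δ Δ'} (h : (B ::ₘ Γ).map (Fm.subst ρ) ≤ Γ') :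
    ∃ Γ'', Γ' = B.subst ρ ::ₘ Γ'' ∧ Γ.map (Fm.subst ρ) ≤ Γ'' := by
  obtain ⟨E, rfl⟩ := Multiset.le_iff_exists_add.1 h
  exact ⟨Γ.map (Fm.subst ρ) + E, by simp, Multiset.le_add_right _ _⟩

/-- The rule `convL` converts one hypothesis at a time; the multiset `E` collects those already
converted, so that the induction can proceed. -/
theorem Derives.conv_left {D : Set (Clause S)} {Δ : Ctx S} {Γ Γ' E : Multiset (Fm S Δ)}
    (h : Multiset.Rel Fm.Conv Γ Γ') {C : Fm S Δ} (d : Derives D Δ (Γ + E) C) :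
    Derives D Δ (Γ' + E) C := by
  induction h generalizing E with
  | zero => exact d
  | @cons B B' Γ Γ' hB _ ih =>
    rw [Multiset.cons_add] at d ⊢
    have := Derives.convL hB d
    rw [← Multiset.add_cons] at this ⊢
    exact ih this

theorem rel_map_subst {Δ Δ' : Ctx S} (Γ : Multiset (Fm S Δ)) {θ η : Sub S Δ Δ'}
    (h : Sub.Conv θ η) : Multiset.Rel Fm.Conv (Γ.map (Fm.subst θ)) (Γ.map (Fm.subst η)) := by
  induction Γ using Multiset.induction_on with
  | empty => simp
  | cons B Γ ih =>
    simp only [Multiset.map_cons]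
    exact .cons (B.subst_conv h) ih

/-- Substitution and weakening. -/
theorem Derives.subst_le {D : Set (Clause S)} {Δ : Ctx S} {Γ : Multiset (Fm S Δ)} {C : Fm S Δ}
    (d : Derives D Δ Γ C) : ∀ {Δ' : Ctx S} (ρ : Sub S Δ Δ') {Γ' : Multiset (Fm S Δ')},
      Γ.map (Fm.subst ρ) ≤ Γ' → Derives D Δ' Γ' (C.subst ρ) := by
  induction d with
  | botL =>
    intro Δ' ρ Γ' h
    obtain ⟨E, rfl, hE⟩ := cons_map_le h
    exact .botL
  | topR => intro Δ' ρ Γ' h; exact .topR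
  | andL₁ _ ih =>
    intro Δ' ρ Γ' h
    obtain ⟨E, rfl, hE⟩ := cons_map_le h
    exact .andL₁ (ih ρ (by simpa using hE))
  | andL₂ _ ih =>
    intro Δ' ρ Γ' h
    obtain ⟨E, rfl, hE⟩ := cons_map_le h
    exact .andL₂ (ih ρ (by simpa using hE))
  | andR _ _ ih ih' => intro Δ' ρ Γ' h; exact .andR (ih ρ h) (ih' ρ h)
  | orL _ _ ih ih' =>
    intro Δ' ρ Γ' h
    obtain ⟨E, rfl, hE⟩ := cons_map_le h
    exact .orL (ih ρ (by simpa using hE)) (ih' ρ (by simpa using hE))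
  | orR₁ _ ih => intro Δ' ρ Γ' h; exact .orR₁ (ih ρ h)
  | orR₂ _ ih => intro Δ' ρ Γ' h; exact .orR₂ (ih ρ h)
  | impL _ _ ih ih' =>
    intro Δ' ρ Γ' h
    obtain ⟨E, rfl, hE⟩ := cons_map_le h
    exact .impL (ih ρ hE) (ih' ρ (by simpa using hE))
  | impR _ ih =>
    intro Δ' ρ Γ' h
    exact .impR (ih ρ (by simpa using h))
  | allL t _ ih =>
    intro Δ' ρ Γ' h
    obtain ⟨E, rfl, hE⟩ := cons_map_le h
    refine .allL (t.subst ρ) ?_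
    rw [← Fm.inst_subst]
    exact ih ρ (by simpa using hE)
  | allR _ ih => intro Δ' ρ Γ' h; exact .allR (ih ρ.lift (map_wk_le h))
  | exL _ ih =>
    intro Δ' ρ Γ' h
    obtain ⟨E, rfl, hE⟩ := cons_map_le h
    refine .exL ?_
    rw [← Fm.wk_subst_lift]
    refine ih ρ.lift ?_
    rw [Multiset.map_cons, Multiset.cons_le_cons_iff]
    exact map_wk_le hE
  | exR t _ ih =>
    intro Δ' ρ Γ' h
    refine .exR (t.subst ρ) ?_
    rw [← Fm.inst_subst]
    exact ih ρ h
  | init ha =>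
    intro Δ' ρ Γ' h
    obtain ⟨E, rfl, hE⟩ := cons_map_le h
    exact .init (ha.subst ρ)
  | contrL _ ih =>
    intro Δ' ρ Γ' h
    obtain ⟨E, rfl, hE⟩ := cons_map_le h
    exact .contrL (ih ρ (by simpa using hE))
  | cut _ _ ih ih' =>
    intro Δ' ρ Γ' h
    obtain ⟨E, rfl⟩ := Multiset.le_iff_exists_add.1 h
    rw [Multiset.map_add, add_assoc]
    exact .cut (ih ρ le_rfl) (ih' ρ (by simp))
  | natR_zero => intro Δ' ρ Γ' h; exact .natR_zero
  | natR_succ _ ih => intro Δ' ρ Γ' h; exact .natR_succ (ih ρ h)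
  | natL B _ _ _ ih₀ ih₁ ih₂ =>
    intro Δ' ρ Γ' h
    obtain ⟨E, rfl, hE⟩ := cons_map_le h
    refine .natL (B.subst ρ.lift) ?_ ?_ ?_
    · have := ih₀ ρ (Γ' := 0) (by simp)
      rwa [Fm.inst_subst] at this
    · have := ih₁ ρ.lift (Γ' := {B.subst ρ.lift}) (by simp)
      rwa [Fm.subst_subst, Sub.step_comp_lift, ← Fm.subst_subst] at this
    · rw [← Fm.inst_subst]
      exact ih₂ ρ (by simpa using hE)
  | @defR Δ Φ Γ τs p u t B θ hc hu _ ih =>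
    intro Δ' ρ Γ' h
    refine .defR (θ.comp ρ) hc ?_ ?_
    · rw [← Args.subst_subst]; exact hu.subst ρ
    · rw [← Fm.subst_subst]; exact ih ρ h
  | @defL Δ Γ C τs p u U hU _ ih =>
    intro Δ' ρ Γ' h
    obtain ⟨E, rfl, hE⟩ := cons_map_le h
    -- The set of all unifiers is trivially complete, with the identity as mediating substitution,
    -- so nothing has to be known about unification after the substitution `ρ`.
    refine .defL (fun Φ t B Δ'' η θ => Unifies (u.subst ρ) t η θ) ?_ ?_
    · intro Φ t B hc
      exact ⟨fun _ _ _ h => h, fun Δ'' η θ h =>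
        ⟨Δ'', η, θ, Sub.id _, h, fun τ x => by rw [Tm.subst_id]; exact .refl _,
          fun τ x => by rw [Tm.subst_id]; exact .refl _⟩⟩
    · intro Φ t B hc Δ'' η θ hun
      -- A unifier `η` after the substitution gives the unifier `ρ` followed by `η` before it, which
      -- is therefore an instance of a member of the given complete set.
      have hun' : Unifies u t (ρ.comp η) θ := by
        unfold Unifies at hun ⊢
        rwa [Args.subst_subst] at hun
      obtain ⟨Δ₀, ρ₀, θ₀, σ, h₀, hρ, hθ⟩ := (hU Φ t B hc).2 _ _ _ hun'
      obtain ⟨E', rfl⟩ := Multiset.le_iff_exists_add.1 hE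
      -- The premise for that member is instantiated by `σ` and weakened. It agrees with the
      -- required sequent only up to conversion, which is repaired below formula by formula.
      have key := ih Φ t B hc Δ₀ ρ₀ θ₀ h₀ σ (Multiset.le_add_right _ (E'.map (Fm.subst η)))
      rw [Fm.subst_subst, Multiset.map_cons, Fm.subst_subst, Multiset.map_map] at key
      simp only [Function.comp_def, Fm.subst_subst] at key
      have hρ' : Sub.Conv (ρ₀.comp σ) (ρ.comp η) := fun τ x => (hρ τ x).symm
      have hθ' : Sub.Conv (θ₀.comp σ) θ := fun τ x => (hθ τ x).symm
      rw [Multiset.cons_add] at key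
      have key := Derives.convL (B.subst_conv hθ') (Derives.convR (C.subst_conv hρ') key)
      rw [← Multiset.add_cons] at key
      have key := Derives.conv_left (rel_map_subst Γ hρ') key
      rw [Multiset.add_cons] at key
      rw [Fm.subst_subst, Multiset.map_add, Multiset.map_map]
      simpa only [Function.comp_def, Fm.subst_subst] using key
  | convL hc _ ih =>
    intro Δ' ρ Γ' h
    obtain ⟨E, rfl, hE⟩ := cons_map_le h
    exact .convL (hc.subst ρ) (ih ρ (by simpa using hE))
  | convR hc _ ih => intro Δ' ρ Γ' h; exact .convR (hc.subst ρ) (ih ρ h)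
  | fresh τ _ ih =>
    intro Δ' ρ Γ' h
    refine .fresh τ ?_
    rw [← Fm.wk_subst_lift]
    exact ih ρ.lift (map_wk_le h)

theorem Derives.weaken {D : Set (Clause S)} {Δ : Ctx S} {Γ Γ' : Multiset (Fm S Δ)} {C : Fm S Δ}
    (d : Derives D Δ Γ C) (h : Γ ≤ Γ') : Derives D Δ Γ' C := by
  have := d.subst_le (Sub.id Δ) (Γ' := Γ') (by
    have e : Fm.subst (Sub.id Δ) = id := funext fun B => B.subst_id
    rwa [e, Multiset.map_id])
  rwa [Fm.subst_id] at this

theorem Derives.contract {D : Set (Clause S)} {Δ : Ctx S} (Γ : Multiset (Fm S Δ))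
    {E : Multiset (Fm S Δ)} {C : Fm S Δ} (d : Derives D Δ (Γ + Γ + E) C) :
    Derives D Δ (Γ + E) C := by
  induction Γ using Multiset.induction_on generalizing E with
  | empty => simpa using d
  | cons B Γ ih =>
    have e : (B ::ₘ Γ) + (B ::ₘ Γ) + E = B ::ₘ B ::ₘ (Γ + Γ + E) := by
      simp [Multiset.cons_add, Multiset.add_cons]
    rw [e] at d
    have d := Derives.contrL d
    rw [← Multiset.add_cons] at d
    rw [Multiset.cons_add, ← Multiset.add_cons]
    exact ih d

/-- Cut with the context shared. -/
theorem Derives.cut_shared {D : Set (Clause S)} {Δ : Ctx S} {Γ : Multiset (Fm S Δ)} {B C : Fm S Δ}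
    (d : Derives D Δ Γ B) (d' : Derives D Δ (B ::ₘ Γ) C) : Derives D Δ Γ C := by
  have := Derives.contract Γ (E := 0) (by simpa using Derives.cut d d')
  simpa using this

/-- Simultaneous cut of all hypotheses. -/
theorem Derives.cut_all {D : Set (Clause S)} {Δ : Ctx S} {Γ Γ' : Multiset (Fm S Δ)} {C : Fm S Δ}
    (d : Derives D Δ Γ C) (h : ∀ G ∈ Γ, Derives D Δ Γ' G) : Derives D Δ Γ' C := by
  suffices H : Derives D Δ (Γ + Γ') C by
    clear d
    induction Γ using Multiset.induction_on with
    | empty => simpa using H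
    | cons B Γ ih =>
      refine ih (fun G hG => h G (Multiset.mem_cons_of_mem hG)) ?_
      refine Derives.cut_shared ((h B (Multiset.mem_cons_self _ _)).weaken ?_) ?_
      · exact Multiset.le_add_left _ _
      · rwa [Multiset.cons_add] at H
  exact d.weaken (Multiset.le_add_right _ _)

/-- Identity sequents on arbitrary formulas. -/
theorem Derives.identity {D : Set (Clause S)} {Δ : Ctx S} (B : Fm S Δ) :
    ∀ {Γ : Multiset (Fm S Δ)}, Derives D Δ (B ::ₘ Γ) B := by
  induction B with
  | bot => exact .botL
  | top => exact .topR
  | and B C ihB ihC => exact .andR (.andL₁ ihB) (.andL₂ ihC)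
  | or B C ihB ihC => exact .orL (.orR₁ ihB) (.orR₂ ihC)
  | imp B C ihB ihC =>
    intro Γ
    refine .impR ?_
    rw [Multiset.cons_swap]
    exact .impL ihB ihC
  | all τ B ih =>
    intro Γ
    refine .allR ?_
    rw [Multiset.map_cons]
    refine .allL (.var .zero) ?_
    have e : (B.subst (Sub.lift (Sub.wk _ τ))).inst (.var .zero) = B := by
      rw [Fm.inst, Fm.subst_subst, Sub.lift_comp_single]
      convert Fm.subst_id B using 2
      funext σ x
      cases x <;> rfl
    change Derives D _ ((B.subst (Sub.lift (Sub.wk _ τ))).inst (.var .zero) ::ₘ _) B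
    rw [e]
    exact ih
  | ex τ B ih =>
    intro Γ
    refine .exL (.exR (.var .zero) ?_)
    have e : (B.subst (Sub.lift (Sub.wk _ τ))).inst (.var .zero) = B := by
      rw [Fm.inst, Fm.subst_subst, Sub.lift_comp_single]
      convert Fm.subst_id B using 2
      funext σ x
      cases x <;> rfl
    change Derives D _ _ ((B.subst (Sub.lift (Sub.wk _ τ))).inst (.var .zero))
    rw [e]
    exact ih
  | nat t => exact .init trivial
  | pred p ts => exact .init trivial

end FOLDN

/-! ### Values: terms modulo conversion, and evaluation of open terms in environments -/

namespace FOLDN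

variable {S : Sig}

/-! ### Terms modulo conversion -/

instance convSetoid (Γ : Ctx S) (τ : Ty S.Base) : Setoid (Tm S Γ τ) :=
  ⟨Conv, .refl, .symm, .trans⟩

/-- Terms modulo `βη`-conversion. -/
def Q (Γ : Ctx S) (τ : Ty S.Base) : Type := Quotient (convSetoid Γ τ)

namespace Q

variable {Γ Δ Ξ : Ctx S} {σ τ : Ty S.Base}

def mk (t : Tm S Γ τ) : Q Γ τ := Quotient.mk _ t

theorem sound {t u : Tm S Γ τ} (h : Conv t u) : mk t = mk u := Quotient.sound h

theorem exact {t u : Tm S Γ τ} (h : mk t = mk u) : Conv t u := Quotient.exact h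

@[elab_as_elim]
theorem ind {P : Q Γ τ → Prop} (h : ∀ t, P (mk t)) (q : Q Γ τ) : P q := Quotient.ind h q

/-- A representative. -/
noncomputable def out (q : Q Γ τ) : Tm S Γ τ := Quotient.out q

@[simp] theorem mk_out (q : Q Γ τ) : mk q.out = q := Quotient.out_eq q

theorem out_mk (t : Tm S Γ τ) : Conv (mk t).out t := exact (mk_out _)

def app (q : Q Γ (.arr σ τ)) (r : Q Γ σ) : Q Γ τ :=
  Quotient.map₂ Tm.app (fun _ _ h _ _ h' => Conv.app h h') q r

def lam (q : Q (σ :: Γ) τ) : Q Γ (.arr σ τ) :=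
  Quotient.map Tm.lam (fun _ _ h => Conv.lam h) q

def map (ρ : Sub S Γ Δ) (q : Q Γ τ) : Q Δ τ :=
  Quotient.map (Tm.subst ρ) (fun _ _ h => Conv.subst h ρ) q

def var (x : Var Γ τ) : Q Γ τ := mk (.var x)

def con (c : Con S τ) : Q Γ τ := mk (.con c)

theorem lam_mk (t : Tm S (σ :: Γ) τ) : lam (mk t) = mk (.lam t) := rfl

theorem map_mk (ρ : Sub S Γ Δ) (t : Tm S Γ τ) : map ρ (mk t) = mk (t.subst ρ) := rfl

@[simp] theorem map_id (q : Q Γ τ) : map (Sub.id Γ) q = q := by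
  induction q using Q.ind with | h t => rw [map_mk, Tm.subst_id]

theorem map_map (ρ : Sub S Γ Δ) (ρ' : Sub S Δ Ξ) (q : Q Γ τ) :
    map ρ' (map ρ q) = map (ρ.comp ρ') q := by
  induction q using Q.ind with | h t => simp only [map_mk, Tm.subst_subst]

@[simp] theorem map_app (ρ : Sub S Γ Δ) (q : Q Γ (.arr σ τ)) (r : Q Γ σ) :
    map ρ (app q r) = app (map ρ q) (map ρ r) := by
  induction q using Q.ind with | h t => induction r using Q.ind with | h u => rfl

@[simp] theorem map_con (ρ : Sub S Γ Δ) (c : Con S τ) : map ρ (con c) = con c := rfl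

theorem map_lam (ρ : Sub S Γ Δ) (q : Q (σ :: Γ) τ) :
    map ρ (lam q) = lam (map ρ.lift q) := by
  induction q using Q.ind with | h t => rfl

theorem map_var (ρ : Sub S Γ Δ) (x : Var Γ τ) : map ρ (var x) = mk (ρ τ x) := rfl

theorem app_lam (q : Q (σ :: Γ) τ) (u : Tm S Γ σ) :
    app (lam q) (mk u) = map (Sub.single u) q := by
  induction q using Q.ind with | h t => exact sound (.beta t u)

theorem app_wk_lam (q : Q (σ :: Γ) τ) : app (map (Sub.wk Γ σ) (lam q)) (var .zero) = q := by
  induction q using Q.ind with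
  | h t =>
    refine (sound (.beta _ _)).trans ?_
    rw [Tm.subst_subst, Sub.lift_comp_single]
    congr 1
    convert Tm.subst_id t using 2
    funext σ x
    cases x <;> rfl

theorem lam_app_wk (q : Q Γ (.arr σ τ)) : lam (app (map (Sub.wk Γ σ) q) (var .zero)) = q := by
  induction q using Q.ind with
  | h t =>
    rw [map_mk, ← Tm.wk_eq_subst]
    exact sound (.eta t)

/-- Extensionality, from $\eta$: a function is determined by its value at a fresh variable.
Equations between pointwise constructors are proved by comparing bodies in this way. -/
theorem funext {q r : Q Γ (.arr σ τ)}
    (h : app (map (Sub.wk Γ σ) q) (var .zero) = app (map (Sub.wk Γ σ) r) (var .zero)) :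
    q = r := by
  rw [← lam_app_wk q, h, lam_app_wk]

end Q

/-- Lists of terms modulo conversion. -/
inductive Env (Δ : Ctx S) : Ctx S → Type
  | nil : Env Δ []
  | cons {τ : Ty S.Base} {τs : Ctx S} : Q Δ τ → Env Δ τs → Env Δ (τ :: τs)

infixr:67 " ∷ " => Env.cons

namespace Env

variable {Γ Δ Ξ Φ Ψ : Ctx S} {σ τ : Ty S.Base}

def get : {Φ : Ctx S} → Env Δ Φ → {τ : Ty S.Base} → Var Φ τ → Q Δ τ
  | _, .cons x _, _, .zero => x
  | _, .cons _ xs, _, .succ y => xs.get y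

@[simp] theorem get_zero (x : Q Δ τ) (xs : Env Δ Φ) : (x ∷ xs).get .zero = x := rfl

@[simp] theorem get_succ (x : Q Δ τ) (xs : Env Δ Φ) (y : Var Φ σ) :
    (x ∷ xs).get (.succ y) = xs.get y := rfl

/-- The environment with given values. -/
def tab : {Φ : Ctx S} → (∀ τ, Var Φ τ → Q Δ τ) → Env Δ Φ
  | [], _ => .nil
  | _ :: _, f => f _ .zero ∷ tab (fun _ x => f _ (.succ x))

@[simp] theorem get_tab (f : ∀ τ, Var Φ τ → Q Δ τ) (x : Var Φ τ) : (tab f).get x = f τ x := by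
  induction x with
  | zero => rfl
  | succ x ih => exact ih _

@[ext] theorem ext {xs ys : Env Δ Φ} (h : ∀ τ (x : Var Φ τ), xs.get x = ys.get x) : xs = ys := by
  induction xs with
  | nil => cases ys; rfl
  | cons x xs ih =>
    cases ys with
    | cons y ys =>
      have h0 := h _ .zero
      simp only [get_zero] at h0
      rw [h0, ih fun τ z => h τ (.succ z)]

def map (ρ : Sub S Δ Ξ) : {Φ : Ctx S} → Env Δ Φ → Env Ξ Φ
  | _, .nil => .nil
  | _, .cons x xs => x.map ρ ∷ xs.map ρ

@[simp] theorem map_nil (ρ : Sub S Δ Ξ) : (nil : Env Δ []).map ρ = .nil := rfl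

@[simp] theorem map_cons (ρ : Sub S Δ Ξ) (x : Q Δ τ) (xs : Env Δ Φ) :
    (x ∷ xs).map ρ = x.map ρ ∷ xs.map ρ := rfl

@[simp] theorem get_map (ρ : Sub S Δ Ξ) (xs : Env Δ Φ) (x : Var Φ τ) :
    (xs.map ρ).get x = (xs.get x).map ρ := by
  induction xs with
  | nil => cases x
  | cons y ys ih =>
    cases x with
    | zero => rfl
    | succ x => exact ih x

@[simp] theorem map_id (xs : Env Δ Φ) : xs.map (Sub.id Δ) = xs := by
  ext τ x; simp

theorem map_map (ρ : Sub S Γ Δ) (ρ' : Sub S Δ Ξ) (xs : Env Γ Φ) :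
    (xs.map ρ).map ρ' = xs.map (ρ.comp ρ') := by
  ext τ x; simp [Q.map_map]

def append : {Ψ : Ctx S} → Env Δ Ψ → Env Δ Φ → Env Δ (Ψ ++ Φ)
  | _, .nil, ys => ys
  | _, .cons x xs, ys => x ∷ xs.append ys

@[simp] theorem nil_append (ys : Env Δ Φ) : (nil : Env Δ []).append ys = ys := rfl

@[simp] theorem cons_append (x : Q Δ τ) (xs : Env Δ Ψ) (ys : Env Δ Φ) :
    (x ∷ xs).append ys = x ∷ xs.append ys := rfl

theorem map_append (ρ : Sub S Δ Ξ) (xs : Env Δ Ψ) (ys : Env Δ Φ) :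
    (xs.append ys).map ρ = (xs.map ρ).append (ys.map ρ) := by
  induction xs with
  | nil => rfl
  | cons x xs ih => exact congrArg _ ih

/-- The substitution by representatives. -/
noncomputable def toSub (xs : Env Δ Φ) : Sub S Φ Δ := fun _ x => (xs.get x).out

/-- Choosing representatives does not commute with substitution on the nose, only up to conversion;
formulas being identified up to conversion, this is harmless. -/
theorem toSub_map (ρ : Sub S Δ Ξ) (xs : Env Δ Φ) :
    Sub.Conv ((xs.toSub).comp ρ) (xs.map ρ).toSub := by
  intro τ x
  refine Q.exact ?_
  simp only [toSub, Sub.comp, Q.mk_out, get_map, ← Q.map_mk]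

end Env

theorem Env.forall_cons {Δ Φ : Ctx S} {τ : Ty S.Base} {P : Env Δ (τ :: Φ) → Prop} :
    (∀ xs, P xs) ↔ ∀ x xs, P (x ∷ xs) :=
  ⟨fun h x xs => h _, fun h xs => by cases xs; exact h _ _⟩

theorem Env.forall_nil {Δ : Ctx S} {P : Env Δ [] → Prop} : (∀ xs, P xs) ↔ P .nil :=
  ⟨fun h => h _, fun h xs => by cases xs; exact h⟩

section eval

variable {Γ Δ Ξ Φ Ψ : Ctx S} {σ τ : Ty S.Base}

/-- The value of a term. -/
noncomputable def Tm.eval (t : Tm S Φ τ) (xs : Env Δ Φ) : Q Δ τ := Q.mk (t.subst xs.toSub)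

/-- The value does not depend on the representatives: any substitution representing the environment
may be used. -/
theorem Tm.mk_subst (t : Tm S Φ τ) {θ : Sub S Φ Δ} {xs : Env Δ Φ}
    (h : ∀ σ x, Q.mk (θ σ x) = xs.get x) : Q.mk (t.subst θ) = t.eval xs := by
  refine Q.sound (t.subst_conv fun σ x => Q.exact ?_)
  rw [h, Env.toSub, Q.mk_out]

@[simp] theorem Tm.eval_var (x : Var Φ τ) (xs : Env Δ Φ) : (Tm.var x : Tm S Φ τ).eval xs = xs.get x
    :=
  Q.mk_out _

@[simp] theorem Tm.eval_con (c : Con S τ) (xs : Env Δ Φ) :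
    (Tm.con c : Tm S Φ τ).eval xs = Q.con c := rfl

@[simp] theorem Tm.eval_app (t : Tm S Φ (.arr σ τ)) (u : Tm S Φ σ) (xs : Env Δ Φ) :
    (t.app u).eval xs = (t.eval xs).app (u.eval xs) := rfl

@[simp] theorem Tm.map_eval (t : Tm S Φ τ) (xs : Env Δ Φ) (ρ : Sub S Δ Ξ) :
    (t.eval xs).map ρ = t.eval (xs.map ρ) := by
  rw [Tm.eval, Q.map_mk, Tm.subst_subst]
  exact Q.sound (t.subst_conv (Env.toSub_map ρ xs))

@[simp] theorem Tm.app_eval_lam (t : Tm S (σ :: Φ) τ) (xs : Env Δ Φ) (u : Q Δ σ) :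
    (t.lam.eval xs).app u = t.eval (u ∷ xs) := by
  induction u using Q.ind with
  | h u =>
    rw [Tm.eval, Tm.subst, ← Q.lam_mk, Q.app_lam, Q.map_mk, Tm.subst_subst, Sub.lift_comp_single]
    refine Tm.mk_subst _ fun σ x => ?_
    cases x with
    | zero => rfl
    | succ x => exact Q.mk_out _

/-- Values of a substitution. -/
noncomputable def Sub.eval (θ : Sub S Φ Ψ) (xs : Env Δ Ψ) : Env Δ Φ :=
  .tab fun _ x => (θ _ x).eval xs

@[simp] theorem Sub.get_eval (θ : Sub S Φ Ψ) (xs : Env Δ Ψ) (x : Var Φ τ) :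
    (θ.eval xs).get x = (θ _ x).eval xs := Env.get_tab _ _

theorem Sub.comp_toSub (θ : Sub S Φ Ψ) (xs : Env Δ Ψ) :
    Sub.Conv (θ.comp xs.toSub) (θ.eval xs).toSub := by
  intro τ x
  refine Q.exact ?_
  rw [Env.toSub, Q.mk_out, Sub.get_eval]; rfl

theorem Tm.eval_subst (t : Tm S Φ τ) (θ : Sub S Φ Ψ) (xs : Env Δ Ψ) :
    (t.subst θ).eval xs = t.eval (θ.eval xs) := by
  rw [Tm.eval, Tm.subst_subst]
  exact Q.sound (t.subst_conv (Sub.comp_toSub θ xs))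

@[simp] theorem Tm.eval_wk (t : Tm S Φ τ) (x : Q Δ σ) (xs : Env Δ Φ) :
    t.wk.eval (x ∷ xs) = t.eval xs := by
  rw [Tm.wk_eq_subst, Tm.eval_subst]
  congr 1
  ext τ y
  simp [Sub.wk]

/-- The generic arguments: a predicate applied to them is a formula whose instances are all atoms
over that predicate, so facts about formulas transfer to atoms given by values. -/
def Args.vars : (τs : Ctx S) → Args S τs τs
  | [] => .nil
  | _ :: τs => .cons (.var .zero) ((Args.vars τs).subst (Sub.wk _ _))

noncomputable def Args.eval (xs : Env Δ Φ) : {τs : Ctx S} → Args S Φ τs → Env Δ τs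
  | _, .nil => .nil
  | _, .cons t ts => t.eval xs ∷ ts.eval xs

@[simp] theorem Args.eval_nil (xs : Env Δ Φ) : (Args.nil : Args S Φ []).eval xs = .nil := rfl

@[simp] theorem Args.eval_cons (xs : Env Δ Φ) {τs : Ctx S} (t : Tm S Φ τ) (ts : Args S Φ τs) :
    (t ;; ts).eval xs = t.eval xs ∷ ts.eval xs := rfl

theorem Args.eval_subst {τs : Ctx S} (ts : Args S Φ τs) (θ : Sub S Φ Ψ) (xs : Env Δ Ψ) :
    (ts.subst θ).eval xs = ts.eval (θ.eval xs) := by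
  induction ts with
  | nil => rfl
  | cons t ts ih => rw [Args.subst, Args.eval_cons, Args.eval_cons, ih, Tm.eval_subst]

/-- Representatives of values as arguments. -/
noncomputable def Env.toArgs : {τs : Ctx S} → Env Δ τs → Args S Δ τs
  | _, .nil => .nil
  | _, .cons x xs => x.out ;; xs.toArgs

theorem Args.subst_toSub_conv {τs : Ctx S} (ts : Args S Φ τs) (xs : Env Δ Φ) :
    Args.Conv (ts.subst xs.toSub) (ts.eval xs).toArgs := by
  induction ts with
  | nil => exact .nil
  | cons t ts ih => exact .cons (Q.out_mk _).symm ih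

theorem Env.eq_of_toArgs_conv {τs : Ctx S} {ts us : Env Δ τs}
    (h : Args.Conv ts.toArgs us.toArgs) : ts = us := by
  induction ts with
  | nil => cases us; rfl
  | cons t ts ih =>
    cases us with
    | cons u us =>
      cases h with
      | cons h hs => rw [← Q.mk_out t, ← Q.mk_out u, Q.sound h, ih hs]

theorem Env.toArgs_subst {τs : Ctx S} (ts : Env Δ τs) (ρ : Sub S Δ Ξ) :
    Args.Conv (ts.toArgs.subst ρ) (ts.map ρ).toArgs := by
  induction ts with
  | nil => exact .nil
  | cons t ts ih =>
    refine .cons (Q.exact ?_) ih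
    rw [← Q.map_mk, Q.mk_out, Q.mk_out]

end eval

end FOLDN

/-! ### A model with formal pairs, and what it says about constructors modulo conversion -/

namespace FOLDN

variable {S : Sig}

/-! ### A model of terms in presheaves over renamings

Base types are interpreted by terms modulo conversion, together with the constant at the head and
    its
arguments, if known; `evs` has formal pairs in addition, on which `fst` and `rst` compute. -/

/-- Presheaves over contexts and renamings. -/
structure Psh (S : Sig) where
  obj : Ctx S → Type
  map : ∀ {Γ Δ : Ctx S}, Ren Γ Δ → obj Γ → obj Δ
  map_id : ∀ {Γ : Ctx S} (a : obj Γ), map (fun _ x => x) a = a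
  map_map : ∀ {Γ Δ Ξ : Ctx S} (ρ : Ren Γ Δ) (ρ' : Ren Δ Ξ) (a : obj Γ),
    map ρ' (map ρ a) = map (fun τ x => ρ' τ (ρ τ x)) a

/-- A renaming as a substitution. -/
def Ren.toSub {Γ Δ : Ctx S} (ρ : Ren Γ Δ) : Sub S Γ Δ := fun τ x => .var (ρ τ x)

theorem Ren.lift_toSub {Γ Δ : Ctx S} {σ : Ty S.Base} (ρ : Ren Γ Δ) :
    (Ren.toSub ρ).lift = (Ren.lift (σ := σ) ρ).toSub := Ren.toSub_lift ρ

/-- A constant applied to terms. -/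
inductive Spine (Γ : Ctx S) : Ty S.Base → Type
  | con {τ : Ty S.Base} (c : Con S τ) : Spine Γ τ
  | app {σ τ : Ty S.Base} : Spine Γ (.arr σ τ) → Q Γ σ → Spine Γ τ

namespace Spine

variable {Γ Δ Ξ : Ctx S} {τ : Ty S.Base}

def map (ρ : Sub S Γ Δ) : {τ : Ty S.Base} → Spine Γ τ → Spine Δ τ
  | _, .con c => .con c
  | _, .app s q => .app (s.map ρ) (q.map ρ)

def toQ : {τ : Ty S.Base} → Spine Γ τ → Q Γ τ
  | _, .con c => .con c
  | _, .app s q => s.toQ.app q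

theorem map_id (s : Spine Γ τ) : s.map (Sub.id Γ) = s := by
  induction s with
  | con c => rfl
  | app s q ih => simp only [map, ih, Q.map_id]

theorem map_map (ρ : Sub S Γ Δ) (ρ' : Sub S Δ Ξ) (s : Spine Γ τ) :
    (s.map ρ).map ρ' = s.map (ρ.comp ρ') := by
  induction s with
  | con c => rfl
  | app s q ih => simp only [map, ih, Q.map_map]

theorem toQ_map (ρ : Sub S Γ Δ) (s : Spine Γ τ) : (s.map ρ).toQ = s.toQ.map ρ := by
  induction s with
  | con c => rfl
  | app s q ih => simp only [map, toQ, ih, Q.map_app]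

end Spine

/-- The optional spine makes the head constant readable from a semantic value, without any theory of
normal forms. It is absent when no head constant is known, as for variables. -/
def basePsh (τ : Ty S.Base) : Psh S where
  obj Γ := Q Γ τ × Option (Spine Γ τ)
  map ρ a := (a.1.map (Ren.toSub ρ), a.2.map (Spine.map (Ren.toSub ρ)))
  map_id := by
    rintro Γ ⟨q, s⟩
    refine Prod.ext (Q.map_id q) ?_
    cases s with
    | none => rfl
    | some s => exact congrArg some s.map_id
  map_map := by
    rintro Γ Δ Ξ ρ ρ' ⟨q, s⟩
    refine Prod.ext (Q.map_map _ _ q) ?_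
    cases s with
    | none => rfl
    | some s => exact congrArg some (s.map_map _ _)

/-- The syntax has no pairing for `evs`. The formal pairs are added so that an environment can
prescribe $fst\,l$ and $rst\,l$ independently of each other. -/
def evsPsh : Psh S where
  obj Γ := Q Γ .evs ⊕ Q Γ .i × Q Γ .evs
  map ρ a := Sum.map (Q.map (Ren.toSub ρ))
    (fun p => (p.1.map (Ren.toSub ρ), p.2.map (Ren.toSub ρ))) a
  map_id := by
    rintro Γ (q | ⟨q, r⟩)
    · exact congrArg Sum.inl q.map_id
    · exact congrArg Sum.inr (Prod.ext q.map_id r.map_id)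
  map_map := by
    rintro Γ Δ Ξ ρ ρ' (q | ⟨q, r⟩)
    · exact congrArg Sum.inl (q.map_map _ _)
    · exact congrArg Sum.inr (Prod.ext (q.map_map _ _) (r.map_map _ _))

/-- Elements of the exponential of presheaves. -/
@[ext] structure Expo (A B : Psh S) (Γ : Ctx S) where
  fn : ∀ Δ : Ctx S, Ren Γ Δ → A.obj Δ → B.obj Δ
  nat : ∀ (Δ Ξ : Ctx S) (ρ : Ren Γ Δ) (ρ' : Ren Δ Ξ) (a : A.obj Δ),
    B.map ρ' (fn Δ ρ a) = fn Ξ (fun τ x => ρ' τ (ρ τ x)) (A.map ρ' a)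

def expPsh (A B : Psh S) : Psh S where
  obj := Expo A B
  map ρ f := ⟨fun Ξ ρ' a => f.fn Ξ (fun τ x => ρ' τ (ρ τ x)) a, fun _ _ _ _ _ => f.nat _ _ _ _ _⟩
  map_id _ := rfl
  map_map _ _ _ := rfl

/-- The interpretation of types. -/
def sem : Ty S.Base → Psh S
  | .nt => basePsh .nt
  | .i => basePsh .i
  | .evs => evsPsh
  | .atm => basePsh .atm
  | .prp => basePsh .prp
  | .atmlst => basePsh .atmlst
  | .prplst => basePsh .prplst
  | .other b => basePsh (.other b)
  | .arr σ τ => expPsh (sem σ) (sem τ)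

/-- Natural maps between an interpretation and terms. -/
structure Reification (τ : Ty S.Base) (A : Psh S) where
  reify : ∀ {Γ : Ctx S}, A.obj Γ → Q Γ τ
  reflect : ∀ {Γ : Ctx S}, Q Γ τ → Option (Spine Γ τ) → A.obj Γ
  map_reify : ∀ {Γ Δ : Ctx S} (ρ : Ren Γ Δ) (a : A.obj Γ),
    (reify a).map (Ren.toSub ρ) = reify (A.map ρ a)
  map_reflect : ∀ {Γ Δ : Ctx S} (ρ : Ren Γ Δ) (q : Q Γ τ) (s : Option (Spine Γ τ)),
    A.map ρ (reflect q s) = reflect (q.map (Ren.toSub ρ)) (s.map (Spine.map (Ren.toSub ρ)))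

def baseReification (τ : Ty S.Base) : Reification τ (basePsh τ) where
  reify a := a.1
  reflect q s := (q, s)
  map_reify _ _ := rfl
  map_reflect _ _ _ := rfl

/-- The term assigned to a formal pair is an arbitrary natural choice: such a pair realizes no term,
so it never matters which one is taken. -/
def evsReification : Reification (S := S) .evs evsPsh where
  reify a := Sum.elim id Prod.snd a
  reflect q _ := Sum.inl q
  map_reify := by rintro Γ Δ ρ (q | ⟨q, r⟩) <;> rfl
  map_reflect _ _ _ := rfl

/-- Application of a possibly known spine. -/
def Spine.appOpt {Γ : Ctx S} {σ τ : Ty S.Base} (s : Option (Spine Γ (.arr σ τ))) (q : Q Γ σ) :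
    Option (Spine Γ τ) := s.map (·.app q)

theorem Spine.map_appOpt {Γ Δ : Ctx S} {σ τ : Ty S.Base} (s : Option (Spine Γ (.arr σ τ)))
    (q : Q Γ σ) (ρ : Sub S Γ Δ) :
    (Spine.appOpt s q).map (Spine.map ρ) = Spine.appOpt (s.map (Spine.map ρ)) (q.map ρ) := by
  cases s <;> rfl

theorem Spine.optMap_map {Γ Δ Ξ : Ctx S} {τ : Ty S.Base} (s : Option (Spine Γ τ))
    (ρ : Sub S Γ Δ) (ρ' : Sub S Δ Ξ) :
    (s.map (Spine.map ρ)).map (Spine.map ρ') = s.map (Spine.map (ρ.comp ρ')) := by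
  cases s with
  | none => rfl
  | some s => exact congrArg some (s.map_map _ _)

def expReification {σ τ : Ty S.Base} {A B : Psh S} (ra : Reification σ A) (rb : Reification τ B) :
    Reification (.arr σ τ) (expPsh A B) where
  reify {Γ} f := .lam (rb.reify (f.fn (σ :: Γ) (fun _ x => .succ x) (ra.reflect (.var .zero) none)))
  reflect q s := ⟨fun _ ρ a => rb.reflect ((q.map (Ren.toSub ρ)).app (ra.reify a))
      (Spine.appOpt (s.map (Spine.map (Ren.toSub ρ))) (ra.reify a)), by
    intro Δ Ξ ρ ρ' a
    rw [rb.map_reflect, Q.map_app, ra.map_reify, Q.map_map, Spine.map_appOpt, ra.map_reify,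
      Spine.optMap_map]
    rfl⟩
  map_reify ρ f := by
    rw [Q.map_lam, Ren.lift_toSub, rb.map_reify, f.nat, ra.map_reflect]
    rfl
  map_reflect ρ q s := by
    refine Expo.ext ?_
    funext Δ ρ' a
    simp only [Q.map_map, Spine.optMap_map]
    rfl

def reification : (τ : Ty S.Base) → Reification τ (sem τ)
  | .nt => baseReification .nt
  | .i => baseReification .i
  | .evs => evsReification
  | .atm => baseReification .atm
  | .prp => baseReification .prp
  | .atmlst => baseReification .atmlst
  | .prplst => baseReification .prplst
  | .other b => baseReification (.other b)
  | .arr σ τ => expReification (reification σ) (reification τ)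

/-- Semantic environments. -/
abbrev SEnv (Γ Δ : Ctx S) : Type := ∀ τ : Ty S.Base, Var Γ τ → (sem τ).obj Δ

def SEnv.cons {Γ Δ : Ctx S} {σ : Ty S.Base} (a : (sem σ).obj Δ) (η : SEnv Γ Δ) : SEnv (σ :: Γ) Δ
  | _, .zero => a
  | _, .succ x => η _ x

def SEnv.map {Γ Δ Ξ : Ctx S} (ρ : Ren Δ Ξ) (η : SEnv Γ Δ) : SEnv Γ Ξ :=
  fun τ x => (sem τ).map ρ (η τ x)

theorem SEnv.map_cons {Γ Δ Ξ : Ctx S} {σ : Ty S.Base} (ρ : Ren Δ Ξ) (a : (sem σ).obj Δ)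
    (η : SEnv Γ Δ) : (SEnv.cons a η).map ρ = SEnv.cons ((sem σ).map ρ a) (η.map ρ) := by
  funext τ x; cases x <;> rfl

theorem SEnv.map_map {Γ Δ Ξ Ψ : Ctx S} (ρ : Ren Δ Ξ) (ρ' : Ren Ξ Ψ) (η : SEnv Γ Δ) :
    (η.map ρ).map ρ' = η.map (fun τ x => ρ' τ (ρ τ x)) := by
  funext τ x; exact (sem τ).map_map _ _ _

/-- The generic environment. -/
def SEnv.id (Γ : Ctx S) : SEnv Γ Γ := fun τ x => (reification τ).reflect (.var x) none

/-- `fst` on formal pairs. -/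
def semFst {Δ : Ctx S} (a : (evsPsh (S := S)).obj Δ) : (basePsh (S := S) .i).obj Δ :=
  Sum.elim (fun q => ((Q.con .fst).app q, none)) (fun p => (p.1, none)) a

/-- `rst` on formal pairs. -/
def semRst {Δ : Ctx S} (a : (evsPsh (S := S)).obj Δ) : (evsPsh (S := S)).obj Δ :=
  Sum.elim (fun q => Sum.inl ((Q.con .rst).app q)) (fun p => Sum.inl p.2) a

theorem map_semFst {Δ Ξ : Ctx S} (ρ : Ren Δ Ξ) (a : (evsPsh (S := S)).obj Δ) :
    (basePsh .i).map ρ (semFst a) = semFst (evsPsh.map ρ a) := by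
  rcases a with q | ⟨q, r⟩
  · exact Prod.ext (Q.map_app (Ren.toSub ρ) (Q.con .fst) q) rfl
  · rfl

theorem map_semRst {Δ Ξ : Ctx S} (ρ : Ren Δ Ξ) (a : (evsPsh (S := S)).obj Δ) :
    evsPsh.map ρ (semRst a) = semRst (evsPsh.map ρ a) := by
  rcases a with q | ⟨q, r⟩
  · exact congrArg Sum.inl (Q.map_app (Ren.toSub ρ) (Q.con .rst) q)
  · rfl

/-- The interpretation of constants. -/
def denCon : {τ : Ty S.Base} → Con S τ → (Δ : Ctx S) → (sem τ).obj Δ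
  | _, .fst, _ => (⟨fun _ _ a => semFst a, fun _ _ _ _ _ => map_semFst _ _⟩ :
      Expo evsPsh (basePsh .i) _)
  | _, .rst, _ => (⟨fun _ _ a => semRst a, fun _ _ _ _ _ => map_semRst _ _⟩ :
      Expo evsPsh evsPsh _)
  | τ, c, _ => (reification τ).reflect (.con c) (some (.con c))

/-- Constants that are interpreted by themselves. -/
def Con.IsFree {τ : Ty S.Base} (c : Con S τ) : Prop :=
  ∀ Δ : Ctx S, denCon c Δ = (reification τ).reflect (.con c) (some (.con c))

theorem map_denCon {τ : Ty S.Base} (c : Con S τ) {Δ Ξ : Ctx S} (ρ : Ren Δ Ξ) :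
    (sem τ).map ρ (denCon c Δ) = denCon c Ξ := by
  cases c <;> first | rfl | exact (reification _).map_reflect _ _ _

/-- Interpretations of terms: natural functions of environments. -/
@[ext] structure Den (Γ : Ctx S) (τ : Ty S.Base) where
  fn : ∀ Δ : Ctx S, SEnv Γ Δ → (sem τ).obj Δ
  nat : ∀ (Δ Ξ : Ctx S) (ρ : Ren Δ Ξ) (η : SEnv Γ Δ), (sem τ).map ρ (fn Δ η) = fn Ξ (η.map ρ)

def Tm.den : {Γ : Ctx S} → {τ : Ty S.Base} → Tm S Γ τ → Den Γ τ
  | _, τ, .var x => ⟨fun _ η => η τ x, fun _ _ _ _ => rfl⟩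
  | _, _, .con c => ⟨fun Δ _ => denCon c Δ, fun _ _ ρ _ => map_denCon c ρ⟩
  | _, _, .app t u => ⟨fun Δ η => (t.den.fn Δ η).fn Δ (fun _ x => x) (u.den.fn Δ η), by
      intro Δ Ξ ρ η
      rw [← t.den.nat, ← u.den.nat]
      exact (t.den.fn Δ η).nat _ _ _ _ _⟩
  | _, _, .lam t => ⟨fun Δ η => ⟨fun Ξ ρ a => t.den.fn Ξ (SEnv.cons a (η.map ρ)), by
        intro Ξ Ψ ρ ρ' a
        rw [t.den.nat, SEnv.map_cons, SEnv.map_map]⟩, by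
      intro Δ Ξ ρ η
      refine Expo.ext ?_
      funext Ψ ρ' a
      change t.den.fn Ψ _ = t.den.fn Ψ _
      rw [SEnv.map_map]⟩

theorem SEnv.cons_lift_ren {Γ Δ Ξ : Ctx S} {σ : Ty S.Base} (ρ : Ren Γ Δ) (a : (sem σ).obj Ξ)
    (η : SEnv Δ Ξ) : (fun τ x => SEnv.cons a η τ (ρ.lift τ x)) =
      SEnv.cons a (fun τ x => η τ (ρ τ x)) := by
  funext τ x; cases x <;> rfl

theorem Tm.den_rename {Γ Δ : Ctx S} {τ : Ty S.Base} (t : Tm S Γ τ) (ρ : Ren Γ Δ) :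
    ∀ {Ξ : Ctx S} (η : SEnv Δ Ξ), (t.rename ρ).den.fn Ξ η = t.den.fn Ξ (fun τ x => η τ (ρ τ x)) :=
      by
  induction t generalizing Δ with
  | var x => intro Ξ η; rfl
  | con c => intro Ξ η; rfl
  | app t u iht ihu =>
    intro Ξ η
    change ((t.rename ρ).den.fn Ξ η).fn Ξ _ ((u.rename ρ).den.fn Ξ η) = _
    rw [iht, ihu]; rfl
  | lam t ih =>
    intro Ξ η
    refine Expo.ext ?_
    funext Ψ ρ' a
    refine (ih _ _).trans ?_
    rw [SEnv.cons_lift_ren]; rfl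

theorem Tm.den_subst {Γ Δ : Ctx S} {τ : Ty S.Base} (t : Tm S Γ τ) (θ : Sub S Γ Δ) :
    ∀ {Ξ : Ctx S} (η : SEnv Δ Ξ),
      (t.subst θ).den.fn Ξ η = t.den.fn Ξ (fun τ x => (θ τ x).den.fn Ξ η) := by
  induction t generalizing Δ with
  | var x => intro Ξ η; rfl
  | con c => intro Ξ η; rfl
  | app t u iht ihu =>
    intro Ξ η
    change ((t.subst θ).den.fn Ξ η).fn Ξ _ ((u.subst θ).den.fn Ξ η) = _
    rw [iht, ihu]; rfl
  | lam t ih =>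
    intro Ξ η
    refine Expo.ext ?_
    funext Ψ ρ' a
    refine (ih _ _).trans ?_
    change _ = t.den.fn Ψ _
    congr 1
    funext τ x
    cases x with
    | zero => rfl
    | succ x =>
      refine (Tm.den_rename _ _ _).trans ?_
      exact ((θ τ x).den.nat _ _ _ _).symm

/-- Soundness of the model. The $\beta$ case is the substitution lemma, and the $\eta$ case is
naturality, since elements of an exponential are determined by their action at all later stages. It
holds in every environment, including those with formal pairs. -/
theorem Conv.den_eq {Γ : Ctx S} {τ : Ty S.Base} {t u : Tm S Γ τ} (h : Conv t u) :
    ∀ {Δ : Ctx S} (η : SEnv Γ Δ), t.den.fn Δ η = u.den.fn Δ η := by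
  induction h with
  | refl t => intro Δ η; rfl
  | symm _ ih => intro Δ η; exact (ih η).symm
  | trans _ _ ih₁ ih₂ => intro Δ η; exact (ih₁ η).trans (ih₂ η)
  | @app _ _ _ t t' u u' _ _ ih₁ ih₂ =>
    intro Δ η
    change (t.den.fn Δ η).fn Δ _ (u.den.fn Δ η) = _
    rw [ih₁, ih₂]; rfl
  | lam _ ih =>
    intro Δ η
    refine Expo.ext ?_
    funext Ψ ρ' a
    exact ih _
  | beta t u =>
    intro Δ η
    rw [Tm.den_subst]
    change t.den.fn Δ _ = _
    congr 1
    funext τ x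
    cases x with
    | zero => rfl
    | succ x => exact (sem _).map_id _
  | eta t =>
    intro Δ η
    refine Expo.ext ?_
    funext Ψ ρ a
    change (t.wk.den.fn Ψ _).fn Ψ _ a = _
    rw [Tm.wk, Tm.den_rename]
    change (t.den.fn Ψ (η.map ρ)).fn Ψ _ a = _
    rw [← t.den.nat]; rfl

/-! ### Completeness of the model -/

/-- The logical relation between terms and their interpretations. -/
def Realizes : (τ : Ty S.Base) → {Γ : Ctx S} → Q Γ τ → (sem τ).obj Γ → Prop
  | .nt, _, q, a => q = a.1 ∧ ∀ s ∈ a.2, s.toQ = q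
  | .i, _, q, a => q = a.1 ∧ ∀ s ∈ a.2, s.toQ = q
  | .evs, _, q, a => a = Sum.inl q
  | .atm, _, q, a => q = a.1 ∧ ∀ s ∈ a.2, s.toQ = q
  | .prp, _, q, a => q = a.1 ∧ ∀ s ∈ a.2, s.toQ = q
  | .atmlst, _, q, a => q = a.1 ∧ ∀ s ∈ a.2, s.toQ = q
  | .prplst, _, q, a => q = a.1 ∧ ∀ s ∈ a.2, s.toQ = q
  | .other _, _, q, a => q = a.1 ∧ ∀ s ∈ a.2, s.toQ = q
  | .arr σ τ, Γ, q, f => ∀ (Δ : Ctx S) (ρ : Ren Γ Δ) (r : Q Δ σ) (a : (sem σ).obj Δ),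
      Realizes σ r a → Realizes τ ((q.map (Ren.toSub ρ)).app r) (f.fn Δ ρ a)

theorem Realizes.map {τ : Ty S.Base} {Γ Δ : Ctx S} (ρ : Ren Γ Δ) {q : Q Γ τ} {a : (sem τ).obj Γ}
    (h : Realizes τ q a) : Realizes τ (q.map (Ren.toSub ρ)) ((sem τ).map ρ a) := by
  have base : ∀ {b : Ty S.Base} {q : Q Γ b} {a : (basePsh b).obj Γ},
      (q = a.1 ∧ ∀ s ∈ a.2, s.toQ = q) → (q.map (Ren.toSub ρ) = ((basePsh b).map ρ a).1 ∧
        ∀ s ∈ ((basePsh b).map ρ a).2, s.toQ = q.map (Ren.toSub ρ)) := by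
    rintro b q ⟨q', s⟩ ⟨rfl, h⟩
    refine ⟨rfl, ?_⟩
    intro s' hs
    obtain ⟨s'', hs'', rfl⟩ := Option.mem_map.1 hs
    rw [Spine.toQ_map, h _ hs'']
  cases τ with
  | evs => cases h; rfl
  | arr σ τ =>
    intro Ξ ρ' r a hr
    rw [Q.map_map]
    exact h Ξ _ r a hr
  | _ => exact base h

/-- Both halves are proved together by induction on the type: at a function type, reification
applies the function to a reflected variable, and reflection reifies the argument. -/
theorem Realizes.reify_reflect (τ : Ty S.Base) {Γ : Ctx S} :
    (∀ {q : Q Γ τ} {a : (sem τ).obj Γ}, Realizes τ q a → (reification τ).reify a = q) ∧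
    ∀ {q : Q Γ τ} {s : Option (Spine Γ τ)}, (∀ s' ∈ s, s'.toQ = q) →
      Realizes τ q ((reification τ).reflect q s) := by
  induction τ generalizing Γ with
  | evs => exact ⟨fun h => by cases h; rfl, fun _ => rfl⟩
  | arr σ τ ihσ ihτ =>
    constructor
    · intro q f h
      change Q.lam _ = q
      rw [ihτ.1 (h (σ :: Γ) (fun _ x => .succ x) (.var .zero) _ (ihσ.2 (by simp)))]
      exact Q.lam_app_wk q
    · intro q s hs Δ ρ r a hr
      have e := ihσ.1 hr
      subst e
      refine ihτ.2 ?_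
      intro s' hs'
      obtain ⟨s₁, hs₁, rfl⟩ := Option.mem_map.1 hs'
      obtain ⟨s₂, hs₂, rfl⟩ := Option.mem_map.1 hs₁
      rw [Spine.toQ, Spine.toQ_map, hs _ hs₂]
  | _ => exact ⟨fun h => h.1.symm, fun h => ⟨rfl, h⟩⟩

theorem realizes_con {τ : Ty S.Base} (c : Con S τ) (Γ : Ctx S) :
    Realizes τ (.con c : Q Γ τ) (denCon c Γ) := by
  have gen : ∀ {τ : Ty S.Base} (c : Con S τ),
      Realizes τ (.con c : Q Γ τ) ((reification τ).reflect (.con c) (some (.con c))) :=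
    fun c => (Realizes.reify_reflect _).2 (by rintro s ⟨⟩; rfl)
  cases c with
  -- At type `evs` only `Sum.inl` is related to a term, and there `fst` and `rst` act as the
  -- syntactic constants.
  | fst => rintro Δ ρ r a ⟨⟩; exact ⟨rfl, by rintro _ ⟨⟩⟩
  | rst => rintro Δ ρ r a ⟨⟩; rfl
  | _ => exact gen _

/-- The fundamental lemma of the logical relation. For an abstraction the relation is a condition at
all later contexts, so the environment is first renamed and then extended. -/
theorem Tm.realizes {Γ : Ctx S} {τ : Ty S.Base} (t : Tm S Γ τ) : ∀ {Δ : Ctx S} (θ : Sub S Γ Δ)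
    (η : SEnv Γ Δ), (∀ σ x, Realizes σ (.mk (θ σ x)) (η σ x)) →
      Realizes τ (.mk (t.subst θ)) (t.den.fn Δ η) := by
  induction t with
  | var x => intro Δ θ η h; exact h _ x
  | con c => intro Δ θ η h; exact realizes_con c Δ
  | app t u iht ihu =>
    intro Δ θ η h
    have := iht θ η h Δ (fun _ x => x) _ _ (ihu θ η h)
    change Realizes _ ((Q.map (Sub.id _) _).app _) _ at this
    rwa [Q.map_id] at this
  | lam t ih =>
    intro Δ θ η h Ξ ρ r a hr
    induction r using Q.ind with
    | h r =>
    have := ih (Sub.cons r (θ.comp (Ren.toSub ρ))) (SEnv.cons a (η.map ρ)) (by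
      intro σ x
      cases x with
      | zero => exact hr
      | succ x => exact (h _ x).map ρ)
    change Realizes _ _ (t.den.fn Ξ (SEnv.cons a (SEnv.map ρ η)))
    convert this using 1
    rw [Tm.subst, Q.map_mk, Tm.subst, ← Q.lam_mk, Q.app_lam, Q.map_mk, Tm.subst_subst,
      Tm.subst_subst, ← Sub.comp_assoc, ← Sub.lift_comp, Sub.lift_comp_single]

namespace Q

variable {Γ Δ Ξ : Ctx S} {σ τ : Ty S.Base}

/-- The interpretation of a term modulo conversion. -/
def den (η : SEnv Γ Δ) (q : Q Γ τ) : (sem τ).obj Δ :=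
  Quotient.lift (fun t => t.den.fn Δ η) (fun _ _ h => Conv.den_eq h η) q

theorem den_app (η : SEnv Γ Δ) (q : Q Γ (.arr σ τ)) (r : Q Γ σ) :
    (q.app r).den η = (q.den η).fn Δ (fun _ x => x) (r.den η) := by
  induction q using Q.ind with | h t => induction r using Q.ind with | h u => rfl

theorem den_con (η : SEnv Γ Δ) (c : Con S τ) : (con c : Q Γ τ).den η = denCon c Δ := rfl

theorem den_map (θ : Sub S Γ Δ) (η : SEnv Δ Ξ) (q : Q Γ τ) :
    (q.map θ).den η = q.den (fun σ x => (mk (θ σ x)).den η) := by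
  induction q using Q.ind with | h t => exact t.den_subst θ η

theorem realizes_den_id (q : Q Γ τ) : Realizes τ q (q.den (SEnv.id Γ)) := by
  induction q using Q.ind with
  | h t =>
    have := t.realizes (Sub.id Γ) (SEnv.id Γ)
      fun σ x => (Realizes.reify_reflect σ).2 (by rintro s ⟨⟩)
    rwa [Tm.subst_id] at this

/-- A term can be recovered from its interpretation in the generic environment. Equality of these
interpretations therefore implies convertibility. -/
theorem reify_den_id (q : Q Γ τ) : (reification τ).reify (q.den (SEnv.id Γ)) = q :=
  (Realizes.reify_reflect τ).1 q.realizes_den_id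

end Q

/-- The known spine of an interpretation. -/
def spineOf : (τ : Ty S.Base) → {Γ : Ctx S} → (sem τ).obj Γ → Option (Spine Γ τ)
  | .nt, _, a => a.2
  | .i, _, a => a.2
  | .evs, _, _ => none
  | .atm, _, a => a.2
  | .prp, _, a => a.2
  | .atmlst, _, a => a.2
  | .prplst, _, a => a.2
  | .other _, _, a => a.2
  | .arr _ _, _, _ => none

/-- Base types with known spines. -/
def Ty.IsData (τ : Ty S.Base) : Prop :=
  ∀ {Γ : Ctx S} (q : Q Γ τ) (s : Option (Spine Γ τ)), spineOf τ ((reification τ).reflect q s) = s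

theorem spineOf_toQ {τ : Ty S.Base} {Γ : Ctx S} {q : Q Γ τ} {a : (sem τ).obj Γ}
    (h : Realizes τ q a) {s : Spine Γ τ} (hs : spineOf τ a = some s) : s.toQ = q := by
  cases τ with
  | evs => cases hs
  | arr σ τ => cases hs
  | _ => exact h.2 s hs

/-- `θ` has a semantic left inverse. -/
def Sub.IsSplit {Γ Δ : Ctx S} (θ : Sub S Γ Δ) : Prop :=
  ∃ η : SEnv Δ Γ, ∀ σ x, (Q.mk (θ σ x)).den η = SEnv.id Γ σ x

theorem Sub.IsSplit.den_map {Γ Δ : Ctx S} {θ : Sub S Γ Δ} {η : SEnv Δ Γ}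
    (h : ∀ σ x, (Q.mk (θ σ x)).den η = SEnv.id Γ σ x) {τ : Ty S.Base} (q : Q Γ τ) :
    (q.map θ).den η = q.den (SEnv.id Γ) := by
  rw [Q.den_map]; congr 1; funext σ x; exact h σ x

/-- Interpreting the substituted term in the left inverse gives back the generic interpretation of
the original term, and reification then gives the term. The inverse may use formal pairs, for which
no substitution of terms is available. -/
theorem Sub.IsSplit.injective {Γ Δ : Ctx S} {θ : Sub S Γ Δ} (h : θ.IsSplit) {τ : Ty S.Base}
    {q r : Q Γ τ} (e : q.map θ = r.map θ) : q = r := by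
  obtain ⟨η, h⟩ := h
  rw [← q.reify_den_id, ← r.reify_den_id, ← den_map h, e, den_map h]

/-- The left inverse turns the interpretation of a constant into that of `q`; the spine recorded
there is realized by `q`, which must thus have been this constant before the substitution. The
variants with one and two arguments hold for the same reason, with arguments obtained by
reification. -/
theorem Sub.IsSplit.con₀ {Γ Δ : Ctx S} {θ : Sub S Γ Δ} (h : θ.IsSplit) {τ : Ty S.Base}
    (hτ : τ.IsData) {c : Con S τ} (hc : c.IsFree) {q : Q Γ τ} (e : q.map θ = .con c) :
    q = .con c := by
  obtain ⟨η, h⟩ := h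
  have e' := den_map h q
  rw [e, Q.den_con, hc] at e'
  refine (spineOf_toQ q.realizes_den_id (s := .con c) ?_).symm
  rw [← e', hτ]

theorem Sub.IsSplit.con₁ {Γ Δ : Ctx S} {θ : Sub S Γ Δ} (h : θ.IsSplit) {σ τ : Ty S.Base}
    (hτ : τ.IsData) {c : Con S (.arr σ τ)} (hc : c.IsFree) {q : Q Γ τ} {a : Q Δ σ}
    (e : q.map θ = .app (.con c) a) : ∃ a₀, q = .app (.con c) a₀ := by
  obtain ⟨η, h⟩ := h
  have e' := den_map h q
  rw [e, Q.den_app, Q.den_con, hc] at e'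
  have key : spineOf τ (q.den (SEnv.id Γ)) =
      some (.app (.con c) ((reification _).reify (a.den η))) := by
    rw [← e']
    exact hτ _ _
  exact ⟨_, (spineOf_toQ q.realizes_den_id key).symm⟩

theorem Sub.IsSplit.con₂ {Γ Δ : Ctx S} {θ : Sub S Γ Δ} (h : θ.IsSplit) {σ₁ σ₂ τ : Ty S.Base}
    (hτ : τ.IsData) {c : Con S (.arr σ₁ (.arr σ₂ τ))} (hc : c.IsFree) {q : Q Γ τ} {a : Q Δ σ₁}
    {b : Q Δ σ₂} (e : q.map θ = .app (.app (.con c) a) b) :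
    ∃ a₀ b₀, q = .app (.app (.con c) a₀) b₀ := by
  obtain ⟨η, h⟩ := h
  have e' := den_map h q
  rw [e, Q.den_app, Q.den_app, Q.den_con, hc] at e'
  have key : spineOf τ (q.den (SEnv.id Γ)) = some (.app (.app (.con c)
      ((reification _).reify (a.den η))) ((reification _).reify (b.den η))) := by
    rw [← e']
    refine (hτ _ _).trans ?_
    simp only [Spine.appOpt, Option.map_some, Spine.map]
    congr 3
    exact Q.map_id _
  exact ⟨_, _, (spineOf_toQ q.realizes_den_id key).symm⟩

namespace Q

variable {Γ : Ctx S} {σ σ₁ σ₂ τ : Ty S.Base}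

/-- The known spine of a term. -/
def spine (q : Q Γ τ) : Option (Spine Γ τ) := spineOf τ (q.den (SEnv.id Γ))

theorem spine_con₀ (hτ : τ.IsData) {c : Con S τ} (hc : c.IsFree) :
    (con c : Q Γ τ).spine = some (.con c) := by
  rw [spine, den_con, hc, hτ]

theorem spine_con₁ (hτ : τ.IsData) {c : Con S (.arr σ τ)} (hc : c.IsFree) (a : Q Γ σ) :
    (app (con c) a).spine = some (.app (.con c) a) := by
  rw [spine, den_app, den_con, hc]
  refine (hτ _ _).trans ?_
  simp only [Spine.appOpt, Option.map_some, Spine.map]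
  rw [reify_den_id]

theorem spine_con₂ (hτ : τ.IsData) {c : Con S (.arr σ₁ (.arr σ₂ τ))} (hc : c.IsFree)
    (a : Q Γ σ₁) (b : Q Γ σ₂) :
    (app (app (con c) a) b).spine = some (.app (.app (.con c) a) b) := by
  rw [spine, den_app, den_app, den_con, hc]
  refine (hτ _ _).trans ?_
  simp only [Spine.appOpt, Option.map_some, Spine.map]
  rw [reify_den_id, reify_den_id]
  congr 3
  exact Q.map_id a

/-- The known spine is a function of the conversion class and contains the arguments of the
constructor. -/
theorem con₁_injective (hτ : τ.IsData) {c : Con S (.arr σ τ)} (hc : c.IsFree) {a a' : Q Γ σ}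
    (e : app (con c) a = app (con c) a') : a = a' := by
  have := congrArg spine e
  rw [spine_con₁ hτ hc, spine_con₁ hτ hc] at this
  cases this; rfl

theorem con₂_injective (hτ : τ.IsData) {c : Con S (.arr σ₁ (.arr σ₂ τ))} (hc : c.IsFree)
    {a a' : Q Γ σ₁} {b b' : Q Γ σ₂}
    (e : app (app (con c) a) b = app (app (con c) a') b') : a = a' ∧ b = b' := by
  have := congrArg spine e
  rw [spine_con₂ hτ hc, spine_con₂ hτ hc] at this
  cases this; exact ⟨rfl, rfl⟩

end Q

end FOLDN

/-! ### Derivability read as truth at worlds -/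

namespace FOLDN

variable {S : Sig} {D : Set (Clause S)}

/-! ### Worlds and forcing -/

/-- A world: variables and hypotheses. -/
structure World (D : Set (Clause S)) where
  ctx : Ctx S
  hyps : Multiset (Fm S ctx)

/-- `F`, with the values `xs` of its variables, is derivable from the hypotheses of `w`. -/
def Holds (w : World D) {Φ : Ctx S} (F : Fm S Φ) (xs : Env w.ctx Φ) : Prop :=
  Derives D w.ctx w.hyps (F.subst xs.toSub)

/-- Extensions of worlds. -/
structure Hom (w w' : World D) where
  sub : Sub S w.ctx w'.ctx
  holds : ∀ G ∈ w.hyps, Derives D w'.ctx w'.hyps (G.subst sub)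

notation:90 x:90 " ↾ " ρ:91 => Q.map (Hom.sub ρ) x

theorem Derives.of_mem {Δ : Ctx S} {Γ : Multiset (Fm S Δ)} {G : Fm S Δ} (h : G ∈ Γ) :
    Derives D Δ Γ G := by
  obtain ⟨E, rfl⟩ := Multiset.exists_cons_of_mem h
  exact Derives.identity G

theorem Derives.hom {w w' : World D} {C : Fm S w.ctx} (d : Derives D w.ctx w.hyps C)
    (ρ : Hom w w') : Derives D w'.ctx w'.hyps (C.subst ρ.sub) := by
  refine (d.subst_le ρ.sub le_rfl).cut_all fun G hG => ?_
  obtain ⟨G, hG', rfl⟩ := Multiset.mem_map.1 hG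
  exact ρ.holds G hG'

namespace Hom

def id (w : World D) : Hom w w := ⟨Sub.id _, fun G hG => by rw [Fm.subst_id]; exact .of_mem hG⟩

def comp {w w' w'' : World D} (ρ : Hom w w') (ρ' : Hom w' w'') : Hom w w'' :=
  ⟨ρ.sub.comp ρ'.sub, fun G hG => by rw [← Fm.subst_subst]; exact (ρ.holds G hG).hom ρ'⟩

end Hom

@[simp] theorem Q.map_hom_id {w : World D} {τ : Ty S.Base} (q : Q w.ctx τ) : q ↾ (Hom.id w) = q :=
  Q.map_id q

@[simp] theorem Q.map_hom_comp {w w' w'' : World D} (ρ : Hom w w') (ρ' : Hom w' w'')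
    {τ : Ty S.Base} (q : Q w.ctx τ) : q ↾ (ρ.comp ρ') = (q ↾ ρ) ↾ ρ' := (Q.map_map _ _ q).symm

@[simp] theorem Env.map_hom_id {w : World D} {Φ : Ctx S} (xs : Env w.ctx Φ) :
    xs.map (Hom.id w).sub = xs := Env.map_id xs

@[simp] theorem Env.map_hom_comp {w w' w'' : World D} (ρ : Hom w w') (ρ' : Hom w' w'')
    {Φ : Ctx S} (xs : Env w.ctx Φ) : xs.map (ρ.comp ρ').sub = (xs.map ρ.sub).map ρ'.sub :=
  (Env.map_map _ _ xs).symm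

section rules

variable {w w' : World D} {Φ Ψ : Ctx S} {τ : Ty S.Base}

theorem Holds.mono {F : Fm S Φ} {xs : Env w.ctx Φ} (h : Holds w F xs) (ρ : Hom w w') :
    Holds w' F (xs.map ρ.sub) := by
  have := Derives.hom h ρ
  rw [Fm.subst_subst] at this
  exact .convR (F.subst_conv (Env.toSub_map ρ.sub xs)) this

theorem holds_subst {F : Fm S Φ} {θ : Sub S Φ Ψ} {xs : Env w.ctx Ψ} :
    Holds w (F.subst θ) xs ↔ Holds w F (θ.eval xs) := by
  unfold Holds
  rw [Fm.subst_subst]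
  exact ⟨.convR (F.subst_conv (Sub.comp_toSub θ xs)),
    .convR (F.subst_conv (Sub.comp_toSub θ xs)).symm⟩

theorem derives_of_holds {F : Fm S Φ} {θ : Sub S Φ w.ctx} {xs : Env w.ctx Φ}
    (e : ∀ σ x, Q.mk (θ σ x) = xs.get x) :
    Holds w F xs ↔ Derives D w.ctx w.hyps (F.subst θ) := by
  have c : Sub.Conv xs.toSub θ := fun σ x => Q.exact (by rw [Env.toSub, Q.mk_out, e])
  exact ⟨.convR (F.subst_conv c), .convR (F.subst_conv c).symm⟩

@[simp] theorem holds_top {xs : Env w.ctx Φ} : Holds w .top xs ↔ True :=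
  ⟨fun _ => trivial, fun _ => .topR⟩

@[simp] theorem holds_and {A B : Fm S Φ} {xs : Env w.ctx Φ} :
    Holds w (A ⊓ₘ B) xs ↔ Holds w A xs ∧ Holds w B xs :=
  ⟨fun h => ⟨Derives.cut_shared h (.andL₁ (.identity _)),
    Derives.cut_shared h (.andL₂ (.identity _))⟩, fun h => .andR h.1 h.2⟩

theorem Holds.mp {A B : Fm S Φ} {xs : Env w.ctx Φ} (h : Holds w (A ⊃ₘ B) xs) (h' : Holds w A xs) :
    Holds w B xs := by
  refine Derives.cut_shared h' (Derives.cut_shared (Derives.weaken h (Multiset.le_cons_self _ _))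
    ?_)
  exact .impL (.identity _) (.identity _)

/-- Addition of a hypothesis. -/
abbrev World.add (w : World D) (A : Fm S w.ctx) : World D := ⟨w.ctx, A ::ₘ w.hyps⟩

abbrev Hom.add (w : World D) (A : Fm S w.ctx) : Hom w (w.add A) :=
  ⟨Sub.id _, fun G hG => by rw [Fm.subst_id]; exact .of_mem (Multiset.mem_cons_of_mem hG)⟩

/-- Addition of a variable and a hypothesis. -/
abbrev World.var (w : World D) (τ : Ty S.Base) (Γ : Multiset (Fm S (τ :: w.ctx))) : World D :=
  ⟨τ :: w.ctx, Γ + w.hyps.map Fm.wk⟩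

abbrev Hom.var (w : World D) (τ : Ty S.Base) (Γ : Multiset (Fm S (τ :: w.ctx))) :
    Hom w (w.var τ Γ) :=
  ⟨Sub.wk _ _, fun _ hG => .of_mem (Multiset.mem_add.2 (.inr (Multiset.mem_map_of_mem _ hG)))⟩

/-- The Kripke clause. For the converse it is enough to look at one later world, the one with the
antecedent as additional hypothesis; for `holds_all` it is the world with one fresh variable. -/
theorem holds_imp {A B : Fm S Φ} {xs : Env w.ctx Φ} : Holds w (A ⊃ₘ B) xs ↔
    ∀ (w' : World D) (ρ : Hom w w'), Holds w' A (xs.map ρ.sub) → Holds w' B (xs.map ρ.sub) := by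
  refine ⟨fun h w' ρ => (h.mono ρ).mp, fun h => ?_⟩
  have := h (w.add (A.subst xs.toSub)) (.add w _)
  have e : xs.map (Hom.add w (A.subst xs.toSub)).sub = xs := Env.map_id xs
  rw [e] at this
  exact .impR (this (Derives.identity _))

theorem Env.cons_toSub {Δ : Ctx S} (xs : Env Δ Φ) (t : Tm S Δ τ) :
    ∀ σ x, Q.mk (Sub.cons t xs.toSub σ x) = ((Q.mk t) ∷ xs).get x := by
  intro σ x
  cases x with
  | zero => rfl
  | succ x => exact Q.mk_out _

theorem Env.lift_toSub {Δ : Ctx S} (xs : Env Δ Φ) :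
    ∀ σ x, Q.mk (Sub.lift (σ := τ) xs.toSub σ x) =
      ((Q.var .zero) ∷ xs.map (Sub.wk Δ τ)).get x := by
  intro σ x
  cases x with
  | zero => rfl
  | succ x =>
    simp only [Sub.lift, Tm.wk_eq_subst, ← Q.map_mk, Env.get_succ, Env.get_map, Env.toSub, Q.mk_out]

theorem holds_inst {B : Fm S (τ :: Φ)} {xs : Env w.ctx Φ} {t : Tm S w.ctx τ} :
    Derives D w.ctx w.hyps ((B.subst xs.toSub.lift).inst t) ↔ Holds w B (Q.mk t ∷ xs) := by
  rw [Fm.inst, Fm.subst_subst, Sub.lift_comp_single]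
  exact (derives_of_holds (xs.cons_toSub t)).symm

theorem Holds.inst {B : Fm S (τ :: Φ)} {xs : Env w.ctx Φ} (h : Holds w (.all τ B) xs)
    (q : Q w.ctx τ) : Holds w B (q ∷ xs) := by
  rw [← q.mk_out]
  exact holds_inst.1 (Derives.cut_shared h (.allL q.out (.identity _)))

theorem holds_all {B : Fm S (τ :: Φ)} {xs : Env w.ctx Φ} : Holds w (.all τ B) xs ↔
    ∀ (w' : World D) (ρ : Hom w w') (q : Q w'.ctx τ), Holds w' B (q ∷ xs.map ρ.sub) := by
  refine ⟨fun h w' ρ => (h.mono ρ).inst, fun h => .allR ?_⟩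
  have := (derives_of_holds (F := B) xs.lift_toSub).1 (h (w.var τ 0) (.var w τ 0) (.var .zero))
  simpa [World.var] using this

theorem Holds.ex_intro {B : Fm S (τ :: Φ)} {xs : Env w.ctx Φ} (q : Q w.ctx τ)
    (h : Holds w B (q ∷ xs)) : Holds w (.ex τ B) xs := by
  rw [← q.mk_out] at h
  exact .exR q.out (holds_inst.2 h)

/-! ### Local truth -/

/-- `R` holds locally at `w`: it may be assumed in the proof of any formula. -/
def J (w : World D) (R : ∀ w' : World D, Hom w w' → Prop) : Prop :=
  ∀ (Φ : Ctx S) (C : Fm S Φ) (xs : Env w.ctx Φ),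
    (∀ (w' : World D) (ρ : Hom w w'), R w' ρ → Holds w' C (xs.map ρ.sub)) → Holds w C xs

theorem J.elim {R : ∀ w' : World D, Hom w w' → Prop} (h : J w R) {C : Fm S Φ} {xs : Env w.ctx Φ}
    (k : ∀ (w' : World D) (ρ : Hom w w'), R w' ρ → Holds w' C (xs.map ρ.sub)) : Holds w C xs :=
  h _ C xs k

/-- The modality is a continuation monad with formulas as answers. Accordingly, local truth may be
eliminated only towards a derivability statement or another local truth, which is why later results
with existential conclusions are stated under `J`. -/
theorem J.pure {R : ∀ w' : World D, Hom w w' → Prop} (h : R w (Hom.id w)) : J w R := by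
  intro Φ C xs k
  simpa using k w (Hom.id w) h

theorem J.bind {R R' : ∀ w' : World D, Hom w w' → Prop} (h : J w R)
    (k : ∀ (w' : World D) (ρ : Hom w w'), R w' ρ → J w' (fun w'' ρ' => R' w'' (ρ.comp ρ'))) :
    J w R' := by
  intro Φ C xs c
  refine h _ C xs fun w' ρ hR => k w' ρ hR _ C _ fun w'' ρ' hR' => ?_
  rw [← Env.map_hom_comp]
  exact c _ _ hR'

theorem J.imp {R R' : ∀ w' : World D, Hom w w' → Prop} (h : J w R)
    (k : ∀ (w' : World D) (ρ : Hom w w'), R w' ρ → R' w' ρ) : J w R' :=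
  fun _ C xs c => h _ C xs fun w' ρ hR => c w' ρ (k w' ρ hR)

/-- The left rule for the existential quantifier amounts to passing to the world with a fresh
variable and the instance at this variable as hypothesis; there the variable is a witness. -/
theorem Holds.ex_elim {B : Fm S (τ :: Φ)} {xs : Env w.ctx Φ} (h : Holds w (.ex τ B) xs) :
    J w (fun w' ρ => ∃ q : Q w'.ctx τ, Holds w' B (q ∷ xs.map ρ.sub)) := by
  intro Ψ C ys k
  refine Derives.cut_shared h (.exL ?_)
  have h' := k (w.var τ {B.subst xs.toSub.lift}) (.var w τ _) ⟨.var .zero,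
    (derives_of_holds (F := B) xs.lift_toSub).2 (.of_mem (Multiset.mem_add.2 (.inl (by simp))))⟩
  have := (derives_of_holds (F := C) (θ := ys.toSub.comp (Sub.wk _ τ)) (by
    intro σ x
    simp only [Sub.comp, ← Q.map_mk, Env.toSub, Q.mk_out, Env.get_map])).1 h'
  rw [← Fm.subst_subst] at this
  rw [Fm.wk_eq_subst]
  simpa [World.var] using this

@[simp] theorem holds_ex {B : Fm S (τ :: Φ)} {xs : Env w.ctx Φ} : Holds w (.ex τ B) xs ↔
    J w (fun w' ρ => ∃ q : Q w'.ctx τ, Holds w' B (q ∷ xs.map ρ.sub)) :=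
  ⟨Holds.ex_elim, fun h => h.elim fun _ _ ⟨q, hq⟩ => hq.ex_intro q⟩

@[simp high] theorem holds_ex_ex {σ : Ty S.Base} {B : Fm S (σ :: τ :: Φ)} {xs : Env w.ctx Φ} :
    Holds w (.ex τ (.ex σ B)) xs ↔ J w (fun w' ρ => ∃ (q : Q w'.ctx τ) (r : Q w'.ctx σ),
      Holds w' B (r ∷ q ∷ xs.map ρ.sub)) := by
  refine ⟨fun h => h.ex_elim.bind ?_, fun h => h.elim fun _ _ ⟨q, r, hr⟩ => (hr.ex_intro r).ex_intro
    q⟩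
  rintro w' ρ ⟨q, hq⟩
  refine hq.ex_elim.imp ?_
  rintro w'' ρ' ⟨r, hr⟩
  exact ⟨q ↾ ρ', r, by simpa using hr⟩

/-! ### Iterated quantifiers and implications -/

def Fm.alls : (τs : Ctx S) → Fm S (τs ++ Φ) → Fm S Φ
  | [], C => C
  | τ :: τs, C => Fm.alls τs (.all τ C)

def Fm.imps (As : List (Fm S Φ)) (C : Fm S Φ) : Fm S Φ := As.foldr .imp C

theorem holds_alls {τs : Ctx S} {C : Fm S (τs ++ Φ)} {ys : Env w.ctx Φ} :
    Holds w (.alls τs C) ys ↔ ∀ (w' : World D) (ρ : Hom w w') (xs : Env w'.ctx τs),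
      Holds w' C (xs.append (ys.map ρ.sub)) := by
  induction τs generalizing w with
  | nil =>
    refine ⟨fun h w' ρ xs => ?_, fun h => ?_⟩
    · cases xs; exact h.mono ρ
    · have := h w (Hom.id w) .nil
      rwa [Env.map_hom_id] at this
  | cons τ τs ih =>
    refine (ih (C := .all τ C)).trans ⟨fun h w' ρ xs => ?_, fun h w' ρ xs => ?_⟩
    · cases xs with | cons x xs => exact (h w' ρ xs).inst x
    · refine holds_all.2 fun w'' ρ' q => ?_
      have := h w'' (ρ.comp ρ') (q ∷ xs.map ρ'.sub)
      rwa [Env.map_hom_comp, Env.cons_append, ← Env.map_append] at this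

theorem holds_imps {As : List (Fm S Φ)} {C : Fm S Φ} {ys : Env w.ctx Φ} :
    Holds w (.imps As C) ys ↔ ∀ (w' : World D) (ρ : Hom w w'),
      (∀ A ∈ As, Holds w' A (ys.map ρ.sub)) → Holds w' C (ys.map ρ.sub) := by
  induction As generalizing w with
  | nil =>
    refine ⟨fun h w' ρ _ => h.mono ρ, fun h => ?_⟩
    have := h w (Hom.id w) (by simp)
    rwa [Env.map_hom_id] at this
  | cons A As ih =>
    refine holds_imp.trans ⟨fun h w' ρ hA => ?_, fun h w' ρ hA => ih.2 fun w'' ρ' hAs => ?_⟩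
    · have := ih.1 (h w' ρ (hA A (by simp))) w' (Hom.id w')
      simp only [Env.map_hom_id] at this
      exact this fun B hB => hA B (by simp [hB])
    · have := h w'' (ρ.comp ρ')
      simp only [Env.map_hom_comp, List.forall_mem_cons] at this
      exact this ⟨hA.mono ρ', hAs⟩

def Fm.rule (τs : Ctx S) (As : List (Fm S (τs ++ Φ))) (C : Fm S (τs ++ Φ)) : Fm S Φ :=
  .alls τs (.imps As C)

theorem holds_rule {τs : Ctx S} {As : List (Fm S (τs ++ Φ))} {C : Fm S (τs ++ Φ)}
    {ys : Env w.ctx Φ} : Holds w (.rule τs As C) ys ↔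
      ∀ (w' : World D) (ρ : Hom w w') (xs : Env w'.ctx τs),
        (∀ A ∈ As, Holds w' A (xs.append (ys.map ρ.sub))) →
          Holds w' C (xs.append (ys.map ρ.sub)) := by
  refine holds_alls.trans ⟨fun h w' ρ xs hA => ?_, fun h w' ρ xs => holds_imps.2 fun w'' ρ' hA =>
    ?_⟩
  · have := holds_imps.1 (h w' ρ xs) w' (Hom.id w')
    simp only [Env.map_hom_id] at this
    exact this hA
  · have := h w'' (ρ.comp ρ') (xs.map ρ'.sub)
    simp only [Env.map_hom_comp, ← Env.map_append] at this
    exact this hA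

/-! ### Natural numbers -/

def Nt (w : World D) (n : Q w.ctx .nt) : Prop := Holds w (.nat v0) (n ∷ .nil)

def qz {Δ : Ctx S} : Q Δ .nt := .con .zero

def qs {Δ : Ctx S} (n : Q Δ .nt) : Q Δ .nt := .app (.con .succ) n

@[simp] theorem map_qz {Δ Ξ : Ctx S} (ρ : Sub S Δ Ξ) : (qz : Q Δ .nt).map ρ = qz := rfl

@[simp] theorem map_qs {Δ Ξ : Ctx S} (ρ : Sub S Δ Ξ) (n : Q Δ .nt) :
    (qs n).map ρ = qs (n.map ρ) := Q.map_app _ _ _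

@[simp] theorem eval_suc {Δ : Ctx S} (t : Tm S Φ .nt) (xs : Env Δ Φ) :
    (suc t).eval xs = qs (t.eval xs) := rfl

@[simp high] theorem eval_zr {Δ : Ctx S} (xs : Env Δ Φ) : (zr : Tm S Φ .nt).eval xs = qz := rfl

@[simp] theorem holds_nat {t : Tm S Φ .nt} {xs : Env w.ctx Φ} :
    Holds w (.nat t) xs ↔ Nt w (t.eval xs) := by
  have e : (Tm.var .zero : Tm S [.nt] .nt).subst (Env.toSub (t.eval xs ∷ .nil)) = (t.eval xs).out :=
    rfl
  unfold Nt Holds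
  simp only [Fm.subst]
  rw [e]
  exact ⟨.convR (.nat (Q.out_mk _).symm), .convR (.nat (Q.out_mk _))⟩

theorem Nt.mono {n : Q w.ctx .nt} (h : Nt w n) (ρ : Hom w w') : Nt w' (n ↾ ρ) := Holds.mono h ρ

theorem J.nt {R : ∀ w' : World D, Hom w w' → Prop} (h : J w R) {n : Q w.ctx .nt}
    (k : ∀ (w' : World D) (ρ : Hom w w'), R w' ρ → Nt w' (n ↾ ρ)) : Nt w n := h.elim k

theorem Nt.zero : Nt w qz := (holds_nat (t := zr) (xs := .nil)).1 .natR_zero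

theorem Nt.succ {n : Q w.ctx .nt} (h : Nt w n) : Nt w (qs n) := by
  have := (holds_nat (t := suc v0) (xs := n ∷ .nil)).1 (.natR_succ h)
  rwa [eval_suc, Tm.eval_var] at this

/-- The minor premises of the induction rule have no side hypotheses. Base and step are therefore
demanded at every world and for all values of the parameters, so that they apply at the worlds with
no hypothesis and with only the induction hypothesis. -/
theorem nat_ind_aux (F : Fm S (.nt :: Φ))
    (zero : ∀ (w : World D) ys, Holds w F (qz ∷ ys))
    (succ : ∀ (w : World D) j ys, Holds w F (j ∷ ys) → Holds w F (qs j ∷ ys))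
    {n : Q w.ctx .nt} (hn : Nt w n) (ys : Env w.ctx Φ) : Holds w F (n ∷ ys) := by
  have hn' : Derives D w.ctx w.hyps (.nat n.out) := hn
  refine Derives.cut_shared hn' ?_
  refine .natL (F.subst ys.toSub.lift) ?_ ?_ ?_
  · exact (holds_inst (w := ⟨w.ctx, 0⟩)).2 (zero ⟨w.ctx, 0⟩ ys)
  · have h := succ ⟨.nt :: w.ctx, {F.subst ys.toSub.lift}⟩ (.var .zero) (ys.map (Sub.wk _ _))
      ((derives_of_holds (F := F) ys.lift_toSub).2 (.of_mem (by simp)))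
    rw [Fm.subst_subst]
    refine (derives_of_holds ?_).1 h
    intro σ x
    cases x with
    | zero => rfl
    | succ x =>
      simp only [Sub.comp, Sub.lift, Tm.wk, Tm.subst_of_rename, Sub.step, Env.get_succ, Env.get_map]
      rw [← Q.mk_out (ys.get x), Q.map_mk]
      rfl
  · refine .convL ?_ (Derives.identity _)
    rw [Fm.inst, Fm.subst_subst, Sub.lift_comp_single]
    refine F.subst_conv fun σ x => Q.exact ?_
    rw [Env.cons_toSub, Q.mk_out, Env.toSub, Q.mk_out]

/-- The rule does not provide $nat\,j$ in its step; strengthening the invariant by this conjunct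
supplies it. -/
theorem nat_ind (F : Fm S (.nt :: Φ))
    (zero : ∀ (w : World D) ys, Holds w F (qz ∷ ys))
    (succ : ∀ (w : World D) j ys, Nt w j → Holds w F (j ∷ ys) → Holds w F (qs j ∷ ys))
    {n : Q w.ctx .nt} (hn : Nt w n) (ys : Env w.ctx Φ) : Holds w F (n ∷ ys) := by
  have := nat_ind_aux (.nat v0 ⊓ₘ F) (fun w ys => ?_) (fun w j ys => ?_) hn ys
  · exact (holds_and.1 this).2
  · simpa [Nt.zero] using zero w ys
  · simp only [holds_and, holds_nat, Tm.eval_var, Env.get_zero]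
    exact fun h => ⟨h.1.succ, succ w j ys h.1 h.2⟩

/-! ### Definitional clauses -/

/-- An atomic formula holds for given values. -/
def At (w : World D) {τs : Ctx S} (p : Pred S τs) (xs : Env w.ctx τs) : Prop :=
  Derives D w.ctx w.hyps (.pred p xs.toArgs)

theorem holds_pred {τs : Ctx S} {p : Pred S τs} {ts : Args S Φ τs} {xs : Env w.ctx Φ} :
    Holds w (.pred p ts) xs ↔ At w p (ts.eval xs) :=
  ⟨.convR (.pred (ts.subst_toSub_conv xs)), .convR (.pred (ts.subst_toSub_conv xs).symm)⟩

theorem Args.eval_vars {Δ : Ctx S} {τs : Ctx S} (xs : Env Δ τs) : (Args.vars τs).eval xs = xs := by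
  induction xs with
  | nil => rfl
  | cons x xs ih =>
    have e : (Sub.wk _ _).eval (x ∷ xs) = xs := by ext τ y; simp [Sub.wk]
    rw [Args.vars, Args.eval_cons, Args.eval_subst, e, ih, Tm.eval_var, Env.get_zero]

theorem holds_vars {τs : Ctx S} {p : Pred S τs} {xs : Env w.ctx τs} :
    Holds w (.pred p (.vars τs)) xs ↔ At w p xs := by
  rw [holds_pred, Args.eval_vars]

theorem At.mono {τs : Ctx S} {p : Pred S τs} {xs : Env w.ctx τs} (h : At w p xs) (ρ : Hom w w') :
    At w' p (xs.map ρ.sub) := holds_vars.1 ((holds_vars.2 h).mono ρ)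

theorem J.at {R : ∀ w' : World D, Hom w w' → Prop} (h : J w R) {τs : Ctx S} {p : Pred S τs}
    {xs : Env w.ctx τs} (k : ∀ (w' : World D) (ρ : Hom w w'), R w' ρ → At w' p (xs.map ρ.sub)) :
    At w p xs :=
  holds_vars.1 (h.elim fun w' ρ hR => holds_vars.2 (k w' ρ hR))

theorem At.intro {τs : Ctx S} {p : Pred S τs} {ts : Args S Φ τs} {B : Fm S Φ}
    (hc : (⟨Φ, p, ts, B⟩ : Clause S) ∈ D) (xs : Env w.ctx Φ) (h : Holds w B xs) :
    At w p (ts.eval xs) :=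
  .defR xs.toSub hc (ts.subst_toSub_conv xs).symm h

/-- The left rule for definitions is applied with the complete set of all unifiers. Each premise is
a world: its substitution makes the atom equal to the head of a clause, and its new hypothesis is
the body. -/
theorem At.cases {τs : Ctx S} {p : Pred S τs} {us : Env w.ctx τs} (h : At w p us) :
    J w (fun w' ρ => ∃ (Φ : Ctx S) (ts : Args S Φ τs) (B : Fm S Φ) (xs : Env w'.ctx Φ),
      (⟨Φ, p, ts, B⟩ : Clause S) ∈ D ∧ us.map ρ.sub = ts.eval xs ∧ Holds w' B xs) := by
  intro Ψ C ys k
  refine Derives.cut_shared h ?_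
  refine .defL (fun Φ t B Δ'' η θ => Unifies us.toArgs t η θ) ?_ ?_
  · intro Φ t B hc
    exact ⟨fun _ _ _ h => h, fun Δ'' η θ h =>
      ⟨Δ'', η, θ, Sub.id _, h, fun τ x => by rw [Tm.subst_id]; exact .refl _,
        fun τ x => by rw [Tm.subst_id]; exact .refl _⟩⟩
  · intro Φ t B hc Δ' η θ hun
    let w' : World D := ⟨Δ', B.subst θ ::ₘ w.hyps.map (Fm.subst η)⟩
    let ρ : Hom w w' := ⟨η, fun G hG =>
      .of_mem (Multiset.mem_cons_of_mem (Multiset.mem_map_of_mem _ hG))⟩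
    let xs : Env w'.ctx Φ := .tab fun _ x => Q.mk (θ _ x)
    have hx : ∀ σ x, Q.mk (θ σ x) = xs.get x := fun σ x =>
      (Env.get_tab (fun _ x => Q.mk (θ _ x)) x).symm
    have hk := k w' ρ ⟨Φ, t, B, xs, hc, ?_, (derives_of_holds hx).2 (Derives.identity _)⟩
    · rw [Fm.subst_subst]
      exact .convR (C.subst_conv (Env.toSub_map η ys)).symm hk
    · refine Env.eq_of_toArgs_conv (((Env.toArgs_subst us η).symm.trans hun).trans ?_)
      refine (t.subst_conv (η := xs.toSub) fun σ x => Q.exact ?_).trans (t.subst_toSub_conv xs)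
      rw [hx, Env.toSub, Q.mk_out]

end rules

end FOLDN

/-! ### Pointwise constructors and operations on expressions with eigenvariables -/

namespace FOLDN

variable {S : Sig}

/-! ### Pointwise constructors -/

section ops

variable {Γ Δ Ξ : Ctx S} {σ σ₁ σ₂ τ : Ty S.Base}

theorem Q.map_wk_var (x : Var Δ τ) : (Q.var x).map (Sub.wk Δ σ) = Q.var (.succ x) := rfl

noncomputable section

/-- Pointwise constructors below one abstraction. -/
def qnul (c : Con S τ) : Q Δ (.star τ) := (Tm.lam (.con c)).eval .nil

def qun (c : Con S (.arr σ τ)) (A : Q Δ (.star σ)) : Q Δ (.star τ) :=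
  (Tm.lam (.con c ⬝ₘ (v1 ⬝ₘ v0))).eval (A ∷ .nil)

def qbin (c : Con S (.arr σ₁ (.arr σ₂ τ))) (A : Q Δ (.star σ₁)) (B : Q Δ (.star σ₂)) :
    Q Δ (.star τ) :=
  (Tm.lam (.con c ⬝ₘ (v1 ⬝ₘ v0) ⬝ₘ (v2 ⬝ₘ v0))).eval (A ∷ B ∷ .nil)

/-- Pointwise constructors below two abstractions. -/
def nul2 (c : Con S τ) : Q Δ (.star (.star τ)) := (Tm.lam (.lam (.con c))).eval .nil

def un2 (c : Con S (.arr σ τ)) (A : Q Δ (.star (.star σ))) : Q Δ (.star (.star τ)) :=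
  (Tm.lam (.lam (.con c ⬝ₘ (v2 ⬝ₘ v1 ⬝ₘ v0)))).eval (A ∷ .nil)

def bin2 (c : Con S (.arr σ₁ (.arr σ₂ τ))) (A : Q Δ (.star (.star σ₁)))
    (B : Q Δ (.star (.star σ₂))) : Q Δ (.star (.star τ)) :=
  (Tm.lam (.lam (.con c ⬝ₘ (v2 ⬝ₘ v1 ⬝ₘ v0) ⬝ₘ (v3 ⬝ₘ v1 ⬝ₘ v0)))).eval (A ∷ B ∷ .nil)

/-- Pointwise constructors below three abstractions. -/
def nul3 (c : Con S τ) : Q Δ (.star (.arr .i (.star τ))) :=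
  (Tm.lam (.lam (.lam (.con c)))).eval .nil

def un3 (c : Con S (.arr σ τ)) (A : Q Δ (.star (.arr .i (.star σ)))) :
    Q Δ (.star (.arr .i (.star τ))) :=
  (Tm.lam (.lam (.lam (.con c ⬝ₘ (v3 ⬝ₘ v2 ⬝ₘ v1 ⬝ₘ v0))))).eval (A ∷ .nil)

def bin3 (c : Con S (.arr σ₁ (.arr σ₂ τ))) (A : Q Δ (.star (.arr .i (.star σ₁))))
    (B : Q Δ (.star (.arr .i (.star σ₂)))) : Q Δ (.star (.arr .i (.star τ))) :=
  (Tm.lam (.lam (.lam (.con c ⬝ₘ (v3 ⬝ₘ v2 ⬝ₘ v1 ⬝ₘ v0) ⬝ₘ (v4 ⬝ₘ v2 ⬝ₘ v1 ⬝ₘ v0))))).eval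
    (A ∷ B ∷ .nil)

/-- `λ l. X (rst l)`. -/
def qshift (X : Q Δ (.star τ)) : Q Δ (.star τ) := (Tm.lam (v1 ⬝ₘ rst v0)).eval (X ∷ .nil)

/-- `λ l. B (rst l) (fst l)`. -/
def qopen (B : Q Δ (.star (.arr .i τ))) : Q Δ (.star τ) :=
  (Tm.lam (v1 ⬝ₘ rst v0 ⬝ₘ fst v0)).eval (B ∷ .nil)

/-- `λ l. B l (X l)`. -/
def qinst (B : Q Δ (.star (.arr .i τ))) (X : Q Δ (.star .i)) : Q Δ (.star τ) :=
  (Tm.lam (v1 ⬝ₘ v0 ⬝ₘ (v2 ⬝ₘ v0))).eval (B ∷ X ∷ .nil)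

/-- `λ l'. X`. -/
def qconst (X : Q Δ τ) : Q Δ (.star τ) := (Tm.lam v1).eval (X ∷ .nil)

/-- `λ l' l. X l' (fst l) (rst l)`. -/
def qonList (X : Q Δ (.star (.arr .i (.star τ)))) : Q Δ (.star (.star τ)) :=
  (onList v0).eval (X ∷ .nil)

/-- `λ l' l. X (rst l') (fst l') l`. -/
def qmoved (X : Q Δ (.star (.arr .i (.star τ)))) : Q Δ (.star (.star τ)) :=
  (moved v0).eval (X ∷ .nil)

/-- `λ l' l. X l' (rst l)`. -/
def qskip (X : Q Δ (.star (.star τ))) : Q Δ (.star (.star τ)) :=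
  (Tm.lam (.lam (v2 ⬝ₘ v1 ⬝ₘ rst v0))).eval (X ∷ .nil)

/-- `λ l' l. X l' (T l' l) (rst l)`. -/
def qput (T : Q Δ (.star (.star .i))) (X : Q Δ (.star (.arr .i (.star τ)))) :
    Q Δ (.star (.star τ)) :=
  (Tm.lam (.lam (v3 ⬝ₘ v1 ⬝ₘ (v2 ⬝ₘ v1 ⬝ₘ v0) ⬝ₘ rst v0))).eval (T ∷ X ∷ .nil)

/-- `λ l' l. B l' l (V l')`. -/
def qat2 (B : Q Δ (.star (.star (.arr .i τ)))) (V : Q Δ (.star .i)) : Q Δ (.star (.star τ)) :=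
  (Tm.lam (.lam (v2 ⬝ₘ v1 ⬝ₘ v0 ⬝ₘ (v3 ⬝ₘ v1)))).eval (B ∷ V ∷ .nil)

/-- `λ l' x l. B l' x l (V l')`. -/
def qat3 (B : Q Δ (.star (.arr .i (.star (.arr .i τ))))) (V : Q Δ (.star .i)) :
    Q Δ (.star (.arr .i (.star τ))) :=
  (Tm.lam (.lam (.lam (v3 ⬝ₘ v2 ⬝ₘ v1 ⬝ₘ v0 ⬝ₘ (v4 ⬝ₘ v2))))).eval (B ∷ V ∷ .nil)

end

variable (ρ : Sub S Δ Ξ)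

@[simp] theorem map_qnul (c : Con S τ) : (qnul c : Q Δ _).map ρ = qnul c := by simp [qnul]
@[simp] theorem map_qun (c : Con S (.arr σ τ)) (A : Q Δ (.star σ)) :
    (qun c A).map ρ = qun c (A.map ρ) := by simp [qun]
@[simp] theorem map_qbin (c : Con S (.arr σ₁ (.arr σ₂ τ))) (A : Q Δ (.star σ₁))
    (B : Q Δ (.star σ₂)) : (qbin c A B).map ρ = qbin c (A.map ρ) (B.map ρ) := by simp [qbin]
@[simp] theorem map_nul2 (c : Con S τ) : (nul2 c : Q Δ _).map ρ = nul2 c := by simp [nul2]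
@[simp] theorem map_un2 (c : Con S (.arr σ τ)) (A : Q Δ (.star (.star σ))) :
    (un2 c A).map ρ = un2 c (A.map ρ) := by simp [un2]
@[simp] theorem map_bin2 (c : Con S (.arr σ₁ (.arr σ₂ τ))) (A : Q Δ (.star (.star σ₁)))
    (B : Q Δ (.star (.star σ₂))) : (bin2 c A B).map ρ = bin2 c (A.map ρ) (B.map ρ) := by simp [bin2]
@[simp] theorem map_qshift (X : Q Δ (.star τ)) : (qshift X).map ρ = qshift (X.map ρ) := by
  simp [qshift]
@[simp] theorem map_qopen (B : Q Δ (.star (.arr .i τ))) : (qopen B).map ρ = qopen (B.map ρ) := by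
  simp [qopen]
@[simp] theorem map_qconst (X : Q Δ τ) : (qconst X).map ρ = qconst (X.map ρ) := by simp [qconst]
@[simp] theorem map_qonList (X : Q Δ (.star (.arr .i (.star τ)))) :
    (qonList X).map ρ = qonList (X.map ρ) := by simp [qonList]
@[simp] theorem map_qmoved (X : Q Δ (.star (.arr .i (.star τ)))) :
    (qmoved X).map ρ = qmoved (X.map ρ) := by simp [qmoved]
@[simp] theorem map_qskip (X : Q Δ (.star (.star τ))) : (qskip X).map ρ = qskip (X.map ρ) := by
  simp [qskip]
@[simp] theorem map_qput (T : Q Δ (.star (.star .i))) (X : Q Δ (.star (.arr .i (.star τ)))) :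
    (qput T X).map ρ = qput (T.map ρ) (X.map ρ) := by simp [qput]
/-! ### Bodies of abstractions -/

/-- The bodies of functions of one, two and three arguments. -/
def b1 (X : Q Δ (.star τ)) : Q (.evs :: Δ) τ := (X.map (Sub.wk _ _)).app (.var .zero)

def b2 (X : Q Δ (.star (.star τ))) : Q (.evs :: .evs :: Δ) τ :=
  (((X.map (Sub.wk _ _)).map (Sub.wk _ _)).app (.var (.succ .zero))).app (.var .zero)

def b3 (X : Q Δ (.star (.arr .i (.star τ)))) : Q (.evs :: .i :: .evs :: Δ) τ :=
  (((((X.map (Sub.wk _ _)).map (Sub.wk _ _)).map (Sub.wk _ _)).app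
    (.var (.succ (.succ .zero)))).app (.var (.succ .zero))).app (.var .zero)

theorem b1_lam (t : Q (.evs :: Δ) τ) : b1 t.lam = t := Q.app_wk_lam t

/-- The definition weakens first and then applies, which suits evaluation; here the applications are
interleaved, which suits peeling off one abstraction at a time. -/
theorem b2_eq (X : Q Δ (.star (.star τ))) :
    b2 X = ((((X.map (Sub.wk _ _)).app (.var .zero)).map (Sub.wk _ _)).app (.var .zero)) := by
  rw [Q.map_app]; rfl

theorem b3_eq (X : Q Δ (.star (.arr .i (.star τ)))) :
    b3 X = (((((X.map (Sub.wk _ _)).app (.var .zero)).map (Sub.wk _ _)).app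
      (.var .zero)).map (Sub.wk _ _)).app (.var .zero) := by
  simp only [Q.map_app]; rfl

theorem b2_lam (t : Q (.evs :: .evs :: Δ) τ) : b2 t.lam.lam = t := by
  rw [b2_eq, Q.app_wk_lam, Q.app_wk_lam]

theorem b3_lam (t : Q (.evs :: .i :: .evs :: Δ) τ) : b3 t.lam.lam.lam = t := by
  rw [b3_eq, Q.app_wk_lam, Q.app_wk_lam, Q.app_wk_lam]

theorem b1_injective {X Y : Q Δ (.star τ)} (h : b1 X = b1 Y) : X = Y := Q.funext h

theorem b2_injective {X Y : Q Δ (.star (.star τ))} (h : b2 X = b2 Y) : X = Y := by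
  rw [b2_eq, b2_eq] at h
  exact Q.funext (Q.funext h)

theorem b3_injective {X Y : Q Δ (.star (.arr .i (.star τ)))} (h : b3 X = b3 Y) : X = Y := by
  rw [b3_eq, b3_eq] at h
  exact Q.funext (Q.funext (Q.funext h))

theorem b1_qnul (c : Con S τ) : b1 (qnul c : Q Δ _) = .con c := by simp [b1, qnul]
theorem b1_qun (c : Con S (.arr σ τ)) (A : Q Δ (.star σ)) :
    b1 (qun c A) = .app (.con c) (b1 A) := by simp [b1, qun]
theorem b1_qbin (c : Con S (.arr σ₁ (.arr σ₂ τ))) (A : Q Δ (.star σ₁)) (B : Q Δ (.star σ₂)) :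
    b1 (qbin c A B) = .app (.app (.con c) (b1 A)) (b1 B) := by simp [b1, qbin]
theorem b2_nul2 (c : Con S τ) : b2 (nul2 c : Q Δ _) = .con c := by simp [b2, nul2]
theorem b2_un2 (c : Con S (.arr σ τ)) (A : Q Δ (.star (.star σ))) :
    b2 (un2 c A) = .app (.con c) (b2 A) := by simp [b2, un2]
theorem b2_bin2 (c : Con S (.arr σ₁ (.arr σ₂ τ))) (A : Q Δ (.star (.star σ₁)))
    (B : Q Δ (.star (.star σ₂))) :
    b2 (bin2 c A B) = .app (.app (.con c) (b2 A)) (b2 B) := by simp [b2, bin2]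
theorem b3_nul3 (c : Con S τ) : b3 (nul3 c : Q Δ _) = .con c := by simp [b3, nul3]
theorem b3_un3 (c : Con S (.arr σ τ)) (A : Q Δ (.star (.arr .i (.star σ)))) :
    b3 (un3 c A) = .app (.con c) (b3 A) := by simp [b3, un3]
theorem b3_bin3 (c : Con S (.arr σ₁ (.arr σ₂ τ))) (A : Q Δ (.star (.arr .i (.star σ₁))))
    (B : Q Δ (.star (.arr .i (.star σ₂)))) :
    b3 (bin3 c A B) = .app (.app (.con c) (b3 A)) (b3 B) := by simp [b3, bin3]

/-! ### Commutation of the operations with constructors -/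

theorem qshift_qnul (c : Con S τ) : qshift (qnul c : Q Δ _) = qnul c :=
  b1_injective (by simp [b1, qshift, qnul])
theorem qshift_qun (c : Con S (.arr σ τ)) (A : Q Δ (.star σ)) :
    qshift (qun c A) = qun c (qshift A) := b1_injective (by simp [b1, qshift, qun])
theorem qshift_qbin (c : Con S (.arr σ₁ (.arr σ₂ τ))) (A : Q Δ (.star σ₁)) (B : Q Δ (.star σ₂)) :
    qshift (qbin c A B) = qbin c (qshift A) (qshift B) :=
  b1_injective (by simp [b1, qshift, qbin])

theorem qconst_qnul (c : Con S τ) : qconst (qnul c : Q Δ _) = nul2 c :=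
  b2_injective (by simp [b2, qconst, qnul, nul2])
theorem qconst_qun (c : Con S (.arr σ τ)) (A : Q Δ (.star σ)) :
    qconst (qun c A) = un2 c (qconst A) := b2_injective (by simp [b2, qconst, qun, un2])
theorem qconst_qbin (c : Con S (.arr σ₁ (.arr σ₂ τ))) (A : Q Δ (.star σ₁)) (B : Q Δ (.star σ₂)) :
    qconst (qbin c A B) = bin2 c (qconst A) (qconst B) :=
  b2_injective (by simp [b2, qconst, qbin, bin2])

theorem qonList_nul3 (c : Con S τ) : qonList (nul3 c : Q Δ _) = nul2 c :=
  b2_injective (by simp [b2, qonList, onList, nul3, nul2])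
theorem qonList_un3 (c : Con S (.arr σ τ)) (A : Q Δ (.star (.arr .i (.star σ)))) :
    qonList (un3 c A) = un2 c (qonList A) :=
  b2_injective (by simp [b2, qonList, onList, un3, un2])
theorem qonList_bin3 (c : Con S (.arr σ₁ (.arr σ₂ τ))) (A : Q Δ (.star (.arr .i (.star σ₁))))
    (B : Q Δ (.star (.arr .i (.star σ₂)))) :
    qonList (bin3 c A B) = bin2 c (qonList A) (qonList B) :=
  b2_injective (by simp [b2, qonList, onList, bin3, bin2])
theorem qonList_qat3 (B : Q Δ (.star (.arr .i (.star (.arr .i τ))))) (V : Q Δ (.star .i)) :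
    qonList (qat3 B V) = qat2 (qonList B) V :=
  b2_injective (by simp [b2, qonList, onList, qat3, qat2])

theorem qmoved_nul3 (c : Con S τ) : qmoved (nul3 c : Q Δ _) = nul2 c :=
  b2_injective (by simp [b2, qmoved, moved, nul3, nul2])
theorem qmoved_un3 (c : Con S (.arr σ τ)) (A : Q Δ (.star (.arr .i (.star σ)))) :
    qmoved (un3 c A) = un2 c (qmoved A) :=
  b2_injective (by simp [b2, qmoved, moved, un3, un2])
theorem qmoved_bin3 (c : Con S (.arr σ₁ (.arr σ₂ τ))) (A : Q Δ (.star (.arr .i (.star σ₁))))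
    (B : Q Δ (.star (.arr .i (.star σ₂)))) :
    qmoved (bin3 c A B) = bin2 c (qmoved A) (qmoved B) :=
  b2_injective (by simp [b2, qmoved, moved, bin3, bin2])
-- Moving an eigenvariable puts it at the front of the parameter list `l'`. Since `V` reads the old
-- parameters, it is shifted past the new one.
theorem qmoved_qat3 (B : Q Δ (.star (.arr .i (.star (.arr .i τ))))) (V : Q Δ (.star .i)) :
    qmoved (qat3 B V) = qat2 (qmoved B) (qshift V) :=
  b2_injective (by simp [b2, qmoved, moved, qat3, qat2, qshift])

theorem qskip_nul2 (c : Con S τ) : qskip (nul2 c : Q Δ _) = nul2 c :=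
  b2_injective (by simp [b2, qskip, nul2])
theorem qskip_un2 (c : Con S (.arr σ τ)) (A : Q Δ (.star (.star σ))) :
    qskip (un2 c A) = un2 c (qskip A) := b2_injective (by simp [b2, qskip, un2])
theorem qskip_bin2 (c : Con S (.arr σ₁ (.arr σ₂ τ))) (A : Q Δ (.star (.star σ₁)))
    (B : Q Δ (.star (.star σ₂))) : qskip (bin2 c A B) = bin2 c (qskip A) (qskip B) :=
  b2_injective (by simp [b2, qskip, bin2])
theorem qskip_qat2 (B : Q Δ (.star (.star (.arr .i τ)))) (V : Q Δ (.star .i)) :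
    qskip (qat2 B V) = qat2 (qskip B) V := b2_injective (by simp [b2, qskip, qat2])

theorem qput_nul3 (T : Q Δ (.star (.star .i))) (c : Con S τ) : qput T (nul3 c : Q Δ _) = nul2 c :=
  b2_injective (by simp [b2, qput, nul3, nul2])
theorem qput_un3 (T : Q Δ (.star (.star .i))) (c : Con S (.arr σ τ))
    (A : Q Δ (.star (.arr .i (.star σ)))) : qput T (un3 c A) = un2 c (qput T A) :=
  b2_injective (by simp [b2, qput, un3, un2])
theorem qput_bin3 (T : Q Δ (.star (.star .i))) (c : Con S (.arr σ₁ (.arr σ₂ τ)))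
    (A : Q Δ (.star (.arr .i (.star σ₁)))) (B : Q Δ (.star (.arr .i (.star σ₂)))) :
    qput T (bin3 c A B) = bin2 c (qput T A) (qput T B) :=
  b2_injective (by simp [b2, qput, bin3, bin2])
theorem qput_qat3 (T : Q Δ (.star (.star .i))) (B : Q Δ (.star (.arr .i (.star (.arr .i τ)))))
    (V : Q Δ (.star .i)) : qput T (qat3 B V) = qat2 (qput T B) V :=
  b2_injective (by simp [b2, qput, qat3, qat2])

/-! ### Injectivity and reflection of constructors -/

theorem qun_injective (hτ : τ.IsData) {c : Con S (.arr σ τ)} (hc : c.IsFree) {A A' : Q Δ (.star σ)}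
    (e : qun c A = qun c A') : A = A' := by
  have := congrArg b1 e
  rw [b1_qun, b1_qun] at this
  exact b1_injective (Q.con₁_injective hτ hc this)

theorem qbin_injective (hτ : τ.IsData) {c : Con S (.arr σ₁ (.arr σ₂ τ))} (hc : c.IsFree)
    {A A' : Q Δ (.star σ₁)} {B B' : Q Δ (.star σ₂)} (e : qbin c A B = qbin c A' B') :
    A = A' ∧ B = B' := by
  have := congrArg b1 e
  rw [b1_qbin, b1_qbin] at this
  exact (Q.con₂_injective hτ hc this).imp b1_injective b1_injective

theorem un2_injective (hτ : τ.IsData) {c : Con S (.arr σ τ)} (hc : c.IsFree)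
    {A A' : Q Δ (.star (.star σ))} (e : un2 c A = un2 c A') : A = A' := by
  have := congrArg b2 e
  rw [b2_un2, b2_un2] at this
  exact b2_injective (Q.con₁_injective hτ hc this)

theorem bin2_injective (hτ : τ.IsData) {c : Con S (.arr σ₁ (.arr σ₂ τ))} (hc : c.IsFree)
    {A A' : Q Δ (.star (.star σ₁))} {B B' : Q Δ (.star (.star σ₂))}
    (e : bin2 c A B = bin2 c A' B') : A = A' ∧ B = B' := by
  have := congrArg b2 e
  rw [b2_bin2, b2_bin2] at this
  exact (Q.con₂_injective hτ hc this).imp b2_injective b2_injective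

/-- On bodies, the operations on eigenvariables are just substitutions, so their injectivity reduces
to the existence of semantic left inverses. -/
def onListSub (Δ : Ctx S) : Sub S (.evs :: .i :: .evs :: Δ) (.evs :: .evs :: Δ) :=
  Sub.cons (rst v0) (Sub.cons (fst v0) (Sub.cons v1 fun _ x => .var (.succ (.succ x))))

def movedSub (Δ : Ctx S) : Sub S (.evs :: .i :: .evs :: Δ) (.evs :: .evs :: Δ) :=
  Sub.cons v0 (Sub.cons (fst v1) (Sub.cons (rst v1) fun _ x => .var (.succ (.succ x))))

def skipSub (Δ : Ctx S) : Sub S (.evs :: .evs :: Δ) (.evs :: .evs :: Δ) :=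
  Sub.cons (rst v0) fun _ x => .var (.succ x)

def constSub (Δ : Ctx S) : Sub S (.evs :: Δ) (.evs :: .evs :: Δ) :=
  Sub.cons v0 fun _ x => .var (.succ (.succ x))

/-- The list `l` is interpreted by the formal pair of the two variables for which $fst\,l$ and
$rst\,l$ were substituted. For `movedSub` the same is done with `l'`. -/
theorem isSplit_onListSub (Δ : Ctx S) : (onListSub Δ).IsSplit := by
  refine ⟨SEnv.cons (σ := .evs) (Sum.inr (.var (.succ .zero), .var .zero)) (SEnv.cons (σ := .evs)
    (Sum.inl (.var (.succ (.succ .zero)))) fun τ x => SEnv.id _ τ (.succ (.succ (.succ x)))), ?_⟩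
  rintro σ (_ | _ | _ | x) <;> rfl

theorem isSplit_movedSub (Δ : Ctx S) : (movedSub Δ).IsSplit := by
  refine ⟨SEnv.cons (σ := .evs) (Sum.inl (.var .zero)) (SEnv.cons (σ := .evs)
    (Sum.inr (.var (.succ .zero), .var (.succ (.succ .zero))))
      fun τ x => SEnv.id _ τ (.succ (.succ (.succ x)))), ?_⟩
  rintro σ (_ | _ | _ | x) <;> rfl

theorem isSplit_skipSub (Δ : Ctx S) : (skipSub Δ).IsSplit := by
  -- Only the second component of the pair matters. The first may be any term of type `i`, and `fst`
  -- of the variable at hand is one.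
  refine ⟨SEnv.cons (σ := .evs) (Sum.inr (.app (.con .fst) (.var .zero), .var .zero))
    fun τ x => SEnv.id _ τ (.succ x), ?_⟩
  rintro σ (_ | x) <;> rfl

theorem isSplit_constSub (Δ : Ctx S) : (constSub Δ).IsSplit := by
  -- The parameter on which the constant function does not depend gets an arbitrary value; the
  -- variable at hand serves again.
  refine ⟨SEnv.cons (σ := .evs) (Sum.inl (.var .zero)) (SEnv.cons (σ := .evs)
    (Sum.inl (.var .zero)) fun τ x => SEnv.id _ τ (.succ x)), ?_⟩
  rintro σ (_ | x) <;> rfl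

theorem b2_qonList (X : Q Δ (.star (.arr .i (.star τ)))) :
    b2 (qonList X) = (b3 X).map (onListSub Δ) := by
  simp [b2, b3, qonList, onList, Q.map_map]; rfl

theorem b2_qmoved (X : Q Δ (.star (.arr .i (.star τ)))) :
    b2 (qmoved X) = (b3 X).map (movedSub Δ) := by
  simp [b2, b3, qmoved, moved, Q.map_map]; rfl

theorem b2_qskip (X : Q Δ (.star (.star τ))) : b2 (qskip X) = (b2 X).map (skipSub Δ) := by
  simp [b2, qskip, Q.map_map]; rfl

theorem b2_qconst (X : Q Δ (.star τ)) : b2 (qconst X) = (b1 X).map (constSub Δ) := by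
  simp [b2, b1, qconst, Q.map_map]; rfl

theorem qonList_injective {X Y : Q Δ (.star (.arr .i (.star τ)))} (h : qonList X = qonList Y) :
    X = Y := by
  have := congrArg b2 h
  rw [b2_qonList, b2_qonList] at this
  exact b3_injective ((isSplit_onListSub Δ).injective this)

theorem qmoved_injective {X Y : Q Δ (.star (.arr .i (.star τ)))} (h : qmoved X = qmoved Y) :
    X = Y := by
  have := congrArg b2 h
  rw [b2_qmoved, b2_qmoved] at this
  exact b3_injective ((isSplit_movedSub Δ).injective this)

theorem qskip_injective {X Y : Q Δ (.star (.star τ))} (h : qskip X = qskip Y) : X = Y := by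
  have := congrArg b2 h
  rw [b2_qskip, b2_qskip] at this
  exact b2_injective ((isSplit_skipSub Δ).injective this)

theorem qconst_injective {X Y : Q Δ (.star τ)} (h : qconst X = qconst Y) : X = Y := by
  have := congrArg b2 h
  rw [b2_qconst, b2_qconst] at this
  exact b1_injective ((isSplit_constSub Δ).injective this)

theorem qonList_eq_nul2 (hτ : τ.IsData) {c : Con S τ} (hc : c.IsFree)
    {X : Q Δ (.star (.arr .i (.star τ)))}
    (h : qonList X = nul2 c) : X = nul3 c := by
  have := congrArg b2 h
  rw [b2_qonList, b2_nul2] at this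
  exact b3_injective (((isSplit_onListSub Δ).con₀ hτ hc this).trans (b3_nul3 c).symm)

theorem qmoved_eq_nul2 (hτ : τ.IsData) {c : Con S τ} (hc : c.IsFree)
    {X : Q Δ (.star (.arr .i (.star τ)))}
    (h : qmoved X = nul2 c) : X = nul3 c := by
  have := congrArg b2 h
  rw [b2_qmoved, b2_nul2] at this
  exact b3_injective (((isSplit_movedSub Δ).con₀ hτ hc this).trans (b3_nul3 c).symm)

theorem qskip_eq_nul2 (hτ : τ.IsData) {c : Con S τ} (hc : c.IsFree) {X : Q Δ (.star (.star τ))}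
    (h : qskip X = nul2 c) : X = nul2 c := by
  have := congrArg b2 h
  rw [b2_qskip, b2_nul2] at this
  exact b2_injective (((isSplit_skipSub Δ).con₀ hτ hc this).trans (b2_nul2 c).symm)

theorem qconst_eq_nul2 (hτ : τ.IsData) {c : Con S τ} (hc : c.IsFree) {X : Q Δ (.star τ)}
    (h : qconst X = nul2 c) : X = qnul c := by
  have := congrArg b2 h
  rw [b2_qconst, b2_nul2] at this
  exact b1_injective (((isSplit_constSub Δ).con₀ hτ hc this).trans (b1_qnul c).symm)

/-- Reflection of the constructor gives the shape of the body of `X`. Abstracting the argument gives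
`A₀`, and injectivity of the constructor identifies its image with `A`. The other inversions with
arguments follow the same pattern. -/
theorem qonList_eq_un2 (hτ : τ.IsData) {c : Con S (.arr σ τ)} (hc : c.IsFree)
    {X : Q Δ (.star (.arr .i (.star τ)))}
    {A : Q Δ (.star (.star σ))} (h : qonList X = un2 c A) :
    ∃ A₀, X = un3 c A₀ ∧ A = qonList A₀ := by
  have := congrArg b2 h
  rw [b2_qonList, b2_un2] at this
  obtain ⟨a, e⟩ := (isSplit_onListSub Δ).con₁ hτ hc this
  obtain rfl : X = un3 c a.lam.lam.lam := b3_injective (by rw [e, b3_un3, b3_lam])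
  exact ⟨_, rfl, (un2_injective hτ hc ((qonList_un3 _ _).symm.trans h)).symm⟩

theorem qmoved_eq_un2 (hτ : τ.IsData) {c : Con S (.arr σ τ)} (hc : c.IsFree)
    {X : Q Δ (.star (.arr .i (.star τ)))}
    {A : Q Δ (.star (.star σ))} (h : qmoved X = un2 c A) :
    ∃ A₀, X = un3 c A₀ ∧ A = qmoved A₀ := by
  have := congrArg b2 h
  rw [b2_qmoved, b2_un2] at this
  obtain ⟨a, e⟩ := (isSplit_movedSub Δ).con₁ hτ hc this
  obtain rfl : X = un3 c a.lam.lam.lam := b3_injective (by rw [e, b3_un3, b3_lam])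
  exact ⟨_, rfl, (un2_injective hτ hc ((qmoved_un3 _ _).symm.trans h)).symm⟩

theorem qskip_eq_un2 (hτ : τ.IsData) {c : Con S (.arr σ τ)} (hc : c.IsFree)
    {X : Q Δ (.star (.star τ))}
    {A : Q Δ (.star (.star σ))} (h : qskip X = un2 c A) : ∃ A₀, X = un2 c A₀ ∧ A = qskip A₀ := by
  have := congrArg b2 h
  rw [b2_qskip, b2_un2] at this
  obtain ⟨a, e⟩ := (isSplit_skipSub Δ).con₁ hτ hc this
  obtain rfl : X = un2 c a.lam.lam := b2_injective (by rw [e, b2_un2, b2_lam])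
  exact ⟨_, rfl, (un2_injective hτ hc ((qskip_un2 _ _).symm.trans h)).symm⟩

theorem qconst_eq_un2 (hτ : τ.IsData) {c : Con S (.arr σ τ)} (hc : c.IsFree) {X : Q Δ (.star τ)}
    {A : Q Δ (.star (.star σ))} (h : qconst X = un2 c A) : ∃ A₀, X = qun c A₀ ∧ A = qconst A₀ := by
  have := congrArg b2 h
  rw [b2_qconst, b2_un2] at this
  obtain ⟨a, e⟩ := (isSplit_constSub Δ).con₁ hτ hc this
  obtain rfl : X = qun c a.lam := b1_injective (by rw [e, b1_qun, b1_lam])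
  exact ⟨_, rfl, (un2_injective hτ hc ((qconst_qun _ _).symm.trans h)).symm⟩

theorem qonList_eq_bin2 (hτ : τ.IsData) {c : Con S (.arr σ₁ (.arr σ₂ τ))} (hc : c.IsFree)
    {X : Q Δ (.star (.arr .i (.star τ)))} {A : Q Δ (.star (.star σ₁))} {B : Q Δ (.star (.star σ₂))}
    (h : qonList X = bin2 c A B) : ∃ A₀ B₀, X = bin3 c A₀ B₀ ∧ A = qonList A₀ ∧ B = qonList B₀ := by
  have := congrArg b2 h
  rw [b2_qonList, b2_bin2] at this
  obtain ⟨a, b, e⟩ := (isSplit_onListSub Δ).con₂ hτ hc this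
  obtain rfl : X = bin3 c a.lam.lam.lam b.lam.lam.lam :=
    b3_injective (by rw [e, b3_bin3, b3_lam, b3_lam])
  obtain ⟨h₁, h₂⟩ := bin2_injective hτ hc ((qonList_bin3 _ _ _).symm.trans h)
  exact ⟨_, _, rfl, h₁.symm, h₂.symm⟩

theorem qmoved_eq_bin2 (hτ : τ.IsData) {c : Con S (.arr σ₁ (.arr σ₂ τ))} (hc : c.IsFree)
    {X : Q Δ (.star (.arr .i (.star τ)))} {A : Q Δ (.star (.star σ₁))} {B : Q Δ (.star (.star σ₂))}
    (h : qmoved X = bin2 c A B) : ∃ A₀ B₀, X = bin3 c A₀ B₀ ∧ A = qmoved A₀ ∧ B = qmoved B₀ := by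
  have := congrArg b2 h
  rw [b2_qmoved, b2_bin2] at this
  obtain ⟨a, b, e⟩ := (isSplit_movedSub Δ).con₂ hτ hc this
  obtain rfl : X = bin3 c a.lam.lam.lam b.lam.lam.lam :=
    b3_injective (by rw [e, b3_bin3, b3_lam, b3_lam])
  obtain ⟨h₁, h₂⟩ := bin2_injective hτ hc ((qmoved_bin3 _ _ _).symm.trans h)
  exact ⟨_, _, rfl, h₁.symm, h₂.symm⟩

theorem qskip_eq_bin2 (hτ : τ.IsData) {c : Con S (.arr σ₁ (.arr σ₂ τ))} (hc : c.IsFree)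
    {X : Q Δ (.star (.star τ))} {A : Q Δ (.star (.star σ₁))} {B : Q Δ (.star (.star σ₂))}
    (h : qskip X = bin2 c A B) : ∃ A₀ B₀, X = bin2 c A₀ B₀ ∧ A = qskip A₀ ∧ B = qskip B₀ := by
  have := congrArg b2 h
  rw [b2_qskip, b2_bin2] at this
  obtain ⟨a, b, e⟩ := (isSplit_skipSub Δ).con₂ hτ hc this
  obtain rfl : X = bin2 c a.lam.lam b.lam.lam :=
    b2_injective (by rw [e, b2_bin2, b2_lam, b2_lam])
  obtain ⟨h₁, h₂⟩ := bin2_injective hτ hc ((qskip_bin2 _ _ _).symm.trans h)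
  exact ⟨_, _, rfl, h₁.symm, h₂.symm⟩

theorem qconst_eq_bin2 (hτ : τ.IsData) {c : Con S (.arr σ₁ (.arr σ₂ τ))} (hc : c.IsFree)
    {X : Q Δ (.star τ)} {A : Q Δ (.star (.star σ₁))} {B : Q Δ (.star (.star σ₂))}
    (h : qconst X = bin2 c A B) : ∃ A₀ B₀, X = qbin c A₀ B₀ ∧ A = qconst A₀ ∧ B = qconst B₀ := by
  have := congrArg b2 h
  rw [b2_qconst, b2_bin2] at this
  obtain ⟨a, b, e⟩ := (isSplit_constSub Δ).con₂ hτ hc this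
  obtain rfl : X = qbin c a.lam b.lam := b1_injective (by rw [e, b1_qbin, b1_lam, b1_lam])
  obtain ⟨h₁, h₂⟩ := bin2_injective hτ hc ((qconst_qbin _ _ _).symm.trans h)
  exact ⟨_, _, rfl, h₁.symm, h₂.symm⟩

end ops

end FOLDN

namespace FOLDN

variable {S : Sig}

/-! ### The constructors of the object logic -/

section

variable {Δ Ξ Φ : Ctx S}

noncomputable section

/-- `nil`, `::` and the connectives, pointwise. -/
def qanil : Q Δ (.star .atmlst) := qnul (τ := .atmlst) (.nil .atm)
def qacons (A : Q Δ (.star .atm)) (L : Q Δ (.star .atmlst)) : Q Δ (.star .atmlst) :=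
  qbin (σ₁ := .atm) (σ₂ := .atmlst) (τ := .atmlst) (.cons .atm) A L
def qpnil : Q Δ (.star .prplst) := qnul (τ := .prplst) (.nil .prp)
def qpcons (A : Q Δ (.star .prp)) (L : Q Δ (.star .prplst)) : Q Δ (.star .prplst) :=
  qbin (σ₁ := .prp) (σ₂ := .prplst) (τ := .prplst) (.cons .prp) A L
def qatom (A : Q Δ (.star .atm)) : Q Δ (.star .prp) := qun .atom A
def qtt : Q Δ (.star .prp) := qnul .tt
def qwith (A B : Q Δ (.star .prp)) : Q Δ (.star .prp) := qbin .wth A B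
def qlimp (A : Q Δ (.star .atm)) (B : Q Δ (.star .prp)) : Q Δ (.star .prp) := qbin .limp A B
def qiimp (A : Q Δ (.star .atm)) (B : Q Δ (.star .prp)) : Q Δ (.star .prp) := qbin .iimp A B
def qbig (B : Q Δ (.star (.arr .i .prp))) : Q Δ (.star .prp) := qun .bigwedge B

end

@[simp] theorem map_qanil (ρ : Sub S Δ Ξ) : (qanil : Q Δ _).map ρ = qanil := map_qnul ρ _
@[simp] theorem map_qacons (ρ : Sub S Δ Ξ) (A : Q Δ (.star .atm)) (L : Q Δ (.star .atmlst)) :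
    (qacons A L).map ρ = qacons (A.map ρ) (L.map ρ) := map_qbin ρ _ _ _
@[simp] theorem map_qpnil (ρ : Sub S Δ Ξ) : (qpnil : Q Δ _).map ρ = qpnil := map_qnul ρ _
@[simp] theorem map_qpcons (ρ : Sub S Δ Ξ) (A : Q Δ (.star .prp)) (L : Q Δ (.star .prplst)) :
    (qpcons A L).map ρ = qpcons (A.map ρ) (L.map ρ) := map_qbin ρ _ _ _
@[simp] theorem map_qatom (ρ : Sub S Δ Ξ) (A : Q Δ (.star .atm)) :
    (qatom A).map ρ = qatom (A.map ρ) := map_qun ρ _ _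
@[simp] theorem map_qtt (ρ : Sub S Δ Ξ) : (qtt : Q Δ _).map ρ = qtt := map_qnul ρ _
@[simp] theorem map_qwith (ρ : Sub S Δ Ξ) (A B : Q Δ (.star .prp)) :
    (qwith A B).map ρ = qwith (A.map ρ) (B.map ρ) := map_qbin ρ _ _ _
@[simp] theorem map_qlimp (ρ : Sub S Δ Ξ) (A : Q Δ (.star .atm)) (B : Q Δ (.star .prp)) :
    (qlimp A B).map ρ = qlimp (A.map ρ) (B.map ρ) := map_qbin ρ _ _ _
@[simp] theorem map_qiimp (ρ : Sub S Δ Ξ) (A : Q Δ (.star .atm)) (B : Q Δ (.star .prp)) :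
    (qiimp A B).map ρ = qiimp (A.map ρ) (B.map ρ) := map_qbin ρ _ _ _
@[simp] theorem map_qbig (ρ : Sub S Δ Ξ) (B : Q Δ (.star (.arr .i .prp))) :
    (qbig B).map ρ = qbig (B.map ρ) := map_qun ρ _ _

theorem eval_lam_con {τ : Ty S.Base} (c : Con S τ) (xs : Env Δ Φ) :
    (Tm.lam (.con c) : Tm S Φ (.star τ)).eval xs = qnul c := b1_injective (by simp [b1, qnul])

theorem eval_lam_con_app {σ τ : Ty S.Base} (c : Con S (.arr σ τ)) (s : Tm S Φ (.star σ))
    (xs : Env Δ Φ) : (Tm.lam (.con c ⬝ₘ (s.wk ⬝ₘ v0)) : Tm S Φ (.star τ)).eval xs =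
      qun c (s.eval xs) := b1_injective (by simp [b1, qun])

theorem eval_lam_con_app_app {σ₁ σ₂ τ : Ty S.Base} (c : Con S (.arr σ₁ (.arr σ₂ τ)))
    (s : Tm S Φ (.star σ₁)) (t : Tm S Φ (.star σ₂)) (xs : Env Δ Φ) :
    (Tm.lam (.con c ⬝ₘ (s.wk ⬝ₘ v0) ⬝ₘ (t.wk ⬝ₘ v0)) : Tm S Φ (.star τ)).eval xs =
      qbin c (s.eval xs) (t.eval xs) := b1_injective (by simp [b1, qbin])

variable (xs : Env Δ Φ)

@[simp] theorem eval_anil : (anil : Tm S Φ _).eval xs = qanil :=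
  eval_lam_con (τ := .atmlst) (.nil .atm) xs
@[simp] theorem eval_acons (s : Tm S Φ (.star .atm)) (t : Tm S Φ (.star .atmlst)) :
    (acons s t).eval xs = qacons (s.eval xs) (t.eval xs) :=
  eval_lam_con_app_app (σ₁ := .atm) (σ₂ := .atmlst) (τ := .atmlst) (.cons .atm) s t xs
@[simp] theorem eval_pnil : (pnil : Tm S Φ _).eval xs = qpnil :=
  eval_lam_con (τ := .prplst) (.nil .prp) xs
@[simp] theorem eval_pcons (s : Tm S Φ (.star .prp)) (t : Tm S Φ (.star .prplst)) :
    (pcons s t).eval xs = qpcons (s.eval xs) (t.eval xs) :=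
  eval_lam_con_app_app (σ₁ := .prp) (σ₂ := .prplst) (τ := .prplst) (.cons .prp) s t xs
@[simp] theorem eval_atomS (s : Tm S Φ (.star .atm)) :
    (atomS s).eval xs = qatom (s.eval xs) := eval_lam_con_app _ _ _
@[simp] theorem eval_ttS : (ttS : Tm S Φ _).eval xs = qtt := eval_lam_con _ _
@[simp] theorem eval_withS (s t : Tm S Φ (.star .prp)) :
    (withS s t).eval xs = qwith (s.eval xs) (t.eval xs) := eval_lam_con_app_app _ _ _ _
@[simp] theorem eval_limpS (s : Tm S Φ (.star .atm)) (t : Tm S Φ (.star .prp)) :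
    (limpS s t).eval xs = qlimp (s.eval xs) (t.eval xs) := eval_lam_con_app_app _ _ _ _
@[simp] theorem eval_iimpS (s : Tm S Φ (.star .atm)) (t : Tm S Φ (.star .prp)) :
    (iimpS s t).eval xs = qiimp (s.eval xs) (t.eval xs) := eval_lam_con_app_app _ _ _ _
@[simp] theorem eval_shift {τ : Ty S.Base} (s : Tm S Φ (.star τ)) :
    (shift s).eval xs = qshift (s.eval xs) := b1_injective (by simp [b1, shift, qshift])
@[simp] theorem eval_onList {τ : Ty S.Base} (s : Tm S Φ (.star (.arr .i (.star τ)))) :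
    (onList s).eval xs = qonList (s.eval xs) := b2_injective (by simp [b2, onList, qonList])
@[simp] theorem eval_moved {τ : Ty S.Base} (s : Tm S Φ (.star (.arr .i (.star τ)))) :
    (moved s).eval xs = qmoved (s.eval xs) := b2_injective (by simp [b2, moved, qmoved])

@[simp] theorem eval_bigwedgeS (s : Tm S Φ (.star (.arr .i .prp))) :
    (bigwedgeS s).eval xs = qbig (s.eval xs) := by
  refine b1_injective ?_
  simp only [b1, bigwedgeS, qbig, qun, Tm.map_eval, Tm.app_eval_lam, Tm.eval_app, Tm.eval_con]
  congr 1
  -- The argument of $\bigwedge$ is written $\eta$-expanded in the object variable.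
  refine Q.funext ?_
  simp [Q.map_wk_var]

/-! ### Disjointness -/

/-- A numbering of the constants. -/
def Con.code {τ : Ty S.Base} : Con S τ → ℕ
  | .zero => 0
  | .succ => 1
  | .nil _ => 2
  | .cons _ => 3
  | .atom => 4
  | .tt => 5
  | .wth => 6
  | .limp => 7
  | .iimp => 8
  | .bigwedge => 9
  | .fst => 10
  | .fstFun => 11
  | .rst => 12
  | .other _ => 13

def Spine.code {τ : Ty S.Base} : Spine Δ τ → ℕ
  | .con c => c.code
  | .app s _ => s.code

/-- The number of the constant at the head. -/
def Q.code {τ : Ty S.Base} (q : Q Δ τ) : Option ℕ := q.spine.map Spine.code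

theorem qz_ne_qs {n : Q Δ .nt} (h : qz = qs n) : False := by
  have := congrArg Q.code h
  rw [Q.code, Q.code, qz, qs, Q.spine_con₀ (fun _ _ => rfl) (fun _ => rfl),
    Q.spine_con₁ (fun _ _ => rfl) (fun _ => rfl)] at this
  -- The numbers of `zero` and `succ` in `Con.code`.
  exact absurd (show (0 : ℕ) = 1 from Option.some.inj this) (by decide)

theorem qs_injective {m n : Q Δ .nt} (h : qs m = qs n) : m = n :=
  Q.con₁_injective (fun _ _ => rfl) (fun _ => rfl) h

/-- The number of the constant at the head of the body. -/
def Q.head {τ : Ty S.Base} (X : Q Δ (.star τ)) : Option ℕ := (b1 X).code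

theorem Q.head_qnul {τ : Ty S.Base} (hτ : τ.IsData) {c : Con S τ} (hc : c.IsFree) :
    (qnul c : Q Δ _).head = some c.code := by
  rw [Q.head, Q.code, b1_qnul, Q.spine_con₀ hτ hc]; rfl

theorem Q.head_qun {σ τ : Ty S.Base} (hτ : τ.IsData) {c : Con S (.arr σ τ)} (hc : c.IsFree)
    (A : Q Δ (.star σ)) : (qun c A).head = some c.code := by
  rw [Q.head, Q.code, b1_qun, Q.spine_con₁ hτ hc]; rfl

theorem Q.head_qbin {σ₁ σ₂ τ : Ty S.Base} (hτ : τ.IsData) {c : Con S (.arr σ₁ (.arr σ₂ τ))}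
    (hc : c.IsFree) (A : Q Δ (.star σ₁)) (B : Q Δ (.star σ₂)) :
    (qbin c A B).head = some c.code := by
  rw [Q.head, Q.code, b1_qbin, Q.spine_con₂ hτ hc]; rfl

@[simp] theorem head_qanil : (qanil : Q Δ _).head = some 2 :=
  Q.head_qnul (τ := .atmlst) (fun _ _ => rfl) (fun _ => rfl)
@[simp] theorem head_qacons (A : Q Δ (.star .atm)) (L : Q Δ (.star .atmlst)) :
    (qacons A L).head = some 3 :=
  Q.head_qbin (σ₁ := .atm) (σ₂ := .atmlst) (τ := .atmlst) (fun _ _ => rfl) (fun _ => rfl) A L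
@[simp] theorem head_qpnil : (qpnil : Q Δ _).head = some 2 :=
  Q.head_qnul (τ := .prplst) (fun _ _ => rfl) (fun _ => rfl)
@[simp] theorem head_qpcons (A : Q Δ (.star .prp)) (L : Q Δ (.star .prplst)) :
    (qpcons A L).head = some 3 :=
  Q.head_qbin (σ₁ := .prp) (σ₂ := .prplst) (τ := .prplst) (fun _ _ => rfl) (fun _ => rfl) A L
@[simp] theorem head_qatom (A : Q Δ (.star .atm)) : (qatom A).head = some 4 :=
  Q.head_qun (fun _ _ => rfl) (fun _ => rfl) A
@[simp] theorem head_qtt : (qtt : Q Δ _).head = some 5 :=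
  Q.head_qnul (fun _ _ => rfl) (fun _ => rfl)
@[simp] theorem head_qwith (A B : Q Δ (.star .prp)) : (qwith A B).head = some 6 :=
  Q.head_qbin (fun _ _ => rfl) (fun _ => rfl) A B
@[simp] theorem head_qlimp (A : Q Δ (.star .atm)) (B : Q Δ (.star .prp)) :
    (qlimp A B).head = some 7 := Q.head_qbin (fun _ _ => rfl) (fun _ => rfl) A B
@[simp] theorem head_qiimp (A : Q Δ (.star .atm)) (B : Q Δ (.star .prp)) :
    (qiimp A B).head = some 8 := Q.head_qbin (fun _ _ => rfl) (fun _ => rfl) A B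
@[simp] theorem head_qbig (B : Q Δ (.star (.arr .i .prp))) : (qbig B).head = some 9 :=
  Q.head_qun (fun _ _ => rfl) (fun _ => rfl) B

theorem qanil_ne_qacons {A : Q Δ (.star .atm)} {L : Q Δ (.star .atmlst)}
    (h : qanil = qacons A L) : False := by simpa using congrArg Q.head h

theorem qpnil_ne_qpcons {A : Q Δ (.star .prp)} {L : Q Δ (.star .prplst)}
    (h : qpnil = qpcons A L) : False := by simpa using congrArg Q.head h

theorem qacons_injective {A A' : Q Δ (.star .atm)} {L L' : Q Δ (.star .atmlst)}
    (h : qacons A L = qacons A' L') : A = A' ∧ L = L' :=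
  qbin_injective (σ₁ := .atm) (σ₂ := .atmlst) (τ := .atmlst) (fun _ _ => rfl) (fun _ => rfl) h

theorem qpcons_injective {A A' : Q Δ (.star .prp)} {L L' : Q Δ (.star .prplst)}
    (h : qpcons A L = qpcons A' L') : A = A' ∧ L = L' :=
  qbin_injective (σ₁ := .prp) (σ₂ := .prplst) (τ := .prplst) (fun _ _ => rfl) (fun _ => rfl) h

theorem qbig_injective {B B' : Q Δ (.star (.arr .i .prp))} (h : qbig B = qbig B') : B = B' :=
  qun_injective (fun _ _ => rfl) (fun _ => rfl) h

/-! ### Shifts -/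

theorem qshift_qanil : qshift (qanil : Q Δ _) = qanil := qshift_qnul _
theorem qshift_qacons (A : Q Δ (.star .atm)) (L : Q Δ (.star .atmlst)) :
    qshift (qacons A L) = qacons (qshift A) (qshift L) := qshift_qbin _ _ _
theorem qshift_qatom (A : Q Δ (.star .atm)) : qshift (qatom A) = qatom (qshift A) := qshift_qun _ _

end

end FOLDN

/-! ### The clauses as introduction rules and as case analyses -/

namespace FOLDN

variable {S : Sig}

/-! ### Definitions that contain the clauses of linear logic -/

/-- The clauses of linear logic are in `D`, and `D` has no others for the predicates they define. -/
class LinDef (D : Set (Clause S)) : Prop where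
  mem : ∀ c ∈ linearLogicClauses S, c ∈ D
  only : ∀ c ∈ D, (∃ c₀ ∈ linearLogicClauses S,
    (⟨c₀.arity, c₀.head⟩ : Σ τs, Pred S τs) = ⟨c.arity, c.head⟩) → c ∈ linearLogicClauses S

def Elem.code : Elem → ℕ
  | .atm => 0
  | .prp => 1

def ETy.code : ETy → ℕ
  | .atm => 0
  | .prp => 1
  | .atmlst => 2
  | .prplst => 3

/-- A numbering of the predicates. -/
def Pred.tag {τs : Ctx S} : Pred S τs → ℕ
  | .eq => 0
  | .lt => 1
  | .le => 2
  | .sum => 3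
  | .prog => 4
  | .seq => 5
  | .splitSeq => 6
  | .other _ => 7
  | .length e n => 10 * (e.code + 2 * n) + 10
  | .list e n => 10 * (e.code + 2 * n) + 11
  | .element e n => 10 * (e.code + 2 * n) + 12
  | .split e n => 10 * (e.code + 2 * n) + 13
  | .permute e n => 10 * (e.code + 2 * n) + 14
  | .subst e => 10 * e.code + 15
  | .subst₀ e => 10 * e.code + 16
  | .extend e => 10 * e.code + 17
  | .extend₀ e => 10 * e.code + 18

/-- The clauses of linear logic for the predicate with a given number. -/
def clausesFor (S : Sig) (k : ℕ) : List (Clause S) :=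
  (linearLogicClauses S).filter fun c => c.head.tag == k

section

variable {D : Set (Clause S)} [LinDef D] {w w' : World D} {Φ : Ctx S}

theorem At.of_clause {k : ℕ} {L : List (Clause S)} (hL : clausesFor S k = L) {c : Clause S}
    (hc : List.Mem c L) (xs : Env w.ctx c.ctx) (h : Holds w c.body xs) :
    At w c.head (c.args.eval xs) :=
  At.intro (LinDef.mem _ (List.mem_of_mem_filter (hL ▸ hc : c ∈ clausesFor S k))) xs h

/-- As `D` has no further clauses for the predicates that linear logic defines, the analysis ranges
over a known finite list, whatever `D` contains for other predicates. -/
theorem At.cases_of {τs : Ctx S} {p : Pred S τs} {us : Env w.ctx τs} (h : At w p us)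
    {L : List (Clause S)} (hL : clausesFor S p.tag = L)
    (hp : ∃ c ∈ L, (⟨c.arity, c.head⟩ : Σ τs, Pred S τs) = ⟨τs, p⟩) :
    J w (fun w' ρ => ∃ (Φ : Ctx S) (ts : Args S Φ τs) (B : Fm S Φ) (xs : Env w'.ctx Φ),
      (⟨Φ, p, ts, B⟩ : Clause S) ∈ L ∧ us.map ρ.sub = ts.eval xs ∧ Holds w' B xs) := by
  subst hL
  refine h.cases.imp ?_
  rintro w' ρ ⟨Φ, ts, B, xs, hc, e, hB⟩
  refine ⟨Φ, ts, B, xs, List.mem_filter.2 ⟨LinDef.only _ hc ?_, by simp⟩, e, hB⟩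
  obtain ⟨c, hc, e⟩ := hp
  exact ⟨c, List.mem_of_mem_filter hc, e⟩

end

section

variable {D : Set (Clause S)} {w w' : World D} {Φ : Ctx S}

/-! ### Sums -/

/-- The filter is evaluated by computation on the numbers `Pred.tag`; here 3 is that of `sum`. -/
theorem clauses_sum : clausesFor S 3 =
    [⟨[.nt], .sum, zr ;; v0 ;; v0 ;; .nil, .nat v0⟩,
      ⟨[.nt, .nt, .nt], .sum, suc v0 ;; v1 ;; suc v2 ;; .nil, fSum v0 v1 v2⟩] := rfl

def Sum (w : World D) (i j k : Q w.ctx .nt) : Prop :=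
  At w .sum (i ∷ j ∷ k ∷ .nil)

@[simp] theorem holds_sum {i j k : Tm S Φ .nt} {xs : Env w.ctx Φ} :
    Holds w (fSum i j k) xs ↔
      Sum w (i.eval xs) (j.eval xs) (k.eval xs) := holds_pred

theorem Sum.mono {i j k : Q w.ctx .nt}
    (h : Sum w i j k) (ρ : Hom w w') :
    Sum w' (i ↾ ρ) (j ↾ ρ) (k ↾ ρ) := At.mono h ρ

theorem J.sum {R : ∀ w' : World D, Hom w w' → Prop} (h : J w R) {i j k : Q w.ctx .nt}
    (c : ∀ (w' : World D) (ρ : Hom w w'), R w' ρ →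
      Sum w' (i ↾ ρ) (j ↾ ρ) (k ↾ ρ)) :
    Sum w i j k := J.at h c

/-- The ways to derive `sum i j k`. -/
inductive SumCase (w : World D) : (i j k : Q w.ctx .nt) → Prop
  | zero {j} : Nt w j → SumCase w qz j j
  | succ {i j k} : Sum w i j k → SumCase w (qs i) j (qs k)

theorem SumCase.intro [LinDef D] {i j k : Q w.ctx .nt} (h : SumCase w i j k) : Sum w i j k := by
  match i, j, k, h with
  | _, j, _, .zero h =>
    simpa [Sum] using At.of_clause (w := w) clauses_sum (.head _) (j ∷ .nil) (by simpa using h)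
  | _, j, _, .succ (i := i) (k := k) h =>
    simpa [Sum] using At.of_clause (w := w) clauses_sum (.tail _ (.head _)) (i ∷ j ∷ k ∷ .nil)
      (by simpa using h)

theorem Sum.cases [LinDef D] {i j k : Q w.ctx .nt} (h : Sum w i j k) :
    J w (fun w' ρ => SumCase w' (i ↾ ρ) (j ↾ ρ) (k ↾ ρ)) := by
  refine J.imp (At.cases_of h clauses_sum ⟨_, .head _, rfl⟩) ?_
  rintro w' ρ ⟨Φ, ts, B, xs, hc, e, hB⟩
  simp only [List.mem_cons, List.not_mem_nil, or_false] at hc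
  rcases hc with hc | hc <;> cases hc
  · rcases xs with _ | ⟨i, _ | _⟩
    simp at e hB
    rw [e.1, e.2.1, e.2.2]
    exact .zero hB
  · rcases xs with _ | ⟨i, _ | ⟨j, _ | ⟨k, _ | _⟩⟩⟩
    simp at e hB
    rw [e.1, e.2.1, e.2.2]
    exact .succ hB

/-! ### Lists -/

/-- The same predicate, with its argument types displayed in the form $\tau^*$ in place of
`Ty.stars`; likewise for the other list predicates below. -/
def Pred.lengthA : Pred S [.star .atmlst, .nt] := .length .atm 1

def Pred.listA : Pred S [.star .atmlst] := .list .atm 1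

theorem clauses_lengthA : clausesFor S 30 =
    [⟨[], .lengthA, anil ;; zr ;; .nil, .top⟩,
      ⟨[.star .atm, .star .atmlst, .nt], .lengthA, acons v0 v1 ;; suc v2 ;; .nil,
        fLength .atm 1 v1 v2⟩] := rfl

theorem clauses_listA : clausesFor S 31 =
    [⟨[.star .atmlst], .listA, v0 ;; .nil, .ex .nt (.nat v0 ⊓ₘ fLength .atm 1 v1 v0)⟩] := rfl

def LengthA (w : World D) (l : Q w.ctx (.star .atmlst)) (n : Q w.ctx .nt) : Prop :=
  At w .lengthA (l ∷ n ∷ .nil)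

@[simp] theorem holds_lengthA {l : Tm S Φ (.star .atmlst)} {n : Tm S Φ .nt} {xs : Env w.ctx Φ} :
    Holds w (fLength .atm 1 l n) xs ↔
      LengthA w (l.eval xs) (n.eval xs) := holds_pred

theorem LengthA.mono {l : Q w.ctx (.star .atmlst)} {n : Q w.ctx .nt}
    (h : LengthA w l n) (ρ : Hom w w') :
    LengthA w' (l ↾ ρ) (n ↾ ρ) := At.mono h ρ

def ListA (w : World D) (l : Q w.ctx (.star .atmlst)) : Prop :=
  At w .listA (l ∷ .nil)

@[simp] theorem holds_listA {l : Tm S Φ (.star .atmlst)} {xs : Env w.ctx Φ} :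
    Holds w (fList .atm 1 l) xs ↔
      ListA w (l.eval xs) := holds_pred

theorem ListA.mono {l : Q w.ctx (.star .atmlst)}
    (h : ListA w l) (ρ : Hom w w') :
    ListA w' (l ↾ ρ) := At.mono h ρ

theorem J.listA {R : ∀ w' : World D, Hom w w' → Prop} (h : J w R) {l : Q w.ctx (.star .atmlst)}
    (c : ∀ (w' : World D) (ρ : Hom w w'), R w' ρ →
      ListA w' (l ↾ ρ)) :
    ListA w l := J.at h c

/-- The ways to derive `length l n`. -/
inductive LengthACase (w : World D) : (l : Q w.ctx (.star .atmlst)) → (n : Q w.ctx .nt) → Prop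
  | nil : LengthACase w qanil qz
  | cons {a l n} : LengthA w l n → LengthACase w (qacons a l) (qs n)

theorem LengthACase.intro [LinDef D] {l : Q w.ctx (.star .atmlst)} {n : Q w.ctx .nt}
    (h : LengthACase w l n) : LengthA w l n := by
  cases h with
  | nil => simpa [LengthA] using At.of_clause (w := w) clauses_lengthA (.head _) .nil (by simp)
  | @cons a l n h =>
    simpa [LengthA] using At.of_clause (w := w) clauses_lengthA (.tail _ (.head _))
      (a ∷ l ∷ n ∷ .nil) (by simpa using h)

theorem LengthA.cases [LinDef D] {l : Q w.ctx (.star .atmlst)} {n : Q w.ctx .nt}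
    (h : LengthA w l n) : J w (fun w' ρ => LengthACase w' (l ↾ ρ) (n ↾ ρ)) := by
  refine J.imp (At.cases_of h clauses_lengthA ⟨_, .head _, rfl⟩) ?_
  rintro w' ρ ⟨Φ, ts, B, xs, hc, e, hB⟩
  simp only [List.mem_cons, List.not_mem_nil, or_false] at hc
  rcases hc with hc | hc <;> cases hc
  · simp at e
    rw [e.1, e.2]
    exact .nil
  · rcases xs with _ | ⟨a, _ | ⟨l, _ | ⟨n, _ | _⟩⟩⟩
    simp at e hB
    rw [e.1, e.2]
    exact .cons hB

theorem LengthA.list [LinDef D] {l : Q w.ctx (.star .atmlst)} {n : Q w.ctx .nt}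
    (h : LengthA w l n) (hn : Nt w n) : ListA w l := by
  simpa [ListA] using At.of_clause (w := w) clauses_listA (.head _) (l ∷ .nil)
    (holds_ex.2 (.pure ⟨n, by simpa using ⟨hn, h⟩⟩))

theorem ListA.length [LinDef D] {l : Q w.ctx (.star .atmlst)} (h : ListA w l) :
    J w (fun w' ρ => ∃ n, Nt w' n ∧ LengthA w' (l ↾ ρ) n) := by
  refine J.bind (At.cases_of h clauses_listA ⟨_, .head _, rfl⟩) ?_
  rintro w' ρ ⟨Φ, ts, B, xs, hc, e, hB⟩
  simp only [List.mem_cons, List.not_mem_nil, or_false] at hc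
  cases hc
  rcases xs with _ | ⟨l, _ | _⟩
  simp at e
  refine (holds_ex.1 hB).imp ?_
  rintro w'' ρ' ⟨n, hn⟩
  exact ⟨n, by simpa [e] using hn⟩

def Pred.lengthP : Pred S [.star .prplst, .nt] := .length .prp 1

def Pred.listP : Pred S [.star .prplst] := .list .prp 1

theorem clauses_lengthP : clausesFor S 40 =
    [⟨[], .lengthP, pnil ;; zr ;; .nil, .top⟩,
      ⟨[.star .prp, .star .prplst, .nt], .lengthP, pcons v0 v1 ;; suc v2 ;; .nil,
        fLength .prp 1 v1 v2⟩] := rfl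

theorem clauses_listP : clausesFor S 41 =
    [⟨[.star .prplst], .listP, v0 ;; .nil, .ex .nt (.nat v0 ⊓ₘ fLength .prp 1 v1 v0)⟩] := rfl

def LengthP (w : World D) (l : Q w.ctx (.star .prplst)) (n : Q w.ctx .nt) : Prop :=
  At w .lengthP (l ∷ n ∷ .nil)

@[simp] theorem holds_lengthP {l : Tm S Φ (.star .prplst)} {n : Tm S Φ .nt} {xs : Env w.ctx Φ} :
    Holds w (fLength .prp 1 l n) xs ↔
      LengthP w (l.eval xs) (n.eval xs) := holds_pred

theorem LengthP.mono {l : Q w.ctx (.star .prplst)} {n : Q w.ctx .nt}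
    (h : LengthP w l n) (ρ : Hom w w') :
    LengthP w' (l ↾ ρ) (n ↾ ρ) := At.mono h ρ

def ListP (w : World D) (l : Q w.ctx (.star .prplst)) : Prop :=
  At w .listP (l ∷ .nil)

@[simp] theorem holds_listP {l : Tm S Φ (.star .prplst)} {xs : Env w.ctx Φ} :
    Holds w (fList .prp 1 l) xs ↔
      ListP w (l.eval xs) := holds_pred

theorem ListP.mono {l : Q w.ctx (.star .prplst)}
    (h : ListP w l) (ρ : Hom w w') :
    ListP w' (l ↾ ρ) := At.mono h ρ

theorem J.listP {R : ∀ w' : World D, Hom w w' → Prop} (h : J w R) {l : Q w.ctx (.star .prplst)}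
    (c : ∀ (w' : World D) (ρ : Hom w w'), R w' ρ →
      ListP w' (l ↾ ρ)) :
    ListP w l := J.at h c

/-- The ways to derive `length l n`. -/
inductive LengthPCase (w : World D) : (l : Q w.ctx (.star .prplst)) → (n : Q w.ctx .nt) → Prop
  | nil : LengthPCase w qpnil qz
  | cons {a l n} : LengthP w l n → LengthPCase w (qpcons a l) (qs n)

theorem LengthPCase.intro [LinDef D] {l : Q w.ctx (.star .prplst)} {n : Q w.ctx .nt}
    (h : LengthPCase w l n) : LengthP w l n := by
  cases h with
  | nil => simpa [LengthP] using At.of_clause (w := w) clauses_lengthP (.head _) .nil (by simp)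
  | @cons a l n h =>
    simpa [LengthP] using At.of_clause (w := w) clauses_lengthP (.tail _ (.head _))
      (a ∷ l ∷ n ∷ .nil) (by simpa using h)

theorem LengthP.cases [LinDef D] {l : Q w.ctx (.star .prplst)} {n : Q w.ctx .nt}
    (h : LengthP w l n) : J w (fun w' ρ => LengthPCase w' (l ↾ ρ) (n ↾ ρ)) := by
  refine J.imp (At.cases_of h clauses_lengthP ⟨_, .head _, rfl⟩) ?_
  rintro w' ρ ⟨Φ, ts, B, xs, hc, e, hB⟩
  simp only [List.mem_cons, List.not_mem_nil, or_false] at hc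
  rcases hc with hc | hc <;> cases hc
  · simp at e
    rw [e.1, e.2]
    exact .nil
  · rcases xs with _ | ⟨a, _ | ⟨l, _ | ⟨n, _ | _⟩⟩⟩
    simp at e hB
    rw [e.1, e.2]
    exact .cons hB

theorem LengthP.list [LinDef D] {l : Q w.ctx (.star .prplst)} {n : Q w.ctx .nt}
    (h : LengthP w l n) (hn : Nt w n) : ListP w l := by
  simpa [ListP] using At.of_clause (w := w) clauses_listP (.head _) (l ∷ .nil)
    (holds_ex.2 (.pure ⟨n, by simpa using ⟨hn, h⟩⟩))

theorem ListP.length [LinDef D] {l : Q w.ctx (.star .prplst)} (h : ListP w l) :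
    J w (fun w' ρ => ∃ n, Nt w' n ∧ LengthP w' (l ↾ ρ) n) := by
  refine J.bind (At.cases_of h clauses_listP ⟨_, .head _, rfl⟩) ?_
  rintro w' ρ ⟨Φ, ts, B, xs, hc, e, hB⟩
  simp only [List.mem_cons, List.not_mem_nil, or_false] at hc
  cases hc
  rcases xs with _ | ⟨l, _ | _⟩
  simp at e
  refine (holds_ex.1 hB).imp ?_
  rintro w'' ρ' ⟨n, hn⟩
  exact ⟨n, by simpa [e] using hn⟩

/-! ### Elements -/

def Pred.elementA : Pred S [.star .atm, .star .atmlst] := .element .atm 1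

theorem clauses_element : clausesFor S 32 =
    [⟨[.star .atm, .star .atmlst], .elementA, v0 ;; acons v0 v1 ;; .nil, .top⟩,
      ⟨[.star .atm, .star .atm, .star .atmlst], .elementA, v0 ;; acons v1 v2 ;; .nil,
        fElement .atm 1 v0 v2⟩] := rfl

def ElemA (w : World D) (a : Q w.ctx (.star .atm)) (l : Q w.ctx (.star .atmlst)) : Prop :=
  At w .elementA (a ∷ l ∷ .nil)

@[simp] theorem holds_element {a : Tm S Φ (.star .atm)} {l : Tm S Φ (.star .atmlst)}
    {xs : Env w.ctx Φ} :
    Holds w (fElement .atm 1 a l) xs ↔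
      ElemA w (a.eval xs) (l.eval xs) := holds_pred

theorem ElemA.mono {a : Q w.ctx (.star .atm)} {l : Q w.ctx (.star .atmlst)}
    (h : ElemA w a l) (ρ : Hom w w') :
    ElemA w' (a ↾ ρ) (l ↾ ρ) := At.mono h ρ

theorem J.elemA {R : ∀ w' : World D, Hom w w' → Prop} (h : J w R) {a : Q w.ctx (.star .atm)}
    {l : Q w.ctx (.star .atmlst)}
    (c : ∀ (w' : World D) (ρ : Hom w w'), R w' ρ →
      ElemA w' (a ↾ ρ) (l ↾ ρ)) :
    ElemA w a l := J.at h c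

/-- The ways to derive `element a l`. -/
inductive ElemCase (w : World D) : (a : Q w.ctx (.star .atm)) → (l : Q w.ctx (.star .atmlst)) → Prop
  | head {a l} : ElemCase w a (qacons a l)
  | tail {a a' l} : ElemA w a l → ElemCase w a (qacons a' l)

theorem ElemCase.intro [LinDef D] {a : Q w.ctx (.star .atm)} {l : Q w.ctx (.star .atmlst)}
    (h : ElemCase w a l) : ElemA w a l := by
  match l, h with
  | _, .head (l := l) =>
    simpa [ElemA] using At.of_clause (w := w) clauses_element (.head _) (a ∷ l ∷ .nil) (by simp)
  | _, .tail (a' := a') (l := l) h =>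
    simpa [ElemA] using At.of_clause (w := w) clauses_element (.tail _ (.head _))
      (a ∷ a' ∷ l ∷ .nil) (by simpa using h)

theorem ElemA.cases [LinDef D] {a : Q w.ctx (.star .atm)} {l : Q w.ctx (.star .atmlst)}
    (h : ElemA w a l) : J w (fun w' ρ => ElemCase w' (a ↾ ρ) (l ↾ ρ)) := by
  refine J.imp (At.cases_of h clauses_element ⟨_, .head _, rfl⟩) ?_
  rintro w' ρ ⟨Φ, ts, B, xs, hc, e, hB⟩
  simp only [List.mem_cons, List.not_mem_nil, or_false] at hc
  rcases hc with hc | hc <;> cases hc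
  · rcases xs with _ | ⟨a, _ | ⟨l, _ | _⟩⟩
    simp at e
    rw [e.1, e.2]
    exact .head
  · rcases xs with _ | ⟨a, _ | ⟨a', _ | ⟨l, _ | _⟩⟩⟩
    simp at e hB
    rw [e.1, e.2]
    exact .tail hB

/-! ### Splitting -/

def Pred.splitA : Pred S [.star .atmlst, .star .atmlst, .star .atmlst] := .split .atm 1

theorem clauses_split : clausesFor S 33 =
    [⟨[], .splitA, anil ;; anil ;; anil ;; .nil, .top⟩,
      ⟨[.star .atm, .star .atmlst, .star .atmlst, .star .atmlst], .splitA,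
        acons v0 v1 ;; acons v0 v2 ;; v3 ;; .nil, fSplit .atm 1 v1 v2 v3⟩,
      ⟨[.star .atm, .star .atmlst, .star .atmlst, .star .atmlst], .splitA,
        acons v0 v1 ;; v2 ;; acons v0 v3 ;; .nil, fSplit .atm 1 v1 v2 v3⟩] := rfl

def SplitA (w : World D) (l l₁ l₂ : Q w.ctx (.star .atmlst)) : Prop :=
  At w .splitA (l ∷ l₁ ∷ l₂ ∷ .nil)

@[simp] theorem holds_split {l l₁ l₂ : Tm S Φ (.star .atmlst)} {xs : Env w.ctx Φ} :
    Holds w (fSplit .atm 1 l l₁ l₂) xs ↔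
      SplitA w (l.eval xs) (l₁.eval xs) (l₂.eval xs) := holds_pred

theorem SplitA.mono {l l₁ l₂ : Q w.ctx (.star .atmlst)}
    (h : SplitA w l l₁ l₂) (ρ : Hom w w') :
    SplitA w' (l ↾ ρ) (l₁ ↾ ρ) (l₂ ↾ ρ) := At.mono h ρ

theorem J.splitA {R : ∀ w' : World D, Hom w w' → Prop} (h : J w R)
    {l l₁ l₂ : Q w.ctx (.star .atmlst)}
    (c : ∀ (w' : World D) (ρ : Hom w w'), R w' ρ →
      SplitA w' (l ↾ ρ) (l₁ ↾ ρ) (l₂ ↾ ρ)) :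
    SplitA w l l₁ l₂ := J.at h c

/-- The ways to derive `split l l₁ l₂`. -/
inductive SplitCase (w : World D) : (l l₁ l₂ : Q w.ctx (.star .atmlst)) → Prop
  | nil : SplitCase w qanil qanil qanil
  | left {a l l₁ l₂} : SplitA w l l₁ l₂ → SplitCase w (qacons a l) (qacons a l₁) l₂
  | right {a l l₁ l₂} : SplitA w l l₁ l₂ → SplitCase w (qacons a l) l₁ (qacons a l₂)

theorem SplitCase.intro [LinDef D] {l l₁ l₂ : Q w.ctx (.star .atmlst)} (h : SplitCase w l l₁ l₂) :
    SplitA w l l₁ l₂ := by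
  cases h with
  | nil => simpa [SplitA] using At.of_clause (w := w) clauses_split (.head _) .nil (by simp)
  | @left a l l₁ l₂ h =>
    simpa [SplitA] using At.of_clause (w := w) clauses_split (.tail _ (.head _))
      (a ∷ l ∷ l₁ ∷ l₂ ∷ .nil) (by simpa using h)
  | @right a l l₁ l₂ h =>
    simpa [SplitA] using At.of_clause (w := w) clauses_split (.tail _ (.tail _ (.head _)))
      (a ∷ l ∷ l₁ ∷ l₂ ∷ .nil)
      (by simpa using h)

theorem SplitA.cases [LinDef D] {l l₁ l₂ : Q w.ctx (.star .atmlst)} (h : SplitA w l l₁ l₂) :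
    J w (fun w' ρ => SplitCase w' (l ↾ ρ) (l₁ ↾ ρ) (l₂ ↾ ρ)) := by
  refine J.imp (At.cases_of h clauses_split ⟨_, .head _, rfl⟩) ?_
  rintro w' ρ ⟨Φ, ts, B, xs, hc, e, hB⟩
  simp only [List.mem_cons, List.not_mem_nil, or_false] at hc
  rcases hc with hc | hc | hc <;> cases hc
  · simp at e
    rw [e.1, e.2.1, e.2.2]
    exact .nil
  · rcases xs with _ | ⟨a, _ | ⟨m, _ | ⟨m₁, _ | ⟨m₂, _ | _⟩⟩⟩⟩
    simp at e hB
    rw [e.1, e.2.1, e.2.2]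
    exact .left hB
  · rcases xs with _ | ⟨a, _ | ⟨m, _ | ⟨m₁, _ | ⟨m₂, _ | _⟩⟩⟩⟩
    simp at e hB
    rw [e.1, e.2.1, e.2.2]
    exact .right hB

/-! ### Permutations -/

def Pred.permuteA : Pred S [.star .atmlst, .star .atmlst] := .permute .atm 1

theorem clauses_permute : clausesFor S 34 =
    [⟨[], .permuteA, anil ;; anil ;; .nil, .top⟩,
      ⟨[.star .atm, .star .atmlst, .star .atmlst], .permuteA, acons v0 v1 ;; v2 ;; .nil,
        .ex (.star .atmlst) (fSplit .atm 1 v3 (acons v1 anil) v0 ⊓ₘ fPermute .atm 1 v2 v0)⟩] := rfl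

def PermA (w : World D) (l l' : Q w.ctx (.star .atmlst)) : Prop :=
  At w .permuteA (l ∷ l' ∷ .nil)

@[simp] theorem holds_permute {l l' : Tm S Φ (.star .atmlst)} {xs : Env w.ctx Φ} :
    Holds w (fPermute .atm 1 l l') xs ↔
      PermA w (l.eval xs) (l'.eval xs) := holds_pred

theorem PermA.mono {l l' : Q w.ctx (.star .atmlst)}
    (h : PermA w l l') (ρ : Hom w w') :
    PermA w' (l ↾ ρ) (l' ↾ ρ) := At.mono h ρ

theorem J.permA {R : ∀ w' : World D, Hom w w' → Prop} (h : J w R) {l l' : Q w.ctx (.star .atmlst)}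
    (c : ∀ (w' : World D) (ρ : Hom w w'), R w' ρ →
      PermA w' (l ↾ ρ) (l' ↾ ρ)) :
    PermA w l l' := J.at h c

/-- The ways to derive `permute l l'`. -/
inductive PermCase (w : World D) : (l l' : Q w.ctx (.star .atmlst)) → Prop
  | nil : PermCase w qanil qanil
  | cons {a l l' m} : SplitA w l' (qacons a qanil) m → PermA w l m → PermCase w (qacons a l) l'

theorem PermCase.intro [LinDef D] {l l' : Q w.ctx (.star .atmlst)} (h : PermCase w l l') :
    PermA w l l' := by
  cases h with
  | nil => simpa [PermA] using At.of_clause (w := w) clauses_permute (.head _) .nil (by simp)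
  | @cons a l l' m h h' =>
    simpa [PermA] using At.of_clause (w := w) clauses_permute (.tail _ (.head _))
      (a ∷ l ∷ l' ∷ .nil) (holds_ex.2 (.pure ⟨m, by simpa using ⟨h, h'⟩⟩))

theorem PermA.cases [LinDef D] {l l' : Q w.ctx (.star .atmlst)} (h : PermA w l l') :
    J w (fun w' ρ => PermCase w' (l ↾ ρ) (l' ↾ ρ)) := by
  refine J.bind (At.cases_of h clauses_permute ⟨_, .head _, rfl⟩) ?_
  rintro w' ρ ⟨Φ, ts, B, xs, hc, e, hB⟩
  simp only [List.mem_cons, List.not_mem_nil, or_false] at hc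
  rcases hc with hc | hc <;> cases hc
  · simp at e
    refine .pure ?_
    simp only [Q.map_hom_comp, e.1, e.2, Q.map_hom_id]
    exact .nil
  · rcases xs with _ | ⟨a, _ | ⟨l, _ | ⟨l', _ | _⟩⟩⟩
    simp at e
    refine (holds_ex.1 hB).imp ?_
    rintro w'' ρ' ⟨m, hm⟩
    simp at hm
    simp only [Q.map_hom_comp, e.1, e.2, map_qacons]
    exact .cons hm.1 hm.2

/-! ### Provability -/

def ProgA (w : World D) (a : Q w.ctx (.star .atm)) (ll il : Q w.ctx (.star .prplst)) : Prop :=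
  At w .prog (a ∷ ll ∷ il ∷ .nil)

@[simp] theorem holds_prog {a : Tm S Φ (.star .atm)} {ll il : Tm S Φ (.star .prplst)}
    {xs : Env w.ctx Φ} :
    Holds w (fProg a ll il) xs ↔
      ProgA w (a.eval xs) (ll.eval xs) (il.eval xs) := holds_pred

theorem ProgA.mono {a : Q w.ctx (.star .atm)} {ll il : Q w.ctx (.star .prplst)}
    (h : ProgA w a ll il) (ρ : Hom w w') :
    ProgA w' (a ↾ ρ) (ll ↾ ρ) (il ↾ ρ) := At.mono h ρ

def Seq (w : World D) (i : Q w.ctx .nt) (il ll : Q w.ctx (.star .atmlst)) (b : Q w.ctx (.star .prp))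
    : Prop :=
  At w .seq (i ∷ il ∷ ll ∷ b ∷ .nil)

@[simp] theorem holds_seq {i : Tm S Φ .nt} {il ll : Tm S Φ (.star .atmlst)}
    {b : Tm S Φ (.star .prp)} {xs : Env w.ctx Φ} :
    Holds w (fSeq i il ll b) xs ↔
      Seq w (i.eval xs) (il.eval xs) (ll.eval xs) (b.eval xs) := holds_pred

theorem Seq.mono {i : Q w.ctx .nt} {il ll : Q w.ctx (.star .atmlst)} {b : Q w.ctx (.star .prp)}
    (h : Seq w i il ll b) (ρ : Hom w w') :
    Seq w' (i ↾ ρ) (il ↾ ρ) (ll ↾ ρ) (b ↾ ρ) := At.mono h ρ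

theorem J.seq {R : ∀ w' : World D, Hom w w' → Prop} (h : J w R) {i : Q w.ctx .nt}
    {il ll : Q w.ctx (.star .atmlst)} {b : Q w.ctx (.star .prp)}
    (c : ∀ (w' : World D) (ρ : Hom w w'), R w' ρ →
      Seq w' (i ↾ ρ) (il ↾ ρ) (ll ↾ ρ) (b ↾ ρ)) :
    Seq w i il ll b := J.at h c

def SplitSeq (w : World D) (i : Q w.ctx .nt) (il ll : Q w.ctx (.star .atmlst))
    (l : Q w.ctx (.star .prplst)) : Prop :=
  At w .splitSeq (i ∷ il ∷ ll ∷ l ∷ .nil)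

@[simp] theorem holds_splitSeq {i : Tm S Φ .nt} {il ll : Tm S Φ (.star .atmlst)}
    {l : Tm S Φ (.star .prplst)} {xs : Env w.ctx Φ} :
    Holds w (fSplitSeq i il ll l) xs ↔
      SplitSeq w (i.eval xs) (il.eval xs) (ll.eval xs) (l.eval xs) := holds_pred

theorem SplitSeq.mono {i : Q w.ctx .nt} {il ll : Q w.ctx (.star .atmlst)}
    {l : Q w.ctx (.star .prplst)}
    (h : SplitSeq w i il ll l) (ρ : Hom w w') :
    SplitSeq w' (i ↾ ρ) (il ↾ ρ) (ll ↾ ρ) (l ↾ ρ) := At.mono h ρ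

theorem J.splitSeq {R : ∀ w' : World D, Hom w w' → Prop} (h : J w R) {i : Q w.ctx .nt}
    {il ll : Q w.ctx (.star .atmlst)} {l : Q w.ctx (.star .prplst)}
    (c : ∀ (w' : World D) (ρ : Hom w w'), R w' ρ →
      SplitSeq w' (i ↾ ρ) (il ↾ ρ) (ll ↾ ρ) (l ↾ ρ)) :
    SplitSeq w i il ll l := J.at h c

theorem clauses_seq : clausesFor S 5 =
    [⟨[.nt, .star .atmlst, .star .atm], .seq, v0 ;; v1 ;; acons v2 anil ;; atomS v2 ;; .nil, .top⟩,
      ⟨[.nt, .star .atm, .star .atmlst, .star .atm], .seq,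
        v0 ;; acons v1 v2 ;; anil ;; atomS v3 ;; .nil, fElement .atm 1 v3 (acons v1 v2)⟩,
      ⟨[.nt, .star .atmlst, .star .atmlst, .star .atm], .seq,
        suc v0 ;; v1 ;; v2 ;; atomS v3 ;; .nil,
        .ex (.star .prplst) (.ex (.star .prplst)
          (fList .prp 1 v1 ⊓ₘ fList .prp 1 v0 ⊓ₘ fProg v5 v1 v0 ⊓ₘ
            fSplitSeq v2 v3 v4 v1 ⊓ₘ fSplitSeq v2 v3 anil v0))⟩,
      ⟨[.nt, .star .atmlst, .star .atmlst], .seq, v0 ;; v1 ;; v2 ;; ttS ;; .nil, .top⟩,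
      ⟨[.nt, .star .atmlst, .star .atmlst, .star .prp, .star .prp], .seq,
        suc v0 ;; v1 ;; v2 ;; withS v3 v4 ;; .nil, fSeq v0 v1 v2 v3 ⊓ₘ fSeq v0 v1 v2 v4⟩,
      ⟨[.nt, .star .atmlst, .star .atmlst, .star .atm, .star .prp], .seq,
        suc v0 ;; v1 ;; v2 ;; limpS v3 v4 ;; .nil, fSeq v0 v1 (acons v3 v2) v4⟩,
      ⟨[.nt, .star .atmlst, .star .atmlst, .star .atm, .star .prp], .seq,
        suc v0 ;; v1 ;; v2 ;; iimpS v3 v4 ;; .nil, fSeq v0 (acons v3 v1) v2 v4⟩,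
      ⟨[.nt, .star .atmlst, .star .atmlst, .star (.arr .i .prp)], .seq,
        suc v0 ;; v1 ;; v2 ;; bigwedgeS v3 ;; .nil,
        fSeq v0 (shift v1) (shift v2) (.lam (v4 ⬝ₘ rst v0 ⬝ₘ fst v0))⟩] := rfl

theorem clauses_splitSeq : clausesFor S 6 =
    [⟨[.nt, .star .atmlst], .splitSeq, v0 ;; v1 ;; anil ;; pnil ;; .nil, .top⟩,
      ⟨[.nt, .star .atmlst, .star .atmlst, .star .prp, .star .prplst], .splitSeq,
        v0 ;; v1 ;; v2 ;; pcons v3 v4 ;; .nil,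
        .ex (.star .atmlst) (.ex (.star .atmlst)
          (fSplit .atm 1 v4 v1 v0 ⊓ₘ fSeq v2 v3 v1 v5 ⊓ₘ fSplitSeq v2 v3 v0 v6))⟩] := rfl

@[simp] theorem eval_open {Δ : Ctx S} {τ₁ τ₂ τ₃ : Ty S.Base} {q₁ : Q Δ τ₁} {q₂ : Q Δ τ₂}
    {q₃ : Q Δ τ₃} {B : Q Δ (.star (.arr .i .prp))} :
    (Tm.lam (v4 ⬝ₘ rst v0 ⬝ₘ fst v0)).eval (q₁ ∷ q₂ ∷ q₃ ∷ B ∷ .nil) = qopen B :=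
  b1_injective (by simp [b1, qopen])

/-- The ways to derive `seq i il ll b`. -/
inductive SeqCase (w : World D) : (i : Q w.ctx .nt) → (il ll : Q w.ctx (.star .atmlst)) →
    (b : Q w.ctx (.star .prp)) → Prop
  | init {i il a} : SeqCase w i il (qacons a qanil) (qatom a)
  | elem {i a a' il} : ElemA w a (qacons a' il) → SeqCase w i (qacons a' il) qanil (qatom a)
  | prog {i il ll a m n} : ListP w m → ListP w n → ProgA w a m n → SplitSeq w i il ll m →
      SplitSeq w i il qanil n → SeqCase w (qs i) il ll (qatom a)
  | tt {i il ll} : SeqCase w i il ll qtt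
  | wth {i il ll b c} : Seq w i il ll b → Seq w i il ll c → SeqCase w (qs i) il ll (qwith b c)
  | limp {i il ll a b} : Seq w i il (qacons a ll) b → SeqCase w (qs i) il ll (qlimp a b)
  | iimp {i il ll a b} : Seq w i (qacons a il) ll b → SeqCase w (qs i) il ll (qiimp a b)
  | big {i il ll b} : Seq w i (qshift il) (qshift ll) (qopen b) → SeqCase w (qs i) il ll (qbig b)

theorem SeqCase.intro [LinDef D] {i : Q w.ctx .nt} {il ll : Q w.ctx (.star .atmlst)}
    {b : Q w.ctx (.star .prp)} (h : SeqCase w i il ll b) : Seq w i il ll b := by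
  match i, il, ll, b, h with
  | i, il, _, _, .init (a := a) =>
    simpa [Seq] using At.of_clause (w := w) clauses_seq (.head _) (i ∷ il ∷ a ∷ .nil) (by simp)
  | i, _, _, _, .elem (a := a) (a' := a') (il := il) h =>
    simpa [Seq] using At.of_clause (w := w) clauses_seq (.tail _ (.head _))
      (i ∷ a' ∷ il ∷ a ∷ .nil) (by simpa using h)
  | _, il, ll, _, .prog (i := i) (a := a) (m := m) (n := n) h₁ h₂ h₃ h₄ h₅ =>
    simpa [Seq] using At.of_clause (w := w) clauses_seq (.tail _ (.tail _ (.head _)))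
      (i ∷ il ∷ ll ∷ a ∷ .nil) (holds_ex_ex.2 (.pure ⟨m, n, by simpa using ⟨h₁, h₂, h₃, h₄, h₅⟩⟩))
  | i, il, ll, _, .tt =>
    simpa [Seq] using At.of_clause (w := w) clauses_seq (.tail _ (.tail _ (.tail _ (.head _))))
      (i ∷ il ∷ ll ∷ .nil) (by simp)
  | _, il, ll, _, .wth (i := i) (b := b) (c := c) h h' =>
    simpa [Seq] using At.of_clause (w := w) clauses_seq
      (.tail _ (.tail _ (.tail _ (.tail _ (.head _))))) (i ∷ il ∷ ll ∷ b ∷ c ∷ .nil)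
      (by simpa using ⟨h, h'⟩)
  | _, il, ll, _, .limp (i := i) (a := a) (b := b) h =>
    simpa [Seq] using At.of_clause (w := w) clauses_seq
      (.tail _ (.tail _ (.tail _ (.tail _ (.tail _ (.head _)))))) (i ∷ il ∷ ll ∷ a ∷ b ∷ .nil)
      (by simpa using h)
  | _, il, ll, _, .iimp (i := i) (a := a) (b := b) h =>
    simpa [Seq] using At.of_clause (w := w) clauses_seq
      (.tail _ (.tail _ (.tail _ (.tail _ (.tail _ (.tail _ (.head _)))))))
      (i ∷ il ∷ ll ∷ a ∷ b ∷ .nil) (by simpa using h)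
  | _, il, ll, _, .big (i := i) (b := b) h =>
    simpa [Seq] using At.of_clause (w := w) clauses_seq
      (.tail _ (.tail _ (.tail _ (.tail _ (.tail _ (.tail _ (.tail _ (.head _))))))))
      (i ∷ il ∷ ll ∷ b ∷ .nil) (by simpa using h)

theorem Seq.cases [LinDef D] {i : Q w.ctx .nt} {il ll : Q w.ctx (.star .atmlst)}
    {b : Q w.ctx (.star .prp)} (h : Seq w i il ll b) :
    J w (fun w' ρ => SeqCase w' (i ↾ ρ) (il ↾ ρ) (ll ↾ ρ) (b ↾ ρ)) := by
  refine J.bind (At.cases_of h clauses_seq ⟨_, .head _, rfl⟩) ?_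
  rintro w' ρ ⟨Φ, ts, B, xs, hc, e, hB⟩
  -- Only the program clause has existential quantifiers in its body and so needs a further world;
  -- the other cases stay at the present one.
  have pure : SeqCase w' (i ↾ ρ) (il ↾ ρ) (ll ↾ ρ) (b ↾ ρ) → J w' (fun w'' ρ' =>
      SeqCase w'' (i ↾ (ρ.comp ρ')) (il ↾ (ρ.comp ρ')) (ll ↾ (ρ.comp ρ')) (b ↾ (ρ.comp ρ'))) :=
    fun h => .pure (by simpa using h)
  simp only [List.mem_cons, List.not_mem_nil, or_false] at hc
  rcases hc with hc | hc | hc | hc | hc | hc | hc | hc <;> cases hc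
  · rcases xs with _ | ⟨i, _ | ⟨il, _ | ⟨a, _ | _⟩⟩⟩
    simp at e
    rw [e.1, e.2.1, e.2.2.1, e.2.2.2] at pure
    exact pure .init
  · rcases xs with _ | ⟨i, _ | ⟨a', _ | ⟨il, _ | ⟨a, _ | _⟩⟩⟩⟩
    simp at e hB
    rw [e.1, e.2.1, e.2.2.1, e.2.2.2] at pure
    exact pure (.elem hB)
  · rcases xs with _ | ⟨i, _ | ⟨il, _ | ⟨ll, _ | ⟨a, _ | _⟩⟩⟩⟩
    simp at e
    refine (holds_ex_ex.1 hB).imp ?_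
    rintro w'' ρ' ⟨m, n, h⟩
    simp at h
    simp only [Q.map_hom_comp, e.1, e.2.1, e.2.2.1, e.2.2.2, map_qs, map_qatom]
    exact .prog h.1 h.2.1 h.2.2.1 h.2.2.2.1 h.2.2.2.2
  · rcases xs with _ | ⟨i, _ | ⟨il, _ | ⟨ll, _ | _⟩⟩⟩
    simp at e
    rw [e.1, e.2.1, e.2.2.1, e.2.2.2] at pure
    exact pure .tt
  · rcases xs with _ | ⟨i, _ | ⟨il, _ | ⟨ll, _ | ⟨b, _ | ⟨c, _ | _⟩⟩⟩⟩⟩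
    simp at e hB
    rw [e.1, e.2.1, e.2.2.1, e.2.2.2] at pure
    exact pure (.wth hB.1 hB.2)
  · rcases xs with _ | ⟨i, _ | ⟨il, _ | ⟨ll, _ | ⟨a, _ | ⟨b, _ | _⟩⟩⟩⟩⟩
    simp at e hB
    rw [e.1, e.2.1, e.2.2.1, e.2.2.2] at pure
    exact pure (.limp hB)
  · rcases xs with _ | ⟨i, _ | ⟨il, _ | ⟨ll, _ | ⟨a, _ | ⟨b, _ | _⟩⟩⟩⟩⟩
    simp at e hB
    rw [e.1, e.2.1, e.2.2.1, e.2.2.2] at pure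
    exact pure (.iimp hB)
  · rcases xs with _ | ⟨i, _ | ⟨il, _ | ⟨ll, _ | ⟨b, _ | _⟩⟩⟩⟩
    simp at e hB
    rw [e.1, e.2.1, e.2.2.1, e.2.2.2] at pure
    exact pure (.big hB)

/-- The ways to derive `split_seq i il ll l`. -/
inductive SplitSeqCase (w : World D) (i : Q w.ctx .nt) (il : Q w.ctx (.star .atmlst)) :
    (ll : Q w.ctx (.star .atmlst)) → (l : Q w.ctx (.star .prplst)) → Prop
  | nil : SplitSeqCase w i il qanil qpnil
  | cons {ll b l l₁ l₂} : SplitA w ll l₁ l₂ → Seq w i il l₁ b → SplitSeq w i il l₂ l →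
      SplitSeqCase w i il ll (qpcons b l)

theorem SplitSeqCase.intro [LinDef D] {i : Q w.ctx .nt} {il ll : Q w.ctx (.star .atmlst)}
    {l : Q w.ctx (.star .prplst)} (h : SplitSeqCase w i il ll l) : SplitSeq w i il ll l := by
  match ll, l, h with
  | _, _, .nil =>
    simpa [SplitSeq] using At.of_clause (w := w) clauses_splitSeq (.head _) (i ∷ il ∷ .nil)
      (by simp)
  | ll, _, .cons (b := b) (l := l) (l₁ := l₁) (l₂ := l₂) h₁ h₂ h₃ =>
    simpa [SplitSeq] using At.of_clause (w := w) clauses_splitSeq (.tail _ (.head _))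
      (i ∷ il ∷ ll ∷ b ∷ l ∷ .nil) (holds_ex_ex.2 (.pure ⟨l₁, l₂, by simpa using ⟨h₁, h₂, h₃⟩⟩))

theorem SplitSeq.cases [LinDef D] {i : Q w.ctx .nt} {il ll : Q w.ctx (.star .atmlst)}
    {l : Q w.ctx (.star .prplst)} (h : SplitSeq w i il ll l) :
    J w (fun w' ρ => SplitSeqCase w' (i ↾ ρ) (il ↾ ρ) (ll ↾ ρ) (l ↾ ρ)) := by
  refine J.bind (At.cases_of h clauses_splitSeq ⟨_, .head _, rfl⟩) ?_
  rintro w' ρ ⟨Φ, ts, B, xs, hc, e, hB⟩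
  simp only [List.mem_cons, List.not_mem_nil, or_false] at hc
  rcases hc with hc | hc <;> cases hc
  · rcases xs with _ | ⟨i, _ | ⟨il, _ | _⟩⟩
    simp at e
    refine .pure ?_
    simp only [Q.map_hom_comp, e.1, e.2.1, e.2.2.1, e.2.2.2, Q.map_hom_id]
    exact .nil
  · rcases xs with _ | ⟨i, _ | ⟨il, _ | ⟨ll, _ | ⟨b, _ | ⟨l, _ | _⟩⟩⟩⟩⟩
    simp at e
    refine (holds_ex_ex.1 hB).imp ?_
    rintro w'' ρ' ⟨l₁, l₂, h⟩
    simp at h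
    simp only [Q.map_hom_comp, e.1, e.2.1, e.2.2.1, e.2.2.2, map_qpcons]
    exact .cons h.1 h.2.1 h.2.2

/-! ### Substitution and extension -/

theorem clauses_subst₀ (e : ETy) : clausesFor S (10 * e.code + 16) =
    [⟨[.star (.star .i), .star (.arr .i (.star e.ty))], .subst₀ e,
        zr ;; v0 ;; onList v1 ;; .lam (.lam (v3 ⬝ₘ v1 ⬝ₘ (v2 ⬝ₘ v1 ⬝ₘ v0) ⬝ₘ rst v0)) ;; .nil,
          .top⟩,
      ⟨[.nt, .star (.arr .i (.star .i)), .star (.arr .i (.star e.ty)),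
          .star (.arr .i (.star e.ty))],
        .subst₀ e, suc v0 ;; onList v1 ;; onList v2 ;; onList v3 ;; .nil,
        fSubst₀ e v0 (moved v1) (moved v2) (moved v3)⟩] := by cases e <;> rfl

theorem clauses_extend (e : ETy) : clausesFor S (10 * e.code + 17) =
    [⟨[.nt, .star e.ty, .star e.ty], .extend e, v0 ;; v1 ;; v2 ;; .nil,
      fExtend₀ e v0 (.lam v2) (.lam v3)⟩] := by cases e <;> rfl

theorem clauses_extend₀ (e : ETy) : clausesFor S (10 * e.code + 18) =
    [⟨[.star (.star e.ty)], .extend₀ e,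
        zr ;; .lam (.lam (v2 ⬝ₘ v1 ⬝ₘ v0)) ;; .lam (.lam (v2 ⬝ₘ v1 ⬝ₘ rst v0)) ;; .nil, .top⟩,
      ⟨[.nt, .star (.arr .i (.star e.ty)), .star (.arr .i (.star e.ty))],
        .extend₀ e, suc v0 ;; onList v1 ;; onList v2 ;; .nil,
        fExtend₀ e v0 (moved v1) (moved v2)⟩] := by cases e <;> rfl

def Ext (e : ETy) (w : World D) (n : Q w.ctx .nt) (x x' : Q w.ctx (.star e.ty)) : Prop :=
  At w (.extend e) (n ∷ x ∷ x' ∷ .nil)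

@[simp] theorem holds_extend {e : ETy} {n : Tm S Φ .nt} {x x' : Tm S Φ (.star e.ty)}
    {xs : Env w.ctx Φ} :
    Holds w (fExtend e n x x') xs ↔
      Ext e w (n.eval xs) (x.eval xs) (x'.eval xs) := holds_pred

def Ext₀ (e : ETy) (w : World D) (n : Q w.ctx .nt) (x x' : Q w.ctx (.star (.star e.ty))) : Prop :=
  At w (.extend₀ e) (n ∷ x ∷ x' ∷ .nil)

@[simp] theorem holds_extend₀ {e : ETy} {n : Tm S Φ .nt} {x x' : Tm S Φ (.star (.star e.ty))}
    {xs : Env w.ctx Φ} :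
    Holds w (fExtend₀ e n x x') xs ↔
      Ext₀ e w (n.eval xs) (x.eval xs) (x'.eval xs) := holds_pred

theorem Ext₀.mono {e : ETy} {n : Q w.ctx .nt} {x x' : Q w.ctx (.star (.star e.ty))}
    (h : Ext₀ e w n x x') (ρ : Hom w w') :
    Ext₀ e w' (n ↾ ρ) (x ↾ ρ) (x' ↾ ρ) := At.mono h ρ

theorem J.ext₀ {R : ∀ w' : World D, Hom w w' → Prop} (h : J w R) {e : ETy} {n : Q w.ctx .nt}
    {x x' : Q w.ctx (.star (.star e.ty))}
    (c : ∀ (w' : World D) (ρ : Hom w w'), R w' ρ →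
      Ext₀ e w' (n ↾ ρ) (x ↾ ρ) (x' ↾ ρ)) :
    Ext₀ e w n x x' := J.at h c

def Subst₀ (e : ETy) (w : World D) (n : Q w.ctx .nt) (t : Q w.ctx (.star (.star .i)))
    (x x' : Q w.ctx (.star (.star e.ty))) : Prop :=
  At w (.subst₀ e) (n ∷ t ∷ x ∷ x' ∷ .nil)

@[simp] theorem holds_subst₀ {e : ETy} {n : Tm S Φ .nt} {t : Tm S Φ (.star (.star .i))}
    {x x' : Tm S Φ (.star (.star e.ty))} {xs : Env w.ctx Φ} :
    Holds w (fSubst₀ e n t x x') xs ↔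
      Subst₀ e w (n.eval xs) (t.eval xs) (x.eval xs) (x'.eval xs) := holds_pred

theorem Subst₀.mono {e : ETy} {n : Q w.ctx .nt} {t : Q w.ctx (.star (.star .i))}
    {x x' : Q w.ctx (.star (.star e.ty))}
    (h : Subst₀ e w n t x x') (ρ : Hom w w') :
    Subst₀ e w' (n ↾ ρ) (t ↾ ρ) (x ↾ ρ) (x' ↾ ρ) := At.mono h ρ

theorem J.subst₀ {R : ∀ w' : World D, Hom w w' → Prop} (h : J w R) {e : ETy} {n : Q w.ctx .nt}
    {t : Q w.ctx (.star (.star .i))} {x x' : Q w.ctx (.star (.star e.ty))}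
    (c : ∀ (w' : World D) (ρ : Hom w w'), R w' ρ →
      Subst₀ e w' (n ↾ ρ) (t ↾ ρ) (x ↾ ρ) (x' ↾ ρ)) :
    Subst₀ e w n t x x' := J.at h c

@[simp] theorem eval_lam_succ {Δ Φ : Ctx S} {τ : Ty S.Base} (x : Var Φ τ) (xs : Env Δ Φ) :
    (Tm.lam (.var (.succ x)) : Tm S Φ (.star τ)).eval xs = qconst (xs.get x) :=
  b1_injective (by simp [b1, qconst])

@[simp] theorem eval_lam_lam_eta {Δ : Ctx S} {τ : Ty S.Base} (X : Q Δ (.star (.star τ))) :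
    (Tm.lam (.lam (v2 ⬝ₘ v1 ⬝ₘ v0))).eval (X ∷ .nil) = X := b2_injective (by simp [b2])

@[simp] theorem eval_lam_lam_rst {Δ : Ctx S} {τ : Ty S.Base} (X : Q Δ (.star (.star τ))) :
    (Tm.lam (.lam (v2 ⬝ₘ v1 ⬝ₘ rst v0))).eval (X ∷ .nil) = qskip X := rfl

@[simp] theorem eval_lam_lam_put {Δ : Ctx S} {τ : Ty S.Base} (T : Q Δ (.star (.star .i)))
    (X : Q Δ (.star (.arr .i (.star τ)))) :
    (Tm.lam (.lam (v3 ⬝ₘ v1 ⬝ₘ (v2 ⬝ₘ v1 ⬝ₘ v0) ⬝ₘ rst v0))).eval (T ∷ X ∷ .nil) = qput T X := rfl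

/-- The ways to derive `extend₀ n x x'`. -/
inductive ExtCase (e : ETy) (w : World D) : (n : Q w.ctx .nt) →
    (x x' : Q w.ctx (.star (.star e.ty))) → Prop
  | zero {x} : ExtCase e w qz x (qskip x)
  | succ {n x x'} : Ext₀ e w n (qmoved x) (qmoved x') → ExtCase e w (qs n) (qonList x) (qonList x')

theorem ExtCase.intro [LinDef D] {e : ETy} {n : Q w.ctx .nt} {x x' : Q w.ctx (.star (.star e.ty))}
    (h : ExtCase e w n x x') : Ext₀ e w n x x' := by
  cases h with
  | zero =>
    simpa [Ext₀] using At.of_clause (w := w) (clauses_extend₀ e) (.head _) (x ∷ .nil) (by simp)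
  | @succ n x x' h =>
    simpa [Ext₀] using At.of_clause (w := w) (clauses_extend₀ e) (.tail _ (.head _))
      (n ∷ x ∷ x' ∷ .nil) (by simpa using h)

theorem Ext₀.cases [LinDef D] {e : ETy} {n : Q w.ctx .nt} {x x' : Q w.ctx (.star (.star e.ty))}
    (h : Ext₀ e w n x x') : J w (fun w' ρ => ExtCase e w' (n ↾ ρ) (x ↾ ρ) (x' ↾ ρ)) := by
  refine J.imp (At.cases_of h (clauses_extend₀ e) ⟨_, .head _, rfl⟩) ?_
  rintro w' ρ ⟨Φ, ts, B, xs, hc, e, hB⟩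
  simp only [List.mem_cons, List.not_mem_nil, or_false] at hc
  rcases hc with hc | hc <;> cases hc
  · rcases xs with _ | ⟨x, _ | _⟩
    simp at e
    rw [e.1, e.2.1, e.2.2]
    exact .zero
  · rcases xs with _ | ⟨n, _ | ⟨x, _ | ⟨x', _ | _⟩⟩⟩
    simp at e hB
    rw [e.1, e.2.1, e.2.2]
    exact .succ hB

theorem Ext₀.ext [LinDef D] {e : ETy} {n : Q w.ctx .nt} {x x' : Q w.ctx (.star e.ty)}
    (h : Ext₀ e w n (qconst x) (qconst x')) : Ext e w n x x' := by
  simpa [Ext] using At.of_clause (w := w) (clauses_extend e) (.head _) (n ∷ x ∷ x' ∷ .nil)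
    (by simpa using h)

theorem Ext.ext₀ [LinDef D] {e : ETy} {n : Q w.ctx .nt} {x x' : Q w.ctx (.star e.ty)}
    (h : Ext e w n x x') : Ext₀ e w n (qconst x) (qconst x') := by
  refine J.ext₀ (At.cases_of h (clauses_extend e) ⟨_, .head _, rfl⟩) ?_
  rintro w' ρ ⟨Φ, ts, B, xs, hc, e, hB⟩
  simp only [List.mem_cons, List.not_mem_nil, or_false] at hc
  cases hc
  rcases xs with _ | ⟨n, _ | ⟨x, _ | ⟨x', _ | _⟩⟩⟩
  simp at e hB
  simpa [e] using hB

/-- The ways to derive `subst₀ n t x x'`. -/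
inductive SubstCase (e : ETy) (w : World D) : (n : Q w.ctx .nt) → (t : Q w.ctx (.star (.star .i))) →
    (x x' : Q w.ctx (.star (.star e.ty))) → Prop
  | zero {t x} : SubstCase e w qz t (qonList x) (qput t x)
  | succ {n t x x'} : Subst₀ e w n (qmoved t) (qmoved x) (qmoved x') →
      SubstCase e w (qs n) (qonList t) (qonList x) (qonList x')

theorem SubstCase.intro [LinDef D] {e : ETy} {n : Q w.ctx .nt} {t : Q w.ctx (.star (.star .i))}
    {x x' : Q w.ctx (.star (.star e.ty))} (h : SubstCase e w n t x x') : Subst₀ e w n t x x' := by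
  match n, t, x, x', h with
  | _, t, _, _, .zero (x := x) =>
    simpa [Subst₀] using At.of_clause (w := w) (clauses_subst₀ e) (.head _) (t ∷ x ∷ .nil) (by simp)
  | _, _, _, _, .succ (n := n) (t := t) (x := x) (x' := x') h =>
    simpa [Subst₀] using At.of_clause (w := w) (clauses_subst₀ e) (.tail _ (.head _))
      (n ∷ t ∷ x ∷ x' ∷ .nil) (by simpa using h)

theorem Subst₀.cases [LinDef D] {e : ETy} {n : Q w.ctx .nt} {t : Q w.ctx (.star (.star .i))}
    {x x' : Q w.ctx (.star (.star e.ty))} (h : Subst₀ e w n t x x') :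
    J w (fun w' ρ => SubstCase e w' (n ↾ ρ) (t ↾ ρ) (x ↾ ρ) (x' ↾ ρ)) := by
  refine J.imp (At.cases_of h (clauses_subst₀ e) ⟨_, .head _, rfl⟩) ?_
  rintro w' ρ ⟨Φ, ts, B, xs, hc, e, hB⟩
  simp only [List.mem_cons, List.not_mem_nil, or_false] at hc
  rcases hc with hc | hc <;> cases hc
  · rcases xs with _ | ⟨t, _ | ⟨x, _ | _⟩⟩
    simp at e
    rw [e.1, e.2.1, e.2.2.1, e.2.2.2]
    exact .zero
  · rcases xs with _ | ⟨n, _ | ⟨t, _ | ⟨x, _ | ⟨x', _ | _⟩⟩⟩⟩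
    simp at e hB
    rw [e.1, e.2.1, e.2.2.1, e.2.2.2]
    exact .succ hB

end

end FOLDN

/-! ### Induction on numbers and on lists in the presence of hypotheses -/

namespace FOLDN

variable {S : Sig} {D : Set (Clause S)} {w w' : World D} {Φ : Ctx S}

/-! ### Induction relative to a world -/

theorem Env.map_toSub_var {Δ : Ctx S} (ys : Env Δ Φ) :
    ys.map (Env.toSub (.tab fun _ x => Q.var x)) = ys := by
  have key : ∀ {τ} (q : Q Δ τ), q.map (Env.toSub (.tab fun _ x => Q.var x)) = q := by
    intro τ q
    induction q using Q.ind with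
    | h t =>
      rw [Q.map_mk]
      refine (Q.sound (t.subst_conv (η := Sub.id _) fun σ x => Q.exact ?_)).trans
        (by rw [Tm.subst_id])
      rw [Env.toSub, Q.mk_out, Env.get_tab]; rfl
  ext τ x
  rw [Env.get_map, key]

/-- The extension of worlds given by values of the variables that satisfy the hypotheses. -/
noncomputable def Hom.ofEnv (zs : Env w'.ctx w.ctx) (h : ∀ G ∈ w.hyps, Holds w' G zs) : Hom w w' :=
  ⟨zs.toSub, h⟩

/-- The hypotheses of the world are not available in the minor premises of the induction rule, so
they are made antecedents of the invariant and its variables become parameters. A world with values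
satisfying these antecedents is the same as a world later than `w`, which gives the stated relative
form. -/
theorem Holds.nat_ind_rel (F : Fm S (.nt :: Φ)) (ys : Env w.ctx Φ)
    (zero : ∀ (w' : World D) (ρ : Hom w w'), Holds w' F (qz ∷ ys.map ρ.sub))
    (succ : ∀ (w' : World D) (ρ : Hom w w') j, Nt w' j → Holds w' F (j ∷ ys.map ρ.sub) →
      Holds w' F (qs j ∷ ys.map ρ.sub))
    {n : Q w.ctx .nt} (hn : Nt w n) : Holds w F (n ∷ ys) := by
  have e₁ : ∀ {w' : World D} (zs : Env w'.ctx w.ctx) (j : Q w'.ctx .nt),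
      (Sub.lift (σ := .nt) ys.toSub).eval (j ∷ zs) = j ∷ ys.map zs.toSub := by
    intro w' zs j
    ext τ x
    cases x with
    | zero => simp [Sub.lift]
    | succ x =>
      rw [Sub.get_eval, Env.get_succ, Env.get_map, Sub.lift, Tm.eval_wk, Env.toSub, Tm.eval]
      conv_rhs => rw [← Q.mk_out (ys.get x), Q.map_mk]
  have e₂ : ∀ {w' : World D} (zs : Env w'.ctx w.ctx) (j : Q w'.ctx .nt),
      (Sub.wk w.ctx .nt).eval (j ∷ zs) = zs := by
    intro w' zs j
    ext τ x
    simp [Sub.wk]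
  have iff : ∀ {w' : World D} (j : Q w'.ctx .nt) (zs : Env w'.ctx w.ctx),
      Holds w' (.imps (w.hyps.toList.map (Fm.subst (Sub.wk _ _))) (F.subst ys.toSub.lift)) (j ∷ zs)
        ↔ ∀ (w'' : World D) (ρ : Hom w' w''), (∀ G ∈ w.hyps, Holds w'' G (zs.map ρ.sub)) →
          Holds w'' F (j ↾ ρ ∷ ys.map (zs.map ρ.sub).toSub) := by
    intro w' j zs
    refine holds_imps.trans (forall_congr' fun w'' => forall_congr' fun ρ => ?_)
    simp [holds_subst, e₁, e₂]
  have key := nat_ind (.imps (w.hyps.toList.map (Fm.subst (Sub.wk _ _))) (F.subst ys.toSub.lift))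
    (fun w' zs => (iff _ _).2 fun w'' ρ h => zero w'' (.ofEnv _ h))
    (fun w' j zs hj h => (iff _ _).2 fun w'' ρ h' => by
      rw [map_qs]
      exact succ w'' (.ofEnv _ h') _ (hj.mono ρ) ((iff _ _).1 h w'' ρ h'))
    -- At the end the parameters are instantiated by the variables of `w` themselves, where the
    -- antecedents hold.
    hn (.tab fun _ x => Q.var x)
  have := (iff _ _).1 key w (Hom.id w) fun G hG => by
    rw [Env.map_hom_id]
    refine (derives_of_holds (θ := Sub.id _) fun σ x => ?_).2 ?_
    · rw [Env.get_tab]; rfl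
    · rw [Fm.subst_id]; exact .of_mem hG
  simpa [Env.map_toSub_var] using this

/-- Induction for rules $\forall\bar x(A\supset C)$ with the zero and successor cases merged: the
induction hypothesis concerns every predecessor that the number acquires at a later world. In
applications the case distinction then comes from inverting a clause, which reveals the form of the
number at the same time. -/
theorem nat_rule {w₀ : World D} {ys : Env w₀.ctx Φ} {τs : Ctx S}
    (A C : Fm S (τs ++ .nt :: Φ))
    (step : ∀ (w : World D) (ρ : Hom w₀ w) (i : Q w.ctx .nt), Nt w i →
      (∀ (w' : World D) (ρ' : Hom w w') (j : Q w'.ctx .nt), i ↾ ρ' = qs j → Nt w' j ∧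
        ∀ xs : Env w'.ctx τs,
          Holds w' A (xs.append (j ∷ (ys.map ρ.sub).map ρ'.sub)) →
            Holds w' C (xs.append (j ∷ (ys.map ρ.sub).map ρ'.sub))) →
      ∀ xs : Env w.ctx τs, Holds w A (xs.append (i ∷ ys.map ρ.sub)) →
        Holds w C (xs.append (i ∷ ys.map ρ.sub)))
    {n : Q w₀.ctx .nt} (hn : Nt w₀ n) (xs : Env w₀.ctx τs)
    (h : Holds w₀ A (xs.append (n ∷ ys))) : Holds w₀ C (xs.append (n ∷ ys)) := by
  have key : Holds w₀ (.rule τs [A] C) (n ∷ ys) := by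
    refine Holds.nat_ind_rel _ ys (fun w ρ => ?_) (fun w ρ j hj hF => ?_) hn
    · refine holds_rule.2 fun w' ρ' xs hA => ?_
      rw [List.forall_mem_singleton] at hA
      -- Zero has no predecessor at any later world, so the induction hypothesis is vacuous.
      have := step w' (ρ.comp ρ') qz .zero (fun _ _ j e => (qz_ne_qs e).elim) xs
      simp only [Env.map_hom_comp] at this
      exact this hA
    · refine holds_rule.2 fun w' ρ' xs hA => ?_
      rw [List.forall_mem_singleton] at hA
      have := step w' (ρ.comp ρ') (qs (j ↾ ρ')) (hj.mono ρ').succ ?_ xs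
      · simp only [Env.map_cons, map_qs, Env.map_hom_comp] at this hA ⊢
        exact this hA
      · intro w'' ρ'' k e
        rw [map_qs] at e
        obtain rfl := qs_injective e
        refine ⟨(hj.mono ρ').mono ρ'', fun xs hA => ?_⟩
        have := holds_rule.1 hF w'' (ρ'.comp ρ'') xs
        simp only [List.forall_mem_singleton, Env.map_cons, Env.map_hom_comp, Q.map_hom_comp]
          at this hA ⊢
        exact this hA
  have := holds_rule.1 key w₀ (Hom.id w₀) xs
  rw [Env.map_hom_id, List.forall_mem_singleton] at this
  exact this h

theorem LengthA.cons_inv [LinDef D] {a : Q w.ctx (.star .atm)} {t : Q w.ctx (.star .atmlst)}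
    {n : Q w.ctx .nt} (h : LengthA w (qacons a t) n) :
    J w (fun w' ρ => ∃ m, n ↾ ρ = qs m ∧ LengthA w' (t ↾ ρ) m) := by
  refine h.cases.imp fun w' ρ hc => ?_
  rw [map_qacons] at hc
  generalize hm : qacons (a ↾ ρ) (t ↾ ρ) = m at hc
  generalize n ↾ ρ = k at hc ⊢
  cases hc with
  | nil => exact (qanil_ne_qacons hm.symm).elim
  | cons h =>
    obtain ⟨-, rfl⟩ := qacons_injective hm
    exact ⟨_, rfl, h⟩

/-- Induction on the length, in the same merged form: the induction hypothesis concerns every tail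
that the list acquires at a later world. The list is quantified inside the induction formula, under
the assumption that its length is the given number. -/
theorem listA_rule [LinDef D] {w₀ : World D} {ys : Env w₀.ctx Φ} {τs : Ctx S}
    (A C : Fm S (τs ++ .star .atmlst :: Φ))
    (step : ∀ (w : World D) (ρ : Hom w₀ w) (l : Q w.ctx (.star .atmlst)), ListA w l →
      (∀ (w' : World D) (ρ' : Hom w w') (a : Q w'.ctx (.star .atm)) (t : Q w'.ctx (.star .atmlst)),
        l ↾ ρ' = qacons a t → ListA w' t ∧ ∀ xs : Env w'.ctx τs,
          Holds w' A (xs.append (t ∷ (ys.map ρ.sub).map ρ'.sub)) →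
            Holds w' C (xs.append (t ∷ (ys.map ρ.sub).map ρ'.sub))) →
      ∀ xs : Env w.ctx τs, Holds w A (xs.append (l ∷ ys.map ρ.sub)) →
        Holds w C (xs.append (l ∷ ys.map ρ.sub)))
    {l : Q w₀.ctx (.star .atmlst)} (hl : ListA w₀ l) (xs : Env w₀.ctx τs)
    (h : Holds w₀ A (xs.append (l ∷ ys))) : Holds w₀ C (xs.append (l ∷ ys)) := by
  -- Inserts the length as an additional variable, on which the rule to be proved does not depend.
  let θ : Sub S (.star .atmlst :: Φ) (.star .atmlst :: .nt :: Φ) :=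
    Sub.cons v0 fun _ x => .var (.succ (.succ x))
  have hθ : ∀ {w : World D} (l : Q w.ctx (.star .atmlst)) (n : Q w.ctx .nt) (zs : Env w.ctx Φ),
      θ.eval (l ∷ n ∷ zs) = l ∷ zs := by
    intro w l n zs
    ext τ x
    cases x <;> simp [θ, Sub.cons]
  have key : Holds w₀ (.rule τs [A] C) (l ∷ ys) := by
    refine hl.length.elim ?_
    rintro w₁ ρ₁ ⟨n, hn, hln⟩
    have := nat_rule (τs := [.star .atmlst]) (ys := ys.map ρ₁.sub) (fLength .atm 1 v0 v1)
      (Fm.subst θ (.rule τs [A] C)) ?_ hn (l ↾ ρ₁ ∷ .nil) (by simpa using hln)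
    · simpa [holds_subst, hθ] using this
    · simp only [Env.forall_cons, Env.forall_nil, Env.cons_append, Env.nil_append, holds_subst, hθ,
        holds_lengthA, Tm.eval_var, Env.get_zero, Env.get_succ]
      intro w ρ i hi ih l hl
      refine holds_rule.2 fun w' ρ' xs hA => ?_
      rw [List.forall_mem_singleton] at hA
      have := step w' ((ρ₁.comp ρ).comp ρ') (l ↾ ρ') ((hl.mono ρ').list (hi.mono ρ')) ?_ xs
      · simp only [Env.map_cons, Env.map_hom_comp] at this hA ⊢
        exact this hA
      · intro w'' ρ'' a t e
        have hl' := (hl.mono ρ').mono ρ''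
        rw [e] at hl'
        refine ⟨J.listA hl'.cons_inv ?_, fun xs hA => hl'.cons_inv.elim ?_⟩
        · rintro w₃ ρ₃ ⟨m, e, hm⟩
          exact hm.list (ih w₃ ((ρ'.comp ρ'').comp ρ₃) m (by simpa using e)).1
        · rintro w₃ ρ₃ ⟨m, e, hm⟩
          have h₃ := (ih w₃ ((ρ'.comp ρ'').comp ρ₃) m (by simpa using e)).2 _ hm
          have := holds_rule.1 h₃ w₃ (Hom.id w₃) (xs.map ρ₃.sub)
          simp only [List.forall_mem_singleton, Env.map_cons, Env.map_hom_comp, Env.map_append,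
            Q.map_hom_id, Env.map_hom_id] at this hA ⊢
          refine this ?_
          simpa only [Env.map_append, Env.map_cons] using hA.mono ρ₃
  have := holds_rule.1 key w₀ (Hom.id w₀) xs
  rw [Env.map_hom_id, List.forall_mem_singleton] at this
  exact this h

theorem ListA.nil [LinDef D] : ListA w qanil := (LengthACase.nil).intro.list .zero

theorem ListA.cons [LinDef D] {a : Q w.ctx (.star .atm)} {l : Q w.ctx (.star .atmlst)}
    (h : ListA w l) :
    ListA w (qacons a l) := by
  refine J.listA h.length ?_
  rintro w' ρ ⟨n, hn, hl⟩
  rw [map_qacons]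
  exact (LengthACase.cons hl).intro.list hn.succ

/-- A list is empty or not. -/
inductive ListACase (w : World D) : (l : Q w.ctx (.star .atmlst)) → Prop
  | nil : ListACase w qanil
  | cons {a l} : ListACase w (qacons a l)

theorem ListA.cases [LinDef D] {l : Q w.ctx (.star .atmlst)} (h : ListA w l) :
    J w (fun w' ρ => ListACase w' (l ↾ ρ)) := by
  refine h.length.bind ?_
  rintro w' ρ ⟨n, hn, hl⟩
  refine hl.cases.imp fun w'' ρ' hc => ?_
  rw [Q.map_hom_comp]
  generalize l ↾ ρ ↾ ρ' = m at hc ⊢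
  generalize n ↾ ρ' = k at hc
  cases hc with
  | nil => exact .nil
  | cons => exact .cons

theorem LengthP.cons_inv [LinDef D] {a : Q w.ctx (.star .prp)} {t : Q w.ctx (.star .prplst)}
    {n : Q w.ctx .nt} (h : LengthP w (qpcons a t) n) :
    J w (fun w' ρ => ∃ m, n ↾ ρ = qs m ∧ LengthP w' (t ↾ ρ) m) := by
  refine h.cases.imp fun w' ρ hc => ?_
  rw [map_qpcons] at hc
  generalize hm : qpcons (a ↾ ρ) (t ↾ ρ) = m at hc
  generalize n ↾ ρ = k at hc ⊢
  cases hc with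
  | nil => exact (qpnil_ne_qpcons hm.symm).elim
  | cons h =>
    obtain ⟨-, rfl⟩ := qpcons_injective hm
    exact ⟨_, rfl, h⟩

theorem listP_rule [LinDef D] {w₀ : World D} {ys : Env w₀.ctx Φ} {τs : Ctx S}
    (A C : Fm S (τs ++ .star .prplst :: Φ))
    (step : ∀ (w : World D) (ρ : Hom w₀ w) (l : Q w.ctx (.star .prplst)), ListP w l →
      (∀ (w' : World D) (ρ' : Hom w w') (a : Q w'.ctx (.star .prp)) (t : Q w'.ctx (.star .prplst)),
        l ↾ ρ' = qpcons a t → ListP w' t ∧ ∀ xs : Env w'.ctx τs,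
          Holds w' A (xs.append (t ∷ (ys.map ρ.sub).map ρ'.sub)) →
            Holds w' C (xs.append (t ∷ (ys.map ρ.sub).map ρ'.sub))) →
      ∀ xs : Env w.ctx τs, Holds w A (xs.append (l ∷ ys.map ρ.sub)) →
        Holds w C (xs.append (l ∷ ys.map ρ.sub)))
    {l : Q w₀.ctx (.star .prplst)} (hl : ListP w₀ l) (xs : Env w₀.ctx τs)
    (h : Holds w₀ A (xs.append (l ∷ ys))) : Holds w₀ C (xs.append (l ∷ ys)) := by
  let θ : Sub S (.star .prplst :: Φ) (.star .prplst :: .nt :: Φ) :=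
    Sub.cons v0 fun _ x => .var (.succ (.succ x))
  have hθ : ∀ {w : World D} (l : Q w.ctx (.star .prplst)) (n : Q w.ctx .nt) (zs : Env w.ctx Φ),
      θ.eval (l ∷ n ∷ zs) = l ∷ zs := by
    intro w l n zs
    ext τ x
    cases x <;> simp [θ, Sub.cons]
  have key : Holds w₀ (.rule τs [A] C) (l ∷ ys) := by
    refine hl.length.elim ?_
    rintro w₁ ρ₁ ⟨n, hn, hln⟩
    have := nat_rule (τs := [.star .prplst]) (ys := ys.map ρ₁.sub) (fLength .prp 1 v0 v1)
      (Fm.subst θ (.rule τs [A] C)) ?_ hn (l ↾ ρ₁ ∷ .nil) (by simpa using hln)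
    · simpa [holds_subst, hθ] using this
    · simp only [Env.forall_cons, Env.forall_nil, Env.cons_append, Env.nil_append, holds_subst, hθ,
        holds_lengthP, Tm.eval_var, Env.get_zero, Env.get_succ]
      intro w ρ i hi ih l hl
      refine holds_rule.2 fun w' ρ' xs hA => ?_
      rw [List.forall_mem_singleton] at hA
      have := step w' ((ρ₁.comp ρ).comp ρ') (l ↾ ρ') ((hl.mono ρ').list (hi.mono ρ')) ?_ xs
      · simp only [Env.map_cons, Env.map_hom_comp] at this hA ⊢
        exact this hA
      · intro w'' ρ'' a t e
        have hl' := (hl.mono ρ').mono ρ''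
        rw [e] at hl'
        refine ⟨J.listP hl'.cons_inv ?_, fun xs hA => hl'.cons_inv.elim ?_⟩
        · rintro w₃ ρ₃ ⟨m, e, hm⟩
          exact hm.list (ih w₃ ((ρ'.comp ρ'').comp ρ₃) m (by simpa using e)).1
        · rintro w₃ ρ₃ ⟨m, e, hm⟩
          have h₃ := (ih w₃ ((ρ'.comp ρ'').comp ρ₃) m (by simpa using e)).2 _ hm
          have := holds_rule.1 h₃ w₃ (Hom.id w₃) (xs.map ρ₃.sub)
          simp only [List.forall_mem_singleton, Env.map_cons, Env.map_hom_comp, Env.map_append,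
            Q.map_hom_id, Env.map_hom_id] at this hA ⊢
          refine this ?_
          simpa only [Env.map_append, Env.map_cons] using hA.mono ρ₃
  have := holds_rule.1 key w₀ (Hom.id w₀) xs
  rw [Env.map_hom_id, List.forall_mem_singleton] at this
  exact this h

theorem ListP.nil [LinDef D] : ListP w qpnil := (LengthPCase.nil).intro.list .zero

theorem ListP.cons [LinDef D] {a : Q w.ctx (.star .prp)} {l : Q w.ctx (.star .prplst)}
    (h : ListP w l) :
    ListP w (qpcons a l) := by
  refine J.listP h.length ?_
  rintro w' ρ ⟨n, hn, hl⟩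
  rw [map_qpcons]
  exact (LengthPCase.cons hl).intro.list hn.succ

/-- A list is empty or not. -/
inductive ListPCase (w : World D) : (l : Q w.ctx (.star .prplst)) → Prop
  | nil : ListPCase w qpnil
  | cons {a l} : ListPCase w (qpcons a l)

theorem ListP.cases [LinDef D] {l : Q w.ctx (.star .prplst)} (h : ListP w l) :
    J w (fun w' ρ => ListPCase w' (l ↾ ρ)) := by
  refine h.length.bind ?_
  rintro w' ρ ⟨n, hn, hl⟩
  refine hl.cases.imp fun w'' ρ' hc => ?_
  rw [Q.map_hom_comp]
  generalize l ↾ ρ ↾ ρ' = m at hc ⊢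
  generalize n ↾ ρ' = k at hc
  cases hc with
  | nil => exact .nil
  | cons => exact .cons

end FOLDN

/-! ### Lists of hypotheses: splitting, permutation and inclusion -/

namespace FOLDN

variable {S : Sig} {D : Set (Clause S)} {w w' : World D}

/-- Inclusion of lists. -/
def SubA (w : World D) (l l' : Q w.ctx (.star .atmlst)) : Prop :=
  ∀ (w' : World D) (ρ : Hom w w') (a : Q w'.ctx (.star .atm)), ElemA w' a (l ↾ ρ) → ElemA w' a
    (l' ↾ ρ)

theorem SubA.mono {l l' : Q w.ctx (.star .atmlst)} (h : SubA w l l') (ρ : Hom w w') :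
    SubA w' (l ↾ ρ) (l' ↾ ρ) := fun w'' ρ' a ha => by
  have := h w'' (ρ.comp ρ') a
  simp only [Q.map_hom_comp] at this
  exact this ha

theorem SubA.elem {l l' : Q w.ctx (.star .atmlst)} (h : SubA w l l') {a : Q w.ctx (.star .atm)}
    (ha : ElemA w a l) : ElemA w a l' := by
  simpa using h w (Hom.id w) a (by simpa using ha)

theorem SubA.refl (l : Q w.ctx (.star .atmlst)) : SubA w l l := fun _ _ _ h => h

variable [LinDef D]

/-! ### Lists of hypotheses -/

section

set_option linter.unusedSimpArgs false

theorem ListA.split_nil {l : Q w.ctx (.star .atmlst)} (hl : ListA w l) : SplitA w l qanil l := by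
  have := listA_rule (Φ := []) (τs := []) (ys := .nil) .top (fSplit .atm 1 v0 anil v0) ?_ hl .nil
    (by simp)
  · simpa using this
  · simp only [Env.forall_cons, Env.forall_nil, Env.cons_append, Env.nil_append, Env.map_cons,
      Env.map_nil, holds_and, and_imp, holds_top, true_imp_iff, holds_ex, holds_ex_ex, holds_split,
      holds_listA, holds_permute, holds_element, Tm.eval_var, Env.get_zero, Env.get_succ, eval_anil,
      eval_acons, eval_shift]
    intro w ρ l hl ih
    refine hl.cases.splitA fun w' ρ' hc => ?_
    generalize e : l ↾ ρ' = m at hc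
    cases hc with
    | nil => simpa using SplitCase.nil.intro
    | cons => simpa using (SplitCase.right (ih w' ρ' _ _ e).2).intro

theorem SplitA.lists {l l₁ l₂ : Q w.ctx (.star .atmlst)} (h : SplitA w l l₁ l₂) (hl : ListA w l) :
    ListA w l₁ ∧ ListA w l₂ := by
  have := listA_rule (Φ := []) (τs := [.star .atmlst, .star .atmlst]) (ys := .nil)
    (fSplit .atm 1 v2 v0 v1) (fList .atm 1 v0 ⊓ₘ fList .atm 1 v1) ?_ hl (l₁ ∷ l₂ ∷ .nil)
    (by simpa using h)
  · simpa using this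
  · simp only [Env.forall_cons, Env.forall_nil, Env.cons_append, Env.nil_append, Env.map_cons,
      Env.map_nil, holds_and, and_imp, holds_top, true_imp_iff, holds_ex, holds_ex_ex, holds_split,
      holds_listA, holds_permute, holds_element, Tm.eval_var, Env.get_zero, Env.get_succ, eval_anil,
      eval_acons, eval_shift]
    intro w ρ l hl ih l₁ l₂ h
    refine ⟨h.cases.listA fun w' ρ' hc => ?_, h.cases.listA fun w' ρ' hc => ?_⟩
    all_goals
      generalize e : l ↾ ρ' = m at hc
      generalize l₁ ↾ ρ' = m₁ at hc ⊢
      generalize l₂ ↾ ρ' = m₂ at hc ⊢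
    · cases hc with
      | nil => exact .nil
      | left h => exact ((ih w' ρ' _ _ e).2 _ _ h).1.cons
      | right h => exact ((ih w' ρ' _ _ e).2 _ _ h).1
    · cases hc with
      | nil => exact .nil
      | left h => exact ((ih w' ρ' _ _ e).2 _ _ h).2
      | right h => exact ((ih w' ρ' _ _ e).2 _ _ h).2.cons

theorem SplitA.comm {l l₁ l₂ : Q w.ctx (.star .atmlst)} (h : SplitA w l l₁ l₂) (hl : ListA w l) :
    SplitA w l l₂ l₁ := by
  have := listA_rule (Φ := []) (τs := [.star .atmlst, .star .atmlst]) (ys := .nil)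
    (fSplit .atm 1 v2 v0 v1) (fSplit .atm 1 v2 v1 v0) ?_ hl (l₁ ∷ l₂ ∷ .nil)
    (by simpa using h)
  · simpa using this
  · simp only [Env.forall_cons, Env.forall_nil, Env.cons_append, Env.nil_append, Env.map_cons,
      Env.map_nil, holds_and, and_imp, holds_top, true_imp_iff, holds_ex, holds_ex_ex, holds_split,
      holds_listA, holds_permute, holds_element, Tm.eval_var, Env.get_zero, Env.get_succ, eval_anil,
      eval_acons, eval_shift]
    intro w ρ l hl ih l₁ l₂ h
    refine h.cases.splitA fun w' ρ' hc => ?_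
    generalize e : l ↾ ρ' = m at hc
    generalize l₁ ↾ ρ' = m₁ at hc ⊢
    generalize l₂ ↾ ρ' = m₂ at hc ⊢
    cases hc with
    | nil => exact SplitCase.nil.intro
    | left h => exact (SplitCase.right ((ih w' ρ' _ _ e).2 _ _ h)).intro
    | right h => exact (SplitCase.left ((ih w' ρ' _ _ e).2 _ _ h)).intro

/-- Induction on `l`. An element that goes to `l₂` is added to `n` on the right. One that goes to
`l₁` is followed one step further: it ends up in `m`, or in `k` and hence in `n`. -/
theorem SplitA.assoc {l l₁ l₂ m k : Q w.ctx (.star .atmlst)} (hl : ListA w l)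
    (h : SplitA w l l₁ l₂) (h' : SplitA w l₁ m k) :
    J w (fun w' ρ => ∃ n, SplitA w' (l ↾ ρ) (m ↾ ρ) n ∧ SplitA w' n (k ↾ ρ) (l₂ ↾ ρ)) := by
  have := listA_rule (Φ := []) (τs := [.star .atmlst, .star .atmlst, .star .atmlst, .star .atmlst])
    (ys := .nil) (fSplit .atm 1 v4 v0 v1 ⊓ₘ fSplit .atm 1 v0 v2 v3)
    (.ex (.star .atmlst) (fSplit .atm 1 v5 v3 v0 ⊓ₘ fSplit .atm 1 v0 v4 v2)) ?_ hl
    (l₁ ∷ l₂ ∷ m ∷ k ∷ .nil) (by simpa using ⟨h, h'⟩)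
  · simpa using this
  · simp only [Env.forall_cons, Env.forall_nil, Env.cons_append, Env.nil_append, Env.map_cons,
      Env.map_nil, holds_and, and_imp, holds_top, true_imp_iff, holds_ex, holds_ex_ex, holds_split,
      holds_listA, holds_permute, holds_element, Tm.eval_var, Env.get_zero, Env.get_succ, eval_anil,
      eval_acons, eval_shift]
    intro w ρ l hl ih l₁ l₂ m k h h'
    refine h.cases.bind fun w₁ ρ₁ hc => ?_
    replace h' := h'.mono ρ₁
    replace ih := fun w' ρ' => ih w' (ρ₁.comp ρ')
    simp only [Q.map_hom_comp] at ih ⊢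
    generalize l ↾ ρ₁ = l at hc ih ⊢
    generalize l₁ ↾ ρ₁ = l₁ at hc h' ⊢
    generalize l₂ ↾ ρ₁ = l₂ at hc ⊢
    generalize m ↾ ρ₁ = m at h' ⊢
    generalize k ↾ ρ₁ = k at h' ⊢
    refine h'.cases.bind fun w₂ ρ₂ hc' => ?_
    replace ih := fun a t e => (ih w₂ ρ₂ a t e).2
    simp only [Q.map_hom_comp]
    generalize m ↾ ρ₂ = m at hc' ⊢
    generalize k ↾ ρ₂ = k at hc' ⊢
    cases hc with
    | nil =>
      rw [map_qanil] at hc' ⊢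
      generalize e : (qanil : Q w₂.ctx _) = x at hc'
      cases hc' with
      | nil => exact .pure ⟨qanil, by simpa using SplitCase.nil.intro, by simpa using
        SplitCase.nil.intro⟩
      | left => exact (qanil_ne_qacons e).elim
      | right => exact (qanil_ne_qacons e).elim
    | @left a t t₁ _ h =>
      replace h := h.mono ρ₂
      rw [map_qacons] at hc' ih ⊢
      generalize e : qacons (a ↾ ρ₂) (t₁ ↾ ρ₂) = x at hc'
      cases hc' with
      | nil => exact (qanil_ne_qacons e.symm).elim
      | left h' =>
        obtain ⟨rfl, rfl⟩ := qacons_injective e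
        refine (ih _ _ rfl _ _ _ _ h h').imp ?_
        rintro w₃ ρ₃ ⟨n, h₁, h₂⟩
        exact ⟨n, by simpa using (SplitCase.left h₁).intro, h₂⟩
      | right h' =>
        obtain ⟨rfl, rfl⟩ := qacons_injective e
        refine (ih _ _ rfl _ _ _ _ h h').imp ?_
        rintro w₃ ρ₃ ⟨n, h₁, h₂⟩
        exact ⟨qacons (a ↾ ρ₂ ↾ ρ₃) n, by simpa using (SplitCase.right h₁).intro,
          by simpa using (SplitCase.left h₂).intro⟩
    | @right a t _ t₂ h =>
      replace h := h.mono ρ₂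
      rw [map_qacons] at ih ⊢
      refine (ih _ _ rfl _ _ _ _ h hc'.intro).imp ?_
      rintro w₃ ρ₃ ⟨n, h₁, h₂⟩
      exact ⟨qacons (a ↾ ρ₂ ↾ ρ₃) n, by simpa using (SplitCase.right h₁).intro,
        by simpa using (SplitCase.right h₂).intro⟩

theorem SplitA.assoc' {l l₁ l₂ m k : Q w.ctx (.star .atmlst)} (hl : ListA w l)
    (h : SplitA w l l₁ l₂) (h' : SplitA w l₂ m k) :
    J w (fun w' ρ => ∃ n, SplitA w' n (l₁ ↾ ρ) (m ↾ ρ) ∧ SplitA w' (l ↾ ρ) n (k ↾ ρ)) := by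
  refine (SplitA.assoc hl (h.comm hl) (h'.comm (h.lists hl).2)).imp ?_
  rintro w' ρ ⟨n, h₁, h₂⟩
  have hl' := hl.mono ρ
  exact ⟨n, h₂.comm (h₁.lists hl').2, h₁.comm hl'⟩

theorem SplitA.list {l l₁ l₂ : Q w.ctx (.star .atmlst)} (h : SplitA w l l₁ l₂)
    (h₁ : ListA w l₁) (h₂ : ListA w l₂) : ListA w l := by
  have := listA_rule (Φ := []) (τs := [.star .atmlst, .star .atmlst]) (ys := .nil)
    (fList .atm 1 v0 ⊓ₘ fSplit .atm 1 v1 v2 v0) (fList .atm 1 v1) ?_ h₁ (l₂ ∷ l ∷ .nil)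
    (by simpa using ⟨h₂, h⟩)
  · simpa using this
  · simp only [Env.forall_cons, Env.forall_nil, Env.cons_append, Env.nil_append, Env.map_cons,
      Env.map_nil, holds_and, and_imp, holds_top, true_imp_iff, holds_ex, holds_ex_ex, holds_split,
      holds_listA, holds_permute, holds_element, Tm.eval_var, Env.get_zero, Env.get_succ, eval_anil,
      eval_acons, eval_shift]
    intro w ρ l₁ h₁ ih l₂ l h₂ h
    -- A second induction inside the first one: the head of `l` may come from either part, and in
    -- each case only this part becomes shorter.
    have := listA_rule (τs := [.star .atmlst]) (ys := l₁ ∷ .nil)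
      (fSplit .atm 1 v0 v2 v1) (fList .atm 1 v0) ?_ h₂ (l ∷ .nil) (by simpa using h)
    · simpa using this
    · simp only [Env.forall_cons, Env.forall_nil, Env.cons_append, Env.nil_append, Env.map_cons,
      Env.map_nil, holds_and, and_imp, holds_top, true_imp_iff, holds_ex, holds_ex_ex, holds_split,
      holds_listA, holds_permute, holds_element, Tm.eval_var, Env.get_zero, Env.get_succ, eval_anil,
      eval_acons, eval_shift]
      intro w₁ ρ₁ l₂ h₂ ih' l h
      refine h.cases.listA fun w₂ ρ₂ hc => ?_
      replace ih := ih w₂ (ρ₁.comp ρ₂)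
      replace ih' := ih' w₂ ρ₂
      replace h₂ := h₂.mono ρ₂
      simp only [Q.map_hom_comp] at ih
      generalize l ↾ ρ₂ = l at hc ⊢
      generalize l₁ ↾ ρ₁ ↾ ρ₂ = l₁ at hc ih ih'
      generalize l₂ ↾ ρ₂ = l₂ at hc ih' h₂
      cases hc with
      | nil => exact .nil
      | left h => exact ((ih _ _ rfl).2 _ _ h₂ h).cons
      | right h => exact ((ih' _ _ rfl).2 _ h).cons

theorem ListA.perm_refl {l : Q w.ctx (.star .atmlst)} (hl : ListA w l) : PermA w l l := by
  have := listA_rule (Φ := []) (τs := []) (ys := .nil) .top (fPermute .atm 1 v0 v0) ?_ hl .nil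
    (by simp)
  · simpa using this
  · simp only [Env.forall_cons, Env.forall_nil, Env.cons_append, Env.nil_append, Env.map_cons,
      Env.map_nil, holds_and, and_imp, holds_top, true_imp_iff, holds_ex, holds_ex_ex, holds_split,
      holds_listA, holds_permute, holds_element, Tm.eval_var, Env.get_zero, Env.get_succ, eval_anil,
      eval_acons, eval_shift]
    intro w ρ l hl ih
    refine hl.cases.permA fun w' ρ' hc => ?_
    generalize e : l ↾ ρ' = m at hc
    cases hc with
    | nil => exact PermCase.nil.intro
    | cons =>
      obtain ⟨ht, ih⟩ := ih w' ρ' _ _ e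
      exact (PermCase.cons (SplitCase.left ht.split_nil).intro ih).intro

theorem PermA.cons {l l' : Q w.ctx (.star .atmlst)} {a : Q w.ctx (.star .atm)}
    (h : PermA w l l') (hl : ListA w l') : PermA w (qacons a l) (qacons a l') :=
  (PermCase.cons (SplitCase.left hl.split_nil).intro h).intro

theorem ListA.perm_swap {l : Q w.ctx (.star .atmlst)} (hl : ListA w l) (a b : Q w.ctx (.star .atm))
    :
    PermA w (qacons a (qacons b l)) (qacons b (qacons a l)) :=
  (PermCase.cons (SplitCase.right (SplitCase.left hl.split_nil).intro).intro
    hl.cons.perm_refl).intro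

theorem PermA.list {l l' : Q w.ctx (.star .atmlst)} (h : PermA w l l') (hl : ListA w l) :
    ListA w l' := by
  have := listA_rule (Φ := []) (τs := [.star .atmlst]) (ys := .nil)
    (fPermute .atm 1 v1 v0) (fList .atm 1 v0) ?_ hl (l' ∷ .nil) (by simpa using h)
  · simpa using this
  · simp only [Env.forall_cons, Env.forall_nil, Env.cons_append, Env.nil_append, Env.map_cons,
      Env.map_nil, holds_and, and_imp, holds_top, true_imp_iff, holds_ex, holds_ex_ex, holds_split,
      holds_listA, holds_permute, holds_element, Tm.eval_var, Env.get_zero, Env.get_succ, eval_anil,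
      eval_acons, eval_shift]
    intro w ρ l hl ih l' h
    refine h.cases.listA fun w' ρ' hc => ?_
    generalize e : l ↾ ρ' = m at hc
    generalize l' ↾ ρ' = m' at hc ⊢
    cases hc with
    | nil => exact .nil
    | cons h h' => exact h.list ListA.nil.cons ((ih w' ρ' _ _ e).2 _ h')

theorem PermA.nil_inv {l : Q w.ctx (.star .atmlst)} (h : PermA w qanil l) :
    J w (fun _ ρ => l ↾ ρ = qanil) := by
  refine h.cases.imp fun w' ρ hc => ?_
  rw [map_qanil] at hc
  generalize e : (qanil : Q w'.ctx _) = x at hc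
  generalize l ↾ ρ = l at hc ⊢
  cases hc with
  | nil => rfl
  | cons => exact (qanil_ne_qacons e).elim

/-- Inversion of permutations of a list with one element. -/
theorem PermA.single_inv {a : Q w.ctx (.star .atm)} {l : Q w.ctx (.star .atmlst)}
    (h : PermA w (qacons a qanil) l) : J w (fun _ ρ => l ↾ ρ = qacons (a ↾ ρ) qanil) := by
  refine h.cases.bind fun w₁ ρ₁ hc => ?_
  rw [map_qacons, map_qanil] at hc
  simp only [Q.map_hom_comp]
  generalize a ↾ ρ₁ = a at hc ⊢
  generalize l ↾ ρ₁ = l at hc ⊢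
  generalize e : qacons a qanil = x at hc
  cases hc with
  | nil => exact (qanil_ne_qacons e.symm).elim
  | cons h h' =>
    obtain ⟨rfl, rfl⟩ := qacons_injective e
    refine h'.nil_inv.bind fun w₂ ρ₂ e₂ => ?_
    replace h := h.mono ρ₂
    simp only [Q.map_hom_comp]
    rw [e₂, map_qacons, map_qanil] at h
    generalize a ↾ ρ₂ = a at h ⊢
    generalize l ↾ ρ₂ = l at h ⊢
    refine h.cases.bind fun w₃ ρ₃ hc => ?_
    rw [map_qacons, map_qanil] at hc
    simp only [Q.map_hom_comp]
    generalize a ↾ ρ₃ = a at hc ⊢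
    generalize l ↾ ρ₃ = l at hc ⊢
    generalize e : qacons a qanil = x at hc
    generalize e' : (qanil : Q w₃.ctx _) = y at hc
    cases hc with
    | nil => exact (qanil_ne_qacons e.symm).elim
    | right => exact (qanil_ne_qacons e').elim
    | left h =>
      obtain ⟨rfl, rfl⟩ := qacons_injective e
      subst e'
      refine h.cases.imp fun w₄ ρ₄ hc => ?_
      rw [map_qanil] at hc
      rw [map_qacons]
      generalize e' : (qanil : Q w₄.ctx _) = y at hc
      generalize _ ↾ ρ₄ = l at hc ⊢
      cases hc with
      | nil => rfl
      | left => exact (qanil_ne_qacons e').elim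
      | right => exact (qanil_ne_qacons e').elim

/-- At each step only the clause that feeds the right part is possible. Permutation, not equality,
is concluded because it is what the structural rules consume. -/
theorem SplitA.perm {l l₂ : Q w.ctx (.star .atmlst)} (h : SplitA w l qanil l₂) (hl : ListA w l₂) :
    PermA w l₂ l := by
  have := listA_rule (Φ := []) (τs := [.star .atmlst]) (ys := .nil)
    (fSplit .atm 1 v0 anil v1) (fPermute .atm 1 v1 v0) ?_ hl (l ∷ .nil) (by simpa using h)
  · simpa using this
  · simp only [Env.forall_cons, Env.forall_nil, Env.cons_append, Env.nil_append, Env.map_cons,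
      Env.map_nil, holds_and, and_imp, holds_top, true_imp_iff, holds_ex, holds_ex_ex, holds_split,
      holds_listA, holds_permute, holds_element, Tm.eval_var, Env.get_zero, Env.get_succ, eval_anil,
      eval_acons, eval_shift]
    intro w ρ l₂ hl ih l h
    refine h.cases.permA fun w' ρ' hc => ?_
    rw [map_qanil] at hc
    generalize e : l₂ ↾ ρ' = m at hc
    generalize l ↾ ρ' = m' at hc ⊢
    generalize e' : (qanil : Q w'.ctx _) = y at hc
    cases hc with
    | nil => exact PermCase.nil.intro
    | left => exact (qanil_ne_qacons e').elim
    | right h =>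
      subst e'
      exact (PermCase.cons (SplitCase.left h).intro (ih w' ρ' _ _ e).1.perm_refl).intro

/-- A permutation carries a splitting along. By induction the rest of `l'`, with the partner of the
head of `l` taken out, splits suitably; associativity puts this element into the part where the head
of `l` went. -/
theorem PermA.split {l l' l₁ l₂ : Q w.ctx (.star .atmlst)} (h : PermA w l l') (hl : ListA w l)
    (hl' : ListA w l') (h' : SplitA w l l₁ l₂) :
    J w (fun w' ρ => ∃ l₁' l₂', SplitA w' (l' ↾ ρ) l₁' l₂' ∧ PermA w' (l₁ ↾ ρ) l₁' ∧
      PermA w' (l₂ ↾ ρ) l₂') := by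
  have := listA_rule (Φ := []) (τs := [.star .atmlst, .star .atmlst, .star .atmlst])
    (ys := .nil) (fPermute .atm 1 v3 v0 ⊓ₘ fList .atm 1 v0 ⊓ₘ fSplit .atm 1 v3 v1 v2)
    (.ex (.star .atmlst) (.ex (.star .atmlst) (fSplit .atm 1 v2 v1 v0 ⊓ₘ fPermute .atm 1 v3 v1 ⊓ₘ
      fPermute .atm 1 v4 v0))) ?_ hl (l' ∷ l₁ ∷ l₂ ∷ .nil) (by simpa using ⟨h, hl', h'⟩)
  · simpa using this
  · simp only [Env.forall_cons, Env.forall_nil, Env.cons_append, Env.nil_append, Env.map_cons,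
      Env.map_nil, holds_and, and_imp, holds_top, true_imp_iff, holds_ex_ex, holds_split,
      holds_listA, holds_permute, holds_element, Tm.eval_var, Env.get_zero, Env.get_succ, eval_anil,
      eval_acons, eval_shift]
    intro w ρ l hl ih l' l₁ l₂ h hl' h'
    refine h'.cases.bind fun w₁ ρ₁ hc => ?_
    replace h := h.mono ρ₁
    replace hl' := hl'.mono ρ₁
    replace ih := fun w' ρ' => ih w' (ρ₁.comp ρ')
    simp only [Q.map_hom_comp] at ih ⊢
    generalize l ↾ ρ₁ = l at hc h ih
    generalize l₁ ↾ ρ₁ = l₁ at hc ⊢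
    generalize l₂ ↾ ρ₁ = l₂ at hc ⊢
    generalize l' ↾ ρ₁ = l' at h hl' ⊢
    refine h.cases.bind fun w₂ ρ₂ hc' => ?_
    replace ih := fun a t e => (ih w₂ ρ₂ a t e).2
    replace hl' := hl'.mono ρ₂
    simp only [Q.map_hom_comp]
    generalize l' ↾ ρ₂ = l' at hc' hl' ⊢
    cases hc with
    | nil =>
      rw [map_qanil] at hc' ⊢
      generalize e : (qanil : Q w₂.ctx _) = x at hc'
      cases hc' with
      | nil =>
        exact .pure ⟨qanil, qanil, by
          simpa using SplitCase.nil.intro, by simpa using PermCase.nil.intro,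
          by simpa using PermCase.nil.intro⟩
      | cons => exact (qanil_ne_qacons e).elim
    | @left a t t₁ _ h =>
      replace h := h.mono ρ₂
      rw [map_qacons] at hc' ih ⊢
      generalize e : qacons (a ↾ ρ₂) (t ↾ ρ₂) = x at hc'
      cases hc' with
      | nil => exact (qanil_ne_qacons e.symm).elim
      | cons h₁ h₂ =>
        obtain ⟨rfl, rfl⟩ := qacons_injective e
        refine (ih _ _ rfl _ _ _ h₂ (h₁.lists hl').2 h).bind ?_
        rintro w₃ ρ₃ ⟨n₁, n₂, k, k₁, k₂⟩
        refine (SplitA.assoc' (hl'.mono ρ₃) (h₁.mono ρ₃) k).imp ?_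
        rintro w₄ ρ₄ ⟨n, s₁, s₂⟩
        simp only [Q.map_hom_comp, map_qacons, map_qanil] at s₁ s₂ ⊢
        exact ⟨n, n₂ ↾ ρ₄, s₂, (PermCase.cons s₁ (k₁.mono ρ₄)).intro, k₂.mono ρ₄⟩
    | @right a t _ t₂ h =>
      replace h := h.mono ρ₂
      rw [map_qacons] at hc' ih ⊢
      generalize e : qacons (a ↾ ρ₂) (t ↾ ρ₂) = x at hc'
      cases hc' with
      | nil => exact (qanil_ne_qacons e.symm).elim
      | cons h₁ h₂ =>
        obtain ⟨rfl, rfl⟩ := qacons_injective e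
        refine (ih _ _ rfl _ _ _ h₂ (h₁.lists hl').2 h).bind ?_
        rintro w₃ ρ₃ ⟨n₁, n₂, k, k₁, k₂⟩
        refine (SplitA.assoc' (hl'.mono ρ₃) (h₁.mono ρ₃)
          (k.comm ((h₁.lists hl').2.mono ρ₃))).imp ?_
        rintro w₄ ρ₄ ⟨n, s₁, s₂⟩
        simp only [Q.map_hom_comp, map_qacons, map_qanil] at s₁ s₂ ⊢
        exact ⟨n₁ ↾ ρ₄, n, s₂.comm ((hl'.mono ρ₃).mono ρ₄), k₁.mono ρ₄,
          (PermCase.cons s₁ (k₂.mono ρ₄)).intro⟩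

theorem ElemA.cons_inv {a b : Q w.ctx (.star .atm)} {l : Q w.ctx (.star .atmlst)}
    (h : ElemA w a (qacons b l)) :
    J w (fun w' ρ => a ↾ ρ = b ↾ ρ ∨ ElemA w' (a ↾ ρ) (l ↾ ρ)) := by
  refine h.cases.imp fun w' ρ hc => ?_
  rw [map_qacons] at hc
  generalize a ↾ ρ = a at hc ⊢
  generalize e : qacons (b ↾ ρ) (l ↾ ρ) = x at hc
  cases hc with
  | head => exact .inl (qacons_injective e).1.symm
  | tail h =>
    obtain ⟨-, rfl⟩ := qacons_injective e
    exact .inr h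

/-! ### Shifts of lists -/

theorem ListA.shift {l : Q w.ctx (.star .atmlst)} (hl : ListA w l) : ListA w (qshift l) := by
  have := listA_rule (Φ := []) (τs := []) (ys := .nil) .top
    (fList .atm 1 (FOLDN.shift (τ := .atmlst) v0)) ?_ hl .nil
    (by simp)
  · simpa using this
  · simp only [Env.forall_cons, Env.forall_nil, Env.cons_append, Env.nil_append, Env.map_cons,
      Env.map_nil, holds_and, and_imp, holds_top, true_imp_iff, holds_ex, holds_ex_ex, holds_split,
      holds_listA, holds_permute, holds_element, Tm.eval_var, Env.get_zero, Env.get_succ, eval_anil,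
      eval_acons, eval_shift]
    intro w ρ l hl ih
    refine hl.cases.listA fun w' ρ' hc => ?_
    rw [map_qshift]
    generalize e : l ↾ ρ' = m at hc
    cases hc with
    | nil => rw [qshift_qanil]; exact .nil
    | cons => rw [qshift_qacons]; exact (ih w' ρ' _ _ e).2.cons

theorem SplitA.shift {l l₁ l₂ : Q w.ctx (.star .atmlst)} (h : SplitA w l l₁ l₂) (hl : ListA w l) :
    SplitA w (qshift l) (qshift l₁) (qshift l₂) := by
  have := listA_rule (Φ := []) (τs := [.star .atmlst, .star .atmlst]) (ys := .nil)
    (fSplit .atm 1 v2 v0 v1) (fSplit .atm 1 (FOLDN.shift (τ := .atmlst) v2)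
      (FOLDN.shift (τ := .atmlst) v0) (FOLDN.shift (τ := .atmlst) v1)) ?_ hl
    (l₁ ∷ l₂ ∷ .nil) (by simpa using h)
  · simpa using this
  · simp only [Env.forall_cons, Env.forall_nil, Env.cons_append, Env.nil_append, Env.map_cons,
      Env.map_nil, holds_and, and_imp, holds_top, true_imp_iff, holds_ex, holds_ex_ex, holds_split,
      holds_listA, holds_permute, holds_element, Tm.eval_var, Env.get_zero, Env.get_succ, eval_anil,
      eval_acons, eval_shift]
    intro w ρ l hl ih l₁ l₂ h
    refine h.cases.splitA fun w' ρ' hc => ?_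
    simp only [map_qshift]
    generalize e : l ↾ ρ' = m at hc
    generalize l₁ ↾ ρ' = m₁ at hc ⊢
    generalize l₂ ↾ ρ' = m₂ at hc ⊢
    cases hc with
    | nil => rw [qshift_qanil]; exact SplitCase.nil.intro
    | left h =>
      rw [qshift_qacons, qshift_qacons]
      exact (SplitCase.left ((ih w' ρ' _ _ e).2 _ _ h)).intro
    | right h =>
      rw [qshift_qacons, qshift_qacons]
      exact (SplitCase.right ((ih w' ρ' _ _ e).2 _ _ h)).intro

theorem PermA.shift {l l' : Q w.ctx (.star .atmlst)} (h : PermA w l l') (hl : ListA w l) :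
    PermA w (qshift l) (qshift l') := by
  have := listA_rule (Φ := []) (τs := [.star .atmlst]) (ys := .nil)
    (fPermute .atm 1 v1 v0) (fPermute .atm 1 (FOLDN.shift (τ := .atmlst) v1)
      (FOLDN.shift (τ := .atmlst) v0)) ?_ hl (l' ∷ .nil)
    (by simpa using h)
  · simpa using this
  · simp only [Env.forall_cons, Env.forall_nil, Env.cons_append, Env.nil_append, Env.map_cons,
      Env.map_nil, holds_and, and_imp, holds_top, true_imp_iff, holds_ex, holds_ex_ex, holds_split,
      holds_listA, holds_permute, holds_element, Tm.eval_var, Env.get_zero, Env.get_succ, eval_anil,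
      eval_acons, eval_shift]
    intro w ρ l hl ih l' h
    have hl' := h.list hl
    refine h.cases.permA fun w' ρ' hc => ?_
    replace hl' := hl'.mono ρ'
    simp only [map_qshift]
    generalize e : l ↾ ρ' = m at hc
    generalize l' ↾ ρ' = m' at hc hl' ⊢
    cases hc with
    | nil => rw [qshift_qanil]; exact PermCase.nil.intro
    | cons h h' =>
      rw [qshift_qacons]
      have := h.shift hl'
      rw [qshift_qacons, qshift_qanil] at this
      exact (PermCase.cons this ((ih w' ρ' _ _ e).2 _ h')).intro

theorem ElemA.shift {l : Q w.ctx (.star .atmlst)} {a : Q w.ctx (.star .atm)} (h : ElemA w a l)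
    (hl : ListA w l) : ElemA w (qshift a) (qshift l) := by
  have := listA_rule (Φ := []) (τs := [.star .atm]) (ys := .nil)
    (fElement .atm 1 v0 v1) (fElement .atm 1 (FOLDN.shift (τ := .atm) v0)
      (FOLDN.shift (τ := .atmlst) v1)) ?_ hl (a ∷ .nil)
    (by simpa using h)
  · simpa using this
  · simp only [Env.forall_cons, Env.forall_nil, Env.cons_append, Env.nil_append, Env.map_cons,
      Env.map_nil, holds_and, and_imp, holds_top, true_imp_iff, holds_ex, holds_ex_ex, holds_split,
      holds_listA, holds_permute, holds_element, Tm.eval_var, Env.get_zero, Env.get_succ, eval_anil,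
      eval_acons, eval_shift]
    intro w ρ l hl ih a h
    refine h.cases.elemA fun w' ρ' hc => ?_
    simp only [map_qshift]
    generalize e : l ↾ ρ' = m at hc
    generalize a ↾ ρ' = a at hc ⊢
    cases hc with
    | head => rw [qshift_qacons]; exact ElemCase.head.intro
    | tail h => rw [qshift_qacons]; exact (ElemCase.tail ((ih w' ρ' _ _ e).2 _ h)).intro

theorem ElemA.not_nil {a : Q w.ctx (.star .atm)} (h : ElemA w a qanil) : J w (fun _ _ => False) :=
    by
  refine h.cases.imp fun w' ρ hc => ?_
  rw [map_qanil] at hc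
  generalize e : (qanil : Q w'.ctx _) = x at hc
  cases hc with
  | head => exact qanil_ne_qacons e
  | tail => exact qanil_ne_qacons e

theorem SubA.cons {l l' : Q w.ctx (.star .atmlst)} (h : SubA w l l') (b : Q w.ctx (.star .atm)) :
    SubA w (qacons b l) (qacons b l') := by
  intro w₁ ρ₁ a ha
  rw [map_qacons] at ha ⊢
  replace h := h.mono ρ₁
  generalize l ↾ ρ₁ = l at h ha
  generalize l' ↾ ρ₁ = l' at h ⊢
  generalize b ↾ ρ₁ = b at ha ⊢
  refine ha.cases.elemA fun w₂ ρ₂ hc => ?_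
  rw [map_qacons] at hc ⊢
  generalize a ↾ ρ₂ = a at hc ⊢
  generalize e : qacons (b ↾ ρ₂) (l ↾ ρ₂) = x at hc
  cases hc with
  | head => rw [(qacons_injective e).1]; exact ElemCase.head.intro
  | tail hc =>
    obtain ⟨rfl, rfl⟩ := qacons_injective e
    exact (ElemCase.tail ((h.mono ρ₂).elem hc)).intro

theorem subA_cons (l : Q w.ctx (.star .atmlst)) (b : Q w.ctx (.star .atm)) :
    SubA w l (qacons b l) := fun w' ρ a h => by
  rw [map_qacons]
  exact (ElemCase.tail h).intro

theorem subA_swap (l : Q w.ctx (.star .atmlst)) (a b : Q w.ctx (.star .atm)) :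
    SubA w (qacons a (qacons b l)) (qacons b (qacons a l)) := by
  intro w₁ ρ₁ c h
  simp only [map_qacons] at h ⊢
  refine h.cases.elemA fun w₂ ρ₂ hc => ?_
  simp only [map_qacons] at hc ⊢
  generalize c ↾ ρ₂ = c at hc ⊢
  generalize e : qacons (a ↾ ρ₁ ↾ ρ₂) _ = x at hc
  cases hc with
  | head =>
    rw [(qacons_injective e).1]
    exact (ElemCase.tail ElemCase.head.intro).intro
  | tail h =>
    obtain ⟨-, rfl⟩ := qacons_injective e
    exact (subA_cons _ _).cons _ |>.elem h

/-- Inclusion speaks about arbitrary elements, and an element of a shifted list is not presented as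
a shift. Induction on `l` exhibits it as the shift of an element of `l`. -/
theorem SubA.shift {l l' : Q w.ctx (.star .atmlst)} (h : SubA w l l') (hl : ListA w l)
    (hl' : ListA w l') : SubA w (qshift l) (qshift l') := by
  intro w₁ ρ₁ a ha
  -- The hypothesis that shifts of elements of the list lie in the shifted `l'` is part of the
  -- induction formula, because it has to be restricted to the tail.
  have := listA_rule (w₀ := w₁) (τs := [.star .atm]) (ys := qshift (l' ↾ ρ₁) ∷ .nil)
    (.all (.star .atm) (fElement .atm 1 v0 v2 ⊃ₘ fElement .atm 1 (FOLDN.shift (τ := .atm) v0) v3) ⊓ₘ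
      fElement .atm 1 v0 (FOLDN.shift (τ := .atmlst) v1)) (fElement .atm 1 v0 v2) ?_ (hl.mono ρ₁)
        (a ∷ .nil) ?_
  · simpa using this
  · simp only [Env.forall_cons, Env.forall_nil, Env.cons_append, Env.nil_append, Env.map_cons,
      Env.map_nil, holds_and, and_imp, holds_top, true_imp_iff, holds_ex, holds_ex_ex, holds_split,
      holds_listA, holds_permute, holds_element, Tm.eval_var, Env.get_zero, Env.get_succ, eval_anil,
      eval_acons, eval_shift]
    simp only [holds_all, holds_imp, Env.map_cons, Env.map_nil, holds_element, Tm.eval_var,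
      Env.get_zero, Env.get_succ, eval_shift]
    intro w ρ l hl ih a H ha
    refine hl.cases.elemA fun w₂ ρ₂ hc => ?_
    replace ha := ha.mono ρ₂
    replace ih := fun w' ρ' => ih w' (ρ₂.comp ρ')
    replace H := fun w' ρ' q => H w' (ρ₂.comp ρ') q w' (Hom.id w')
    simp only [Q.map_hom_comp, Q.map_hom_id, map_qshift] at H ha ih ⊢
    generalize l ↾ ρ₂ = l at hc ha ih H
    generalize a ↾ ρ₂ = a at ha ⊢
    generalize l' ↾ ρ₁ ↾ ρ ↾ ρ₂ = l' at ih H ⊢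
    cases hc with
    | nil =>
      rw [qshift_qanil] at ha
      exact ha.not_nil.elemA fun _ _ h => h.elim
    | @cons b t =>
      rw [qshift_qacons] at ha
      simp only [map_qacons] at H
      have hb : ElemA w₂ (qshift b) (qshift l') := by
        simpa using H w₂ (Hom.id w₂) b (by simpa using ElemCase.head.intro)
      refine ha.cons_inv.elemA fun w₃ ρ₃ h => ?_
      obtain e | h := h
      · rw [e]; exact hb.mono ρ₃
      · rw [map_qshift] at h ⊢
        refine (ih w₃ ρ₃ _ _ (map_qacons _ _ _)).2 _ (fun w' ρ' q w'' ρ'' h => ?_) h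
        have := H w'' ((ρ₃.comp ρ').comp ρ'') (q ↾ ρ'')
        simp only [Q.map_hom_comp] at this
        exact this (ElemCase.tail h).intro
  · simp only [Env.cons_append, Env.nil_append, holds_and, holds_all, holds_imp, Env.map_cons,
      Env.map_nil, holds_element, Tm.eval_var, Env.get_zero, Env.get_succ, eval_shift]
    rw [map_qshift] at ha
    refine ⟨fun w₂ ρ₂ q w₃ ρ₃ h' => ?_, ha⟩
    have h := (((h.mono ρ₁).mono ρ₂).mono ρ₃).elem h'
    simpa only [map_qshift] using h.shift ((((hl'.mono ρ₁).mono ρ₂).mono ρ₃))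

end

end FOLDN

/-! ### Addition of heights and the structural rules -/

namespace FOLDN

variable {S : Sig} {D : Set (Clause S)} {w w' : World D} {Φ : Ctx S}

/-- `∀ a (element a L ⊃ element a L')`. -/
def fIncl (L L' : Tm S Φ (.star .atmlst)) : Fm S Φ :=
  .all (.star .atm) (fElement .atm 1 v0 L.wk ⊃ₘ fElement .atm 1 v0 L'.wk)

@[simp] theorem holds_incl {L L' : Tm S Φ (.star .atmlst)} {xs : Env w.ctx Φ} :
    Holds w (fIncl L L') xs ↔ SubA w (L.eval xs) (L'.eval xs) := by
  simp only [fIncl, holds_all, holds_imp, Env.map_cons, holds_element, Tm.eval_var, Env.get_zero,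
    Tm.eval_wk]
  constructor
  · intro h w' ρ a ha
    simpa using h w' ρ a w' (Hom.id w') (by simpa using ha)
  · intro h w' ρ a w'' ρ' ha
    simp only [← Tm.map_eval] at ha ⊢
    exact ((h.mono ρ).mono ρ').elem ha

variable [LinDef D]

/-! ### Addition -/

section

set_option linter.unusedSimpArgs false

theorem Sum.succ_inv {i j k : Q w.ctx .nt} (h : Sum w (qs i) j k) :
    J w (fun w' ρ => ∃ m, k ↾ ρ = qs m ∧ Sum w' (i ↾ ρ) (j ↾ ρ) m) := by
  refine h.cases.imp fun w' ρ hc => ?_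
  rw [map_qs] at hc
  generalize e : qs (i ↾ ρ) = x at hc
  generalize j ↾ ρ = j at hc ⊢
  generalize k ↾ ρ = k at hc ⊢
  cases hc with
  | zero => exact (qz_ne_qs e.symm).elim
  | succ h =>
    obtain rfl := qs_injective e
    exact ⟨_, rfl, h⟩

theorem Nt.sum_zero {k : Q w.ctx .nt} (hk : Nt w k) : Sum w k qz k := by
  have := Holds.nat_ind_rel (Φ := []) (fSum v0 zr v0) .nil (fun w' ρ => ?_) (fun w' ρ j hj h => ?_)
    hk
  · simpa using this
  · simpa using (SumCase.zero .zero).intro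
  · simp only [holds_sum, Tm.eval_var, Env.get_zero, eval_zr] at h ⊢
    exact (SumCase.succ h).intro

/-- A natural number is zero or a successor. -/
inductive NtCase (w : World D) : (n : Q w.ctx .nt) → Prop
  | zero : NtCase w qz
  | succ {n} : NtCase w (qs n)

/-- The case distinction is read off from the clauses for $n+0=n$, so that no separate induction is
needed. -/
theorem Nt.cases {n : Q w.ctx .nt} (h : Nt w n) : J w (fun w' ρ => NtCase w' (n ↾ ρ)) := by
  have key : ∀ {w : World D} {i j k : Q w.ctx .nt}, SumCase w i j k → NtCase w i := by
    intro w i j k hc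
    cases hc with
    | zero => exact .zero
    | succ => exact .succ
  exact h.sum_zero.cases.imp fun w' ρ hc => key hc

theorem Sum.succ_right {i j k : Q w.ctx .nt} (h : Sum w i j k) (hi : Nt w i) :
    Sum w i (qs j) (qs k) := by
  have := nat_rule (Φ := []) (τs := [.nt, .nt]) (ys := .nil) (fSum v2 v0 v1)
    (fSum v2 (suc v0) (suc v1)) ?_ hi (j ∷ k ∷ .nil) (by simpa using h)
  · simpa using this
  · simp only [Env.forall_cons, Env.forall_nil, Env.cons_append, Env.nil_append, Env.map_cons,
      Env.map_nil, holds_and, and_imp, holds_top, true_imp_iff, holds_ex, holds_split, holds_incl,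
      holds_listA, holds_listP, holds_permute, holds_sum, holds_nat, holds_seq, holds_splitSeq,
      Tm.eval_var, Env.get_zero, Env.get_succ, eval_anil, eval_suc, eval_zr]
    intro w ρ i hi ih j k h
    refine h.cases.sum fun w' ρ' hc => ?_
    rw [map_qs, map_qs]
    generalize e : i ↾ ρ' = i at hc
    generalize j ↾ ρ' = j at hc
    generalize k ↾ ρ' = k at hc
    cases hc with
    | zero h => exact (SumCase.zero h.succ).intro
    | succ h => exact (SumCase.succ ((ih w' ρ' _ e).2 _ _ h)).intro

theorem Sum.comm {i j k : Q w.ctx .nt} (h : Sum w i j k) (hi : Nt w i) (hj : Nt w j) :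
    Sum w j i k := by
  have := nat_rule (Φ := []) (τs := [.nt, .nt]) (ys := .nil) (.nat v0 ⊓ₘ fSum v2 v0 v1)
    (fSum v0 v2 v1) ?_ hi (j ∷ k ∷ .nil) (by simpa using ⟨hj, h⟩)
  · simpa using this
  · simp only [Env.forall_cons, Env.forall_nil, Env.cons_append, Env.nil_append, Env.map_cons,
      Env.map_nil, holds_and, and_imp, holds_top, true_imp_iff, holds_ex, holds_split, holds_incl,
      holds_listA, holds_listP, holds_permute, holds_sum, holds_nat, holds_seq, holds_splitSeq,
      Tm.eval_var, Env.get_zero, Env.get_succ, eval_anil, eval_suc, eval_zr]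
    intro w ρ i hi ih j k hj h
    refine h.cases.sum fun w' ρ' hc => ?_
    replace hj := hj.mono ρ'
    generalize e : i ↾ ρ' = i at hc
    generalize j ↾ ρ' = j at hc hj
    generalize k ↾ ρ' = k at hc
    cases hc with
    | zero h => exact h.sum_zero
    | succ h => exact ((ih w' ρ' _ e).2 _ _ hj h).succ_right hj

theorem Nt.sum {i j : Q w.ctx .nt} (hi : Nt w i) (hj : Nt w j) :
    J w (fun w' ρ => ∃ k, Nt w' k ∧ Sum w' (i ↾ ρ) (j ↾ ρ) k) := by
  have := nat_rule (Φ := []) (τs := [.nt]) (ys := .nil) (.nat v0)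
    (.ex .nt (.nat v0 ⊓ₘ fSum v2 v1 v0)) ?_ hi (j ∷ .nil) (by simpa using hj)
  · simpa using this
  · simp only [Env.forall_cons, Env.forall_nil, Env.cons_append, Env.nil_append, Env.map_cons,
      Env.map_nil, holds_and, and_imp, holds_top, true_imp_iff, holds_ex, holds_split, holds_incl,
      holds_listA, holds_listP, holds_permute, holds_sum, holds_nat, holds_seq, holds_splitSeq,
      Tm.eval_var, Env.get_zero, Env.get_succ, eval_anil, eval_suc, eval_zr]
    intro w ρ i hi ih j hj
    refine hi.cases.bind fun w' ρ' hc => ?_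
    replace hj := hj.mono ρ'
    replace ih := ih w' ρ'
    simp only [Q.map_hom_comp]
    generalize i ↾ ρ' = i at hc ih
    generalize j ↾ ρ' = j at hj
    cases hc with
    | zero => exact .pure ⟨j, hj, by simpa using (SumCase.zero hj).intro⟩
    | succ =>
      refine ((ih _ rfl).2 _ hj).imp ?_
      rintro w₂ ρ₂ ⟨k, hk, h⟩
      exact ⟨qs k, hk.succ, by simpa using (SumCase.succ h).intro⟩

/-! ### Structural rules -/

/-- Separates the induction on the list of premises from the induction on heights: what happens to a
single premise is the assumption `f`, supplied later by the induction hypothesis of a height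
induction. The permutation is distributed over the premises by `PermA.split`. -/
theorem SplitSeq.map {i i' : Q w.ctx .nt} {il il' ll ll' : Q w.ctx (.star .atmlst)}
    {m : Q w.ctx (.star .prplst)} (hm : ListP w m)
    (f : ∀ (w' : World D) (ρ : Hom w w') l l' b, ListA w' l → PermA w' l l' →
      Seq w' (i ↾ ρ) (il ↾ ρ) l b → Seq w' (i' ↾ ρ) (il' ↾ ρ) l' b)
    (hl : ListA w ll) (hp : PermA w ll ll') (h : SplitSeq w i il ll m) :
    SplitSeq w i' il' ll' m := by
  have := listP_rule (τs := [.star .atmlst, .star .atmlst]) (ys := i ∷ i' ∷ il ∷ il' ∷ .nil)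
    (fList .atm 1 v0 ⊓ₘ fPermute .atm 1 v0 v1 ⊓ₘ fSplitSeq v3 v5 v0 v2) (fSplitSeq v4 v6 v1 v2) ?_
      hm
    (ll ∷ ll' ∷ .nil) (by simpa using ⟨hl, hp, h⟩)
  · simpa using this
  · simp only [Env.forall_cons, Env.forall_nil, Env.cons_append, Env.nil_append, Env.map_cons,
      Env.map_nil, holds_and, and_imp, holds_top, true_imp_iff, holds_ex, holds_split, holds_incl,
      holds_listA, holds_listP, holds_permute, holds_sum, holds_nat, holds_seq, holds_splitSeq,
      Tm.eval_var, Env.get_zero, Env.get_succ, eval_anil, eval_suc, eval_zr]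
    intro w ρ m hm ih ll ll' hl hp h
    have hl' := hp.list hl
    refine h.cases.splitSeq fun w₁ ρ₁ hc => ?_
    replace hl := hl.mono ρ₁
    replace hl' := hl'.mono ρ₁
    replace hp := hp.mono ρ₁
    replace f := fun w' ρ' => f w' ((ρ.comp ρ₁).comp ρ')
    replace ih := fun w' ρ' => ih w' (ρ₁.comp ρ')
    simp only [Q.map_hom_comp] at f ih
    generalize m ↾ ρ₁ = m at hc ih ⊢
    generalize ll ↾ ρ₁ = ll at hc hl hp
    generalize ll' ↾ ρ₁ = ll' at hp hl' ⊢
    generalize i ↾ ρ ↾ ρ₁ = i at *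
    generalize i' ↾ ρ ↾ ρ₁ = i' at *
    generalize il ↾ ρ ↾ ρ₁ = il at *
    generalize il' ↾ ρ ↾ ρ₁ = il' at *
    cases hc with
    | nil =>
      refine hp.nil_inv.splitSeq fun w₂ ρ₂ e => ?_
      rw [e, map_qpnil]
      exact SplitSeqCase.nil.intro
    | cons h₁ h₂ h₃ =>
      refine (hp.split hl hl' h₁).splitSeq ?_
      rintro w₂ ρ₂ ⟨l₁', l₂', k, k₁, k₂⟩
      obtain ⟨q₁, q₂⟩ := (h₁.mono ρ₂).lists (hl.mono ρ₂)
      rw [map_qpcons]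
      exact (SplitSeqCase.cons k (f w₂ ρ₂ _ _ _ q₁ k₁ (h₂.mono ρ₂))
        ((ih w₂ ρ₂ _ _ (map_qpcons _ _ _)).2 _ _ q₂ k₂ (h₃.mono ρ₂))).intro

/-- Weakening, contraction and exchange, and increase of the height. -/
theorem Seq.weaken {i k m : Q w.ctx .nt} {il il' ll ll' : Q w.ctx (.star .atmlst)}
    {b : Q w.ctx (.star .prp)} (hi : Nt w i) (hs : Sum w i k m) (hil : ListA w il)
    (hil' : ListA w il') (hll : ListA w ll) (hsub : SubA w il il') (hp : PermA w ll ll')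
    (h : Seq w i il ll b) : Seq w m il' ll' b := by
  have := nat_rule (Φ := []) (ys := .nil)
    (τs := [.nt, .nt, .star .atmlst, .star .atmlst, .star .atmlst, .star .atmlst, .star .prp])
    (fSum v7 v0 v1 ⊓ₘ fList .atm 1 v2 ⊓ₘ fList .atm 1 v3 ⊓ₘ fList .atm 1 v4 ⊓ₘ fIncl v2 v3 ⊓ₘ
      fPermute .atm 1 v4 v5 ⊓ₘ fSeq v7 v2 v4 v6)
    (fSeq v1 v3 v5 v6) ?_ hi (k ∷ m ∷ il ∷ il' ∷ ll ∷ ll' ∷ b ∷ .nil)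
    (by simpa using ⟨hs, hil, hil', hll, hsub, hp, h⟩)
  · simpa using this
  · simp only [Env.forall_cons, Env.forall_nil, Env.cons_append, Env.nil_append, Env.map_cons,
      Env.map_nil, holds_and, and_imp, holds_top, true_imp_iff, holds_ex, holds_split, holds_incl,
      holds_listA, holds_listP, holds_permute, holds_sum, holds_nat, holds_seq, holds_splitSeq,
      Tm.eval_var, Env.get_zero, Env.get_succ, eval_anil, eval_suc, eval_zr]
    clear hi hs hil hil' hll hsub hp h
    intro w ρ i hi ih k m il il' ll ll' b hs hil hil' hll hsub hp h
    refine h.cases.seq fun w₁ ρ₁ hc => ?_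
    replace hi := hi.mono ρ₁
    replace hs := hs.mono ρ₁
    replace hil := hil.mono ρ₁
    replace hil' := hil'.mono ρ₁
    replace hll := hll.mono ρ₁
    replace hsub := hsub.mono ρ₁
    replace hp := hp.mono ρ₁
    replace ih := fun w' ρ' => ih w' (ρ₁.comp ρ')
    simp only [Q.map_hom_comp] at ih
    generalize i ↾ ρ₁ = i at *
    generalize k ↾ ρ₁ = k at *
    generalize m ↾ ρ₁ = m at *
    generalize il ↾ ρ₁ = il at *
    generalize il' ↾ ρ₁ = il' at *
    generalize ll ↾ ρ₁ = ll at *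
    generalize ll' ↾ ρ₁ = ll' at *
    generalize b ↾ ρ₁ = b at *
    have hll' := hp.list hll
    cases hc with
    | init =>
      refine hp.single_inv.seq fun w₂ ρ₂ e => ?_
      rw [e, map_qatom]
      exact SeqCase.init.intro
    | elem ha =>
      replace ha := hsub.elem ha
      refine hp.nil_inv.seq fun w₂ ρ₂ e => ?_
      rw [e, map_qatom]
      replace ha := ha.mono ρ₂
      -- The clause for intuitionistic hypotheses applies only to a list displayed as nonempty;
      -- since the atom is an element of the new list, that list is not empty.
      refine (hil'.mono ρ₂).cases.seq fun w₃ ρ₃ hc => ?_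
      replace ha := ha.mono ρ₃
      generalize il' ↾ ρ₂ ↾ ρ₃ = il' at *
      rw [map_qanil, map_qatom]
      cases hc with
      | nil => exact ha.not_nil.seq fun _ _ h => h.elim
      | cons => exact (SeqCase.elem ha).intro
    | @prog j _ _ _ _ _ h₁ h₂ h₃ h₄ h₅ =>
      refine hs.succ_inv.seq ?_
      rintro w₂ ρ₂ ⟨m', e, hm⟩
      -- The height induction hypothesis, in the form required for the premises of a program clause.
      -- It is used for the linear premises and, with no linear hypotheses, for the intuitionistic
      -- ones.
      have f : ∀ (w' : World D) (ρ : Hom w₂ w') l l' b, ListA w' l → PermA w' l l' →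
          Seq w' (j ↾ ρ₂ ↾ ρ) (il ↾ ρ₂ ↾ ρ) l b → Seq w' (m' ↾ ρ) (il' ↾ ρ₂ ↾ ρ) l' b := by
        intro w₃ ρ₃ l l' b hl hp h
        exact (ih w₃ (ρ₂.comp ρ₃) _ (by rw [Q.map_hom_comp, map_qs, map_qs])).2 _ _ _ _ _ _ _
          (hm.mono ρ₃) ((hil.mono ρ₂).mono ρ₃) ((hil'.mono ρ₂).mono ρ₃) hl
          ((hsub.mono ρ₂).mono ρ₃) hp h
      rw [e, map_qatom]
      have h₆ := (h₅.mono ρ₂)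
      rw [map_qanil] at h₆
      exact (SeqCase.prog (h₁.mono ρ₂) (h₂.mono ρ₂) (h₃.mono ρ₂)
        ((h₄.mono ρ₂).map (h₁.mono ρ₂) f (hll.mono ρ₂) (hp.mono ρ₂))
        (h₆.map (h₂.mono ρ₂) f .nil ListA.nil.perm_refl)).intro
    | tt => exact SeqCase.tt.intro
    | wth h₁ h₂ =>
      refine hs.succ_inv.seq ?_
      rintro w₂ ρ₂ ⟨m', e, hm⟩
      obtain ⟨hj, ih⟩ := ih w₂ ρ₂ _ (map_qs _ _)
      replace ih := fun b => ih _ _ _ _ _ _ b hm (hil.mono ρ₂) (hil'.mono ρ₂) (hll.mono ρ₂)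
        (hsub.mono ρ₂) (hp.mono ρ₂)
      rw [e, map_qwith]
      exact (SeqCase.wth (ih _ (h₁.mono ρ₂)) (ih _ (h₂.mono ρ₂))).intro
    | limp h =>
      refine hs.succ_inv.seq ?_
      rintro w₂ ρ₂ ⟨m', e, hm⟩
      obtain ⟨hj, ih⟩ := ih w₂ ρ₂ _ (map_qs _ _)
      rw [e, map_qlimp]
      replace h := h.mono ρ₂
      rw [map_qacons] at h
      exact (SeqCase.limp (ih _ _ _ _ _ _ _ hm (hil.mono ρ₂) (hil'.mono ρ₂) (hll.mono ρ₂).cons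
        (hsub.mono ρ₂) ((hp.mono ρ₂).cons (hll'.mono ρ₂)) h)).intro
    | iimp h =>
      refine hs.succ_inv.seq ?_
      rintro w₂ ρ₂ ⟨m', e, hm⟩
      obtain ⟨hj, ih⟩ := ih w₂ ρ₂ _ (map_qs _ _)
      rw [e, map_qiimp]
      replace h := h.mono ρ₂
      rw [map_qacons] at h
      exact (SeqCase.iimp (ih _ _ _ _ _ _ _ hm (hil.mono ρ₂).cons (hil'.mono ρ₂).cons
        (hll.mono ρ₂) ((hsub.mono ρ₂).cons _) (hp.mono ρ₂) h)).intro
    | big h =>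
      refine hs.succ_inv.seq ?_
      rintro w₂ ρ₂ ⟨m', e, hm⟩
      obtain ⟨hj, ih⟩ := ih w₂ ρ₂ _ (map_qs _ _)
      rw [e, map_qbig]
      replace h := h.mono ρ₂
      rw [map_qshift, map_qshift, map_qopen] at h
      exact (SeqCase.big (ih _ _ _ _ _ _ _ hm (hil.mono ρ₂).shift (hil'.mono ρ₂).shift
        (hll.mono ρ₂).shift ((hsub.mono ρ₂).shift (hil.mono ρ₂) (hil'.mono ρ₂))
        ((hp.mono ρ₂).shift (hll.mono ρ₂)) h)).intro

theorem Seq.structural {i : Q w.ctx .nt} {il il' ll ll' : Q w.ctx (.star .atmlst)}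
    {b : Q w.ctx (.star .prp)} (hi : Nt w i) (hil : ListA w il)
    (hil' : ListA w il') (hll : ListA w ll) (hsub : SubA w il il') (hp : PermA w ll ll')
    (h : Seq w i il ll b) : Seq w i il' ll' b :=
  h.weaken hi hi.sum_zero hil hil' hll hsub hp

end

end FOLDN

/-! ### Inserting, deleting and instantiating an eigenvariable -/

namespace FOLDN

variable {S : Sig} {D : Set (Clause S)} {w w' : World D} {Φ : Ctx S}

/-! ### Changes of eigenvariables -/

/-- Extension by an eigenvariable, its converse, and substitution for an eigenvariable. -/
inductive Change : Type
  | ext | unext | sub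

/-- The changes at the first eigenvariable. -/
inductive Change.Base {Δ : Ctx S} {τ : Ty S.Base} : Change → (t : Q Δ (.star (.star .i))) →
    (x x' : Q Δ (.star (.star τ))) → Prop
  | ext {t x} : Base .ext t x (qskip x)
  | unext {t x} : Base .unext t (qskip x) x
  | sub {t y} : Base .sub t (qonList y) (qput t y)

/-- The substituted term when the first eigenvariable is moved to the parameters. -/
def Change.Step {Δ : Ctx S} : Change → (t t' : Q Δ (.star (.star .i))) → Prop
  | .ext, t, t' => t' = t
  | .unext, t, t' => t' = t
  | .sub, t, t' => ∃ u, t = qonList u ∧ t' = qmoved u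

namespace Change

variable {Δ Ξ : Ctx S} {k : Change} {t t' : Q Δ (.star (.star .i))} {σ σ₁ σ₂ τ : Ty S.Base}
  {x x' x'' : Q Δ (.star (.star τ))}

theorem Step.map (h : k.Step t t') (ρ : Sub S Δ Ξ) : k.Step (t.map ρ) (t'.map ρ) := by
  cases k with
  | ext => exact congrArg _ h
  | unext => exact congrArg _ h
  | sub =>
    obtain ⟨u, rfl, rfl⟩ := h
    exact ⟨u.map ρ, map_qonList ρ u, map_qmoved ρ u⟩

/-- For a substitution the decomposition of the substituted term is unique because `qonList` is
injective. This lets two changes with the same term be inverted simultaneously. -/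
theorem Step.unique {t'' : Q Δ (.star (.star .i))} (h : k.Step t t') (h' : k.Step t t'') :
    t' = t'' := by
  cases k with
  | ext => exact Eq.trans h h'.symm
  | unext => exact Eq.trans h h'.symm
  | sub =>
    obtain ⟨u, rfl, rfl⟩ := h
    obtain ⟨u', e, rfl⟩ := h'
    rw [qonList_injective e]

theorem Base.map (h : k.Base t x x') (ρ : Sub S Δ Ξ) :
    k.Base (t.map ρ) (x.map ρ) (x'.map ρ) := by
  cases h with
  | ext => rw [map_qskip]; exact .ext
  | unext => rw [map_qskip]; exact .unext
  | sub => rw [map_qonList, map_qput]; exact .sub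

theorem Base.unique (h : k.Base t x x') (h' : k.Base t x x'') : x' = x'' := by
  cases h with
  | ext => cases h'; rfl
  | unext =>
    generalize e : qskip x' = y at h'
    cases h'
    exact qskip_injective e
  | @sub _ y =>
    generalize e : qonList y = z at h'
    cases h'
    rw [qonList_injective e]

theorem Base.nul (k : Change) (t : Q Δ (.star (.star .i))) (c : Con S τ) :
    k.Base t (nul2 c) (nul2 c) := by
  cases k with
  | ext => simpa only [qskip_nul2] using Base.ext (t := t) (x := nul2 c)
  | unext => simpa only [qskip_nul2] using Base.unext (t := t) (x := nul2 c)
  | sub => simpa only [qonList_nul3, qput_nul3] using Base.sub (t := t) (y := nul3 c)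

theorem Base.bin {A A' : Q Δ (.star (.star σ₁))} {B B' : Q Δ (.star (.star σ₂))}
    (h : k.Base t A A') (h' : k.Base t B B') (c : Con S (.arr σ₁ (.arr σ₂ τ))) :
    k.Base t (bin2 c A B) (bin2 c A' B') := by
  cases h with
  | ext =>
    cases h'
    simpa only [qskip_bin2] using Base.ext (t := t) (x := bin2 c A B)
  | unext =>
    cases h'
    simpa only [qskip_bin2] using Base.unext (t := t) (x := bin2 c A' B')
  | @sub _ y =>
    cases h' with
    | @sub _ y' => simpa only [qonList_bin3, qput_bin3] using Base.sub (t := t) (y := bin3 c y y')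

theorem Base.at {B B' : Q Δ (.star (.star (.arr .i τ)))} (h : k.Base t B B') (V : Q Δ (.star .i)) :
    k.Base t (qat2 B V) (qat2 B' V) := by
  cases h with
  | ext => simpa only [qskip_qat2] using Base.ext (t := t) (x := qat2 B V)
  | unext => simpa only [qskip_qat2] using Base.unext (t := t) (x := qat2 B' V)
  | @sub _ y => simpa only [qonList_qat3, qput_qat3] using Base.sub (t := t) (y := qat3 y V)

theorem Base.nul_inv (hτ : τ.IsData) {c : Con S τ} (hc : c.IsFree) (h : k.Base t (nul2 c) x') :
    x' = nul2 c := by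
  obtain ⟨x, e⟩ : ∃ x, nul2 c = x := ⟨_, rfl⟩
  rw [e] at h
  cases h with
  | ext => rw [← e, qskip_nul2]
  | unext => exact qskip_eq_nul2 hτ hc e.symm
  | sub => rw [qonList_eq_nul2 hτ hc e.symm, qput_nul3]

theorem Base.un_inv (hτ : τ.IsData) {c : Con S (.arr σ τ)} (hc : c.IsFree)
    {A : Q Δ (.star (.star σ))} (h : k.Base t (un2 c A) x') :
    ∃ A', x' = un2 c A' ∧ k.Base t A A' := by
  generalize e : un2 c A = x at h
  cases h with
  | ext => exact ⟨_, by rw [← e, qskip_un2], .ext⟩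
  | unext =>
    obtain ⟨A', rfl, rfl⟩ := qskip_eq_un2 hτ hc e.symm
    exact ⟨_, rfl, .unext⟩
  | sub =>
    obtain ⟨A', rfl, rfl⟩ := qonList_eq_un2 hτ hc e.symm
    exact ⟨_, qput_un3 _ _ _, .sub⟩

theorem Base.bin_inv (hτ : τ.IsData) {c : Con S (.arr σ₁ (.arr σ₂ τ))} (hc : c.IsFree)
    {A : Q Δ (.star (.star σ₁))} {B : Q Δ (.star (.star σ₂))} (h : k.Base t (bin2 c A B) x') :
    ∃ A' B', x' = bin2 c A' B' ∧ k.Base t A A' ∧ k.Base t B B' := by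
  generalize e : bin2 c A B = x at h
  cases h with
  | ext => exact ⟨_, _, by rw [← e, qskip_bin2], .ext, .ext⟩
  | unext =>
    obtain ⟨A', B', rfl, rfl, rfl⟩ := qskip_eq_bin2 hτ hc e.symm
    exact ⟨_, _, rfl, .unext, .unext⟩
  | sub =>
    obtain ⟨A', B', rfl, rfl, rfl⟩ := qonList_eq_bin2 hτ hc e.symm
    exact ⟨_, _, qput_bin3 _ _ _ _, .sub, .sub⟩

end Change

/-- The formula for a change at a given eigenvariable. -/
def fRel (k : Change) (e : ETy) (n : Tm S Φ .nt) (t : Tm S Φ (.star (.star .i)))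
    (x x' : Tm S Φ (.star (.star e.ty))) : Fm S Φ :=
  match k with
  | .ext => fExtend₀ e n x x'
  | .unext => fExtend₀ e n x' x
  | .sub => fSubst₀ e n t x x'

def Rel (k : Change) (e : ETy) (w : World D) (n : Q w.ctx .nt) (t : Q w.ctx (.star (.star .i)))
    (x x' : Q w.ctx (.star (.star e.ty))) : Prop :=
  match k with
  | .ext => Ext₀ e w n x x'
  | .unext => Ext₀ e w n x' x
  | .sub => Subst₀ e w n t x x'

@[simp] theorem holds_rel {k : Change} {e : ETy} {n : Tm S Φ .nt} {t : Tm S Φ (.star (.star .i))}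
    {x x' : Tm S Φ (.star (.star e.ty))} {xs : Env w.ctx Φ} :
    Holds w (fRel k e n t x x') xs ↔
      Rel k e w (n.eval xs) (t.eval xs) (x.eval xs) (x'.eval xs) := by
  cases k
  exacts [holds_extend₀, holds_extend₀, holds_subst₀]

section

variable {k : Change} {e : ETy} {n : Q w.ctx .nt} {t : Q w.ctx (.star (.star .i))}
  {x x' : Q w.ctx (.star (.star e.ty))}

theorem Rel.mono (h : Rel k e w n t x x') (ρ : Hom w w') :
    Rel k e w' (n ↾ ρ) (t ↾ ρ) (x ↾ ρ) (x' ↾ ρ) := by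
  cases k
  exacts [Ext₀.mono h ρ, Ext₀.mono h ρ, Subst₀.mono h ρ]

theorem J.rel {R : ∀ w' : World D, Hom w w' → Prop} (h : J w R)
    (c : ∀ (w' : World D) (ρ : Hom w w'), R w' ρ → Rel k e w' (n ↾ ρ) (t ↾ ρ) (x ↾ ρ) (x' ↾ ρ)) :
    Rel k e w n t x x' := by
  cases k
  exacts [h.ext₀ c, h.ext₀ c, h.subst₀ c]

variable [LinDef D]

theorem Change.Base.rel (h : k.Base t x x') : Rel k e w qz t x x' := by
  cases h
  exacts [ExtCase.zero.intro, ExtCase.zero.intro, SubstCase.zero.intro]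

theorem Change.Step.rel {t' : Q w.ctx (.star (.star .i))} (h : k.Step t t')
    {y y' : Q w.ctx (.star (.arr .i (.star e.ty)))} (h' : Rel k e w n t' (qmoved y) (qmoved y')) :
    Rel k e w (qs n) t (qonList y) (qonList y') := by
  cases k with
  | ext => exact (ExtCase.succ h').intro
  | unext => exact (ExtCase.succ h').intro
  | sub =>
    obtain ⟨u, rfl, rfl⟩ := h
    exact (SubstCase.succ h').intro

theorem Ext₀.zero_inv (h : Ext₀ e w qz x x') : J w (fun _ ρ => x' ↾ ρ = qskip (x ↾ ρ)) := by
  refine h.cases.imp fun w' ρ hc => ?_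
  rw [map_qz] at hc
  generalize e : qz = z at hc
  generalize x ↾ ρ = x at hc ⊢
  generalize x' ↾ ρ = x' at hc ⊢
  cases hc with
  | zero => rfl
  | succ => exact (qz_ne_qs e).elim

theorem Ext₀.succ_inv (h : Ext₀ e w (qs n) x x') : J w (fun w' ρ => ∃ y y', x ↾ ρ = qonList y ∧
    x' ↾ ρ = qonList y' ∧ Ext₀ e w' (n ↾ ρ) (qmoved y) (qmoved y')) := by
  refine h.cases.imp fun w' ρ hc => ?_
  rw [map_qs] at hc
  generalize e : qs (n ↾ ρ) = z at hc
  generalize x ↾ ρ = x at hc ⊢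
  generalize x' ↾ ρ = x' at hc ⊢
  cases hc with
  | zero => exact (qz_ne_qs e.symm).elim
  | succ h =>
    obtain rfl := qs_injective e
    exact ⟨_, _, rfl, rfl, h⟩

theorem Rel.zero_inv (h : Rel k e w qz t x x') :
    J w (fun _ ρ => k.Base (t ↾ ρ) (x ↾ ρ) (x' ↾ ρ)) := by
  cases k with
  | ext => exact (Ext₀.zero_inv h).imp fun w' ρ e => by rw [e]; exact .ext
  | unext => exact (Ext₀.zero_inv h).imp fun w' ρ e => by rw [e]; exact .unext
  | sub =>
    refine (Subst₀.cases h).imp fun w' ρ hc => ?_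
    rw [map_qz] at hc
    generalize e : qz = z at hc
    generalize t ↾ ρ = t at hc ⊢
    generalize x ↾ ρ = x at hc ⊢
    generalize x' ↾ ρ = x' at hc ⊢
    cases hc with
    | zero => exact .sub
    | succ => exact (qz_ne_qs e).elim

theorem Rel.succ_inv (h : Rel k e w (qs n) t x x') :
    J w (fun w' ρ => ∃ t' y y', k.Step (t ↾ ρ) t' ∧ x ↾ ρ = qonList y ∧ x' ↾ ρ = qonList y' ∧
      Rel k e w' (n ↾ ρ) t' (qmoved y) (qmoved y')) := by
  cases k with
  | ext =>
    refine (Ext₀.succ_inv h).imp ?_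
    rintro w' ρ ⟨y, y', e, e', h⟩
    exact ⟨_, y, y', rfl, e, e', h⟩
  | unext =>
    refine (Ext₀.succ_inv h).imp ?_
    rintro w' ρ ⟨y, y', e, e', h⟩
    exact ⟨_, y', y, rfl, e', e, h⟩
  | sub =>
    refine (Subst₀.cases h).imp fun w' ρ hc => ?_
    rw [map_qs] at hc
    generalize e : qs (n ↾ ρ) = z at hc
    generalize t ↾ ρ = t at hc ⊢
    generalize x ↾ ρ = x at hc ⊢
    generalize x' ↾ ρ = x' at hc ⊢
    cases hc with
    | zero => exact (qz_ne_qs e.symm).elim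
    | succ h =>
      obtain rfl := qs_injective e
      exact ⟨_, _, _, ⟨_, rfl, rfl⟩, rfl, rfl, h⟩

end

/-! ### Equality -/

/-- Equality at the types of the changes, expressed by a common extension. -/
def fSame (e : ETy) (x y : Tm S Φ (.star (.star e.ty))) : Fm S Φ :=
  .ex (.star (.star e.ty)) (fExtend₀ e zr x.wk v0 ⊓ₘ fExtend₀ e zr y.wk v0)

variable [LinDef D]

/-- The definition provides equality for numbers only. Extension at position zero is the injective
operation `qskip`, so a common extension forces equality, in the local sense. -/
theorem holds_same {e : ETy} {x y : Tm S Φ (.star (.star e.ty))} {xs : Env w.ctx Φ} :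
    Holds w (fSame e x y) xs ↔ J w (fun _ ρ => x.eval xs ↾ ρ = y.eval xs ↾ ρ) := by
  simp only [fSame, holds_ex, holds_and, holds_extend₀, eval_zr, Tm.eval_wk, Tm.eval_var,
    Env.get_zero, ← Tm.map_eval]
  constructor
  · intro h
    refine h.bind ?_
    rintro w₁ ρ₁ ⟨m, h₁, h₂⟩
    refine h₁.zero_inv.bind fun w₂ ρ₂ e₁ => (h₂.mono ρ₂).zero_inv.imp fun w₃ ρ₃ e₂ => ?_
    simp only [Q.map_hom_comp]
    rw [e₁, map_qskip] at e₂
    exact qskip_injective e₂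
  · intro h
    refine h.imp fun w' ρ e => ⟨qskip (x.eval xs ↾ ρ), ExtCase.zero.intro, ?_⟩
    rw [e]
    exact ExtCase.zero.intro

/-- Under the existential quantifier the local equality can be made an actual one by moving to a
later world. -/
theorem holds_ex_same {e : ETy} {τ : Ty S.Base} {x y : Tm S (τ :: Φ) (.star (.star e.ty))}
    {F : Fm S (τ :: Φ)} {xs : Env w.ctx Φ} :
    Holds w (.ex τ (fSame e x y ⊓ₘ F)) xs ↔ J w (fun w' ρ => ∃ q,
      x.eval (q ∷ xs.map ρ.sub) = y.eval (q ∷ xs.map ρ.sub) ∧ Holds w' F (q ∷ xs.map ρ.sub)) := by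
  simp only [holds_ex, holds_and, holds_same]
  constructor
  · intro h
    refine h.bind ?_
    rintro w₁ ρ₁ ⟨q, e, h⟩
    refine e.imp fun w₂ ρ₂ e => ⟨q ↾ ρ₂, ?_, ?_⟩
    · simpa using e
    · simpa using h.mono ρ₂
  · intro h
    refine h.imp ?_
    rintro w₁ ρ₁ ⟨q, e, h⟩
    exact ⟨q, .pure (by rw [e]), h⟩

theorem holds_ex_ex_same {e : ETy} {σ τ : Ty S.Base} {x y : Tm S (σ :: τ :: Φ) (.star (.star e.ty))}
    {F : Fm S (σ :: τ :: Φ)} {xs : Env w.ctx Φ} :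
    Holds w (.ex τ (.ex σ (fSame e x y ⊓ₘ F))) xs ↔ J w (fun w' ρ => ∃ q r,
      x.eval (r ∷ q ∷ xs.map ρ.sub) = y.eval (r ∷ q ∷ xs.map ρ.sub) ∧
        Holds w' F (r ∷ q ∷ xs.map ρ.sub)) := by
  simp only [holds_ex_ex, holds_and, holds_same]
  constructor
  · intro h
    refine h.bind ?_
    rintro w₁ ρ₁ ⟨q, r, e, h⟩
    refine e.imp fun w₂ ρ₂ e => ⟨q ↾ ρ₂, r ↾ ρ₂, ?_, ?_⟩
    · simpa using e
    · simpa using h.mono ρ₂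
  · intro h
    refine h.imp ?_
    rintro w₁ ρ₁ ⟨q, r, e, h⟩
    exact ⟨q, r, .pure (by rw [e]), h⟩

end FOLDN

namespace FOLDN

variable {S : Sig} {D : Set (Clause S)} {w w' : World D} {Φ : Ctx S}

/-! ### Terms for the constructors -/

section

variable {Δ : Ctx S} {σ σ₁ σ₂ τ : Ty S.Base}

def nulT (c : Con S τ) : Tm S Φ (.star (.star τ)) := .lam (.lam (.con c))

def unT (c : Con S (.arr σ τ)) (A : Tm S Φ (.star (.star σ))) : Tm S Φ (.star (.star τ)) :=
  .lam (.lam (.con c ⬝ₘ (A.wk.wk ⬝ₘ v1 ⬝ₘ v0)))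

def binT (c : Con S (.arr σ₁ (.arr σ₂ τ))) (A : Tm S Φ (.star (.star σ₁)))
    (B : Tm S Φ (.star (.star σ₂))) : Tm S Φ (.star (.star τ)) :=
  .lam (.lam (.con c ⬝ₘ (A.wk.wk ⬝ₘ v1 ⬝ₘ v0) ⬝ₘ (B.wk.wk ⬝ₘ v1 ⬝ₘ v0)))

def atT (B : Tm S Φ (.star (.star (.arr .i τ)))) (V : Tm S Φ (.star .i)) :
    Tm S Φ (.star (.star τ)) :=
  .lam (.lam (B.wk.wk ⬝ₘ v1 ⬝ₘ v0 ⬝ₘ (V.wk.wk ⬝ₘ v1)))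

theorem eval_nulT (c : Con S τ) (xs : Env Δ Φ) : (nulT c).eval xs = nul2 c :=
  b2_injective (by simp [b2, nulT, nul2])
theorem eval_unT (c : Con S (.arr σ τ)) (A : Tm S Φ (.star (.star σ))) (xs : Env Δ Φ) :
    (unT c A).eval xs = un2 c (A.eval xs) := b2_injective (by simp [b2, unT, un2])
theorem eval_binT (c : Con S (.arr σ₁ (.arr σ₂ τ))) (A : Tm S Φ (.star (.star σ₁)))
    (B : Tm S Φ (.star (.star σ₂))) (xs : Env Δ Φ) :
    (binT c A B).eval xs = bin2 c (A.eval xs) (B.eval xs) :=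
  b2_injective (by simp [b2, binT, bin2])
theorem eval_atT (B : Tm S Φ (.star (.star (.arr .i τ)))) (V : Tm S Φ (.star .i)) (xs : Env Δ Φ) :
    (atT B V).eval xs = qat2 (B.eval xs) (V.eval xs) := b2_injective (by simp [b2, atT, qat2])

end

theorem ETy.isData (e : ETy) : (e.ty : Ty S.Base).IsData := by
  cases e <;> exact fun _ _ => rfl

/-! ### Changes and constructors -/

section

set_option linter.unusedSimpArgs false

variable [LinDef D] {k : Change} {e e₁ e₂ : ETy} {n : Q w.ctx .nt} {t : Q w.ctx (.star (.star .i))}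
  {x x' x'' : Q w.ctx (.star (.star e.ty))}

/-- Model for the results below on changes and constructors: induction on the position. At zero they
are facts about the base operation. At a successor the first eigenvariable is moved to the
parameters, and constructors commute with `qonList` and `qmoved` and are reflected by them. -/
theorem Rel.nul_inv (hn : Nt w n) {c : Con S e.ty} (hc : c.IsFree)
    (h : Rel k e w n t (nul2 c) x') : J w (fun _ ρ => x' ↾ ρ = nul2 c) := by
  have := nat_rule (Φ := []) (ys := .nil) (τs := [.star (.star .i), .star (.star e.ty)])
    (fRel k e v2 v0 (nulT c) v1) (fSame e v1 (nulT c)) ?_ hn (t ∷ x' ∷ .nil)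
    (by simpa [eval_nulT] using h)
  · simpa [holds_same, eval_nulT] using this
  · simp only [Env.forall_cons, Env.forall_nil, Env.cons_append, Env.nil_append, Env.map_cons,
      Env.map_nil, holds_and, and_imp, holds_all, holds_same, holds_ex_same, holds_ex_ex_same,
      holds_rel, Tm.eval_var, Env.get_zero, Env.get_succ, eval_nulT, eval_unT, eval_binT, eval_atT]
    clear hn h
    intro w ρ n hn ih t x' h
    refine hn.cases.bind fun w₁ ρ₁ hcase => ?_
    replace h := h.mono ρ₁
    replace ih := fun w' ρ' => ih w' (ρ₁.comp ρ')
    simp only [Q.map_hom_comp, map_nul2] at ih h ⊢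
    generalize n ↾ ρ₁ = n at *
    generalize t ↾ ρ₁ = t at *
    generalize x' ↾ ρ₁ = x' at *
    cases hcase with
    | zero =>
      refine h.zero_inv.imp fun w₂ ρ₂ hb => ?_
      rw [map_nul2] at hb
      exact hb.nul_inv e.isData hc
    | succ =>
      refine h.succ_inv.bind ?_
      rintro w₂ ρ₂ ⟨t', y, y', hs, e₀, e₀', h⟩
      rw [map_nul2] at e₀
      obtain rfl := qonList_eq_nul2 e.isData hc e₀.symm
      rw [qmoved_nul3] at h
      refine ((ih w₂ ρ₂ _ (map_qs _ _)).2 _ _ h).imp fun w₃ ρ₃ e₃ => ?_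
      rw [map_qmoved] at e₃
      rw [Q.map_hom_comp, e₀', map_qonList, qmoved_eq_nul2 e.isData hc e₃, qonList_nul3]

theorem Rel.un_inv (hn : Nt w n) {c : Con S (.arr e₁.ty e.ty)} (hc : c.IsFree)
    {A : Q w.ctx (.star (.star e₁.ty))} (h : Rel k e w n t (un2 c A) x') :
    J w (fun w' ρ => ∃ A', x' ↾ ρ = un2 c A' ∧ Rel k e₁ w' (n ↾ ρ) (t ↾ ρ) (A ↾ ρ) A') := by
  have := nat_rule (Φ := []) (ys := .nil)
    (τs := [.star (.star .i), .star (.star e₁.ty), .star (.star e.ty)])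
    (fRel k e v3 v0 (unT c v1) v2)
    (.ex (.star (.star e₁.ty)) (fSame e v3 (unT c v0) ⊓ₘ fRel k e₁ v4 v1 v2 v0)) ?_ hn
    (t ∷ A ∷ x' ∷ .nil) (by simpa [eval_unT] using h)
  · simp only [Env.forall_cons, Env.forall_nil, Env.cons_append, Env.nil_append, Env.map_cons,
      Env.map_nil, holds_and, and_imp, holds_all, holds_same, holds_ex_same, holds_ex_ex_same,
      holds_rel, Tm.eval_var, Env.get_zero, Env.get_succ, eval_nulT, eval_unT, eval_binT, eval_atT]
        at this
    exact this
  · simp only [Env.forall_cons, Env.forall_nil, Env.cons_append, Env.nil_append, Env.map_cons,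
      Env.map_nil, holds_and, and_imp, holds_all, holds_same, holds_ex_same, holds_ex_ex_same,
      holds_rel, Tm.eval_var, Env.get_zero, Env.get_succ, eval_nulT, eval_unT, eval_binT, eval_atT]
    clear hn h
    intro w ρ n hn ih t A x' h
    refine hn.cases.bind fun w₁ ρ₁ hcase => ?_
    replace h := h.mono ρ₁
    replace ih := fun w' ρ' => ih w' (ρ₁.comp ρ')
    simp only [Q.map_hom_comp, map_un2] at ih h ⊢
    generalize n ↾ ρ₁ = n at *
    generalize t ↾ ρ₁ = t at *
    generalize A ↾ ρ₁ = A at *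
    generalize x' ↾ ρ₁ = x' at *
    cases hcase with
    | zero =>
      refine h.zero_inv.imp fun w₂ ρ₂ hb => ?_
      rw [map_un2] at hb
      obtain ⟨A', e, h₁⟩ := hb.un_inv e.isData hc
      exact ⟨A', e, by rw [map_qz]; exact h₁.rel⟩
    | succ =>
      refine h.succ_inv.bind ?_
      rintro w₂ ρ₂ ⟨t', y, y', hs, e₀, e₀', h⟩
      rw [map_un2] at e₀
      obtain ⟨A₀, rfl, eA⟩ := qonList_eq_un2 e.isData hc e₀.symm
      rw [qmoved_un3] at h
      refine ((ih w₂ ρ₂ _ (map_qs _ _)).2 _ _ _ h).imp ?_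
      rintro w₃ ρ₃ ⟨A', e₃, h₁⟩
      rw [map_qmoved] at e₃ h₁
      obtain ⟨A₁, e₄, rfl⟩ := qmoved_eq_un2 e.isData hc e₃
      refine ⟨qonList A₁, ?_, ?_⟩
      · rw [Q.map_hom_comp, e₀', map_qonList, e₄, qonList_un3]
      · simp only [Q.map_hom_comp, map_qs]
        rw [eA, map_qonList]
        exact (hs.map ρ₃.sub).rel h₁

theorem Rel.bin_inv (hn : Nt w n) {c : Con S (.arr e₁.ty (.arr e₂.ty e.ty))} (hc : c.IsFree)
    {A : Q w.ctx (.star (.star e₁.ty))} {B : Q w.ctx (.star (.star e₂.ty))}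
    (h : Rel k e w n t (bin2 c A B) x') :
    J w (fun w' ρ => ∃ A' B', x' ↾ ρ = bin2 c A' B' ∧ Rel k e₁ w' (n ↾ ρ) (t ↾ ρ) (A ↾ ρ) A' ∧
      Rel k e₂ w' (n ↾ ρ) (t ↾ ρ) (B ↾ ρ) B') := by
  have := nat_rule (Φ := []) (ys := .nil)
    (τs := [.star (.star .i), .star (.star e₁.ty), .star (.star e₂.ty), .star (.star e.ty)])
    (fRel k e v4 v0 (binT c v1 v2) v3)
    (.ex (.star (.star e₁.ty)) (.ex (.star (.star e₂.ty)) (fSame e v5 (binT c v1 v0) ⊓ₘ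
      fRel k e₁ v6 v2 v3 v1 ⊓ₘ fRel k e₂ v6 v2 v4 v0))) ?_ hn
    (t ∷ A ∷ B ∷ x' ∷ .nil) (by simpa [eval_binT] using h)
  · simp only [Env.forall_cons, Env.forall_nil, Env.cons_append, Env.nil_append, Env.map_cons,
      Env.map_nil, holds_and, and_imp, holds_all, holds_same, holds_ex_same, holds_ex_ex_same,
      holds_rel, Tm.eval_var, Env.get_zero, Env.get_succ, eval_nulT, eval_unT, eval_binT, eval_atT]
        at this
    exact this
  · simp only [Env.forall_cons, Env.forall_nil, Env.cons_append, Env.nil_append, Env.map_cons,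
      Env.map_nil, holds_and, and_imp, holds_all, holds_same, holds_ex_same, holds_ex_ex_same,
      holds_rel, Tm.eval_var, Env.get_zero, Env.get_succ, eval_nulT, eval_unT, eval_binT, eval_atT]
    clear hn h
    intro w ρ n hn ih t A B x' h
    refine hn.cases.bind fun w₁ ρ₁ hcase => ?_
    replace h := h.mono ρ₁
    replace ih := fun w' ρ' => ih w' (ρ₁.comp ρ')
    simp only [Q.map_hom_comp, map_bin2] at ih h ⊢
    generalize n ↾ ρ₁ = n at *
    generalize t ↾ ρ₁ = t at *
    generalize A ↾ ρ₁ = A at *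
    generalize B ↾ ρ₁ = B at *
    generalize x' ↾ ρ₁ = x' at *
    cases hcase with
    | zero =>
      refine h.zero_inv.imp fun w₂ ρ₂ hb => ?_
      rw [map_bin2] at hb
      obtain ⟨A', B', e, h₁, h₂⟩ := hb.bin_inv e.isData hc
      exact ⟨A', B', e, by rw [map_qz]; exact ⟨h₁.rel, h₂.rel⟩⟩
    | succ =>
      refine h.succ_inv.bind ?_
      rintro w₂ ρ₂ ⟨t', y, y', hs, e₀, e₀', h⟩
      rw [map_bin2] at e₀
      obtain ⟨A₀, B₀, rfl, eA, eB⟩ := qonList_eq_bin2 e.isData hc e₀.symm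
      rw [qmoved_bin3] at h
      refine ((ih w₂ ρ₂ _ (map_qs _ _)).2 _ _ _ _ h).imp ?_
      rintro w₃ ρ₃ ⟨A', B', e₃, h₁, h₂⟩
      rw [map_qmoved] at e₃ h₁ h₂
      obtain ⟨A₁, B₁, e₄, rfl, rfl⟩ := qmoved_eq_bin2 e.isData hc e₃
      refine ⟨qonList A₁, qonList B₁, ?_, ?_, ?_⟩
      · rw [Q.map_hom_comp, e₀', map_qonList, e₄, qonList_bin3]
      · simp only [Q.map_hom_comp, map_qs]
        rw [eA, map_qonList]
        exact (hs.map ρ₃.sub).rel h₁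
      · simp only [Q.map_hom_comp, map_qs]
        rw [eB, map_qonList]
        exact (hs.map ρ₃.sub).rel h₂

/-- The argument of a binder does not have one of the four types for which changes are defined. It
is therefore compared after application to an arbitrary `V` that depends on the parameters only; the
change, which acts on `l`, leaves such a `V` alone. -/
theorem Rel.binder_inv (hn : Nt w n) {c : Con S (.arr (.arr .i e₁.ty) e.ty)} (hc : c.IsFree)
    {B : Q w.ctx (.star (.star (.arr .i e₁.ty)))} (h : Rel k e w n t (un2 c B) x') :
    J w (fun w' ρ => ∃ B', x' ↾ ρ = un2 c B' ∧ ∀ (w'' : World D) (ρ' : Hom w' w'')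
      (V : Q w''.ctx (.star .i)), Rel k e₁ w'' (n ↾ ρ ↾ ρ') (t ↾ ρ ↾ ρ') (qat2 (B ↾ ρ ↾ ρ') V)
        (qat2 (B' ↾ ρ') V)) := by
  have := nat_rule (Φ := []) (ys := .nil)
    (τs := [.star (.star .i), .star (.star (.arr .i e₁.ty)), .star (.star e.ty)])
    (fRel k e v3 v0 (unT c v1) v2)
    (.ex (.star (.star (.arr .i e₁.ty))) (fSame e v3 (unT c v0) ⊓ₘ
      .all (.star .i) (fRel k e₁ v5 v2 (atT v3 v0) (atT v1 v0)))) ?_ hn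
    (t ∷ B ∷ x' ∷ .nil) ?_
  · simp only [Env.forall_cons, Env.forall_nil, Env.cons_append, Env.nil_append, Env.map_cons,
      Env.map_nil, holds_and, and_imp, holds_all, holds_same, holds_ex_same, holds_ex_ex_same,
      holds_rel, Tm.eval_var, Env.get_zero, Env.get_succ, eval_nulT, eval_unT, eval_binT, eval_atT]
        at this
    exact this
  · simp only [Env.forall_cons, Env.forall_nil, Env.cons_append, Env.nil_append, Env.map_cons,
      Env.map_nil, holds_and, and_imp, holds_all, holds_same, holds_ex_same, holds_ex_ex_same,
      holds_rel, Tm.eval_var, Env.get_zero, Env.get_succ, eval_nulT, eval_unT, eval_binT, eval_atT]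
    clear hn h
    intro w ρ n hn ih t B x' h
    refine hn.cases.bind fun w₁ ρ₁ hcase => ?_
    replace h := h.mono ρ₁
    replace ih := fun w' ρ' => ih w' (ρ₁.comp ρ')
    simp only [Q.map_hom_comp, map_un2] at ih h ⊢
    generalize n ↾ ρ₁ = n at *
    generalize t ↾ ρ₁ = t at *
    generalize B ↾ ρ₁ = B at *
    generalize x' ↾ ρ₁ = x' at *
    cases hcase with
    | zero =>
      refine h.zero_inv.imp fun w₂ ρ₂ hb => ?_
      rw [map_un2] at hb
      obtain ⟨B', e₀, h₁⟩ := hb.un_inv e.isData hc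
      refine ⟨B', e₀, fun w₃ ρ₃ V => ?_⟩
      rw [map_qz, map_qz]
      exact ((h₁.map ρ₃.sub).at V).rel
    | succ =>
      refine h.succ_inv.bind ?_
      rintro w₂ ρ₂ ⟨t', y, y', hs, e₀, e₀', h⟩
      rw [map_un2] at e₀
      obtain ⟨B₀, rfl, eB⟩ := qonList_eq_un2 e.isData hc e₀.symm
      rw [qmoved_un3] at h
      refine ((ih w₂ ρ₂ _ (map_qs _ _)).2 _ _ _ h).imp ?_
      rintro w₃ ρ₃ ⟨B', e₃, h₁⟩
      rw [map_qmoved] at e₃ h₁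
      obtain ⟨B₁, e₄, rfl⟩ := qmoved_eq_un2 e.isData hc e₃
      refine ⟨qonList B₁, ?_, fun w₄ ρ₄ V => ?_⟩
      · rw [Q.map_hom_comp, e₀', map_qonList, e₄, qonList_un3]
      · simp only [Q.map_hom_comp, map_qs]
        rw [eB, map_qonList, map_qonList, map_qonList, ← qonList_qat3, ← qonList_qat3]
        refine ((hs.map ρ₃.sub).map ρ₄.sub).rel ?_
        -- One eigenvariable has been moved to the parameters, so the induction hypothesis is used
        -- at `V` shifted past it. This is why `V` is quantified in the induction formula.
        have := h₁ w₄ ρ₄ (qshift V)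
        rw [map_qmoved, map_qmoved] at this
        rw [qmoved_qat3, qmoved_qat3]
        exact this
  · simp only [Env.forall_cons, Env.forall_nil, Env.cons_append, Env.nil_append, Env.map_cons,
      Env.map_nil, holds_and, and_imp, holds_all, holds_same, holds_ex_same, holds_ex_ex_same,
      holds_rel, Tm.eval_var, Env.get_zero, Env.get_succ, eval_nulT, eval_unT, eval_binT, eval_atT]
    exact h

/-- A change is a partial function. This is needed where one atom occurs twice in a sequent: both
occurrences must be changed to the same atom. -/
theorem Rel.unique (hn : Nt w n) (h : Rel k e w n t x x') (h' : Rel k e w n t x x'') :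
    J w (fun _ ρ => x' ↾ ρ = x'' ↾ ρ) := by
  have := nat_rule (Φ := []) (ys := .nil)
    (τs := [.star (.star .i), .star (.star e.ty), .star (.star e.ty), .star (.star e.ty)])
    (fRel k e v4 v0 v1 v2 ⊓ₘ fRel k e v4 v0 v1 v3) (fSame e v2 v3) ?_ hn (t ∷ x ∷ x' ∷ x'' ∷ .nil)
    (by simpa using ⟨h, h'⟩)
  · simpa [holds_same] using this
  · simp only [Env.forall_cons, Env.forall_nil, Env.cons_append, Env.nil_append, Env.map_cons,
      Env.map_nil, holds_and, and_imp, holds_all, holds_same, holds_ex_same, holds_ex_ex_same,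
      holds_rel, Tm.eval_var, Env.get_zero, Env.get_succ, eval_nulT, eval_unT, eval_binT, eval_atT]
    clear hn h h'
    intro w ρ n hn ih t x x' x'' h h'
    refine hn.cases.bind fun w₁ ρ₁ hcase => ?_
    replace h := h.mono ρ₁
    replace h' := h'.mono ρ₁
    replace ih := fun w' ρ' => ih w' (ρ₁.comp ρ')
    simp only [Q.map_hom_comp] at ih h ⊢
    generalize n ↾ ρ₁ = n at *
    generalize t ↾ ρ₁ = t at *
    generalize x ↾ ρ₁ = x at *
    generalize x' ↾ ρ₁ = x' at *
    generalize x'' ↾ ρ₁ = x'' at *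
    cases hcase with
    | zero =>
      refine h.zero_inv.bind fun w₂ ρ₂ hb => ?_
      replace h' := h'.mono ρ₂
      rw [map_qz] at h'
      refine h'.zero_inv.imp fun w₃ ρ₃ hb' => ?_
      simp only [Q.map_hom_comp]
      exact (hb.map ρ₃.sub).unique hb'
    | succ =>
      refine h.succ_inv.bind ?_
      rintro w₂ ρ₂ ⟨t', y, y', hs, e₀, e₀', h⟩
      replace h' := h'.mono ρ₂
      rw [map_qs] at h'
      refine h'.succ_inv.bind ?_
      rintro w₃ ρ₃ ⟨t'', z, z', hs', e₁, e₁', h'⟩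
      obtain rfl := (hs.map ρ₃.sub).unique hs'
      rw [e₀, map_qonList] at e₁
      obtain rfl := qonList_injective e₁
      replace h := h.mono ρ₃
      rw [map_qmoved, map_qmoved] at h
      refine ((ih w₃ (ρ₂.comp ρ₃) _ (by rw [Q.map_hom_comp, map_qs, map_qs])).2 _ _ _ _ h h').imp ?_
      intro w₄ ρ₄ e₄
      rw [map_qmoved, map_qmoved] at e₄
      simp only [Q.map_hom_comp]
      rw [e₀', e₁', map_qonList, map_qonList, map_qonList, qmoved_injective e₄]

/-- A constant contains no eigenvariables, but for a substitution the term `t` must still have the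
form demanded at position `n`. The given change of some other expression guarantees this. -/
theorem Rel.nul (hn : Nt w n) (h : Rel k e w n t x x') (c : Con S e₁.ty) :
    Rel k e₁ w n t (nul2 c) (nul2 c) := by
  have := nat_rule (Φ := []) (ys := .nil)
    (τs := [.star (.star .i), .star (.star e.ty), .star (.star e.ty)])
    (fRel k e v3 v0 v1 v2) (fRel k e₁ v3 v0 (nulT c) (nulT c)) ?_ hn (t ∷ x ∷ x' ∷ .nil)
    (by simpa using h)
  · simpa [eval_nulT] using this
  · simp only [Env.forall_cons, Env.forall_nil, Env.cons_append, Env.nil_append, Env.map_cons,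
      Env.map_nil, holds_and, and_imp, holds_all, holds_same, holds_ex_same, holds_ex_ex_same,
      holds_rel, Tm.eval_var, Env.get_zero, Env.get_succ, eval_nulT, eval_unT, eval_binT, eval_atT]
    clear hn h
    intro w ρ n hn ih t x x' h
    refine hn.cases.rel fun w₁ ρ₁ hcase => ?_
    replace h := h.mono ρ₁
    replace ih := fun w' ρ' => ih w' (ρ₁.comp ρ')
    simp only [Q.map_hom_comp, map_nul2] at ih h ⊢
    generalize n ↾ ρ₁ = n at *
    generalize t ↾ ρ₁ = t at *
    cases hcase with
    | zero => exact (Change.Base.nul k t c).rel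
    | succ =>
      refine h.succ_inv.rel ?_
      rintro w₂ ρ₂ ⟨t', y, y', hs, e₀, e₀', h⟩
      have := (ih w₂ ρ₂ _ (map_qs _ _)).2 _ _ _ h
      rw [← qmoved_nul3] at this
      rw [map_qs, map_nul2, ← qonList_nul3]
      exact hs.rel this

theorem Rel.bin (hn : Nt w n) {A A' : Q w.ctx (.star (.star e₁.ty))}
    {B B' : Q w.ctx (.star (.star e₂.ty))} (h : Rel k e₁ w n t A A') (h' : Rel k e₂ w n t B B')
    (c : Con S (.arr e₁.ty (.arr e₂.ty e.ty))) :
    Rel k e w n t (bin2 c A B) (bin2 c A' B') := by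
  have := nat_rule (Φ := []) (ys := .nil)
    (τs := [.star (.star .i), .star (.star e₁.ty), .star (.star e₁.ty), .star (.star e₂.ty),
      .star (.star e₂.ty)])
    (fRel k e₁ v5 v0 v1 v2 ⊓ₘ fRel k e₂ v5 v0 v3 v4) (fRel k e v5 v0 (binT c v1 v3) (binT c v2 v4))
    ?_ hn (t ∷ A ∷ A' ∷ B ∷ B' ∷ .nil) (by simpa using ⟨h, h'⟩)
  · simpa [eval_binT] using this
  · simp only [Env.forall_cons, Env.forall_nil, Env.cons_append, Env.nil_append, Env.map_cons,
      Env.map_nil, holds_and, and_imp, holds_all, holds_same, holds_ex_same, holds_ex_ex_same,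
      holds_rel, Tm.eval_var, Env.get_zero, Env.get_succ, eval_nulT, eval_unT, eval_binT, eval_atT]
    clear hn h h'
    intro w ρ n hn ih t A A' B B' h h'
    refine hn.cases.rel fun w₁ ρ₁ hcase => ?_
    replace h := h.mono ρ₁
    replace h' := h'.mono ρ₁
    replace ih := fun w' ρ' => ih w' (ρ₁.comp ρ')
    simp only [Q.map_hom_comp, map_bin2] at ih h ⊢
    generalize n ↾ ρ₁ = n at *
    generalize t ↾ ρ₁ = t at *
    generalize A ↾ ρ₁ = A at *
    generalize A' ↾ ρ₁ = A' at *
    generalize B ↾ ρ₁ = B at *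
    generalize B' ↾ ρ₁ = B' at *
    cases hcase with
    | zero =>
      refine h.zero_inv.rel fun w₂ ρ₂ hb => ?_
      replace h' := h'.mono ρ₂
      rw [map_qz] at h'
      refine h'.zero_inv.rel fun w₃ ρ₃ hb' => ?_
      simp only [map_bin2, map_qz]
      exact ((hb.map ρ₃.sub).bin hb' c).rel
    | succ =>
      refine h.succ_inv.rel ?_
      rintro w₂ ρ₂ ⟨t', y, y', hs, e₀, e₀', h⟩
      replace h' := h'.mono ρ₂
      rw [map_qs] at h'
      rw [map_qs, map_bin2, map_bin2]
      refine h'.succ_inv.rel ?_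
      rintro w₃ ρ₃ ⟨t'', z, z', hs', e₁, e₁', h'⟩
      obtain rfl := (hs.map ρ₃.sub).unique hs'
      replace h := h.mono ρ₃
      rw [map_qmoved, map_qmoved] at h
      have := (ih w₃ (ρ₂.comp ρ₃) _ (by rw [Q.map_hom_comp, map_qs, map_qs])).2 _ _ _ _ _ h h'
      rw [← qmoved_bin3, ← qmoved_bin3] at this
      rw [map_qs, map_bin2, map_bin2, e₀, e₀', e₁, e₁', map_qonList, map_qonList, ← qonList_bin3,
        ← qonList_bin3]
      exact hs'.rel this

end

end FOLDN

namespace FOLDN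

variable {S : Sig} {D : Set (Clause S)} {w w' : World D} {Φ : Ctx S}

/-! ### Changes of object-level expressions -/

section

variable {Δ : Ctx S} {τ : Ty S.Base}

/-- `λ l' x l. X l`. -/
noncomputable def qlift (X : Q Δ (.star τ)) : Q Δ (.star (.arr .i (.star τ))) :=
  (Tm.lam (.lam (.lam (v3 ⬝ₘ v0)))).eval (X ∷ .nil)

/-- `qlift X` has the shifted expression as its `qonList` and the expression itself as its `qmoved`.
It thus exhibits a change at position $n+1$ of shifted expressions as coming from a change at
position $n$. -/
theorem qonList_qlift (X : Q Δ (.star τ)) : qonList (qlift X) = qconst (qshift X) :=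
  b2_injective (by simp [-eval_lam_succ, b2, qonList, onList, qlift, qconst, qshift])

theorem qmoved_qlift (X : Q Δ (.star τ)) : qmoved (qlift X) = qconst X :=
  b2_injective (by simp [-eval_lam_succ, b2, qmoved, moved, qlift, qconst])

/-- `λ l' x l. B l x`. -/
noncomputable def qflip (B : Q Δ (.star (.arr .i τ))) : Q Δ (.star (.arr .i (.star τ))) :=
  (Tm.lam (.lam (.lam (v3 ⬝ₘ v0 ⬝ₘ v1)))).eval (B ∷ .nil)

/-- `λ l. fst l`. -/
noncomputable def qfst : Q Δ (.star .i) := (Tm.lam (fst v0)).eval .nil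

/-- Opening a binder puts a new eigenvariable in front of the list. Moving it to the parameters
leaves the body applied to the first parameter, which is the form treated by `Rel.binder_inv`. -/
theorem qonList_qflip (B : Q Δ (.star (.arr .i τ))) : qonList (qflip B) = qconst (qopen B) :=
  b2_injective (by simp [-eval_lam_succ, b2, qonList, onList, qflip, qconst, qopen])

theorem qmoved_qflip (B : Q Δ (.star (.arr .i τ))) :
    qmoved (qflip B) = qat2 (qconst B) qfst :=
  b2_injective (by simp [-eval_lam_succ, b2, qmoved, moved, qflip, qconst, qat2, qfst])

theorem eval_lam_wk (X : Tm S Φ (.star τ)) (xs : Env Δ Φ) :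
    (Tm.lam X.wk : Tm S Φ (.star (.star τ))).eval xs = qconst (X.eval xs) :=
  b2_injective (by simp [-eval_lam_succ, b2, qconst])

end

theorem Rel.lift [LinDef D] {k : Change} {e : ETy} {n : Q w.ctx .nt} {t : Q w.ctx (.star .i)}
    {y y' : Q w.ctx (.star (.arr .i (.star e.ty)))}
    (h : Rel k e w n (qconst t) (qmoved y) (qmoved y')) :
    Rel k e w (qs n) (qconst (qshift t)) (qonList y) (qonList y') := by
  cases k with
  | ext => exact (ExtCase.succ h).intro
  | unext => exact (ExtCase.succ h).intro
  | sub =>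
    rw [← qonList_qlift]
    rw [← qmoved_qlift] at h
    exact (SubstCase.succ h).intro

/-- A change of an expression without parameters. -/
def Rel₁ (k : Change) (e : ETy) (w : World D) (n : Q w.ctx .nt) (t : Q w.ctx (.star .i))
    (x x' : Q w.ctx (.star e.ty)) : Prop :=
  Rel k e w n (qconst t) (qconst x) (qconst x')

def fRel₁ (k : Change) (e : ETy) (n : Tm S Φ .nt) (t : Tm S Φ (.star .i))
    (x x' : Tm S Φ (.star e.ty)) : Fm S Φ :=
  fRel k e n (.lam t.wk) (.lam x.wk) (.lam x'.wk)

theorem holds_rel₁ {k : Change} {e : ETy} {n : Tm S Φ .nt} {t : Tm S Φ (.star .i)}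
    {x x' : Tm S Φ (.star e.ty)} {xs : Env w.ctx Φ} : Holds w (fRel₁ k e n t x x') xs ↔
      Rel₁ k e w (n.eval xs) (t.eval xs) (x.eval xs) (x'.eval xs) := by
  rw [fRel₁, Rel₁, holds_rel, eval_lam_wk, eval_lam_wk, eval_lam_wk]

namespace Rel₁

variable {k : Change} {e e₁ e₂ : ETy} {n : Q w.ctx .nt} {t : Q w.ctx (.star .i)}
  {x x' x'' : Q w.ctx (.star e.ty)}

theorem mono (h : Rel₁ k e w n t x x') (ρ : Hom w w') :
    Rel₁ k e w' (n ↾ ρ) (t ↾ ρ) (x ↾ ρ) (x' ↾ ρ) := by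
  have := Rel.mono h ρ
  rwa [map_qconst, map_qconst, map_qconst] at this

variable [LinDef D]

theorem unique (hn : Nt w n) (h : Rel₁ k e w n t x x') (h' : Rel₁ k e w n t x x'') :
    J w (fun _ ρ => x' ↾ ρ = x'' ↾ ρ) := by
  refine (Rel.unique hn h h').imp fun w' ρ e => ?_
  rw [map_qconst, map_qconst] at e
  exact qconst_injective e

theorem nul (hn : Nt w n) (h : Rel₁ k e w n t x x') (c : Con S e₁.ty) :
    Rel₁ k e₁ w n t (qnul c) (qnul c) := by
  rw [Rel₁, qconst_qnul]
  exact Rel.nul hn h c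

theorem bin (hn : Nt w n) {a a' : Q w.ctx (.star e₁.ty)} {b b' : Q w.ctx (.star e₂.ty)}
    (h : Rel₁ k e₁ w n t a a') (h' : Rel₁ k e₂ w n t b b')
    (c : Con S (.arr e₁.ty (.arr e₂.ty e.ty))) : Rel₁ k e w n t (qbin c a b) (qbin c a' b') := by
  rw [Rel₁, qconst_qbin, qconst_qbin]
  exact Rel.bin hn h h' c

theorem shift (h : Rel₁ k e w n t x x') :
    Rel₁ k e w (qs n) (qshift t) (qshift x) (qshift x') := by
  rw [Rel₁, ← qmoved_qlift x, ← qmoved_qlift x'] at h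
  rw [Rel₁, ← qonList_qlift x, ← qonList_qlift x']
  exact h.lift

theorem nul_inv (hn : Nt w n) {c : Con S e.ty} (hc : c.IsFree) (h : Rel₁ k e w n t (qnul c) x') :
    J w (fun _ ρ => x' ↾ ρ = qnul c) := by
  rw [Rel₁, qconst_qnul] at h
  refine (Rel.nul_inv hn hc h).imp fun w' ρ e' => ?_
  rw [map_qconst] at e'
  exact qconst_eq_nul2 e.isData hc e'

theorem un_inv (hn : Nt w n) {c : Con S (.arr e₁.ty e.ty)} (hc : c.IsFree)
    {a : Q w.ctx (.star e₁.ty)} (h : Rel₁ k e w n t (qun c a) x') :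
    J w (fun w' ρ => ∃ a', x' ↾ ρ = qun c a' ∧ Rel₁ k e₁ w' (n ↾ ρ) (t ↾ ρ) (a ↾ ρ) a') := by
  rw [Rel₁, qconst_qun] at h
  refine (Rel.un_inv hn hc h).imp ?_
  rintro w' ρ ⟨A', e', h⟩
  rw [map_qconst] at e'
  obtain ⟨a', e₀, rfl⟩ := qconst_eq_un2 e.isData hc e'
  rw [map_qconst, map_qconst] at h
  exact ⟨a', e₀, h⟩

theorem bin_inv (hn : Nt w n) {c : Con S (.arr e₁.ty (.arr e₂.ty e.ty))} (hc : c.IsFree)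
    {a : Q w.ctx (.star e₁.ty)} {b : Q w.ctx (.star e₂.ty)} (h : Rel₁ k e w n t (qbin c a b) x') :
    J w (fun w' ρ => ∃ a' b', x' ↾ ρ = qbin c a' b' ∧ Rel₁ k e₁ w' (n ↾ ρ) (t ↾ ρ) (a ↾ ρ) a' ∧
      Rel₁ k e₂ w' (n ↾ ρ) (t ↾ ρ) (b ↾ ρ) b') := by
  rw [Rel₁, qconst_qbin] at h
  refine (Rel.bin_inv hn hc h).imp ?_
  rintro w' ρ ⟨A', B', e', h₁, h₂⟩
  rw [map_qconst] at e'
  obtain ⟨a', b', e₀, rfl, rfl⟩ := qconst_eq_bin2 e.isData hc e'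
  rw [map_qconst, map_qconst] at h₁ h₂
  exact ⟨a', b', e₀, h₁, h₂⟩

theorem binder_inv (hn : Nt w n) {c : Con S (.arr (.arr .i e₁.ty) e.ty)} (hc : c.IsFree)
    {b : Q w.ctx (.star (.arr .i e₁.ty))} (h : Rel₁ k e w n t (qun c b) x') :
    J w (fun w' ρ => ∃ b', x' ↾ ρ = qun c b' ∧
      Rel₁ k e₁ w' (qs (n ↾ ρ)) (qshift (t ↾ ρ)) (qopen (b ↾ ρ)) (qopen b')) := by
  rw [Rel₁, qconst_qun] at h
  refine (Rel.binder_inv hn hc h).imp ?_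
  rintro w' ρ ⟨B', e', h⟩
  rw [map_qconst] at e'
  obtain ⟨b', e₀, rfl⟩ := qconst_eq_un2 e.isData hc e'
  refine ⟨b', e₀, ?_⟩
  -- The parameter list begins with the variable of the opened binder.
  have := h w' (Hom.id w') qfst
  simp only [Q.map_hom_id, map_qconst] at this
  rw [Rel₁, ← qonList_qflip, ← qonList_qflip]
  refine Rel.lift ?_
  rw [qmoved_qflip, qmoved_qflip]
  exact this

end Rel₁

/-- A change of an expression of type `atm`. -/
def RelAtm (k : Change) (w : World D) (n : Q w.ctx .nt) (t : Q w.ctx (.star .i))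
    (x x' : Q w.ctx (.star .atm)) : Prop := Rel₁ k .atm w n t x x'

def fRelAtm (k : Change) (n : Tm S Φ .nt) (t : Tm S Φ (.star .i)) (x x' : Tm S Φ (.star .atm)) :
    Fm S Φ := fRel₁ k .atm n t x x'

@[simp] theorem holds_relAtm {k : Change} {n : Tm S Φ .nt} {t : Tm S Φ (.star .i)}
    {x x' : Tm S Φ (.star .atm)} {xs : Env w.ctx Φ} : Holds w (fRelAtm k n t x x') xs ↔
      RelAtm k w (n.eval xs) (t.eval xs) (x.eval xs) (x'.eval xs) := holds_rel₁

theorem RelAtm.mono {k : Change} {n : Q w.ctx .nt} {t : Q w.ctx (.star .i)}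
    {x x' : Q w.ctx (.star .atm)} (h : RelAtm k w n t x x') (ρ : Hom w w') :
    RelAtm k w' (n ↾ ρ) (t ↾ ρ) (x ↾ ρ) (x' ↾ ρ) := Rel₁.mono h ρ

/-- A change of an expression of type `atmlst`. -/
def RelAtms (k : Change) (w : World D) (n : Q w.ctx .nt) (t : Q w.ctx (.star .i))
    (x x' : Q w.ctx (.star .atmlst)) : Prop := Rel₁ k .atmlst w n t x x'

def fRelAtms (k : Change) (n : Tm S Φ .nt) (t : Tm S Φ (.star .i)) (x x' : Tm S Φ (.star .atmlst)) :
    Fm S Φ := fRel₁ k .atmlst n t x x'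

@[simp] theorem holds_relAtms {k : Change} {n : Tm S Φ .nt} {t : Tm S Φ (.star .i)}
    {x x' : Tm S Φ (.star .atmlst)} {xs : Env w.ctx Φ} : Holds w (fRelAtms k n t x x') xs ↔
      RelAtms k w (n.eval xs) (t.eval xs) (x.eval xs) (x'.eval xs) := holds_rel₁

theorem RelAtms.mono {k : Change} {n : Q w.ctx .nt} {t : Q w.ctx (.star .i)}
    {x x' : Q w.ctx (.star .atmlst)} (h : RelAtms k w n t x x') (ρ : Hom w w') :
    RelAtms k w' (n ↾ ρ) (t ↾ ρ) (x ↾ ρ) (x' ↾ ρ) := Rel₁.mono h ρ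

/-- A change of an expression of type `prp`. -/
def RelPrp (k : Change) (w : World D) (n : Q w.ctx .nt) (t : Q w.ctx (.star .i))
    (x x' : Q w.ctx (.star .prp)) : Prop := Rel₁ k .prp w n t x x'

def fRelPrp (k : Change) (n : Tm S Φ .nt) (t : Tm S Φ (.star .i)) (x x' : Tm S Φ (.star .prp)) :
    Fm S Φ := fRel₁ k .prp n t x x'

@[simp] theorem holds_relPrp {k : Change} {n : Tm S Φ .nt} {t : Tm S Φ (.star .i)}
    {x x' : Tm S Φ (.star .prp)} {xs : Env w.ctx Φ} : Holds w (fRelPrp k n t x x') xs ↔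
      RelPrp k w (n.eval xs) (t.eval xs) (x.eval xs) (x'.eval xs) := holds_rel₁

theorem RelPrp.mono {k : Change} {n : Q w.ctx .nt} {t : Q w.ctx (.star .i)}
    {x x' : Q w.ctx (.star .prp)} (h : RelPrp k w n t x x') (ρ : Hom w w') :
    RelPrp k w' (n ↾ ρ) (t ↾ ρ) (x ↾ ρ) (x' ↾ ρ) := Rel₁.mono h ρ

/-- A change of an expression of type `prplst`. -/
def RelPrps (k : Change) (w : World D) (n : Q w.ctx .nt) (t : Q w.ctx (.star .i))
    (x x' : Q w.ctx (.star .prplst)) : Prop := Rel₁ k .prplst w n t x x'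

def fRelPrps (k : Change) (n : Tm S Φ .nt) (t : Tm S Φ (.star .i)) (x x' : Tm S Φ (.star .prplst)) :
    Fm S Φ := fRel₁ k .prplst n t x x'

@[simp] theorem holds_relPrps {k : Change} {n : Tm S Φ .nt} {t : Tm S Φ (.star .i)}
    {x x' : Tm S Φ (.star .prplst)} {xs : Env w.ctx Φ} : Holds w (fRelPrps k n t x x') xs ↔
      RelPrps k w (n.eval xs) (t.eval xs) (x.eval xs) (x'.eval xs) := holds_rel₁

theorem RelPrps.mono {k : Change} {n : Q w.ctx .nt} {t : Q w.ctx (.star .i)}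
    {x x' : Q w.ctx (.star .prplst)} (h : RelPrps k w n t x x') (ρ : Hom w w') :
    RelPrps k w' (n ↾ ρ) (t ↾ ρ) (x ↾ ρ) (x' ↾ ρ) := Rel₁.mono h ρ

section

variable [LinDef D] {k : Change} {n : Q w.ctx .nt} {t : Q w.ctx (.star .i)}

theorem RelAtm.unique {a a' a'' : Q w.ctx (.star .atm)} (hn : Nt w n) (h : RelAtm k w n t a a')
    (h' : RelAtm k w n t a a'') : J w (fun _ ρ => a' ↾ ρ = a'' ↾ ρ) := Rel₁.unique hn h h'

theorem RelAtms.nil {l l' : Q w.ctx (.star .atmlst)} (hn : Nt w n) (h : RelAtms k w n t l l') :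
    RelAtms k w n t qanil qanil := Rel₁.nul (e₁ := .atmlst) hn h (.nil .atm)

theorem RelAtms.cons {a a' : Q w.ctx (.star .atm)} {l l' : Q w.ctx (.star .atmlst)} (hn : Nt w n)
    (h : RelAtm k w n t a a') (h' : RelAtms k w n t l l') :
    RelAtms k w n t (qacons a l) (qacons a' l') := Rel₁.bin (e := .atmlst) hn h h' (.cons .atm)

theorem RelAtms.shift {l l' : Q w.ctx (.star .atmlst)} (h : RelAtms k w n t l l') :
    RelAtms k w (qs n) (qshift t) (qshift l) (qshift l') := Rel₁.shift h

theorem RelAtms.nil_inv {x' : Q w.ctx (.star .atmlst)} (hn : Nt w n) (h : RelAtms k w n t qanil x')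
    :
    J w (fun _ ρ => x' ↾ ρ = qanil) := Rel₁.nul_inv (e := .atmlst) hn (c := .nil .atm)
      (fun _ => rfl) h

theorem RelPrps.nil_inv {x' : Q w.ctx (.star .prplst)} (hn : Nt w n) (h : RelPrps k w n t qpnil x')
    :
    J w (fun _ ρ => x' ↾ ρ = qpnil) := Rel₁.nul_inv (e := .prplst) hn (c := .nil .prp)
      (fun _ => rfl) h

theorem RelPrp.tt_inv {x' : Q w.ctx (.star .prp)} (hn : Nt w n) (h : RelPrp k w n t qtt x') :
    J w (fun _ ρ => x' ↾ ρ = qtt) := Rel₁.nul_inv (e := .prp) hn (c := .tt) (fun _ => rfl) h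

theorem RelPrp.atom_inv {a : Q w.ctx (.star .atm)} {b : Q w.ctx (.star .prp)} (hn : Nt w n)
    (h : RelPrp k w n t (qatom a) b) :
    J w (fun w' ρ => ∃ a', b ↾ ρ = qatom a' ∧ RelAtm k w' (n ↾ ρ) (t ↾ ρ) (a ↾ ρ) a') :=
  Rel₁.un_inv (e := .prp) (e₁ := .atm) hn (c := .atom) (fun _ => rfl) h

theorem RelAtms.cons_inv {a : Q w.ctx (.star .atm)} {b : Q w.ctx (.star .atmlst)}
    {x' : Q w.ctx (.star .atmlst)} (hn : Nt w n) (h : RelAtms k w n t (qacons a b) x') :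
    J w (fun w' ρ => ∃ a' b', x' ↾ ρ = qacons a' b' ∧ RelAtm k w' (n ↾ ρ) (t ↾ ρ) (a ↾ ρ) a' ∧
      RelAtms k w' (n ↾ ρ) (t ↾ ρ) (b ↾ ρ) b') :=
  Rel₁.bin_inv (e := .atmlst) (e₁ := .atm) (e₂ := .atmlst) hn (c := .cons .atm) (fun _ => rfl) h

theorem RelPrps.cons_inv {a : Q w.ctx (.star .prp)} {b : Q w.ctx (.star .prplst)}
    {x' : Q w.ctx (.star .prplst)} (hn : Nt w n) (h : RelPrps k w n t (qpcons a b) x') :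
    J w (fun w' ρ => ∃ a' b', x' ↾ ρ = qpcons a' b' ∧ RelPrp k w' (n ↾ ρ) (t ↾ ρ) (a ↾ ρ) a' ∧
      RelPrps k w' (n ↾ ρ) (t ↾ ρ) (b ↾ ρ) b') :=
  Rel₁.bin_inv (e := .prplst) (e₁ := .prp) (e₂ := .prplst) hn (c := .cons .prp) (fun _ => rfl) h

theorem RelPrp.with_inv {a : Q w.ctx (.star .prp)} {b : Q w.ctx (.star .prp)}
    {x' : Q w.ctx (.star .prp)} (hn : Nt w n) (h : RelPrp k w n t (qwith a b) x') :
    J w (fun w' ρ => ∃ a' b', x' ↾ ρ = qwith a' b' ∧ RelPrp k w' (n ↾ ρ) (t ↾ ρ) (a ↾ ρ) a' ∧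
      RelPrp k w' (n ↾ ρ) (t ↾ ρ) (b ↾ ρ) b') :=
  Rel₁.bin_inv (e := .prp) (e₁ := .prp) (e₂ := .prp) hn (c := .wth) (fun _ => rfl) h

theorem RelPrp.limp_inv {a : Q w.ctx (.star .atm)} {b : Q w.ctx (.star .prp)}
    {x' : Q w.ctx (.star .prp)} (hn : Nt w n) (h : RelPrp k w n t (qlimp a b) x') :
    J w (fun w' ρ => ∃ a' b', x' ↾ ρ = qlimp a' b' ∧ RelAtm k w' (n ↾ ρ) (t ↾ ρ) (a ↾ ρ) a' ∧
      RelPrp k w' (n ↾ ρ) (t ↾ ρ) (b ↾ ρ) b') :=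
  Rel₁.bin_inv (e := .prp) (e₁ := .atm) (e₂ := .prp) hn (c := .limp) (fun _ => rfl) h

theorem RelPrp.iimp_inv {a : Q w.ctx (.star .atm)} {b : Q w.ctx (.star .prp)}
    {x' : Q w.ctx (.star .prp)} (hn : Nt w n) (h : RelPrp k w n t (qiimp a b) x') :
    J w (fun w' ρ => ∃ a' b', x' ↾ ρ = qiimp a' b' ∧ RelAtm k w' (n ↾ ρ) (t ↾ ρ) (a ↾ ρ) a' ∧
      RelPrp k w' (n ↾ ρ) (t ↾ ρ) (b ↾ ρ) b') :=
  Rel₁.bin_inv (e := .prp) (e₁ := .atm) (e₂ := .prp) hn (c := .iimp) (fun _ => rfl) h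

theorem RelPrp.big_inv {b : Q w.ctx (.star (.arr .i .prp))} {p : Q w.ctx (.star .prp)} (hn : Nt w n)
    (h : RelPrp k w n t (qbig b) p) :
    J w (fun w' ρ => ∃ b', p ↾ ρ = qbig b' ∧
      RelPrp k w' (qs (n ↾ ρ)) (qshift (t ↾ ρ)) (qopen (b ↾ ρ)) (qopen b')) :=
  Rel₁.binder_inv (e := .prp) (e₁ := .prp) hn (c := .bigwedge) (fun _ => rfl) h

end

end FOLDN

namespace FOLDN

variable {S : Sig} {D : Set (Clause S)} {w w' : World D} {Φ : Ctx S} [LinDef D]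

abbrev v8 {a b c d e f g h j : Ty S.Base} : Tm S (a :: b :: c :: d :: e :: f :: g :: h :: j :: Φ) j
    :=
  .var (.succ (.succ (.succ (.succ (.succ (.succ (.succ (.succ .zero))))))))

/-! ### Changes and the predicates on lists -/

section

set_option linter.unusedSimpArgs false

variable {k : Change} {n : Q w.ctx .nt} {t : Q w.ctx (.star .i)}

theorem ElemA.rel {a a' : Q w.ctx (.star .atm)} {l l' : Q w.ctx (.star .atmlst)} (hl : ListA w l)
    (hn : Nt w n) (ha : RelAtm k w n t a a') (hr : RelAtms k w n t l l') (h : ElemA w a l) :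
    ElemA w a' l' := by
  have := listA_rule (τs := [.star .atm, .star .atm, .star .atmlst]) (ys := n ∷ t ∷ .nil)
    (.nat v4 ⊓ₘ fRelAtm k v4 v5 v0 v1 ⊓ₘ fRelAtms k v4 v5 v3 v2 ⊓ₘ fElement .atm 1 v0 v3)
    (fElement .atm 1 v1 v2) ?_ hl (a ∷ a' ∷ l' ∷ .nil) (by simpa using ⟨hn, ha, hr, h⟩)
  · simpa using this
  · simp only [Env.forall_cons, Env.forall_nil, Env.cons_append, Env.nil_append, Env.map_cons,
      Env.map_nil, holds_and, and_imp, holds_ex_ex, holds_split, holds_element, holds_listA,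
      holds_listP, holds_nat, holds_seq, holds_splitSeq, holds_relAtm, holds_relAtms,
      holds_relPrp, holds_relPrps, Tm.eval_var, Env.get_zero, Env.get_succ]
    clear hn hl ha hr h
    intro w ρ l hl ih a a' l' hn ha hr h
    generalize n ↾ ρ = n at *
    generalize t ↾ ρ = t at *
    refine h.cases.elemA fun w₁ ρ₁ hc => ?_
    replace hn := hn.mono ρ₁
    replace ha := ha.mono ρ₁
    replace hr := hr.mono ρ₁
    replace ih := fun w' ρ' => ih w' (ρ₁.comp ρ')
    simp only [Q.map_hom_comp] at ih
    generalize n ↾ ρ₁ = n at *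
    generalize t ↾ ρ₁ = t at *
    generalize a ↾ ρ₁ = a at *
    generalize a' ↾ ρ₁ = a' at *
    generalize l ↾ ρ₁ = l at *
    generalize l' ↾ ρ₁ = l' at *
    cases hc with
    | head =>
      refine (hr.cons_inv hn).elemA ?_
      rintro w₂ ρ₂ ⟨b, m, e, hb, hm⟩
      rw [e]
      -- The atom is the head of `l`; its change and that of the head of the list agree by
      -- uniqueness.
      refine ((ha.mono ρ₂).unique (hn.mono ρ₂) hb).elemA fun w₃ ρ₃ e => ?_
      rw [map_qacons, e]
      exact ElemCase.head.intro
    | tail h =>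
      refine (hr.cons_inv hn).elemA ?_
      rintro w₂ ρ₂ ⟨b, m, e, hb, hm⟩
      rw [e]
      exact (ElemCase.tail ((ih w₂ ρ₂ _ _ (map_qacons _ _ _)).2 _ _ _ (hn.mono ρ₂) (ha.mono ρ₂) hm
        (h.mono ρ₂))).intro

theorem SplitA.rel {l l' l₁ l₂ : Q w.ctx (.star .atmlst)} (hl : ListA w l)
    (hn : Nt w n) (hr : RelAtms k w n t l l') (h : SplitA w l l₁ l₂) :
    J w (fun w' ρ => ∃ l₁' l₂', SplitA w' (l' ↾ ρ) l₁' l₂' ∧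
      RelAtms k w' (n ↾ ρ) (t ↾ ρ) (l₁ ↾ ρ) l₁' ∧ RelAtms k w' (n ↾ ρ) (t ↾ ρ) (l₂ ↾ ρ) l₂') := by
  have := listA_rule (τs := [.star .atmlst, .star .atmlst, .star .atmlst]) (ys := n ∷ t ∷ .nil)
    (.nat v4 ⊓ₘ fRelAtms k v4 v5 v3 v0 ⊓ₘ fSplit .atm 1 v3 v1 v2)
    (.ex (.star .atmlst) (.ex (.star .atmlst) (fSplit .atm 1 v2 v1 v0 ⊓ₘ
      fRelAtms k v6 v7 v3 v1 ⊓ₘ fRelAtms k v6 v7 v4 v0))) ?_ hl (l' ∷ l₁ ∷ l₂ ∷ .nil)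
    (by simpa using ⟨hn, hr, h⟩)
  · simp only [Env.forall_cons, Env.forall_nil, Env.cons_append, Env.nil_append, Env.map_cons,
      Env.map_nil, holds_and, and_imp, holds_ex_ex, holds_split, holds_element, holds_listA,
      holds_listP, holds_nat, holds_seq, holds_splitSeq, holds_relAtm, holds_relAtms,
      holds_relPrp, holds_relPrps, Tm.eval_var, Env.get_zero, Env.get_succ] at this
    exact this
  · simp only [Env.forall_cons, Env.forall_nil, Env.cons_append, Env.nil_append, Env.map_cons,
      Env.map_nil, holds_and, and_imp, holds_ex_ex, holds_split, holds_element, holds_listA,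
      holds_listP, holds_nat, holds_seq, holds_splitSeq, holds_relAtm, holds_relAtms,
      holds_relPrp, holds_relPrps, Tm.eval_var, Env.get_zero, Env.get_succ]
    clear hn hl hr h
    intro w ρ l hl ih l' l₁ l₂ hn hr h
    generalize n ↾ ρ = n at *
    generalize t ↾ ρ = t at *
    refine h.cases.bind fun w₁ ρ₁ hc => ?_
    replace hn := hn.mono ρ₁
    replace hr := hr.mono ρ₁
    replace ih := fun w' ρ' => ih w' (ρ₁.comp ρ')
    simp only [Q.map_hom_comp] at ih ⊢
    generalize n ↾ ρ₁ = n at *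
    generalize t ↾ ρ₁ = t at *
    generalize l ↾ ρ₁ = l at *
    generalize l' ↾ ρ₁ = l' at *
    generalize l₁ ↾ ρ₁ = l₁ at *
    generalize l₂ ↾ ρ₁ = l₂ at *
    cases hc with
    | nil =>
      refine (hr.nil_inv hn).imp fun w₂ ρ₂ e => ⟨qanil, qanil, ?_, ?_⟩
      · rw [e]; exact SplitCase.nil.intro
      · rw [map_qanil]
        exact ⟨(hr.mono ρ₂).nil (hn.mono ρ₂), (hr.mono ρ₂).nil (hn.mono ρ₂)⟩
    | @left a _ _ _ h =>
      refine (hr.cons_inv hn).bind ?_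
      rintro w₂ ρ₂ ⟨b, m, e, hb, hm⟩
      refine ((ih w₂ ρ₂ _ _ (map_qacons _ _ _)).2 _ _ _ (hn.mono ρ₂) hm (h.mono ρ₂)).imp ?_
      rintro w₃ ρ₃ ⟨l₁', l₂', hs, h₁, h₂⟩
      simp only [Q.map_hom_comp, map_qacons, e]
      exact ⟨_, _, (SplitCase.left hs).intro,
        .cons ((hn.mono ρ₂).mono ρ₃) (hb.mono ρ₃) h₁, h₂⟩
    | @right a _ _ _ h =>
      refine (hr.cons_inv hn).bind ?_
      rintro w₂ ρ₂ ⟨b, m, e, hb, hm⟩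
      refine ((ih w₂ ρ₂ _ _ (map_qacons _ _ _)).2 _ _ _ (hn.mono ρ₂) hm (h.mono ρ₂)).imp ?_
      rintro w₃ ρ₃ ⟨l₁', l₂', hs, h₁, h₂⟩
      simp only [Q.map_hom_comp, map_qacons, e]
      exact ⟨_, _, (SplitCase.right hs).intro, h₁,
        .cons ((hn.mono ρ₂).mono ρ₃) (hb.mono ρ₃) h₂⟩

theorem ListP.rel {m m' : Q w.ctx (.star .prplst)} (hm : ListP w m) (hn : Nt w n)
    (hr : RelPrps k w n t m m') : ListP w m' := by
  have := listP_rule (τs := [.star .prplst]) (ys := n ∷ t ∷ .nil)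
    (.nat v2 ⊓ₘ fRelPrps k v2 v3 v1 v0) (fList .prp 1 v0) ?_ hm (m' ∷ .nil)
    (by simpa using ⟨hn, hr⟩)
  · simpa using this
  · simp only [Env.forall_cons, Env.forall_nil, Env.cons_append, Env.nil_append, Env.map_cons,
      Env.map_nil, holds_and, and_imp, holds_ex_ex, holds_split, holds_element, holds_listA,
      holds_listP, holds_nat, holds_seq, holds_splitSeq, holds_relAtm, holds_relAtms,
      holds_relPrp, holds_relPrps, Tm.eval_var, Env.get_zero, Env.get_succ]
    clear hn hm hr
    intro w ρ m hm ih m' hn hr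
    generalize n ↾ ρ = n at *
    generalize t ↾ ρ = t at *
    refine hm.cases.listP fun w₁ ρ₁ hc => ?_
    replace hn := hn.mono ρ₁
    replace hr := hr.mono ρ₁
    replace ih := fun w' ρ' => ih w' (ρ₁.comp ρ')
    simp only [Q.map_hom_comp] at ih
    generalize n ↾ ρ₁ = n at *
    generalize t ↾ ρ₁ = t at *
    generalize m ↾ ρ₁ = m at *
    generalize m' ↾ ρ₁ = m' at *
    cases hc with
    | nil =>
      refine (hr.nil_inv hn).listP fun w₂ ρ₂ e => ?_
      rw [e]
      exact .nil
    | cons =>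
      refine (hr.cons_inv hn).listP ?_
      rintro w₂ ρ₂ ⟨b, m, e, -, hm⟩
      rw [e]
      exact ((ih w₂ ρ₂ _ _ (map_qpcons _ _ _)).2 _ (hn.mono ρ₂) hm).cons

/-! ### Changes and derivability -/

/-- The counterpart of `SplitSeq.map` for changes: induction on the list of premises, with the
effect on a single premise as an assumption. The split of the linear hypotheses is carried along by
`SplitA.rel`. -/
theorem SplitSeq.rel {i : Q w.ctx .nt} {il il' ll ll' : Q w.ctx (.star .atmlst)}
    {m m' : Q w.ctx (.star .prplst)} (hm : ListP w m) (hn : Nt w n)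
    (f : ∀ (w' : World D) (ρ : Hom w w') l l' b b', ListA w' l →
      RelAtms k w' (n ↾ ρ) (t ↾ ρ) l l' → RelPrp k w' (n ↾ ρ) (t ↾ ρ) b b' →
      Seq w' (i ↾ ρ) (il ↾ ρ) l b → Seq w' (i ↾ ρ) (il' ↾ ρ) l' b')
    (hl : ListA w ll) (hr : RelAtms k w n t ll ll') (hr' : RelPrps k w n t m m')
    (h : SplitSeq w i il ll m) : SplitSeq w i il' ll' m' := by
  have := listP_rule (τs := [.star .atmlst, .star .atmlst, .star .prplst])
    (ys := i ∷ il ∷ il' ∷ n ∷ t ∷ .nil)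
    (.nat v7 ⊓ₘ fList .atm 1 v0 ⊓ₘ fRelAtms k v7 v8 v0 v1 ⊓ₘ fRelPrps k v7 v8 v3 v2 ⊓ₘ
      fSplitSeq v4 v5 v0 v3)
    (fSplitSeq v4 v6 v1 v2) ?_ hm (ll ∷ ll' ∷ m' ∷ .nil) (by simpa using ⟨hn, hl, hr, hr', h⟩)
  · simpa using this
  · simp only [Env.forall_cons, Env.forall_nil, Env.cons_append, Env.nil_append, Env.map_cons,
      Env.map_nil, holds_and, and_imp, holds_ex_ex, holds_split, holds_element, holds_listA,
      holds_listP, holds_nat, holds_seq, holds_splitSeq, holds_relAtm, holds_relAtms,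
      holds_relPrp, holds_relPrps, Tm.eval_var, Env.get_zero, Env.get_succ]
    clear hn hm hl hr hr' h
    intro w ρ m hm ih ll ll' m' hn hl hr hr' h
    replace f := fun w' ρ' => f w' (ρ.comp ρ')
    simp only [Q.map_hom_comp] at f
    generalize n ↾ ρ = n at *
    generalize t ↾ ρ = t at *
    generalize i ↾ ρ = i at *
    generalize il ↾ ρ = il at *
    generalize il' ↾ ρ = il' at *
    refine h.cases.splitSeq fun w₁ ρ₁ hc => ?_
    replace hn := hn.mono ρ₁
    replace hl := hl.mono ρ₁
    replace hr := hr.mono ρ₁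
    replace hr' := hr'.mono ρ₁
    replace f := fun w' ρ' => f w' (ρ₁.comp ρ')
    replace ih := fun w' ρ' => ih w' (ρ₁.comp ρ')
    simp only [Q.map_hom_comp] at f ih
    generalize n ↾ ρ₁ = n at *
    generalize t ↾ ρ₁ = t at *
    generalize i ↾ ρ₁ = i at *
    generalize il ↾ ρ₁ = il at *
    generalize il' ↾ ρ₁ = il' at *
    generalize m ↾ ρ₁ = m at *
    generalize m' ↾ ρ₁ = m' at *
    generalize ll ↾ ρ₁ = ll at *
    generalize ll' ↾ ρ₁ = ll' at *
    cases hc with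
    | nil =>
      refine (hr.nil_inv hn).splitSeq fun w₂ ρ₂ e => ?_
      refine ((hr'.mono ρ₂).nil_inv (hn.mono ρ₂)).splitSeq fun w₃ ρ₃ e' => ?_
      rw [e, e', map_qanil]
      exact SplitSeqCase.nil.intro
    | cons h₁ h₂ h₃ =>
      refine (hr'.cons_inv hn).splitSeq ?_
      rintro w₂ ρ₂ ⟨b, m, e, hb, hm⟩
      rw [e]
      refine (SplitA.rel (hl.mono ρ₂) (hn.mono ρ₂) (hr.mono ρ₂) (h₁.mono ρ₂)).splitSeq ?_
      rintro w₃ ρ₃ ⟨l₁', l₂', hs, k₁, k₂⟩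
      obtain ⟨q₁, q₂⟩ := (h₁.lists hl)
      replace f := f w₃ (ρ₂.comp ρ₃)
      replace ih := fun a t e => (ih w₃ (ρ₂.comp ρ₃) a t e).2
      simp only [Q.map_hom_comp] at f ih
      rw [map_qpcons]
      exact (SplitSeqCase.cons hs
        (f _ _ _ _ ((q₁.mono ρ₂).mono ρ₃) k₁ (hb.mono ρ₃) ((h₂.mono ρ₂).mono ρ₃))
        (ih _ _ (by rw [map_qpcons, map_qpcons]) _ _ _ ((hn.mono ρ₂).mono ρ₃)
          ((q₂.mono ρ₂).mono ρ₃) k₂ (hm.mono ρ₃) ((h₃.mono ρ₂).mono ρ₃))).intro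

/-- The change can be made in the clauses of the program. -/
def ProgRel (k : Change) (w₀ : World D) : Prop :=
  ∀ (w : World D), Hom w₀ w → ∀ (n : Q w.ctx .nt) (t : Q w.ctx (.star .i))
    (a a' : Q w.ctx (.star .atm)) (m l : Q w.ctx (.star .prplst)), Nt w n → ProgA w a m l →
    RelAtm k w n t a a' → J w (fun w' ρ => ∃ m' l', ProgA w' (a' ↾ ρ) m' l' ∧
      RelPrps k w' (n ↾ ρ) (t ↾ ρ) (m ↾ ρ) m' ∧ RelPrps k w' (n ↾ ρ) (t ↾ ρ) (l ↾ ρ) l')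

/-- Induction on the height, which is preserved. Each clause is inverted, the changed goal is seen
to have the same outermost constructor, and the clause is applied again. The position and the term
are quantified in the induction formula because $\bigwedge$ alters both. -/
theorem Seq.rel (hprog : ProgRel k w) {i : Q w.ctx .nt} {il il' ll ll' : Q w.ctx (.star .atmlst)}
    {b b' : Q w.ctx (.star .prp)} (hi : Nt w i) (hn : Nt w n) (hil : ListA w il)
    (hll : ListA w ll) (hr₁ : RelAtms k w n t il il') (hr₂ : RelAtms k w n t ll ll')
    (hr₃ : RelPrp k w n t b b') (h : Seq w i il ll b) : Seq w i il' ll' b' := by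
  have := nat_rule (Φ := []) (ys := .nil)
    (τs := [.nt, .star .i, .star .atmlst, .star .atmlst, .star .atmlst, .star .atmlst, .star .prp,
      .star .prp])
    (.nat v0 ⊓ₘ fList .atm 1 v2 ⊓ₘ fList .atm 1 v4 ⊓ₘ fRelAtms k v0 v1 v2 v3 ⊓ₘ
      fRelAtms k v0 v1 v4 v5 ⊓ₘ fRelPrp k v0 v1 v6 v7 ⊓ₘ fSeq v8 v2 v4 v6)
    (fSeq v8 v3 v5 v7) ?_ hi (n ∷ t ∷ il ∷ il' ∷ ll ∷ ll' ∷ b ∷ b' ∷ .nil)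
    (by simpa using ⟨hn, hil, hll, hr₁, hr₂, hr₃, h⟩)
  · simpa using this
  · simp only [Env.forall_cons, Env.forall_nil, Env.cons_append, Env.nil_append, Env.map_cons,
      Env.map_nil, holds_and, and_imp, holds_ex_ex, holds_split, holds_element, holds_listA,
      holds_listP, holds_nat, holds_seq, holds_splitSeq, holds_relAtm, holds_relAtms,
      holds_relPrp, holds_relPrps, Tm.eval_var, Env.get_zero, Env.get_succ]
    clear hi hn hil hll hr₁ hr₂ hr₃ h
    intro w₀ ρ₀ i hi ih n t il il' ll ll' b b' hn hil hll hr₁ hr₂ hr₃ h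
    refine h.cases.seq fun w₁ ρ₁ hc => ?_
    replace hprog := fun w (ρ : Hom w₁ w) => hprog w ((ρ₀.comp ρ₁).comp ρ)
    replace hn := hn.mono ρ₁
    replace hil := hil.mono ρ₁
    replace hll := hll.mono ρ₁
    replace hr₁ := hr₁.mono ρ₁
    replace hr₂ := hr₂.mono ρ₁
    replace hr₃ := hr₃.mono ρ₁
    replace ih := fun w' ρ' => ih w' (ρ₁.comp ρ')
    simp only [Q.map_hom_comp] at ih
    generalize i ↾ ρ₁ = i at *
    generalize n ↾ ρ₁ = n at *
    generalize t ↾ ρ₁ = t at *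
    generalize il ↾ ρ₁ = il at *
    generalize il' ↾ ρ₁ = il' at *
    generalize ll ↾ ρ₁ = ll at *
    generalize ll' ↾ ρ₁ = ll' at *
    generalize b ↾ ρ₁ = b at *
    generalize b' ↾ ρ₁ = b' at *
    cases hc with
    | init =>
      refine (hr₂.cons_inv hn).seq ?_
      rintro w₂ ρ₂ ⟨a', m, e, ha, hm⟩
      rw [map_qanil] at hm
      refine (hm.nil_inv (hn.mono ρ₂)).seq fun w₃ ρ₃ e₃ => ?_
      replace hr₃ := (hr₃.mono ρ₂).mono ρ₃
      replace hn := (hn.mono ρ₂).mono ρ₃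
      rw [map_qatom, map_qatom] at hr₃
      refine (hr₃.atom_inv hn).seq ?_
      rintro w₄ ρ₄ ⟨a'', e₄, ha'⟩
      -- The goal and the only linear hypothesis are the same atom, hence remain the same after the
      -- change.
      refine (((ha.mono ρ₃).mono ρ₄).unique (hn.mono ρ₄) ha').seq fun w₅ ρ₅ e₅ => ?_
      rw [e, e₄, map_qacons, map_qacons, map_qacons, e₃, map_qanil, map_qanil, e₅, map_qatom]
      exact SeqCase.init.intro
    | elem ha =>
      -- Only the shape matters here: the clause requires the changed list to be displayed as
      -- nonempty.
      refine (hr₁.cons_inv hn).seq ?_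
      rintro w₂ ρ₂ ⟨c, m, e, -, -⟩
      replace hr₁ := hr₁.mono ρ₂
      rw [e] at hr₁ ⊢
      replace hr₂ := hr₂.mono ρ₂
      replace hr₃ := hr₃.mono ρ₂
      rw [map_qanil] at hr₂
      rw [map_qatom] at hr₃
      refine (hr₂.nil_inv (hn.mono ρ₂)).seq fun w₃ ρ₃ e₃ => ?_
      replace hr₃ := hr₃.mono ρ₃
      rw [map_qatom] at hr₃
      rw [e₃]
      refine (hr₃.atom_inv ((hn.mono ρ₂).mono ρ₃)).seq ?_
      rintro w₄ ρ₄ ⟨a', e₄, ha'⟩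
      have := ElemA.rel (((hil.mono ρ₂).mono ρ₃).mono ρ₄) (((hn.mono ρ₂).mono ρ₃).mono ρ₄) ha'
        ((hr₁.mono ρ₃).mono ρ₄) (((ha.mono ρ₂).mono ρ₃).mono ρ₄)
      rw [map_qacons, map_qacons] at this
      rw [e₄, map_qanil, map_qacons, map_qacons]
      exact (SeqCase.elem this).intro
    | @prog j _ _ _ _ _ h₁ h₂ h₃ h₄ h₅ =>
      refine (hr₃.atom_inv hn).seq ?_
      rintro w₂ ρ₂ ⟨a', e, ha'⟩
      rw [e]
      refine (hprog w₂ ρ₂ _ _ _ _ _ _ (hn.mono ρ₂) (h₃.mono ρ₂) ha').seq ?_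
      rintro w₃ ρ₃ ⟨m', l', hp, hm, hl⟩
      replace hn := (hn.mono ρ₂).mono ρ₃
      replace hr₁ := (hr₁.mono ρ₂).mono ρ₃
      replace h₁ := (h₁.mono ρ₂).mono ρ₃
      replace h₂ := (h₂.mono ρ₂).mono ρ₃
      replace h₅ := (h₅.mono ρ₂).mono ρ₃
      rw [map_qanil, map_qanil] at h₅
      have f : ∀ (w' : World D) (ρ : Hom w₃ w') l l' b b', ListA w' l →
          RelAtms k w' (n ↾ ρ₂ ↾ ρ₃ ↾ ρ) (t ↾ ρ₂ ↾ ρ₃ ↾ ρ) l l' →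
          RelPrp k w' (n ↾ ρ₂ ↾ ρ₃ ↾ ρ) (t ↾ ρ₂ ↾ ρ₃ ↾ ρ) b b' →
          Seq w' (j ↾ ρ₂ ↾ ρ₃ ↾ ρ) (il ↾ ρ₂ ↾ ρ₃ ↾ ρ) l b →
          Seq w' (j ↾ ρ₂ ↾ ρ₃ ↾ ρ) (il' ↾ ρ₂ ↾ ρ₃ ↾ ρ) l' b' :=
        fun w₄ ρ₄ l l' b b' hl hr hb h => (ih w₄ ((ρ₂.comp ρ₃).comp ρ₄) _
          (by simp only [Q.map_hom_comp, map_qs])).2 _ _ _ _ _ _ _ _ (hn.mono ρ₄)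
          (((hil.mono ρ₂).mono ρ₃).mono ρ₄) hl (hr₁.mono ρ₄) hr hb h
      rw [map_qs, map_qs, map_qatom]
      exact (SeqCase.prog (h₁.rel hn hm) (h₂.rel hn hl) hp
        (.rel h₁ hn f ((hll.mono ρ₂).mono ρ₃) ((hr₂.mono ρ₂).mono ρ₃) hm ((h₄.mono ρ₂).mono ρ₃))
        (.rel h₂ hn f .nil (hr₁.nil hn) hl h₅)).intro
    | tt =>
      refine (hr₃.tt_inv hn).seq fun w₂ ρ₂ e => ?_
      rw [e]
      exact SeqCase.tt.intro
    | wth h₁ h₂ =>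
      refine (hr₃.with_inv hn).seq ?_
      rintro w₂ ρ₂ ⟨b', c', e, hb, hc⟩
      rw [e, map_qs]
      replace ih := fun b b' => (ih w₂ ρ₂ _ (map_qs _ _)).2 _ _ _ _ _ _ b b' (hn.mono ρ₂)
        (hil.mono ρ₂) (hll.mono ρ₂) (hr₁.mono ρ₂) (hr₂.mono ρ₂)
      exact (SeqCase.wth (ih _ _ hb (h₁.mono ρ₂)) (ih _ _ hc (h₂.mono ρ₂))).intro
    | limp h =>
      refine (hr₃.limp_inv hn).seq ?_
      rintro w₂ ρ₂ ⟨a', b', e, ha, hb⟩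
      rw [e, map_qs]
      replace h := h.mono ρ₂
      rw [map_qacons] at h
      exact (SeqCase.limp ((ih w₂ ρ₂ _ (map_qs _ _)).2 _ _ _ _ _ _ _ _ (hn.mono ρ₂)
        (hil.mono ρ₂) (hll.mono ρ₂).cons (hr₁.mono ρ₂) (.cons (hn.mono ρ₂) ha (hr₂.mono ρ₂))
        hb h)).intro
    | iimp h =>
      refine (hr₃.iimp_inv hn).seq ?_
      rintro w₂ ρ₂ ⟨a', b', e, ha, hb⟩
      rw [e, map_qs]
      replace h := h.mono ρ₂
      rw [map_qacons] at h
      exact (SeqCase.iimp ((ih w₂ ρ₂ _ (map_qs _ _)).2 _ _ _ _ _ _ _ _ (hn.mono ρ₂)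
        (hil.mono ρ₂).cons (hll.mono ρ₂) (.cons (hn.mono ρ₂) ha (hr₁.mono ρ₂)) (hr₂.mono ρ₂)
        hb h)).intro
    | big h =>
      refine (hr₃.big_inv hn).seq ?_
      rintro w₂ ρ₂ ⟨b', e, hb⟩
      rw [e, map_qs]
      replace h := h.mono ρ₂
      rw [map_qshift, map_qshift, map_qopen] at h
      -- The opened binder adds an eigenvariable in front, so the position of the change becomes its
      -- successor and the term is shifted.
      exact (SeqCase.big ((ih w₂ ρ₂ _ (map_qs _ _)).2 _ _ _ _ _ _ _ _ (hn.mono ρ₂).succ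
        (hil.mono ρ₂).shift (hll.mono ρ₂).shift (hr₁.mono ρ₂).shift (hr₂.mono ρ₂).shift
        hb h)).intro

end

end FOLDN

/-! ### Admissibility of the two cut rules -/

namespace FOLDN

variable {S : Sig} {D : Set (Clause S)} {w w' : World D} {Φ : Ctx S}

theorem ProgRel.mono {k : Change} (h : ProgRel k w) (ρ : Hom w w') : ProgRel k w' :=
  fun w'' ρ' => h w'' (ρ.comp ρ')

variable [LinDef D]

/-! ### Extension by a fresh eigenvariable -/

theorem qskip_qconst {Δ : Ctx S} {τ : Ty S.Base} (X : Q Δ (.star τ)) :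
    qskip (qconst X) = qconst (qshift X) :=
  b2_injective (by simp [-eval_lam_succ, -eval_lam_lam_rst, b2, qskip, qconst, qshift])

theorem rel₁_ext {e : ETy} {t : Q w.ctx (.star .i)} (x : Q w.ctx (.star e.ty)) :
    Rel₁ .ext e w qz t x (qshift x) := by
  rw [Rel₁, ← qskip_qconst]
  exact Change.Base.ext.rel

/-- Extension at position zero is the shift. The term given to `Seq.rel` is arbitrary, since an
extension involves none. -/
theorem Seq.shift (hprog : ProgRel .ext w) {i : Q w.ctx .nt} {il ll : Q w.ctx (.star .atmlst)}
    {b : Q w.ctx (.star .prp)} (hi : Nt w i) (hil : ListA w il) (hll : ListA w ll)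
    (h : Seq w i il ll b) : Seq w i (qshift il) (qshift ll) (qshift b) :=
  h.rel (t := qfst) hprog hi .zero hil hll (rel₁_ext (e := .atmlst) il)
    (rel₁_ext (e := .atmlst) ll) (rel₁_ext (e := .prp) b)

section

set_option linter.unusedSimpArgs false

theorem Sum.nt {i j k : Q w.ctx .nt} (h : Sum w i j k) (hi : Nt w i) : Nt w k := by
  have := nat_rule (Φ := []) (τs := [.nt, .nt]) (ys := .nil) (fSum v2 v0 v1) (.nat v1) ?_ hi
    (j ∷ k ∷ .nil) (by simpa using h)
  · simpa using this
  · simp only [Env.forall_cons, Env.forall_nil, Env.cons_append, Env.nil_append, Env.map_cons,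
      Env.map_nil, holds_and, and_imp, holds_split, holds_listA, holds_nat, holds_sum, holds_seq,
      holds_splitSeq, Tm.eval_var, Env.get_zero, Env.get_succ, eval_anil, eval_acons, eval_atomS]
    intro w ρ i hi ih j k h
    refine h.cases.nt fun w' ρ' hc => ?_
    generalize e : i ↾ ρ' = i at hc
    generalize j ↾ ρ' = j at hc
    generalize k ↾ ρ' = k at hc
    cases hc with
    | zero h => exact h
    | succ h => exact ((ih w' ρ' _ e).2 _ _ h).succ

/-! ### Cut for an intuitionistic hypothesis -/

/-- Induction on the height of the derivation with the cut atom among its hypotheses; the atom being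
indecomposable, there are no principal cases beyond the leaf where it is used. The derivation of the
atom has no linear hypotheses, so it may be used in any number of premises. The resulting height is
the sum. -/
theorem Seq.cut (hprog : ProgRel .ext w) {i k m : Q w.ctx .nt} {a : Q w.ctx (.star .atm)}
    {b : Q w.ctx (.star .prp)} {il ll : Q w.ctx (.star .atmlst)} (hi : Nt w i) (hk : Nt w k)
    (hs : Sum w i k m) (hil : ListA w il) (hll : ListA w ll) (h : Seq w i (qacons a il) ll b)
    (h' : Seq w k il qanil (qatom a)) : Seq w m il ll b := by
  have := nat_rule (Φ := []) (ys := .nil)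
    (τs := [.nt, .nt, .star .atm, .star .prp, .star .atmlst, .star .atmlst])
    (fSum v6 v0 v1 ⊓ₘ .nat v0 ⊓ₘ fList .atm 1 v4 ⊓ₘ fList .atm 1 v5 ⊓ₘ
      fSeq v6 (acons v2 v4) v5 v3 ⊓ₘ fSeq v0 v4 anil (atomS v2))
    (fSeq v1 v4 v5 v3) ?_ hi (k ∷ m ∷ a ∷ b ∷ il ∷ ll ∷ .nil)
    (by simpa using ⟨hs, hk, hil, hll, h, h'⟩)
  · simpa using this
  · simp only [Env.forall_cons, Env.forall_nil, Env.cons_append, Env.nil_append, Env.map_cons,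
      Env.map_nil, holds_and, and_imp, holds_split, holds_listA, holds_nat, holds_sum, holds_seq,
      holds_splitSeq, Tm.eval_var, Env.get_zero, Env.get_succ, eval_anil, eval_acons, eval_atomS]
    clear hi hk hs hil hll h h'
    intro w₀ ρ₀ i hi ih k m a b il ll hs hk hil hll h h'
    refine h.cases.seq fun w₁ ρ₁ hc => ?_
    replace hprog := hprog.mono (ρ₀.comp ρ₁)
    replace hi := hi.mono ρ₁
    replace hs := hs.mono ρ₁
    replace hk := hk.mono ρ₁
    replace hil := hil.mono ρ₁
    replace hll := hll.mono ρ₁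
    replace h' := h'.mono ρ₁
    replace ih := fun w' ρ' => ih w' (ρ₁.comp ρ')
    simp only [Q.map_hom_comp, map_qacons, map_qanil, map_qatom] at ih hc h'
    generalize i ↾ ρ₁ = i at *
    generalize k ↾ ρ₁ = k at *
    generalize m ↾ ρ₁ = m at *
    generalize a ↾ ρ₁ = a at *
    generalize il ↾ ρ₁ = il at *
    generalize ll ↾ ρ₁ = ll at *
    generalize b ↾ ρ₁ = b at *
    clear h
    generalize e : qacons a il = l at hc
    cases hc with
    | init => exact SeqCase.init.intro
    | elem ha =>
      obtain ⟨rfl, rfl⟩ := qacons_injective e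
      refine ha.cons_inv.seq ?_
      rintro w₂ ρ₂ (e | ha)
      -- The leaf uses the cut atom itself: the derivation of the atom takes its place, with its
      -- height raised from $k$ to $m=k+i$.
      · replace h' := (h'.mono ρ₂).weaken (hk.mono ρ₂) ((hs.mono ρ₂).comm (hi.mono ρ₂) (hk.mono ρ₂))
          (hil.mono ρ₂) (hil.mono ρ₂) (hll.mono ρ₂) (.refl _) (hll.mono ρ₂).perm_refl
        rw [map_qatom, e]
        rwa [map_qatom] at h'
      · refine (hil.mono ρ₂).cases.seq fun w₃ ρ₃ hc => ?_
        replace ha := ha.mono ρ₃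
        generalize il ↾ ρ₂ ↾ ρ₃ = il at *
        rw [map_qanil, map_qanil, map_qatom, map_qatom]
        cases hc with
        | nil => exact ha.not_nil.seq fun _ _ h => h.elim
        | cons => exact (SeqCase.elem ha).intro
    | @prog j _ _ _ _ _ h₁ h₂ h₃ h₄ h₅ =>
      subst e
      refine hs.succ_inv.seq ?_
      rintro w₂ ρ₂ ⟨m', e, hm⟩
      -- `SplitSeq.map` also asks for a permutation of the linear hypotheses, which is added after
      -- the cut by the structural rule.
      have f : ∀ (w' : World D) (ρ : Hom w₂ w') l l' b, ListA w' l → PermA w' l l' →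
          Seq w' (j ↾ ρ₂ ↾ ρ) (qacons a il ↾ ρ₂ ↾ ρ) l b → Seq w' (m' ↾ ρ) (il ↾ ρ₂ ↾ ρ) l' b := by
        intro w₃ ρ₃ l l' b hl hp h
        replace h' := (h'.mono ρ₂).mono ρ₃
        rw [map_qacons, map_qacons] at h
        rw [map_qanil, map_qanil, map_qatom, map_qatom] at h'
        obtain ⟨hj, ih⟩ := ih w₃ (ρ₂.comp ρ₃) _ (by rw [Q.map_hom_comp, map_qs, map_qs])
        have hil := (hil.mono ρ₂).mono ρ₃
        exact (ih _ _ _ _ _ _ (hm.mono ρ₃) ((hk.mono ρ₂).mono ρ₃) hil hl h h').structural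
          ((hm.mono ρ₃).nt hj) hil hil hl (.refl _) hp
      rw [e, map_qatom]
      replace h₅ := h₅.mono ρ₂
      rw [map_qanil] at h₅
      exact (SeqCase.prog (h₁.mono ρ₂) (h₂.mono ρ₂) (h₃.mono ρ₂)
        ((h₄.mono ρ₂).map (h₁.mono ρ₂) f (hll.mono ρ₂) (hll.mono ρ₂).perm_refl)
        (h₅.map (h₂.mono ρ₂) f .nil ListA.nil.perm_refl)).intro
    | tt => exact SeqCase.tt.intro
    | wth h₁ h₂ =>
      subst e
      refine hs.succ_inv.seq ?_
      rintro w₂ ρ₂ ⟨m', e, hm⟩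
      replace h' := h'.mono ρ₂
      replace h₁ := h₁.mono ρ₂
      replace h₂ := h₂.mono ρ₂
      rw [map_qacons] at h₁ h₂
      rw [map_qanil, map_qatom] at h'
      replace ih := fun b h => (ih w₂ ρ₂ _ (map_qs _ _)).2 _ _ _ b _ _ hm (hk.mono ρ₂)
        (hil.mono ρ₂) (hll.mono ρ₂) h h'
      rw [e, map_qwith]
      exact (SeqCase.wth (ih _ h₁) (ih _ h₂)).intro
    | limp h =>
      subst e
      refine hs.succ_inv.seq ?_
      rintro w₂ ρ₂ ⟨m', e, hm⟩
      replace h' := h'.mono ρ₂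
      replace h := h.mono ρ₂
      rw [map_qacons, map_qacons] at h
      rw [map_qanil, map_qatom] at h'
      rw [e, map_qlimp]
      exact (SeqCase.limp ((ih w₂ ρ₂ _ (map_qs _ _)).2 _ _ _ _ _ _ hm (hk.mono ρ₂) (hil.mono ρ₂)
        (hll.mono ρ₂).cons h h')).intro
    | iimp h =>
      subst e
      refine hs.succ_inv.seq ?_
      rintro w₂ ρ₂ ⟨m', e, hm⟩
      obtain ⟨hj, ih⟩ := ih w₂ ρ₂ _ (map_qs _ _)
      replace h' := h'.mono ρ₂
      replace h := h.mono ρ₂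
      replace hil := hil.mono ρ₂
      replace hll := hll.mono ρ₂
      rw [map_qacons, map_qacons] at h
      rw [map_qanil, map_qatom] at h'
      rw [e, map_qiimp]
      -- The new hypothesis stands in front of the cut atom; the two are exchanged to fit the
      -- induction hypothesis, and the derivation of the atom is weakened by the new hypothesis.
      exact (SeqCase.iimp (ih _ _ _ _ _ _ hm (hk.mono ρ₂) hil.cons hll
        (h.structural hj hil.cons.cons hil.cons.cons hll (subA_swap _ _ _) hll.perm_refl)
        (h'.structural (hk.mono ρ₂) hil hil.cons .nil (subA_cons _ _) ListA.nil.perm_refl))).intro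
    | big h =>
      subst e
      refine hs.succ_inv.seq ?_
      rintro w₂ ρ₂ ⟨m', e, hm⟩
      -- The premise has one more eigenvariable, so the derivation of the cut atom has to be
      -- extended by it.
      replace h' := (h'.shift hprog hk hil .nil).mono ρ₂
      replace h := h.mono ρ₂
      rw [qshift_qanil, qshift_qatom, map_qanil, map_qatom, map_qshift, map_qshift] at h'
      rw [qshift_qacons, map_qacons, map_qshift, map_qshift, map_qshift, map_qopen] at h
      rw [e, map_qbig]
      exact (SeqCase.big ((ih w₂ ρ₂ _ (map_qs _ _)).2 _ _ _ _ _ _ hm (hk.mono ρ₂)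
        (hil.mono ρ₂).shift (hll.mono ρ₂).shift h h')).intro

/-! ### Cut for a linear hypothesis -/

theorem SplitA.cons_inv {a : Q w.ctx (.star .atm)} {l p q : Q w.ctx (.star .atmlst)}
    (h : SplitA w (qacons a l) p q) :
    J w (fun w' ρ => (∃ r, p ↾ ρ = qacons (a ↾ ρ) r ∧ SplitA w' (l ↾ ρ) r (q ↾ ρ)) ∨
      ∃ r, q ↾ ρ = qacons (a ↾ ρ) r ∧ SplitA w' (l ↾ ρ) (p ↾ ρ) r) := by
  refine h.cases.imp fun w' ρ hc => ?_
  rw [map_qacons] at hc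
  generalize e : qacons (a ↾ ρ) (l ↾ ρ) = x at hc
  generalize p ↾ ρ = p at *
  generalize q ↾ ρ = q at *
  cases hc with
  | nil => exact (qanil_ne_qacons e.symm).elim
  | left h =>
    obtain ⟨e₀, rfl⟩ := qacons_injective e
    exact .inl ⟨_, by rw [e₀], h⟩
  | right h =>
    obtain ⟨e₀, rfl⟩ := qacons_injective e
    exact .inr ⟨_, by rw [e₀], h⟩

/-- The linear cut atom is allotted to exactly one premise of the list. That premise receives the
hypotheses `ll₂` through the cut `f`; all others merely have their height raised, through `g`. -/
theorem SplitSeq.cut {i i' : Q w.ctx .nt} {il ll ll₁ ll₂ : Q w.ctx (.star .atmlst)}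
    {a : Q w.ctx (.star .atm)} {m : Q w.ctx (.star .prplst)} (hm : ListP w m)
    (f : ∀ (w' : World D) (ρ : Hom w w') l l₁ b, ListA w' l → SplitA w' l l₁ (ll₂ ↾ ρ) →
      Seq w' (i ↾ ρ) (il ↾ ρ) (qacons (a ↾ ρ) l₁) b → Seq w' (i' ↾ ρ) (il ↾ ρ) l b)
    (g : ∀ (w' : World D) (ρ : Hom w w') l l' b, ListA w' l → PermA w' l l' →
      Seq w' (i ↾ ρ) (il ↾ ρ) l b → Seq w' (i' ↾ ρ) (il ↾ ρ) l' b)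
    (hl : ListA w ll) (hs : SplitA w ll ll₁ ll₂) (h : SplitSeq w i il (qacons a ll₁) m) :
    SplitSeq w i' il ll m := by
  have := listP_rule (τs := [.star .atmlst, .star .atmlst])
    (ys := i ∷ i' ∷ il ∷ a ∷ ll₂ ∷ .nil)
    (fList .atm 1 v0 ⊓ₘ fSplit .atm 1 v0 v1 v7 ⊓ₘ fSplitSeq v3 v5 (acons v6 v1) v2)
    (fSplitSeq v4 v5 v0 v2) ?_ hm (ll ∷ ll₁ ∷ .nil) (by simpa using ⟨hl, hs, h⟩)
  · simpa using this
  · simp only [Env.forall_cons, Env.forall_nil, Env.cons_append, Env.nil_append, Env.map_cons,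
      Env.map_nil, holds_and, and_imp, holds_split, holds_listA, holds_nat, holds_sum, holds_seq,
      holds_splitSeq, Tm.eval_var, Env.get_zero, Env.get_succ, eval_anil, eval_acons, eval_atomS]
    clear hm hl hs h
    intro w₀ ρ₀ m hm ih ll ll₁ hl hs h
    refine h.cases.splitSeq fun w₁ ρ₁ hc => ?_
    replace hm := hm.mono ρ₁
    replace hl := hl.mono ρ₁
    replace hs := hs.mono ρ₁
    replace f := fun w' ρ' => f w' ((ρ₀.comp ρ₁).comp ρ')
    replace g := fun w' ρ' => g w' ((ρ₀.comp ρ₁).comp ρ')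
    replace ih := fun w' ρ' => ih w' (ρ₁.comp ρ')
    simp only [Q.map_hom_comp, map_qacons] at f g ih hc
    generalize i ↾ ρ₀ ↾ ρ₁ = i at *
    generalize i' ↾ ρ₀ ↾ ρ₁ = i' at *
    generalize il ↾ ρ₀ ↾ ρ₁ = il at *
    generalize a ↾ ρ₀ ↾ ρ₁ = a at *
    generalize ll₂ ↾ ρ₀ ↾ ρ₁ = ll₂ at *
    generalize m ↾ ρ₁ = m at *
    generalize ll ↾ ρ₁ = ll at *
    generalize ll₁ ↾ ρ₁ = ll₁ at *
    clear h
    generalize e : qacons a ll₁ = l at hc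
    cases hc with
    | nil => exact (qanil_ne_qacons e.symm).elim
    | cons h₁ h₂ h₃ =>
      subst e
      refine h₁.cons_inv.splitSeq ?_
      rintro w₂ ρ₂ (⟨r, e, hr⟩ | ⟨r, e, hr⟩)
      · replace hs := hs.mono ρ₂
        replace hl := hl.mono ρ₂
        replace h₂ := h₂.mono ρ₂
        rw [e] at h₂
        -- The atom goes to the first premise. With the split of `ll₁` reversed, associativity
        -- combines the remaining hypotheses `r` of this premise with `ll₂`.
        refine (SplitA.assoc hl hs (hr.comm (hs.lists hl).1)).splitSeq ?_
        rintro w₃ ρ₃ ⟨n, k₁, k₂⟩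
        obtain ⟨hq, hn⟩ := k₁.lists (hl.mono ρ₃)
        replace h₂ := h₂.mono ρ₃
        replace h₃ := (h₃.mono ρ₂).mono ρ₃
        replace f := f w₃ (ρ₂.comp ρ₃)
        replace g := fun w' ρ' => g w' ((ρ₂.comp ρ₃).comp ρ')
        simp only [Q.map_hom_comp, map_qacons] at f g h₂
        rw [map_qpcons, map_qpcons]
        exact (SplitSeqCase.cons (k₁.comm (hl.mono ρ₃)) (f _ _ _ hn k₂ h₂)
          (h₃.map (((ih w₁ (Hom.id w₁) _ _ (Q.map_hom_id _)).1.mono ρ₂).mono ρ₃) g hq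
            hq.perm_refl)).intro
      · replace hs := hs.mono ρ₂
        replace hl := hl.mono ρ₂
        replace h₃ := h₃.mono ρ₂
        rw [e] at h₃
        -- The atom goes to a later premise, so `ll₂` is joined to the hypotheses of the rest and
        -- the induction on the list takes over.
        refine (SplitA.assoc hl hs hr).splitSeq ?_
        rintro w₃ ρ₃ ⟨n, k₁, k₂⟩
        obtain ⟨hp, hn⟩ := k₁.lists (hl.mono ρ₃)
        replace h₂ := (h₂.mono ρ₂).mono ρ₃
        replace h₃ := h₃.mono ρ₃
        replace ih := ih w₃ (ρ₂.comp ρ₃) _ _ (by rw [Q.map_hom_comp, map_qpcons, map_qpcons])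
        replace g := g w₃ (ρ₂.comp ρ₃)
        simp only [Q.map_hom_comp, map_qacons] at ih g h₃
        rw [map_qpcons, map_qpcons]
        exact (SplitSeqCase.cons k₁ (g _ _ _ hp hp.perm_refl h₂) (ih.2 _ _ hn k₂ h₃)).intro

/-- The same induction as for `Seq.cut`. The cut atom now occupies a place among the linear
hypotheses, so the derivation of the atom follows it along every splitting. -/
theorem Seq.linearCut (hprog : ProgRel .ext w) {i k m : Q w.ctx .nt} {a : Q w.ctx (.star .atm)}
    {b : Q w.ctx (.star .prp)} {il ll ll₁ ll₂ : Q w.ctx (.star .atmlst)} (hi : Nt w i)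
    (hk : Nt w k) (hs : Sum w i k m) (hil : ListA w il) (hll : ListA w ll)
    (hsp : SplitA w ll ll₁ ll₂) (h : Seq w i il (qacons a ll₁) b)
    (h' : Seq w k il ll₂ (qatom a)) : Seq w m il ll b := by
  have := nat_rule (Φ := []) (ys := .nil)
    (τs := [.nt, .nt, .star .atm, .star .prp, .star .atmlst, .star .atmlst, .star .atmlst,
      .star .atmlst])
    (fSum v8 v0 v1 ⊓ₘ .nat v0 ⊓ₘ fList .atm 1 v4 ⊓ₘ fList .atm 1 v5 ⊓ₘ fSplit .atm 1 v5 v6 v7 ⊓ₘ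
      fSeq v8 v4 (acons v2 v6) v3 ⊓ₘ fSeq v0 v4 v7 (atomS v2))
    (fSeq v1 v4 v5 v3) ?_ hi (k ∷ m ∷ a ∷ b ∷ il ∷ ll ∷ ll₁ ∷ ll₂ ∷ .nil)
    (by simpa using ⟨hs, hk, hil, hll, hsp, h, h'⟩)
  · simpa using this
  · simp only [Env.forall_cons, Env.forall_nil, Env.cons_append, Env.nil_append, Env.map_cons,
      Env.map_nil, holds_and, and_imp, holds_split, holds_listA, holds_nat, holds_sum, holds_seq,
      holds_splitSeq, Tm.eval_var, Env.get_zero, Env.get_succ, eval_anil, eval_acons, eval_atomS]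
    clear hi hk hs hil hll hsp h h'
    intro w₀ ρ₀ i hi ih k m a b il ll ll₁ ll₂ hs hk hil hll hsp h h'
    refine h.cases.seq fun w₁ ρ₁ hc => ?_
    replace hprog := hprog.mono (ρ₀.comp ρ₁)
    replace hi := hi.mono ρ₁
    replace hs := hs.mono ρ₁
    replace hk := hk.mono ρ₁
    replace hil := hil.mono ρ₁
    replace hll := hll.mono ρ₁
    replace hsp := hsp.mono ρ₁
    replace h' := h'.mono ρ₁
    replace ih := fun w' ρ' => ih w' (ρ₁.comp ρ')
    simp only [Q.map_hom_comp, map_qacons, map_qatom] at ih hc h'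
    generalize i ↾ ρ₁ = i at *
    generalize k ↾ ρ₁ = k at *
    generalize m ↾ ρ₁ = m at *
    generalize a ↾ ρ₁ = a at *
    generalize il ↾ ρ₁ = il at *
    generalize ll ↾ ρ₁ = ll at *
    generalize ll₁ ↾ ρ₁ = ll₁ at *
    generalize ll₂ ↾ ρ₁ = ll₂ at *
    generalize b ↾ ρ₁ = b at *
    clear h
    obtain ⟨hll₁, hll₂⟩ := hsp.lists hll
    generalize e : qacons a ll₁ = l at hc
    cases hc with
    | init =>
      obtain ⟨rfl, rfl⟩ := qacons_injective e
      -- The cut atom is the only linear hypothesis, whence `ll₁` is empty and `ll` is a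
      -- rearrangement of `ll₂`.
      exact h'.weaken hk (hs.comm hi hk) hil hil hll₂ (.refl _) (hsp.perm hll₂)
    -- This clause requires that there be no linear hypotheses, but the cut atom is one.
    | elem => exact (qanil_ne_qacons e.symm).elim
    | @prog j _ _ _ _ _ h₁ h₂ h₃ h₄ h₅ =>
      subst e
      refine hs.succ_inv.seq ?_
      rintro w₂ ρ₂ ⟨m', e, hm⟩
      replace ih := fun w' ρ' => ih w' (ρ₂.comp ρ') (j ↾ ρ₂ ↾ ρ')
        (by rw [Q.map_hom_comp, map_qs, map_qs])
      have f : ∀ (w' : World D) (ρ : Hom w₂ w') l l₁ b, ListA w' l →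
          SplitA w' l l₁ (ll₂ ↾ ρ₂ ↾ ρ) →
          Seq w' (j ↾ ρ₂ ↾ ρ) (il ↾ ρ₂ ↾ ρ) (qacons (a ↾ ρ₂ ↾ ρ) l₁) b →
          Seq w' (m' ↾ ρ) (il ↾ ρ₂ ↾ ρ) l b := by
        intro w₃ ρ₃ l l₁ b hl hp h
        replace h' := (h'.mono ρ₂).mono ρ₃
        rw [map_qatom, map_qatom] at h'
        exact (ih w₃ ρ₃).2 _ _ _ _ _ _ _ _ (hm.mono ρ₃) ((hk.mono ρ₂).mono ρ₃)
          ((hil.mono ρ₂).mono ρ₃) hl hp h h'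
      -- The premises without the cut atom, and all intuitionistic premises, only need their height
      -- raised to the common bound.
      have g : ∀ (w' : World D) (ρ : Hom w₂ w') l l' b, ListA w' l → PermA w' l l' →
          Seq w' (j ↾ ρ₂ ↾ ρ) (il ↾ ρ₂ ↾ ρ) l b → Seq w' (m' ↾ ρ) (il ↾ ρ₂ ↾ ρ) l' b :=
        fun w₃ ρ₃ l l' b hl hp h => h.weaken (ih w₃ ρ₃).1 (hm.mono ρ₃) ((hil.mono ρ₂).mono ρ₃)
          ((hil.mono ρ₂).mono ρ₃) hl (.refl _) hp
      rw [e, map_qatom]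
      replace h₄ := h₄.mono ρ₂
      replace h₅ := h₅.mono ρ₂
      rw [map_qacons] at h₄
      rw [map_qanil] at h₅
      exact (SeqCase.prog (h₁.mono ρ₂) (h₂.mono ρ₂) (h₃.mono ρ₂)
        (h₄.cut (h₁.mono ρ₂) f g (hll.mono ρ₂) (hsp.mono ρ₂))
        (h₅.map (h₂.mono ρ₂) g .nil ListA.nil.perm_refl)).intro
    | tt => exact SeqCase.tt.intro
    | wth h₁ h₂ =>
      subst e
      refine hs.succ_inv.seq ?_
      rintro w₂ ρ₂ ⟨m', e, hm⟩
      replace h' := h'.mono ρ₂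
      replace h₁ := h₁.mono ρ₂
      replace h₂ := h₂.mono ρ₂
      rw [map_qacons] at h₁ h₂
      rw [map_qatom] at h'
      replace ih := fun b h => (ih w₂ ρ₂ _ (map_qs _ _)).2 _ _ _ b _ _ _ _ hm (hk.mono ρ₂)
        (hil.mono ρ₂) (hll.mono ρ₂) (hsp.mono ρ₂) h h'
      rw [e, map_qwith]
      exact (SeqCase.wth (ih _ h₁) (ih _ h₂)).intro
    | limp h =>
      subst e
      refine hs.succ_inv.seq ?_
      rintro w₂ ρ₂ ⟨m', e, hm⟩
      obtain ⟨hj, ih⟩ := ih w₂ ρ₂ _ (map_qs _ _)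
      replace h' := h'.mono ρ₂
      replace h := h.mono ρ₂
      replace hil := hil.mono ρ₂
      replace hll₁ := hll₁.mono ρ₂
      rw [map_qacons, map_qacons] at h
      rw [map_qatom] at h'
      rw [e, map_qlimp]
      exact (SeqCase.limp (ih _ _ _ _ _ _ _ _ hm (hk.mono ρ₂) hil (hll.mono ρ₂).cons
        (SplitCase.left (hsp.mono ρ₂)).intro
        (h.structural hj hil hil hll₁.cons.cons (.refl _) (hll₁.perm_swap _ _)) h')).intro
    | iimp h =>
      subst e
      refine hs.succ_inv.seq ?_
      rintro w₂ ρ₂ ⟨m', e, hm⟩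
      replace h' := h'.mono ρ₂
      replace h := h.mono ρ₂
      replace hil := hil.mono ρ₂
      replace hll₂ := hll₂.mono ρ₂
      rw [map_qacons, map_qacons] at h
      rw [map_qatom] at h'
      rw [e, map_qiimp]
      exact (SeqCase.iimp ((ih w₂ ρ₂ _ (map_qs _ _)).2 _ _ _ _ _ _ _ _ hm (hk.mono ρ₂) hil.cons
        (hll.mono ρ₂) (hsp.mono ρ₂) h (h'.structural (hk.mono ρ₂) hil hil.cons hll₂ (subA_cons _ _)
          hll₂.perm_refl))).intro
    | big h =>
      subst e
      refine hs.succ_inv.seq ?_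
      rintro w₂ ρ₂ ⟨m', e, hm⟩
      replace h' := (h'.shift hprog hk hil hll₂).mono ρ₂
      replace h := h.mono ρ₂
      replace hsp := (hsp.shift hll).mono ρ₂
      rw [qshift_qatom, map_qatom, map_qshift, map_qshift, map_qshift] at h'
      rw [qshift_qacons, map_qacons, map_qshift, map_qshift, map_qshift, map_qopen] at h
      rw [map_qshift, map_qshift, map_qshift] at hsp
      rw [e, map_qbig]
      exact (SeqCase.big ((ih w₂ ρ₂ _ (map_qs _ _)).2 _ _ _ _ _ _ _ _ hm (hk.mono ρ₂)
        (hil.mono ρ₂).shift (hll.mono ρ₂).shift hsp h h')).intro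

end

end FOLDN

/-! ### The four rules as derivable formulas -/

namespace FOLDN

variable {S : Sig} {D : Set (Clause S)} {w w' : World D}

instance : LinDef (linearLogic S).clauses := ⟨fun _ h => h, fun _ h _ => h⟩

theorem Definition.Extends.linDef {D : Definition S} (h : D.Extends (linearLogic S)) :
    LinDef D.clauses := ⟨fun _ hc => h.1 hc, h.2⟩

/-- A closed formula is derivable if it holds at the world without variables and hypotheses. -/
theorem Definition.proves_of_holds {D : Definition S} {B : Fm S []}
    (h : Holds (⟨[], 0⟩ : World D.clauses) B .nil) : D.Proves B := by
  have := (derives_of_holds (θ := Sub.id []) fun _ x => by cases x).1 h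
  rwa [Fm.subst_id] at this

/-- Derivability with some height. -/
def Prv (w : World D) (il ll : Q w.ctx (.star .atmlst)) (b : Q w.ctx (.star .prp)) : Prop :=
  J w (fun w' ρ => ∃ i, Nt w' i ∧ Seq w' i (il ↾ ρ) (ll ↾ ρ) (b ↾ ρ))

theorem holds_prv {Φ : Ctx S} {IL LL : Tm S Φ (.star .atmlst)} {B : Tm S Φ (.star .prp)}
    {xs : Env w.ctx Φ} :
    Holds w (prv IL LL B) xs ↔ Prv w (IL.eval xs) (LL.eval xs) (B.eval xs) := by
  simp [prv, Prv]

theorem Prv.mono {il ll : Q w.ctx (.star .atmlst)} {b : Q w.ctx (.star .prp)} (h : Prv w il ll b)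
    (ρ : Hom w w') : Prv w' (il ↾ ρ) (ll ↾ ρ) (b ↾ ρ) := by
  have := (holds_prv (IL := v0) (LL := v1) (B := v2) (xs := il ∷ ll ∷ b ∷ .nil)).2
    (by simpa using h)
  simpa [holds_prv] using this.mono ρ

theorem Prv.bind {il ll il' ll' : Q w.ctx (.star .atmlst)} {b b' : Q w.ctx (.star .prp)}
    (h : Prv w il ll b) (k : ∀ (w' : World D) (ρ : Hom w w') (i : Q w'.ctx .nt), Nt w' i →
      Seq w' i (il ↾ ρ) (ll ↾ ρ) (b ↾ ρ) → Prv w' (il' ↾ ρ) (ll' ↾ ρ) (b' ↾ ρ)) :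
    Prv w il' ll' b' := by
  refine J.bind h ?_
  rintro w₁ ρ₁ ⟨i, hi, h⟩
  simpa only [Prv, Q.map_hom_comp] using k w₁ ρ₁ i hi h

section

variable [LinDef D]

theorem holds_extend_iff {Φ : Ctx S} {e : ETy} {N : Tm S Φ .nt} {X X' : Tm S Φ (.star e.ty)}
    {xs : Env w.ctx Φ} {n : Q w.ctx .nt} {x x' : Q w.ctx (.star e.ty)} (hn : N.eval xs = n)
    (hx : X.eval xs = x) (hx' : X'.eval xs = x') :
    Holds w (fExtend e N X X') xs ↔ Ext₀ e w n (qconst x) (qconst x') := by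
  subst hn hx hx'
  exact holds_extend.trans ⟨Ext.ext₀, Ext₀.ext⟩

/-- $P_{extend}$ is stated with $extend$, the changes with $extend_0$ on constant functions of the
parameters; the single clause for $extend$ translates between them. -/
theorem ProgRel.of_holds (h : Holds w (PExtend S) .nil) : ProgRel .ext w := by
  intro w' ρ n t a a' m l hn hp hr
  have h' := ((((((((h.mono ρ).inst n).inst a).inst a').inst m).inst l).mp
    (by simpa using hn)).mp (by simpa using hp)).mp
    ((holds_extend_iff (e := .atm) (Tm.eval_var _ _) (Tm.eval_var _ _) (Tm.eval_var _ _)).2 hr)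
  refine (holds_ex_ex.1 h').imp ?_
  rintro w'' ρ' ⟨m', l', k⟩
  obtain ⟨k₁, k₂⟩ := holds_and.1 k
  obtain ⟨k₂, k₃⟩ := holds_and.1 k₂
  exact ⟨m', l', by simpa using k₁,
    (holds_extend_iff (e := .prplst) (Tm.eval_var _ _) (Tm.eval_var _ _) (Tm.eval_var _ _)).1 k₂,
    (holds_extend_iff (e := .prplst) (Tm.eval_var _ _) (Tm.eval_var _ _) (Tm.eval_var _ _)).1 k₃⟩

/-- Passes from heights to derivability at some height: witnesses for both premises are taken, and
the sum of the two, which exists locally, bounds the conclusion. -/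
theorem Prv.combine {il₁ ll₁ il₂ ll₂ il ll : Q w.ctx (.star .atmlst)}
    {b₁ b₂ b : Q w.ctx (.star .prp)} (h₁ : Prv w il₁ ll₁ b₁) (h₂ : Prv w il₂ ll₂ b₂)
    (k : ∀ (w' : World D) (ρ : Hom w w') (i j m : Q w'.ctx .nt), Nt w' i → Nt w' j → Sum w' i j m →
      Seq w' i (il₁ ↾ ρ) (ll₁ ↾ ρ) (b₁ ↾ ρ) → Seq w' j (il₂ ↾ ρ) (ll₂ ↾ ρ) (b₂ ↾ ρ) →
      Seq w' m (il ↾ ρ) (ll ↾ ρ) (b ↾ ρ)) : Prv w il ll b := by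
  refine h₁.bind fun w₁ ρ₁ i hi h₁ => (h₂.mono ρ₁).bind fun w₂ ρ₂ j hj h₂ => ?_
  refine ((hi.mono ρ₂).sum hj).imp ?_
  rintro w₃ ρ₃ ⟨m, hm, hs⟩
  have := k w₃ ((ρ₁.comp ρ₂).comp ρ₃) _ _ m ((hi.mono ρ₂).mono ρ₃) (hj.mono ρ₃) hs
  simp only [Q.map_hom_comp] at this
  exact ⟨m, hm, this ((h₁.mono ρ₂).mono ρ₃) (h₂.mono ρ₃)⟩

/-! ### The rules -/

theorem holds_structuralRule : Holds w (structuralRule S) .nil := by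
  -- The types of the quantified variables are listed from the innermost quantifier outwards.
  refine (holds_alls (τs := [.star .atmlst, .star .atmlst, .star .atmlst, .star .atmlst, .star .prp,
    .nt]) (C := .imps [.nat v5, fList .atm 1 v3, fList .atm 1 v2, fList .atm 1 v1, fIncl v3 v2,
      fPermute .atm 1 v1 v0, fSeq v5 v3 v1 v4] (fSeq v5 v2 v0 v4))).2 ?_
  simp only [holds_imps, Env.forall_cons, Env.forall_nil, Env.cons_append, Env.nil_append,
    Env.map_cons,
    Env.map_nil, List.forall_mem_cons, and_imp, holds_listA, holds_permute, holds_incl, holds_nat,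
    holds_seq, Tm.eval_var, Env.get_zero, Env.get_succ]
  intro w₁ ρ₁ ll' ll il' il b i w₂ ρ₂ hi hil hil' hll hs hp h _
  exact h.structural hi hil hil' hll hs hp

theorem holds_cutRule : Holds w (cutRule S) .nil := by
  refine holds_imp.2 fun w₀ ρ₀ hprog => ?_
  replace hprog := ProgRel.of_holds hprog
  refine (holds_alls (τs := [.star .atmlst, .star .atmlst, .star .prp, .star .atm])
    (C := .imps [fList .atm 1 v1, fList .atm 1 v0, prv (acons v3 v1) v0 v2,
      prv v1 anil (atomS v3)] (prv v1 v0 v2))).2 ?_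
  simp only [holds_imps, Env.forall_cons, Env.forall_nil, Env.cons_append, Env.nil_append,
    Env.map_cons,
    Env.map_nil, List.forall_mem_cons, and_imp, holds_listA, holds_prv,
    Tm.eval_var, Env.get_zero, Env.get_succ, eval_acons, eval_anil, eval_atomS]
  intro w₁ ρ₁ ll il b a w₂ ρ₂ hil hll h h' _
  replace hprog := hprog.mono (ρ₁.comp ρ₂)
  refine h.combine h' fun w' ρ i j m hi hj hs h h' => ?_
  rw [map_qacons] at h
  rw [map_qanil, map_qatom] at h'
  exact h.cut (hprog.mono ρ) hi hj hs (hil.mono ρ) (hll.mono ρ) h'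

theorem holds_linearCutRule : Holds w (linearCutRule S) .nil := by
  refine holds_imp.2 fun w₀ ρ₀ hprog => ?_
  replace hprog := ProgRel.of_holds hprog
  refine (holds_alls (τs := [.star .atmlst, .star .atmlst, .star .atmlst, .star .atmlst, .star .prp,
    .star .atm]) (C := .imps [fList .atm 1 v3, fList .atm 1 v2, fSplit .atm 1 v2 v1 v0,
      prv v3 (acons v5 v1) v4, prv v3 v0 (atomS v5)] (prv v3 v2 v4))).2 ?_
  simp only [holds_imps, Env.forall_cons, Env.forall_nil, Env.cons_append, Env.nil_append,
    Env.map_cons, Env.map_nil, List.forall_mem_cons, and_imp, holds_listA, holds_split, holds_prv,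
    Tm.eval_var, Env.get_zero, Env.get_succ, eval_acons, eval_atomS]
  intro w₁ ρ₁ ll₂ ll₁ ll il b a w₂ ρ₂ hil hll hsp h h' _
  replace hprog := hprog.mono (ρ₁.comp ρ₂)
  refine h.combine h' fun w' ρ i j m hi hj hs h h' => ?_
  rw [map_qacons] at h
  rw [map_qatom] at h'
  exact h.linearCut (hprog.mono ρ) hi hj hs (hil.mono ρ) (hll.mono ρ) (hsp.mono ρ) h'

end

/-! ### Specialization -/

section

variable {Δ : Ctx S} {τ : Ty S.Base}

theorem qput_qlift (T : Q Δ (.star (.star .i))) (X : Q Δ (.star τ)) :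
    qput T (qlift X) = qconst (qshift X) :=
  b2_injective (by simp [-eval_lam_succ, -eval_lam_lam_rst, -eval_lam_lam_put, b2, qput, qlift,
    qconst, qshift])

/-- Substitution keeps the length of the list of eigenvariables: the first one is replaced by a term
that still receives the whole list. With a shifted term the result is a shift, that is, it no longer
depends on the first eigenvariable. -/
theorem qput_qflip (B : Q Δ (.star (.arr .i τ))) (X : Q Δ (.star .i)) :
    qput (qconst (qshift X)) (qflip B) = qconst (qshift (qinst B X)) :=
  b2_injective (by simp [-eval_lam_succ, -eval_lam_lam_rst, -eval_lam_lam_put, b2, qput, qflip,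
    qconst, qshift, qinst])

theorem rel₁_unext [LinDef D] {e : ETy} {t : Q w.ctx (.star .i)} (x : Q w.ctx (.star e.ty)) :
    Rel₁ .unext e w qz t (qshift x) x := by
  rw [Rel₁, ← qskip_qconst]
  exact Change.Base.unext.rel

theorem rel₁_sub_shift [LinDef D] {e : ETy} {t : Q w.ctx (.star .i)} (x : Q w.ctx (.star e.ty)) :
    Rel₁ .sub e w qz t (qshift x) (qshift x) := by
  have h := (Change.Base.sub (t := qconst t) (y := qlift x)).rel
  rwa [qput_qlift, qonList_qlift] at h

theorem rel₁_sub_open [LinDef D] {e : ETy} {b : Q w.ctx (.star (.arr .i e.ty))}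
    (x : Q w.ctx (.star .i)) : Rel₁ .sub e w qz (qshift x) (qopen b) (qshift (qinst b x)) := by
  have h := (Change.Base.sub (t := qconst (qshift x)) (y := qflip b)).rel
  rwa [qput_qflip, qonList_qflip] at h

theorem Seq.big_inv [LinDef D] {i : Q w.ctx .nt} {il ll : Q w.ctx (.star .atmlst)}
    {b : Q w.ctx (.star (.arr .i .prp))} (h : Seq w (qs i) il ll (qbig b)) :
    Seq w i (qshift il) (qshift ll) (qopen b) := by
  refine h.cases.seq fun w' ρ hc => ?_
  rw [map_qs, map_qbig] at hc
  rw [map_qshift, map_qshift, map_qopen]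
  generalize e : qs (i ↾ ρ) = j at hc
  generalize e' : qbig (b ↾ ρ) = c at hc
  generalize il ↾ ρ = il at hc ⊢
  generalize ll ↾ ρ = ll at hc ⊢
  -- The head constant of the goal excludes all clauses but the one for $\bigwedge$.
  have hh := congrArg Q.head e'
  cases hc with
  | big h =>
    rw [qs_injective e, qbig_injective e']
    exact h
  | _ => simp at hh

/-- `prog` has no clauses. -/
theorem ProgA.elim {w : World (linearLogic S).clauses} {a : Q w.ctx (.star .atm)}
    {m l : Q w.ctx (.star .prplst)} (h : ProgA w a m l) : J w (fun _ _ => False) := by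
  refine (At.cases h).imp ?_
  rintro w' ρ ⟨Φ, ts, B, xs, hc, -⟩
  have : (⟨Φ, .prog, ts, B⟩ : Clause S) ∈ clausesFor S 4 := List.mem_filter.2 ⟨hc, rfl⟩
  exact absurd this List.not_mem_nil

theorem progRel {w : World (linearLogic S).clauses} {k : Change} : ProgRel k w :=
  fun _ _ _ _ _ _ _ _ _ h _ => h.elim.imp fun _ _ h => h.elim

/-- Inverting the clause for $\bigwedge$ gives a sequent with a fresh first eigenvariable;
instantiating this eigenvariable and then deleting it are two changes at position zero, both of
which preserve the height. -/
theorem holds_specialization {w : World (linearLogic S).clauses} :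
    Holds w (specialization S) .nil := by
  refine holds_imp.2 fun w₀ ρ₀ _ => ?_
  refine (holds_alls (τs := [.star .atmlst, .star .atmlst, .star (.arr .i .prp), .nt])
    (C := .imps [.nat v3, fList .atm 1 v1, fList .atm 1 v0, fSeq (suc v3) v1 v0 (bigwedgeS v2)]
      (.all (.star .i) (fSeq v4 v2 v1 (.lam (v4 ⬝ₘ v0 ⬝ₘ (v1 ⬝ₘ v0))))))).2 ?_
  simp only [holds_imps, holds_all, Env.forall_cons, Env.forall_nil, Env.cons_append,
    Env.nil_append, Env.map_cons, Env.map_nil, List.forall_mem_cons, and_imp, holds_listA,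
    holds_nat, holds_seq, Tm.eval_var, Env.get_zero, Env.get_succ, eval_suc, eval_bigwedgeS]
  intro w₁ ρ₁ ll il b i w₂ ρ₂ hi hil hll h _ w₃ ρ₃ x
  replace h := h.big_inv.mono ρ₃
  replace hi := hi.mono ρ₃
  replace hil := hil.mono ρ₃
  replace hll := hll.mono ρ₃
  rw [map_qshift, map_qshift, map_qopen] at h
  generalize i ↾ ρ₂ ↾ ρ₃ = i at *
  generalize il ↾ ρ₂ ↾ ρ₃ = il at *
  generalize ll ↾ ρ₂ ↾ ρ₃ = ll at *
  generalize b ↾ ρ₂ ↾ ρ₃ = b at *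
  -- The shifted term is substituted for the first eigenvariable: the hypotheses do not contain it,
  -- and the goal becomes the shift of the desired instance.
  have h₁ := h.rel progRel hi .zero hil.shift hll.shift (rel₁_sub_shift (e := .atmlst) il)
    (rel₁_sub_shift (e := .atmlst) ll) (rel₁_sub_open (e := .prp) (b := b) x)
  -- Now every expression is a shift, and the converse of extension removes the idle eigenvariable.
  have h₂ := h₁.rel (t := qfst) progRel hi .zero hil.shift hll.shift (rel₁_unext (e := .atmlst) il)
    (rel₁_unext (e := .atmlst) ll) (rel₁_unext (e := .prp) (qinst b x))
  have e : (Tm.lam (v4 ⬝ₘ v0 ⬝ₘ (v1 ⬝ₘ v0))).eval (x ∷ ll ∷ il ∷ b ∷ i ∷ .nil) = qinst b x :=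
    b1_injective (by simp [b1, qinst])
  rwa [e]

end

end FOLDN

theorem mainTheorem4 (S : FOLDN.Sig) :
    ((FOLDN.linearLogic S).Proves (FOLDN.specialization S) ∧
      (FOLDN.linearLogic S).Proves (FOLDN.cutRule S) ∧
      (FOLDN.linearLogic S).Proves (FOLDN.linearCutRule S) ∧
      (FOLDN.linearLogic S).Proves (FOLDN.structuralRule S)) ∧
    ∀ D : FOLDN.Definition S, D.Extends (FOLDN.linearLogic S) →
      D.Proves (FOLDN.cutRule S) ∧
      D.Proves (FOLDN.linearCutRule S) ∧
      D.Proves (FOLDN.structuralRule S) := by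
  have extends_rules (D : FOLDN.Definition S) (hD : D.Extends (FOLDN.linearLogic S)) :
      D.Proves (FOLDN.cutRule S) ∧ D.Proves (FOLDN.linearCutRule S) ∧
        D.Proves (FOLDN.structuralRule S) :=
    have := hD.linDef
    ⟨FOLDN.Definition.proves_of_holds FOLDN.holds_cutRule,
      FOLDN.Definition.proves_of_holds FOLDN.holds_linearCutRule,
      FOLDN.Definition.proves_of_holds FOLDN.holds_structuralRule⟩
  exact ⟨⟨FOLDN.Definition.proves_of_holds FOLDN.holds_specialization,
    extends_rules _ ⟨subset_rfl, fun _ h _ => h⟩⟩, extends_rules⟩
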